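/- **Setting.** Manifolds are smooth, Hausdorff, second countable, of dimension $n\ge 2$, with boundary. A *Finsler metric* on an open conic set $D\subset TM\setminus 0$ is a smooth function $F:D\to(0,\infty)$, positively homogeneous of degree one in $v$, for which the fibre Hessian of $\frac12F^2$ is positive definite; a Finsler metric on $M$ has $D=TM\setminus0$ and is extended by $0$ to the zero section. For a Finsler metric $F$ on $M$ let $\mathcal L_F(x,v)=(x,\partial_v(\tfrac12F^2)(x,v))$, $F^*(x,\xi)=\max\{\xi(v): F(x,v)=1\}$ and $H=\frac12(F^*)^2$. The geodesic flow on $TM$ is given by the Euler–Lagrange equations of $\frac12F^2$. Let $\mathsf U$ be an open set of inward pointing unit vectors over $\partial M$ (open in the set of all of them) such that every geodesic with initial velocity $u\in\mathsf U$ runs through the interior of $M$ until it meets $\partial M$ for the first time, transversally, at a time $\ell(u)>0$ with velocity $\hat{\mathsf S}^F(u)$. The map $\hat{\mathsf S}^F$ is the scattering relation and $\ell$ the travel time. Let $\mathcal G\subset TM\setminus0$ be the set of all positive multiples of the velocities of these geodesics at times $t\in[0,\ell(u)]$, $u\in\mathsf U$, and put $\Gamma=\mathcal L_F(\mathcal G)$.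 Let $\tilde M$ be another $n$-dimensional manifold with the same boundary, where $TM$ and $T\tilde M$ (hence also $T^*M$ and $T^*\tilde M$) are identified over the common boundary by the differential, at the boundary points, of a diffeomorphism between a neighbourhood of $\partial M$ in $M$ and a neighbourhood of $\partial\tilde M$ in $\tilde M$ which maps $\partial M$ onto $\partial\tilde M$. Let $\mathcal K_{\Gamma,H}$ be the set of all diffeomorphisms $\kappa$ from $\Gamma$ onto an open subset $\tilde\Gamma=\kappa(\Gamma)$ of $T^*\tilde M$ that preserve the symplectic form $d\xi\wedge dx$, commute with the dilations $(x,\xi)\mapsto(x,r\xi)$, $r>0$, and for which the fibre Hessian of $H\circ\kappa^{-1}$ is positive definite on $\tilde\Gamma$. **Theorem (semi-global rigidity of Finsler manifolds).** (a) Let $\kappa\in\mathcal K_{\Gamma,H}$ satisfy $\kappa(x,\xi)=(x,\xi)$ on $\Gamma|_{\partial M}$, and let $\tilde F$ be a Finsler metric dual to $\tilde H=H\circ\kappa^{-1}$. This means either that $\tilde F$ is a Finsler metric on $\tilde M$ with $\tilde H=\frac12(\tilde F^*)^2$ on $\tilde\Gamma$, or, more generally, that $\tilde F$ is a Finsler metric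 on an open conic set $\tilde D\subset T\tilde M\setminus 0$ such that, for all $(y,\eta)\in\tilde\Gamma$, the vector $v=\partial_\eta\tilde H(y,\eta)$ satisfies $(y,v)\in\tilde D$ and $\frac12\tilde F(y,v)^2=\tilde H(y,\eta)$. Then the scattering relation and the travel time of $\tilde F$ are defined on $\mathsf U$, and $\hat{\mathsf S}^{\tilde F}=\hat{\mathsf S}^F$ and $\tilde\ell=\ell$ on $\mathsf U$. (b) Conversely, let $\tilde F$ be a Finsler metric on $\tilde M$ with $\tilde F=F$ on $TM|_{\partial M}$, and suppose that its scattering relation and travel time are defined on $\mathsf U$ and satisfy $\hat{\mathsf S}^{\tilde F}=\hat{\mathsf S}^F$ and $\tilde\ell=\ell$ there. Then there is $\kappa\in\mathcal K_{\Gamma,H}$ with $\kappa=\mathrm{Id}$ on $\Gamma|_{\partial M}$ such that $\phi=\mathcal L_{\tilde F}^{-1}\circ\kappa\circ\mathcal L_F$ satisfies $\phi^*\tilde F=F$ on $\mathcal G$ and $\phi=\mathrm{Id}$ on $\mathcal G|_{\partial M}$. -/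

import Mathlib

open Set Bundle
open scoped Manifold ContDiff

noncomputable section

namespace FinslerRigidity

/-! Throughout, `M` is a smooth `n`-dimensional manifold with boundary, modelled on the Euclidean
half-space `{x ∈ ℝⁿ | 0 ≤ x 0}`. -/

/-- The model vector space `ℝⁿ`. -/
abbrev Vec (n : ℕ) : Type := EuclideanSpace ℝ (Fin n)

/-- The model `(ℝⁿ)*` of the fibres of the cotangent bundle. -/
abbrev Covec (n : ℕ) : Type := Vec n →L[ℝ] ℝ

section Bundles

variable (n : ℕ) [NeZero n] (M : Type*) [TopologicalSpace M]
  [ChartedSpace (EuclideanHalfSpace n) M] [IsManifold (𝓡∂ n) ∞ M]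

/-- The tangent bundle `TM`. -/
abbrev TanB : Type _ := TangentBundle (𝓡∂ n) M

/-- The cotangent bundle `T*M`, with the topology and the smooth structure that Mathlib puts on
bundles of continuous linear maps. -/
abbrev CotB : Type _ :=
  TotalSpace (Covec n) (fun x : M => TangentSpace (𝓡∂ n) x →L[ℝ] Trivial M ℝ x)

/-- The model with corners of `T*M`. -/
abbrev cotModel : ModelWithCorners ℝ (Vec n × Covec n)
    (ModelProd (EuclideanHalfSpace n) (Covec n)) :=
  (𝓡∂ n).prod 𝓘(ℝ, Covec n)

end Bundles

section OneManifold

variable {n : ℕ} [NeZero n] {M : Type*} [TopologicalSpace M]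
  [ChartedSpace (EuclideanHalfSpace n) M] [IsManifold (𝓡∂ n) ∞ M]

/-- The point `(x, v)` of `TM`. -/
def tvec (x : M) (v : Vec n) : TanB n M := ⟨x, v⟩

/-- The point `(x, ξ)` of `T*M`. -/
def cvec (x : M) (ξ : Covec n) : CotB n M := ⟨x, ξ⟩

/-- The fibre component of a tangent vector at `x`, in the coordinates of the preferred chart
at `x`. -/
def TanB.vec (p : TanB n M) : Vec n := p.2

/-- The fibre component of a covector at `x`, in the coordinates of the preferred chart at `x`. -/
def CotB.covec (q : CotB n M) : Covec n := q.2

/-- Fibre dilation `(x, v) ↦ (x, r v)` of `TM`. -/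
def tdil (r : ℝ) (p : TanB n M) : TanB n M := tvec p.proj (r • TanB.vec p)

/-- Fibre dilation `(x, ξ) ↦ (x, r ξ)` of `T*M`. -/
def cdil (r : ℝ) (q : CotB n M) : CotB n M := cvec q.proj (r • CotB.covec q)

variable (n M) in
/-- `TM` without the zero section. -/
def slit : Set (TanB n M) := {p | TanB.vec p ≠ 0}

/-! ### Finsler metrics -/

/-- The restriction of `½F²` to the tangent space at `x`. -/
def halfSq (F : TanB n M → ℝ) (x : M) : Vec n → ℝ := fun w => F (tvec x w) ^ 2 / 2

/-- `F` is a Finsler metric on the open conic set `D ⊆ TM ∖ 0`: smooth, positive, positively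
homogeneous of degree one, and with positive definite fibre Hessian of `½F²` on `D`. Values of `F`
off `D` play no role. -/
structure IsFinslerOn (F : TanB n M → ℝ) (D : Set (TanB n M)) : Prop where
  isOpen : IsOpen D
  subset_slit : D ⊆ slit n M
  conic : ∀ p ∈ D, ∀ r : ℝ, 0 < r → tdil r p ∈ D
  smooth : ContMDiffOn (𝓡∂ n).tangent 𝓘(ℝ, ℝ) ∞ F D
  pos : ∀ p ∈ D, 0 < F p
  homogeneous : ∀ p ∈ D, ∀ r : ℝ, 0 < r → F (tdil r p) = r * F p
  posDef : ∀ p ∈ D, ∀ w : Vec n, w ≠ 0 →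
    0 < fderiv ℝ (fderiv ℝ (halfSq F p.proj)) (TanB.vec p) w w

/-- `F` is a Finsler metric on `M`, extended by continuity (that is, by `0`) to the zero
section. -/
structure IsFinsler (F : TanB n M → ℝ) : Prop where
  isFinslerOn : IsFinslerOn F (slit n M)
  map_zero : ∀ x : M, F (tvec x 0) = 0

/-- The Legendre transform `𝓛_F (x, v) = (x, ∂_v (½F²)(x, v))`. -/
def legendre (F : TanB n M → ℝ) (p : TanB n M) : CotB n M :=
  cvec p.proj (fderiv ℝ (halfSq F p.proj) (TanB.vec p))

/-- The dual function `F*(x, ξ) = max {ξ(v) | F(x, v) = 1}`. -/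
def dualNorm (F : TanB n M → ℝ) (q : CotB n M) : ℝ :=
  sSup {s | ∃ v : Vec n, F (tvec q.proj v) = 1 ∧ s = CotB.covec q v}

/-- The Hamiltonian `H = ½(F*)²` of a Finsler metric. -/
def hamiltonian (F : TanB n M → ℝ) (q : CotB n M) : ℝ := dualNorm F q ^ 2 / 2

/-! ### Geodesics, scattering relation and travel times -/

/-- The curve `c` in `TM` satisfies, on `[0, T]`, the Euler–Lagrange equations of the Lagrangian
`L : TM → ℝ`. At each time `t` they are written in the preferred chart of `TM` at `c t`, in which
`c` reads `s ↦ (x(s), v(s))`: `x' = v` and `d/dt ∂_v L = ∂_x L`. -/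
def SolvesEulerLagrange (L : TanB n M → ℝ) (c : ℝ → TanB n M) (T : ℝ) : Prop :=
  ContinuousOn c (Icc 0 T) ∧
  ∀ t ∈ Icc 0 T,
    let φ := extChartAt (𝓡∂ n).tangent (c t)
    let Lc : Vec n → Vec n → ℝ := fun x v => L (φ.symm (x, v))
    let x : ℝ → Vec n := fun s => (φ (c s)).1
    let v : ℝ → Vec n := fun s => (φ (c s)).2
    HasDerivWithinAt x (v t) (Icc 0 T) t ∧
    HasDerivWithinAt (fun s => fderiv ℝ (Lc (x s)) (v s))
      (fderivWithin ℝ (fun y => Lc y (v t)) (range (𝓡∂ n)) (x t)) (Icc 0 T) t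

/-- `c : [0, T] → TM` is an orbit of the geodesic flow of the Finsler metric `F` on `D` which lies
over the interior of `M` for `0 < t < T` and over the boundary at time `T > 0`. -/
structure IsFirstHitGeodesic (F : TanB n M → ℝ) (D : Set (TanB n M))
    (c : ℝ → TanB n M) (T : ℝ) : Prop where
  pos : 0 < T
  mem : ∀ t ∈ Icc 0 T, c t ∈ D
  eulerLagrange : SolvesEulerLagrange (fun p => F p ^ 2 / 2) c T
  interior : ∀ t ∈ Ioo 0 T, (c t).proj ∈ (𝓡∂ n).interior M
  boundary : (c T).proj ∈ (𝓡∂ n).boundary M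

/-- The graph of the scattering relation together with the travel time: the geodesic with initial
velocity `u` meets the boundary for the first time at time `T`, with velocity `w`, i.e.
`Ŝ(u) = w` and `ℓ(u) = T`. -/
def ScattersTo (F : TanB n M → ℝ) (D : Set (TanB n M)) (u : TanB n M) (T : ℝ)
    (w : TanB n M) : Prop :=
  ∃ c : ℝ → TanB n M, IsFirstHitGeodesic F D c T ∧ c 0 = u ∧ c T = w

/-- The inward pointing unit vectors at boundary points. The coordinate `x 0` of the half-space
model is a boundary defining function of the chart domain. -/
def inwardUnit (F : TanB n M → ℝ) : Set (TanB n M) :=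
  {p | p.proj ∈ (𝓡∂ n).boundary M ∧ F p = 1 ∧ 0 < TanB.vec p 0}

/-- `𝒰` is an open set of inward pointing unit vectors over the boundary, and every geodesic with
initial velocity in `𝒰` meets the boundary for the first time, transversally. -/
structure IsAdmissible (F : TanB n M → ℝ) (𝒰 : Set (TanB n M)) : Prop where
  relOpen : ∃ O : Set (TanB n M), IsOpen O ∧ 𝒰 = O ∩ inwardUnit F
  hits : ∀ u ∈ 𝒰, ∃ (T : ℝ) (w : TanB n M),
    ScattersTo F (slit n M) u T w ∧ TanB.vec w 0 ≠ 0

/-- The conic set `𝒢 ⊆ TM ∖ 0` swept out by the geodesics issued from `𝒰`, up to and including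
their first hit of the boundary. -/
def geodesicCone (F : TanB n M → ℝ) (𝒰 : Set (TanB n M)) : Set (TanB n M) :=
  {p | ∃ (c : ℝ → TanB n M) (T : ℝ), IsFirstHitGeodesic F (slit n M) c T ∧ c 0 ∈ 𝒰 ∧
    ∃ t ∈ Icc 0 T, ∃ r : ℝ, 0 < r ∧ p = tdil r (c t)}

/-! ### Symplectic structure -/

/-- The canonical symplectic form `σ = dξ ∧ dx` at a point of `T*M`. Mathlib identifies the tangent
space of `T*M` at `(x, ξ)` with `ℝⁿ × (ℝⁿ)*` by the canonical coordinates of `T*M` that are induced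
by the preferred chart of `M` at `x`. -/
def symp {q : CotB n M} (a b : TangentSpace (cotModel n) q) : ℝ :=
  let a' : Vec n × Covec n := a
  let b' : Vec n × Covec n := b
  a'.2 b'.1 - b'.2 a'.1

/-- `G` is strictly convex in the fibres on `Γ`: its fibre Hessian is positive definite. -/
def StrictConvexFiberOn (G : CotB n M → ℝ) (Γ : Set (CotB n M)) : Prop :=
  ∀ q ∈ Γ, ∀ θ : Covec n, θ ≠ 0 →
    0 < fderiv ℝ (fderiv ℝ (fun ζ : Covec n => G (cvec q.proj ζ))) (CotB.covec q) θ θ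

/-- `F` is the Finsler metric on `D ⊆ TM` that is obtained from the Hamiltonian `G` on
`Γ ⊆ T*M` by the Legendre transform `(x, ξ) ↦ (x, v)`, `v = ∂_ξ G(x, ξ)`: the transform maps `Γ`
into `D`, and `½F(x, v)² = G(x, ξ)`. -/
def IsLegendreDualOn (F : TanB n M → ℝ) (D : Set (TanB n M)) (G : CotB n M → ℝ)
    (Γ : Set (CotB n M)) : Prop :=
  ∀ q ∈ Γ, ∀ v : Vec n,
    (∀ θ : Covec n, fderiv ℝ (fun ζ : Covec n => G (cvec q.proj ζ)) (CotB.covec q) θ = θ v) →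
    tvec q.proj v ∈ D ∧ F (tvec q.proj v) ^ 2 / 2 = G q

end OneManifold

section TwoManifolds

variable {n : ℕ} [NeZero n] {M M' : Type*}
  [TopologicalSpace M] [ChartedSpace (EuclideanHalfSpace n) M] [IsManifold (𝓡∂ n) ∞ M]
  [TopologicalSpace M'] [ChartedSpace (EuclideanHalfSpace n) M'] [IsManifold (𝓡∂ n) ∞ M']

/-- `M` and `M'` have a common boundary: `Ψ` is a diffeomorphism of a neighbourhood of `∂M` onto a
neighbourhood of `∂M'` with `Ψ(∂M) = ∂M'`. Only `Ψ` and `dΨ` at the points of `∂M` are used; they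
identify `∂M` with `∂M'` and `TM` with `TM'` over the boundary. -/
structure IsBoundaryIdentification (Ψ : OpenPartialHomeomorph M M') : Prop where
  smooth : ContMDiffOn (𝓡∂ n) (𝓡∂ n) ∞ Ψ Ψ.source
  smooth_symm : ContMDiffOn (𝓡∂ n) (𝓡∂ n) ∞ Ψ.symm Ψ.target
  subset_source : (𝓡∂ n).boundary M ⊆ Ψ.source
  image_boundary : Ψ '' (𝓡∂ n).boundary M = (𝓡∂ n).boundary M'

/-- The identification `(x, v) ↦ (Ψ x, dΨ v)` of `TM` with `TM'` over the boundary. -/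
def tanId (Ψ : M → M') (p : TanB n M) : TanB n M' := tangentMap (𝓡∂ n) (𝓡∂ n) Ψ p

/-- The identification `(x, ξ) ↦ (Ψ x, ξ ∘ (dΨ)⁻¹)` of `T*M` with `T*M'` over the boundary. -/
def cotId (Ψ : OpenPartialHomeomorph M M') (q : CotB n M) : CotB n M' :=
  let A : Vec n →L[ℝ] Vec n := mfderiv (𝓡∂ n) (𝓡∂ n) Ψ.symm (Ψ q.proj)
  cvec (Ψ q.proj) ((CotB.covec q).comp A)

/-- `F` (on `D`) and `F'` (on `D'`) have the same scattering relation and the same travel times on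
`𝒰`, under the identification of the two tangent bundles over the boundary. -/
def SameLensData (Ψ : M → M') (F : TanB n M → ℝ) (D : Set (TanB n M))
    (F' : TanB n M' → ℝ) (D' : Set (TanB n M')) (𝒰 : Set (TanB n M)) : Prop :=
  ∀ u ∈ 𝒰, ∀ (T : ℝ) (w : TanB n M), w.proj ∈ (𝓡∂ n).boundary M →
    (ScattersTo F D u T w ↔ ScattersTo F' D' (tanId Ψ u) T (tanId Ψ w))

/-- `κ` is a homogeneous canonical transformation: a diffeomorphism of its (conic) source onto its
target that preserves the symplectic form and commutes with dilations. -/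
structure IsHomogeneousCanonical (κ : OpenPartialHomeomorph (CotB n M) (CotB n M')) : Prop where
  smooth : ContMDiffOn (cotModel n) (cotModel n) ∞ κ κ.source
  smooth_symm : ContMDiffOn (cotModel n) (cotModel n) ∞ κ.symm κ.target
  symplectic : ∀ q ∈ κ.source, ∀ a b : TangentSpace (cotModel n) q,
    symp (mfderiv (cotModel n) (cotModel n) κ q a) (mfderiv (cotModel n) (cotModel n) κ q b)
      = symp a b
  homogeneous : ∀ q ∈ κ.source, ∀ r : ℝ, 0 < r →
    cdil r q ∈ κ.source ∧ κ (cdil r q) = cdil r (κ q)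

/-- The class `𝒦_{Γ,H}` of homogeneous canonical transformations `κ : Γ → κ(Γ) ⊆ T*M'` for which
`H ∘ κ⁻¹` is strictly convex on `κ(Γ)`. -/
structure IsConvexCanonical (Γ : Set (CotB n M)) (H : CotB n M → ℝ)
    (κ : OpenPartialHomeomorph (CotB n M) (CotB n M')) : Prop where
  source_eq : κ.source = Γ
  canonical : IsHomogeneousCanonical κ
  convex : StrictConvexFiberOn (fun q => H (κ.symm q)) κ.target

/-- `κ` is the identity on `Γ|_{∂M}`. -/
def IsBoundaryIdentity (Ψ : OpenPartialHomeomorph M M') (Γ : Set (CotB n M))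
    (κ : CotB n M → CotB n M') : Prop :=
  ∀ q ∈ Γ, q.proj ∈ (𝓡∂ n).boundary M → κ q = cotId Ψ q

end TwoManifolds

end FinslerRigidity

end

set_option linter.unusedSectionVars false

noncomputable section

namespace FinslerRigidity

open Filter Topology

/-! The Legendre transform turns geodesics of `F` into orbits of the Hamiltonian field of `H =
½(F*)²` on the cotangent bundle, and the lens data say where and when these orbits return to the
boundary. Both halves of the theorem are statements about conjugating one Hamiltonian flow to
another.

Direct problem. A symplectic diffeomorphism `κ` carries the field of `H` to that of `H ∘ κ⁻¹`
(`hamField_conj`), so it carries orbits to orbits without changing time. Over the boundary `κ` is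
the identity, so the end covectors do not change, and neither do the end velocities, which are fibre
derivatives of the Hamiltonian (`velocity_boundary`). That the transported orbits are geodesics of
the dual metric rests on two facts: the Legendre transform of that metric inverts the fibre
derivative of `H ∘ κ⁻¹` (`legendre_velocity`), and the derivatives in the base variable then agree
up to sign (`isDualAt_velocity`). Uniqueness of geodesics of the new metric (`geodesic_eqOn`)
excludes other scattering data.

Inverse problem. Let `κ` send the point reached at time `s` by the orbit of `H` from a boundary
covector `b` to the point reached at time `s` by the orbit of the second Hamiltonian from the
covector identified with `b`. Transversality at both ends makes orbits disjoint and keeps each one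
from meeting itself (`OrbitFamily.injective`), and equality of the travel times makes `κ` a
bijection of the swept out sets (`OrbitFamily.exists_conjugation`). Smoothness: near the initial
points, boundary point and time are coordinates, and `κ` is smooth in them
(`OrbitFamily.contMDiffAt_initial`). Further along, `κ` is locally a backward flow, followed by `κ`
at an earlier point, followed by a forward flow (`OrbitFamily.contMDiffAt_step`). To have flows up
to the boundary, the fields are extended across it to any finite order by reflection
(`exists_contDiffAt_eventuallyEq_halfSpace`), and the `C^k` flow comes from the implicit function
method in a space of curves (`exists_contDiffAt_flow`). Symplecticity: along an orbit the defect of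
the pulled back form solves a linear homogeneous differential equation (`pullback_bilinear_eq`), so
it vanishes if it vanishes initially. Initially, on vectors tangent to the boundary `κ` agrees with
the cotangent lift of the boundary identification, and the transversal direction is supplied by the
Hamiltonian field; the mixed terms agree because the two Hamiltonians coincide over the boundary
(`cotId_infinitesimal`). The other properties are short. Dilating an orbit by `r` gives an orbit run
`r` times as fast, hence homogeneity. Both flows have unit speed on the initial unit vectors, hence
`H ∘ κ⁻¹` is the second Hamiltonian and is fibrewise convex. Equality of the scattering relations is
the statement that `κ` is the identity at the exit points. -/

section HalfSpaceExtension

/-! ### Extension of functions across the boundary of a half-space by higher order reflection -/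

/-- Weights for which the reflections with factors `-1, -2, …, -(k+1)` reproduce the jets of order
at most `k`. -/
theorem exists_reflection_weights (k : ℕ) :
    ∃ a : Fin (k + 1) → ℝ, ∀ m ≤ k, ∑ j, a j * (-((j : ℝ) + 1)) ^ m = 1 := by
  have hinj : Set.InjOn (fun j : Fin (k + 1) => (-((j : ℝ) + 1))) (Finset.univ : Finset (Fin (k+1))) := by
    intro i _ j _ h
    simp only [neg_inj, add_left_inj, Nat.cast_inj] at h
    exact Fin.ext h
  -- The weights are the Lagrange basis polynomials of the nodes `-(j + 1)`, evaluated at `1`.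
  -- Interpolation at `k + 1` nodes is exact on `X ^ m` for `m ≤ k`, and `1 ^ m = 1`.
  refine ⟨fun j => (Lagrange.basis Finset.univ (fun j : Fin (k + 1) => (-((j : ℝ) + 1))) j).eval 1,
    fun m hm => ?_⟩
  have := Lagrange.eq_interpolate (f := (Polynomial.X ^ m : Polynomial ℝ)) hinj (by
    rw [Polynomial.degree_X_pow]
    simp only [Finset.card_univ, Fintype.card_fin]
    exact_mod_cast Nat.lt_succ_of_le hm)
  have h2 := congrArg (Polynomial.eval 1) this
  rw [Lagrange.interpolate_apply, Polynomial.eval_finsetSum] at h2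
  simp only [Polynomial.eval_pow, Polynomial.eval_X, one_pow, Polynomial.eval_mul,
    Polynomial.eval_C] at h2
  refine (Finset.sum_congr rfl fun j _ => mul_comm _ _).trans h2.symm

variable {E F : Type*} [NormedAddCommGroup E] [NormedSpace ℝ E] [NormedAddCommGroup F]
  [NormedSpace ℝ F]

/-- Derivatives within a union can be checked on each piece. By `hst` both pieces are relatively
closed in the union, so at a point outside one of them that piece does not accumulate and imposes no
condition; at common points the two jets agree by `hpq`. -/
theorem hasFTaylorSeriesUpToOn_piecewise {k : ℕ} {f g : E → F}
    {p q : E → FormalMultilinearSeries ℝ E F} {s t C D : Set E} [∀ x, Decidable (x ∈ C)]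
    (hC : IsClosed C) (hD : IsClosed D) (hs : s ⊆ C) (ht : t ⊆ D)
    (hst : ∀ x ∈ s ∪ t, (x ∈ C → x ∈ s) ∧ (x ∈ D → x ∈ t))
    (hf : HasFTaylorSeriesUpToOn k f p s) (hg : HasFTaylorSeriesUpToOn k g q t)
    (hpq : ∀ x ∈ s, x ∈ t → ∀ m ≤ k, p x m = q x m) :
    HasFTaylorSeriesUpToOn k (C.piecewise f g) (C.piecewise p q) (s ∪ t) := by
  have eqs : ∀ m : ℕ, ∀ x ∈ s, C.piecewise p q x m = p x m := fun m x hx => by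
    rw [Set.piecewise_eq_of_mem _ _ _ (hs hx)]
  have eqt : ∀ m : ℕ, m ≤ k → ∀ x ∈ t, C.piecewise p q x m = q x m := fun m hm x hx => by
    by_cases hxC : x ∈ C
    · rw [Set.piecewise_eq_of_mem _ _ _ hxC]
      exact hpq x ((hst x (Or.inr hx)).1 hxC) hx m hm
    · rw [Set.piecewise_eq_of_notMem _ _ _ hxC]
  constructor
  · intro x hx
    by_cases hxC : x ∈ C
    · rw [Set.piecewise_eq_of_mem _ _ _ hxC, Set.piecewise_eq_of_mem _ _ _ hxC]
      exact hf.zero_eq x ((hst x hx).1 hxC)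
    · rw [Set.piecewise_eq_of_notMem _ _ _ hxC, Set.piecewise_eq_of_notMem _ _ _ hxC]
      exact hg.zero_eq x (hx.resolve_left fun h => hxC (hs h))
  · intro m hm x hx
    have hm' : m + 1 ≤ k := by
      have : (m : WithTop ℕ∞) < (k : WithTop ℕ∞) := hm
      exact Nat.succ_le_of_lt (by exact_mod_cast this)
    refine HasFDerivWithinAt.union ?_ ?_
    · by_cases hxs : x ∈ s
      · rw [eqs _ x hxs]
        exact (hf.fderivWithin m hm x hxs).congr (fun y hy => eqs m y hy) (eqs m x hxs)
      · refine HasFDerivWithinAt.of_notMem_closure fun hcl => hxs ((hst x hx).1 ?_)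
        exact hC.closure_subset_iff.2 hs hcl
    · by_cases hxt : x ∈ t
      · rw [eqt _ hm' x hxt]
        exact (hg.fderivWithin m hm x hxt).congr (fun y hy => eqt m (by omega) y hy)
          (eqt m (by omega) x hxt)
      · refine HasFDerivWithinAt.of_notMem_closure fun hcl => hxt ((hst x hx).2 ?_)
        exact hD.closure_subset_iff.2 ht hcl
  · intro m hm x hx
    have hm' : m ≤ k := by exact_mod_cast hm
    refine ContinuousWithinAt.union ?_ ?_
    · by_cases hxs : x ∈ s
      · exact (hf.cont m hm x hxs).congr (fun y hy => eqs m y hy) (eqs m x hxs)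
      · refine continuousWithinAt_of_notMem_closure fun hcl => hxs ((hst x hx).1 ?_)
        exact hC.closure_subset_iff.2 hs hcl
    · by_cases hxt : x ∈ t
      · exact (hg.cont m hm x hxt).congr (fun y hy => eqt m hm' y hy) (eqt m hm' x hxt)
      · refine continuousWithinAt_of_notMem_closure fun hcl => hxt ((hst x hx).2 ?_)
        exact hD.closure_subset_iff.2 ht hcl

/-- The reflection-dilation `z ↦ z - (1 + c) ℓ(z) e` in the hyperplane `ℓ = 0`. -/
def hyperplaneReflection (ℓ : E →L[ℝ] ℝ) (e : E) (c : ℝ) : E →L[ℝ] E :=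
  ContinuousLinearMap.id ℝ E - (1 + c) • ℓ.smulRight e

theorem hyperplaneReflection_apply (ℓ : E →L[ℝ] ℝ) (e : E) (c : ℝ) (z : E) :
    hyperplaneReflection ℓ e c z = z - ((1 + c) * ℓ z) • e := by
  simp [hyperplaneReflection, mul_smul]

/-- Split every argument as `w i + u i` with `u i = ℓ (v i) • e`. The reflection with factor `c`
fixes `w i` and multiplies `u i` by `-c`, so in the multilinear expansion the term with `u` in the
slots `s` acquires the factor `(-c) ^ s.card`. The moment conditions average these factors to `1`.
-/
theorem sum_compContinuousLinearMap_hyperplaneReflection {k : ℕ} {ι : Type*} [Fintype ι]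
    (ℓ : E →L[ℝ] ℝ) (e : E) (a c : ι → ℝ)
    (ha : ∀ m ≤ k, ∑ j, a j * (-(c j)) ^ m = 1) {m : ℕ} (hm : m ≤ k)
    (φ : ContinuousMultilinearMap ℝ (fun _ : Fin m => E) F) :
    ∑ j, a j • φ.compContinuousLinearMap (fun _ => hyperplaneReflection ℓ e (c j)) = φ := by
  classical
  ext v
  rw [_root_.sum_apply]
  simp only [_root_.smul_apply,
    ContinuousMultilinearMap.compContinuousLinearMap_apply]
  set w : Fin m → E := fun i => v i - ℓ (v i) • e
  set u : Fin m → E := fun i => ℓ (v i) • e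
  have key : ∀ μ : ℝ, φ ((fun i => μ • u i) + w) =
      ∑ s : Finset (Fin m), μ ^ s.card • φ (s.piecewise u w) := by
    intro μ
    rw [ContinuousMultilinearMap.map_add_univ]
    refine Finset.sum_congr rfl fun s _ => ?_
    have : s.piecewise (fun i => μ • u i) w =
        s.piecewise (fun i => μ • (s.piecewise u w) i) (s.piecewise u w) := by
      ext1 i
      by_cases hi : i ∈ s <;> simp [hi]
    rw [this, ContinuousMultilinearMap.map_piecewise_smul, Finset.prod_const]
  have hv : ∀ j, (fun i => hyperplaneReflection ℓ e (c j) (v i)) =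
      (fun i => (-(c j)) • u i) + w := by
    intro j
    ext1 i
    simp only [hyperplaneReflection_apply, Pi.add_apply, u, w]
    module
  have h1 : v = (fun i => (1 : ℝ) • u i) + w := by
    ext1 i
    simp [u, w]
  simp only [hv, key]
  conv_rhs => rw [h1, key]
  simp only [Finset.smul_sum, smul_smul]
  rw [Finset.sum_comm]
  refine Finset.sum_congr rfl fun s _ => ?_
  rw [← Finset.sum_smul, ha s.card, one_pow]
  exact (Finset.card_le_univ s).trans (by simpa using hm)

theorem HasFTaylorSeriesUpToOn.sum_smul {k : ℕ} {ι : Type*} (J : Finset ι)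
    (a : ι → ℝ) {f : ι → E → F} {p : ι → E → FormalMultilinearSeries ℝ E F} {s : Set E}
    (h : ∀ j ∈ J, HasFTaylorSeriesUpToOn k (f j) (p j) s) :
    HasFTaylorSeriesUpToOn k (fun z => ∑ j ∈ J, a j • f j z)
      (fun z m => ∑ j ∈ J, a j • p j z m) s := by
  constructor
  · intro x hx
    rw [ContinuousMultilinearMap.curry0, _root_.sum_apply]
    refine Finset.sum_congr rfl fun j hj => ?_
    rw [_root_.smul_apply]
    exact congrArg _ ((h j hj).zero_eq x hx)
  · intro m hm x hx
    have := HasFDerivWithinAt.fun_sum (u := J) (x := x) (s := s)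
      (A := fun j z => a j • p j z m) (A' := fun j => a j • (p j x m.succ).curryLeft)
      fun j hj => ((h j hj).fderivWithin m hm x hx).const_smul (a j)
    refine this.congr_fderiv ?_
    ext v w
    simp
  · intro m hm
    exact continuousOn_finsetSum _ fun j hj => ((h j hj).cont m hm).const_smul (a j)

/-- A function that is `C^k` on a closed half-space has a `C^k` extension across the boundary. -/
theorem exists_contDiffAt_eventuallyEq_halfSpace {k : ℕ} {ℓ : E →L[ℝ] ℝ} {e : E} (he : ℓ e = 1)
    {f : E → F} {z₀ : E} (hz : 0 ≤ ℓ z₀) (hf : ContDiffWithinAt ℝ k f {z | 0 ≤ ℓ z} z₀) :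
    ∃ g : E → F, ContDiffAt ℝ k g z₀ ∧ ∀ᶠ z in 𝓝[{z | 0 ≤ ℓ z}] z₀, g z = f z := by
  classical
  rcases hz.lt_or_eq with hz | hz
  · have hmem : {z | 0 ≤ ℓ z} ∈ 𝓝 z₀ :=
      mem_of_superset ((isOpen_lt continuous_const ℓ.continuous).mem_nhds hz) fun z hz => le_of_lt (show 0 < ℓ z from hz)
    exact ⟨f, hf.contDiffAt hmem, Eventually.of_forall fun _ => rfl⟩
  obtain ⟨u, hu, p, hp⟩ := contDiffWithinAt_nat.1 hf
  rw [insert_eq_of_mem (show z₀ ∈ {z | 0 ≤ ℓ z} from hz.le)] at hu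
  obtain ⟨U, hU, hz₀U, hUu⟩ := mem_nhdsWithin.1 hu
  obtain ⟨a, ha⟩ := exists_reflection_weights k
  set A : Fin (k + 1) → E →L[ℝ] E := fun j => hyperplaneReflection ℓ e ((j : ℝ) + 1) with hA
  have hℓA : ∀ j z, ℓ (A j z) = -((j : ℝ) + 1) * ℓ z := by
    intro j z
    simp only [hA, hyperplaneReflection_apply, map_sub, map_smul, he, smul_eq_mul]
    ring
  have hA0 : ∀ j z, ℓ z = 0 → A j z = z := by
    intro j z h
    simp [hA, hyperplaneReflection_apply, h]
  -- All finitely many reflections fix the boundary point `z₀`, so near it every reflected point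
  -- still lies where the Taylor series of `f` is available.
  set W : Set E := U ∩ ⋂ j, A j ⁻¹' U with hW
  have hWo : IsOpen W := hU.inter (isOpen_iInter_of_finite fun j => hU.preimage (A j).continuous)
  have hz₀W : z₀ ∈ W := ⟨hz₀U, mem_iInter.2 fun j => by
    rw [mem_preimage, hA0 j z₀ hz.symm]; exact hz₀U⟩
  set C : Set E := {z | 0 ≤ ℓ z}
  set D : Set E := {z | ℓ z ≤ 0}
  have hf1 : HasFTaylorSeriesUpToOn k f p (W ∩ C) :=
    hp.mono fun z hz => hUu ⟨hz.1.1, hz.2⟩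
  -- On the other side the extension is a weighted sum of reflected copies of `f`. On the hyperplane
  -- the reflections are the identity and the weights reproduce the jet of `f` up to order `k`,
  -- which is the matching condition of the gluing lemma.
  have hg1 : HasFTaylorSeriesUpToOn k (fun z => ∑ j, a j • f (A j z))
      (fun z m => ∑ j, a j • (p (A j z) m).compContinuousLinearMap fun _ => A j) (W ∩ D) := by
    refine HasFTaylorSeriesUpToOn.sum_smul Finset.univ a (f := fun j z => f (A j z))
      (p := fun j z m => (p (A j z) m).compContinuousLinearMap fun _ => A j) fun j _ => ?_
    refine (hp.compContinuousLinearMap (A j)).mono fun z hz => ?_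
    refine hUu ⟨mem_iInter.1 hz.1.2 j, ?_⟩
    have h1 : ℓ z ≤ 0 := hz.2
    show 0 ≤ ℓ (A j z)
    rw [hℓA]
    have : (0 : ℝ) ≤ (j : ℝ) + 1 := by positivity
    nlinarith
  have hglue := hasFTaylorSeriesUpToOn_piecewise (C := C) (D := D)
    (isClosed_le continuous_const ℓ.continuous) (isClosed_le ℓ.continuous continuous_const)
    inter_subset_right inter_subset_right
    (fun x hx => ⟨fun h => ⟨by rcases hx with hx | hx <;> exact hx.1, h⟩,
      fun h => ⟨by rcases hx with hx | hx <;> exact hx.1, h⟩⟩) hf1 hg1 (by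
    intro x hx hx' m hm
    have h0 : ℓ x = 0 := le_antisymm hx'.2 hx.2
    have : ∀ j, (p (A j x) m) = p x m := fun j => by rw [hA0 j x h0]
    simp only [this]
    exact (sum_compContinuousLinearMap_hyperplaneReflection ℓ e a _ ha hm (p x m)).symm)
  have hWe : W ∩ C ∪ W ∩ D = W := by
    rw [← inter_union_distrib_left, inter_eq_left]
    exact fun z _ => le_total 0 (ℓ z)
  rw [hWe] at hglue
  refine ⟨_, (hglue.contDiffOn (n := (k : ℕ∞))).contDiffAt (hWo.mem_nhds hz₀W), ?_⟩
  filter_upwards [self_mem_nhdsWithin] with z hz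
  exact Set.piecewise_eq_of_mem _ _ _ hz

end HalfSpaceExtension

/-! ### Smooth dependence of solutions of differential equations on initial data and time -/

section SmoothFlow

universe u

section Superposition

variable {K : Type*} [TopologicalSpace K] [CompactSpace K]
variable {E F : Type*} [NormedAddCommGroup E] [NormedSpace ℝ E] [NormedAddCommGroup F]
  [NormedSpace ℝ F]

variable {G : Type*} [NormedAddCommGroup G] [NormedSpace ℝ G]

set_option synthInstance.maxHeartbeats 400000 in
/-- Pointwise application of a continuous family of continuous linear maps, which are parametrized
by the space `G`. -/
def pointwiseApply (K : Type*) [TopologicalSpace K] [CompactSpace K]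
    (ev : G →L[ℝ] E →L[ℝ] F) : C(K, G) →L[ℝ] C(K, E) →L[ℝ] C(K, F) :=
  LinearMap.mkContinuous₂
    (LinearMap.mk₂ ℝ (fun (A : C(K, G)) (h : C(K, E)) =>
        (⟨fun t => ev (A t) (h t), by fun_prop⟩ : C(K, F)))
      (fun _ _ _ => by ext; simp) (fun _ _ _ => by ext; simp)
      (fun _ _ _ => by ext; simp) (fun _ _ _ => by ext; simp)) ‖ev‖
    (fun A h => by
      rw [ContinuousMap.norm_le _ (by positivity)]
      intro t
      exact (ev.le_opNorm₂ (A t) (h t)).trans (mul_le_mul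
        (mul_le_mul_of_nonneg_left (A.norm_coe_le_norm t) ev.opNorm_nonneg)
        (h.norm_coe_le_norm t) (norm_nonneg _) (mul_nonneg ev.opNorm_nonneg (norm_nonneg _))))

-- The mean value inequality at each `t` gives the remainder estimate, provided that the derivative
-- varies by at most `c` on a ball about `γ t` whose radius does not depend on `t`. This uniformity
-- is the continuity of postcomposition with `f'` at `γ`: a point `x` near `γ t` is the value at `t`
-- of `γ` shifted by the constant `x - γ t`.
set_option synthInstance.maxHeartbeats 400000 in
theorem hasFDerivAt_continuousMap_comp (ev : G →L[ℝ] E →L[ℝ] F) (f : C(E, F)) (f' : C(E, G))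
    (hf : ∀ x, HasFDerivAt f (ev (f' x)) x) (γ : C(K, E)) :
    HasFDerivAt (fun γ : C(K, E) => f.comp γ) (pointwiseApply K ev (f'.comp γ)) γ := by
  rw [hasFDerivAt_iff_isLittleO_nhds_zero, Asymptotics.isLittleO_iff]
  intro c hc
  have hcont : ContinuousAt (fun γ : C(K, E) => f'.comp γ) γ :=
    (ContinuousMap.continuous_postcomp f').continuousAt
  obtain ⟨δ, hδ, hd⟩ := Metric.continuousAt_iff.1 hcont (c / (‖ev‖ + 1)) (by positivity)
  filter_upwards [Metric.ball_mem_nhds (0 : C(K, E)) hδ] with h hh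
  rw [mem_ball_zero_iff] at hh
  rw [ContinuousMap.norm_le _ (by positivity)]
  intro t
  have hbound : ∀ x ∈ Metric.ball (γ t) δ, ‖ev (f' x) - ev (f' (γ t))‖ ≤ c := by
    intro x hx
    set γ' : C(K, E) := γ + ContinuousMap.const K (x - γ t)
    have h1 : dist γ' γ < δ := by
      rw [dist_eq_norm]
      have : γ' - γ = ContinuousMap.const K (x - γ t) := by simp [γ']
      rw [this]
      refine lt_of_le_of_lt ((ContinuousMap.norm_le _ (norm_nonneg (x - γ t))).2
        fun s => le_of_eq rfl) ?_
      rwa [← dist_eq_norm]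
    have h2 := hd h1
    have h3 := (ContinuousMap.dist_apply_le_dist (f := f'.comp γ') (g := f'.comp γ) t).trans h2.le
    rw [dist_eq_norm] at h3
    have h4 : γ' t = x := by simp [γ']
    have h5 : ‖f' x - f' (γ t)‖ ≤ c / (‖ev‖ + 1) := by simpa [h4] using h3
    rw [← map_sub]
    refine (ev.le_opNorm _).trans ?_
    rw [le_div_iff₀ (by positivity)] at h5
    nlinarith [norm_nonneg ev, norm_nonneg (f' x - f' (γ t))]
  have hdf : ∀ x ∈ Metric.ball (γ t) δ,
      HasFDerivWithinAt f (ev (f' x)) (Metric.ball (γ t) δ) x := fun x _ =>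
    (hf x).hasFDerivWithinAt
  have hmem : γ t + h t ∈ Metric.ball (γ t) δ := by
    rw [mem_ball_iff_norm, add_sub_cancel_left]
    exact (h.norm_coe_le_norm t).trans_lt hh
  have := (convex_ball (γ t) δ).norm_image_sub_le_of_norm_hasFDerivWithin_le' hdf hbound
    (Metric.mem_ball_self hδ) hmem
  rw [add_sub_cancel_left] at this
  exact this.trans (mul_le_mul_of_nonneg_left (h.norm_coe_le_norm t) hc.le)

/-- The superposition operator `γ ↦ f ∘ γ` is as smooth as `f`. -/
theorem contDiff_continuousMap_comp {E : Type u} [NormedAddCommGroup E] [NormedSpace ℝ E] (k : ℕ) :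
    ∀ {F : Type u} [NormedAddCommGroup F] [NormedSpace ℝ F] (f : C(E, F)), ContDiff ℝ k f →
      ContDiff ℝ k (fun γ : C(K, E) => f.comp γ) := by
  induction k with
  | zero =>
    intro F _ _ f hf
    exact contDiff_zero.2 (ContinuousMap.continuous_postcomp _)
  | succ k ih =>
    intro F _ _ f hf
    have hf1 : ContDiff ℝ 1 f := hf.of_le (by exact_mod_cast Nat.le_add_left 1 k)
    have hf' : ContDiff ℝ k (fderiv ℝ f) := hf.fderiv_right (by exact_mod_cast le_rfl)
    rw [show ((k + 1 : ℕ) : WithTop ℕ∞) = (k : WithTop ℕ∞) + 1 by push_cast; rfl]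
    -- The derivative is the superposition operator of `fderiv ℝ f`, followed by a bounded linear
    -- map. The induction hypothesis is used with values in `E →L[ℝ] F`, which is why `F` is
    -- quantified inside the induction and lives in the universe of `E`.
    refine contDiff_succ_iff_hasFDerivAt.2 ⟨_,
      (pointwiseApply K (ContinuousLinearMap.id ℝ (E →L[ℝ] F))).contDiff.comp
        (ih ⟨fderiv ℝ f, hf1.continuous_fderiv one_ne_zero⟩ hf'),
      fun γ => hasFDerivAt_continuousMap_comp (ContinuousLinearMap.id ℝ (E →L[ℝ] F)) f _
        (fun x => (hf1.differentiable one_ne_zero x).hasFDerivAt) γ⟩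

end Superposition

variable {E : Type u} [NormedAddCommGroup E] [NormedSpace ℝ E]

/-- The primitive vanishing at `0`, as an operator on `C([0, 1], E)`. -/
def primitiveL (E : Type u) [NormedAddCommGroup E] [NormedSpace ℝ E] :
    C(Icc (0 : ℝ) 1, E) →L[ℝ] C(Icc (0 : ℝ) 1, E) :=
  LinearMap.mkContinuous
    { toFun := fun γ => ⟨fun t => ∫ τ in (0 : ℝ)..t, IccExtend zero_le_one γ τ, by
        have hc : Continuous (IccExtend (zero_le_one (α := ℝ)) γ) := γ.continuous.Icc_extend'
        exact (intervalIntegral.continuous_primitive (fun a b => hc.intervalIntegrable a b) 0).comp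
          continuous_subtype_val⟩
      map_add' := fun γ γ' => by
        have hc : Continuous (IccExtend (zero_le_one (α := ℝ)) γ) := γ.continuous.Icc_extend'
        have hc' : Continuous (IccExtend (zero_le_one (α := ℝ)) γ') := γ'.continuous.Icc_extend'
        ext t
        exact intervalIntegral.integral_add (hc.intervalIntegrable _ _)
          (hc'.intervalIntegrable _ _)
      map_smul' := fun c γ => by
        ext t
        exact intervalIntegral.integral_smul c _ } 1
    (fun γ => by
      rw [one_mul, ContinuousMap.norm_le _ (norm_nonneg _)]
      intro t
      have := intervalIntegral.norm_integral_le_of_norm_le_const (a := 0) (b := t)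
        (f := IccExtend zero_le_one γ) (C := ‖γ‖) fun τ _ => γ.norm_coe_le_norm _
      refine this.trans ?_
      have ht := t.2
      rw [sub_zero, abs_of_nonneg ht.1]
      exact mul_le_of_le_one_right (norm_nonneg _) ht.2)

/-- Constant functions. -/
def constL (K E : Type*) [TopologicalSpace K] [CompactSpace K] [NormedAddCommGroup E]
    [NormedSpace ℝ E] : E →L[ℝ] C(K, E) :=
  LinearMap.mkContinuous
    { toFun := ContinuousMap.const K
      map_add' := fun _ _ => rfl
      map_smul' := fun _ _ => rfl } 1
    (fun x => by
      rw [one_mul, ContinuousMap.norm_le _ (norm_nonneg _)]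
      exact fun _ => le_rfl)

/-- The map whose zero set consists of the solutions of `γ' = s f(γ)`, `γ(0) = z`. -/
def flowEquation (f : C(E, E)) (p : (E × ℝ) × C(Icc (0 : ℝ) 1, E)) :
    (E × ℝ) × C(Icc (0 : ℝ) 1, E) :=
  (p.1, p.2 - constL _ E p.1.1 - p.1.2 • primitiveL E (f.comp p.2))

/-- The linearization of the flow equation at time parameter `0`. There the vector field enters only
through the value `w` of its primitive, since its own derivative is multiplied by the parameter.
Hence the linearization is block triangular with identity blocks on the diagonal, and the inverse is
explicit. -/
def flowEquationDeriv (w : C(Icc (0 : ℝ) 1, E)) :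
    ((E × ℝ) × C(Icc (0 : ℝ) 1, E)) ≃L[ℝ] ((E × ℝ) × C(Icc (0 : ℝ) 1, E)) :=
  let A : (E × ℝ) →L[ℝ] C(Icc (0 : ℝ) 1, E) :=
    (constL _ E).comp (ContinuousLinearMap.fst ℝ E ℝ) +
      (ContinuousLinearMap.snd ℝ E ℝ).smulRight w
  ContinuousLinearEquiv.equivOfInverse
    ((ContinuousLinearMap.fst ℝ _ _).prod
      (ContinuousLinearMap.snd ℝ _ _ - A.comp (ContinuousLinearMap.fst ℝ _ _)))
    ((ContinuousLinearMap.fst ℝ _ _).prod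
      (ContinuousLinearMap.snd ℝ _ _ + A.comp (ContinuousLinearMap.fst ℝ _ _)))
    (fun p => by ext1 <;> simp) (fun p => by ext1 <;> simp)

theorem contDiff_flowEquation {k : ℕ} {f : E → E} (hf : ContDiff ℝ k f) :
    ContDiff ℝ k (flowEquation (⟨f, hf.continuous⟩ : C(E, E))) := by
  have h := (contDiff_continuousMap_comp (K := Icc (0 : ℝ) 1) k (⟨f, hf.continuous⟩ : C(E, E)) hf).comp
    (contDiff_snd (E := E × ℝ) (F := C(Icc (0 : ℝ) 1, E)))
  have h1 : ContDiff ℝ k (fun p : (E × ℝ) × C(Icc (0 : ℝ) 1, E) =>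
      constL (Icc (0 : ℝ) 1) E p.1.1) :=
    (constL (Icc (0 : ℝ) 1) E).contDiff.comp (contDiff_fst.comp contDiff_fst)
  have h2 : ContDiff ℝ k (fun p : (E × ℝ) × C(Icc (0 : ℝ) 1, E) => p.1.2 •
      primitiveL E ((⟨f, hf.continuous⟩ : C(E, E)).comp p.2)) :=
    (contDiff_snd.comp contDiff_fst).smul ((primitiveL E).contDiff.comp h)
  exact contDiff_fst.prodMk ((contDiff_snd.sub h1).sub h2)

theorem hasFDerivAt_flowEquation {f : E → E} (hf : ContDiff ℝ 1 f) (z₀ : E) :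
    HasFDerivAt (flowEquation (⟨f, hf.continuous⟩ : C(E, E)))
      (flowEquationDeriv (primitiveL E ((⟨f, hf.continuous⟩ : C(E, E)).comp (constL _ E z₀))) :
        ((E × ℝ) × C(Icc (0 : ℝ) 1, E)) →L[ℝ] ((E × ℝ) × C(Icc (0 : ℝ) 1, E)))
      ((z₀, 0), constL _ E z₀) := by
  set p₀ : (E × ℝ) × C(Icc (0 : ℝ) 1, E) := ((z₀, 0), constL _ E z₀)
  have h1 : HasFDerivAt (fun p : (E × ℝ) × C(Icc (0 : ℝ) 1, E) => p.1)
    (ContinuousLinearMap.fst ℝ _ _) p₀ := hasFDerivAt_fst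
  have h2 : HasFDerivAt (fun p : (E × ℝ) × C(Icc (0 : ℝ) 1, E) => p.2)
    (ContinuousLinearMap.snd ℝ _ _) p₀ := hasFDerivAt_snd
  have h3 : HasFDerivAt (fun p : (E × ℝ) × C(Icc (0 : ℝ) 1, E) => constL (Icc (0 : ℝ) 1) E p.1.1)
      (((constL _ E).comp (ContinuousLinearMap.fst ℝ E ℝ)).comp (ContinuousLinearMap.fst ℝ _ _))
      p₀ :=
    (((constL (Icc (0 : ℝ) 1) E).comp (ContinuousLinearMap.fst ℝ E ℝ)).comp
      (ContinuousLinearMap.fst ℝ (E × ℝ) C(Icc (0 : ℝ) 1, E))).hasFDerivAt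
  have h4 : HasFDerivAt (fun p : (E × ℝ) × C(Icc (0 : ℝ) 1, E) => p.1.2)
      ((ContinuousLinearMap.snd ℝ E ℝ).comp (ContinuousLinearMap.fst ℝ _ _)) p₀ :=
    ((ContinuousLinearMap.snd ℝ E ℝ).comp
      (ContinuousLinearMap.fst ℝ (E × ℝ) C(Icc (0 : ℝ) 1, E))).hasFDerivAt
  have h5 := (((primitiveL E).hasFDerivAt).comp p₀
    ((hasFDerivAt_continuousMap_comp (ContinuousLinearMap.id ℝ (E →L[ℝ] E))
      (⟨f, hf.continuous⟩ : C(E, E)) ⟨fderiv ℝ f, hf.continuous_fderiv one_ne_zero⟩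
      (fun x => (hf.differentiable one_ne_zero x).hasFDerivAt) (constL (Icc (0 : ℝ) 1) E z₀)).comp p₀ h2))
  have h6 := h4.smul h5
  refine (h1.prodMk ((h2.sub h3).sub h6)).congr_fderiv ?_
  refine ContinuousLinearMap.ext fun p => ?_
  rw [ContinuousLinearEquiv.coe_coe, flowEquationDeriv, ContinuousLinearEquiv.equivOfInverse_apply]
  refine Prod.ext rfl ?_
  simp [p₀, sub_sub]

theorem hasDerivAt_comp_mul {α : ℝ → E} {f : E → E} {ε s τ : ℝ}
    (h : ∀ t ∈ Icc (-ε) ε, HasDerivWithinAt α (f (α t)) (Icc (-ε) ε) t) (hs : |s| < ε)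
    (hτ : τ ∈ Icc (0 : ℝ) 1) : HasDerivAt (fun τ => α (s * τ)) (s • f (α (s * τ))) τ := by
  have hlt : |s * τ| < ε := by
    rw [abs_mul, abs_of_nonneg hτ.1]
    exact (mul_le_of_le_one_right (abs_nonneg _) hτ.2).trans_lt hs
  rw [abs_lt] at hlt
  have h1 := (h (s * τ) ⟨hlt.1.le, hlt.2.le⟩).hasDerivAt (Icc_mem_nhds hlt.1 hlt.2)
  exact h1.scomp τ (by simpa using (hasDerivAt_id τ).const_mul s)

/-- A vector field of class `C^k` has a local flow of class `C^k`; version for globally defined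
vector fields. -/
theorem exists_contDiffAt_flow_of_contDiff [CompleteSpace E] {k : ℕ} (hk : 1 ≤ k) {f : E → E}
    (hf : ContDiff ℝ k f) (z₀ : E) :
    ∃ Φ : E × ℝ → E, ContDiffAt ℝ k Φ (z₀, 0) ∧
      ∀ᶠ p in 𝓝 ((z₀, 0) : E × ℝ), Φ (p.1, 0) = p.1 ∧
        HasDerivAt (fun t => Φ (p.1, t)) (f (Φ p)) p.2 := by
  have hf1 : ContDiff ℝ 1 f := hf.of_le (by exact_mod_cast hk)
  -- Picard–Lindelöf supplies a flow `α` that is only continuous in both variables. Its regularity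
  -- is obtained afterwards by recognizing it in the local inverse of `flowEquation`.
  obtain ⟨ε, hε, a, r, L, K', hr, hpl⟩ := IsPicardLindelof.of_contDiffAt_one (hf1.contDiffAt (x := z₀))
  obtain ⟨α, hα, hαc⟩ := (hpl 0).exists_forall_mem_closedBall_eq_hasDerivWithinAt_continuousOn
  simp only [zero_sub, zero_add] at hα hαc
  have hmem : Metric.closedBall z₀ (r : ℝ) ×ˢ Icc (-ε) ε ∈ 𝓝 ((z₀, 0) : E × ℝ) :=
    prod_mem_nhds (Metric.closedBall_mem_nhds _ hr) (Icc_mem_nhds (by linarith) hε)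
  have hα0 : α (z₀, 0) = z₀ := (hα z₀ (Metric.mem_closedBall_self r.2)).1
  have hcα : ContinuousAt α (z₀, 0) := hαc.continuousAt hmem
  have hFD := hasFDerivAt_flowEquation hf1 z₀
  have hCD : ContDiffAt ℝ k (flowEquation (⟨f, hf1.continuous⟩ : C(E, E)))
    ((z₀, 0), constL (Icc (0 : ℝ) 1) E z₀) := (contDiff_flowEquation hf).contDiffAt
  have hk0 : (k : WithTop ℕ∞) ≠ 0 := by exact_mod_cast (by omega : k ≠ 0)
  have hΛ := hCD.to_localInverse hFD hk0
  set Λ := hCD.localInverse hFD hk0 with hΛdef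
  have hleft : ∀ᶠ p in 𝓝 (((z₀, 0), constL (Icc (0 : ℝ) 1) E z₀) : (E × ℝ) × C(Icc (0 : ℝ) 1, E)),
      Λ (flowEquation (⟨f, hf1.continuous⟩ : C(E, E)) p) = p :=
    (hCD.hasStrictFDerivAt' hFD hk0).eventually_left_inverse
  have hbase : flowEquation (⟨f, hf1.continuous⟩ : C(E, E))
      ((z₀, 0), constL (Icc (0 : ℝ) 1) E z₀) = ((z₀, 0), 0) := by
    simp [flowEquation]
  rw [hbase] at hΛ
  obtain ⟨η, hη, hleft⟩ := Metric.eventually_nhds_iff.1 hleft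
  obtain ⟨δ, hδ, hcα⟩ := Metric.continuousAt_iff.1 hcα (η / 2) (by positivity)
  -- The rescaled orbit `τ ↦ α (z, s * τ)` on the unit interval solves the flow equation, and
  -- continuity of `α` keeps it close to the constant curve. The local inverse therefore returns
  -- this very curve, and its value at `τ = 1` is `α (z, s)`.
  have hev : α =ᶠ[𝓝 ((z₀, 0) : E × ℝ)]
      fun p => (Λ (p, 0)).2 (⟨1, zero_le_one, le_rfl⟩ : Icc (0 : ℝ) 1) := by
    have h1 : Metric.ball ((z₀, 0) : E × ℝ) (min δ η) ∈ 𝓝 ((z₀, 0) : E × ℝ) :=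
      Metric.ball_mem_nhds _ (lt_min hδ hη)
    have h2 : Metric.closedBall z₀ (r : ℝ) ×ˢ Ioo (-ε) ε ∈ 𝓝 ((z₀, 0) : E × ℝ) :=
      prod_mem_nhds (Metric.closedBall_mem_nhds _ hr) (Ioo_mem_nhds (by linarith) hε)
    filter_upwards [h1, h2] with p hp1 hp2
    obtain ⟨z, s⟩ := p
    have hs : |s| < ε := abs_lt.2 hp2.2
    have hz := hα z hp2.1
    have hder : ∀ τ ∈ Icc (0 : ℝ) 1,
        HasDerivAt (fun τ => α (z, s * τ)) (s • f (α (z, s * τ))) τ := fun τ hτ =>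
      hasDerivAt_comp_mul (α := fun t => α (z, t)) hz.2 hs hτ
    have hcc : ContinuousOn (fun τ => α (z, s * τ)) (Icc (0 : ℝ) 1) := fun τ hτ =>
      (hder τ hτ).continuousAt.continuousWithinAt
    set c : C(Icc (0 : ℝ) 1, E) := ⟨fun τ => α (z, s * τ), hcc.domRestrict⟩ with hc
    have hcd : dist ((((z, s), c) : (E × ℝ) × C(Icc (0 : ℝ) 1, E)))
        ((z₀, 0), constL (Icc (0 : ℝ) 1) E z₀) < η := by
      rw [Prod.dist_eq]
      refine max_lt (lt_of_lt_of_le hp1 (min_le_right _ _)) ?_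
      refine lt_of_le_of_lt ((ContinuousMap.dist_le (by positivity : 0 ≤ η / 2)).2 fun τ => ?_)
        (half_lt_self hη)
      have h3 : dist ((z, s * (τ : ℝ)) : E × ℝ) (z₀, 0) < δ := by
        refine lt_of_le_of_lt ?_ (lt_of_lt_of_le hp1 (min_le_left _ _))
        rw [Prod.dist_eq, Prod.dist_eq]
        refine max_le_max le_rfl ?_
        simp only [dist_zero_right, Real.norm_eq_abs, abs_mul, abs_of_nonneg τ.2.1]
        exact mul_le_of_le_one_right (abs_nonneg _) τ.2.2
      have h4 := (hcα h3).le
      rwa [hα0] at h4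
    have hzero : flowEquation (⟨f, hf1.continuous⟩ : C(E, E)) ((z, s), c) = ((z, s), 0) := by
      refine Prod.ext rfl ?_
      ext t
      have hint : ∀ τ ∈ uIcc (0 : ℝ) t, HasDerivAt (fun τ => α (z, s * τ))
          (s • f (α (z, s * τ))) τ := fun τ hτ => by
        rw [uIcc_of_le t.2.1] at hτ
        exact hder τ ⟨hτ.1, hτ.2.trans t.2.2⟩
      have hcont : ContinuousOn (fun τ => s • f (α (z, s * τ))) (uIcc (0 : ℝ) t) := by
        refine (hf1.continuous.comp_continuousOn (hcc.mono ?_)).const_smul s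
        rw [uIcc_of_le t.2.1]
        exact Icc_subset_Icc_right t.2.2
      have hFTC := intervalIntegral.integral_eq_sub_of_hasDerivAt hint hcont.intervalIntegrable
      have h5 : ∫ τ in (0 : ℝ)..t, IccExtend zero_le_one
          ((⟨f, hf1.continuous⟩ : C(E, E)).comp c) τ = ∫ τ in (0 : ℝ)..t, f (α (z, s * τ)) := by
        refine intervalIntegral.integral_congr fun τ hτ => ?_
        rw [uIcc_of_le t.2.1] at hτ
        have hτ' : τ ∈ Icc (0 : ℝ) 1 := ⟨hτ.1, hτ.2.trans t.2.2⟩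
        simp only [IccExtend_of_mem _ _ hτ']
        rfl
      have h6 : (flowEquation (⟨f, hf1.continuous⟩ : C(E, E)) ((z, s), c)).2 t =
          α (z, s * t) - z - s • ∫ τ in (0 : ℝ)..t, f (α (z, s * τ)) := by
        rw [← h5]; rfl
      rw [h6, ← intervalIntegral.integral_smul, hFTC, mul_zero, hz.1]
      simp
    have h7 := hleft hcd
    rw [hzero] at h7
    show α (z, s) = (Λ ((z, s), 0)).2 _
    rw [h7]
    show α (z, s) = α (z, s * 1)
    rw [mul_one]
  refine ⟨α, ?_, ?_⟩
  · refine ContDiffAt.congr_of_eventuallyEq ?_ hev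
    have hΛ2 : ContDiffAt ℝ k (fun p : E × ℝ => Λ (p, 0)) (z₀, 0) :=
      hΛ.comp (z₀, 0) (contDiffAt_id.prodMk contDiffAt_const)
    exact ((ContinuousMap.evalCLM ℝ (⟨1, zero_le_one, le_rfl⟩ : Icc (0 : ℝ) 1)).contDiff.contDiffAt).comp
      (z₀, (0 : ℝ)) (contDiff_snd.contDiffAt.comp (z₀, (0 : ℝ)) hΛ2)
  · have h2 : Metric.closedBall z₀ (r : ℝ) ×ˢ Ioo (-ε) ε ∈ 𝓝 ((z₀, 0) : E × ℝ) :=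
      prod_mem_nhds (Metric.closedBall_mem_nhds _ hr) (Ioo_mem_nhds (by linarith) hε)
    filter_upwards [h2] with p hp
    have hz := hα p.1 hp.1
    exact ⟨hz.1, (hz.2 p.2 ⟨hp.2.1.le, hp.2.2.le⟩).hasDerivAt (Icc_mem_nhds hp.2.1 hp.2.2)⟩

/-- A vector field of class `C^k` has a local flow of class `C^k`. -/
theorem exists_contDiffAt_flow [FiniteDimensional ℝ E] {k : ℕ} (hk : 1 ≤ k) {f : E → E} {z₀ : E}
    (hf : ContDiffAt ℝ k f z₀) :
    ∃ Φ : E × ℝ → E, ContDiffAt ℝ k Φ (z₀, 0) ∧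
      ∀ᶠ p in 𝓝 ((z₀, 0) : E × ℝ), Φ (p.1, 0) = p.1 ∧
        HasDerivAt (fun t => Φ (p.1, t)) (f (Φ p)) p.2 := by
  have : CompleteSpace E := FiniteDimensional.complete ℝ E
  obtain ⟨R, hR, hfR⟩ := Metric.eventually_nhds_iff_ball.1 (hf.eventually (by simp))
  -- A cutoff makes the field globally of class `C^k` without changing it near `z₀`; short orbits
  -- stay where the cutoff equals `1`.
  set χ : ContDiffBump z₀ := ⟨R / 4, R / 2, by positivity, by linarith⟩
  have hg : ContDiff ℝ k (fun z => χ z • f z) := by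
    refine contDiff_iff_contDiffAt.2 fun z => ?_
    rcases lt_or_ge (dist z z₀) R with hz | hz
    · exact χ.contDiffAt.smul (hfR z hz)
    · refine (contDiffAt_const (c := (0 : E))).congr_of_eventuallyEq ?_
      have : {w | R / 2 < dist w z₀} ∈ 𝓝 z :=
        (isOpen_lt continuous_const (continuous_id.dist continuous_const)).mem_nhds
          (show R / 2 < dist z z₀ by linarith)
      filter_upwards [this] with w hw
      rw [χ.zero_of_le_dist (le_of_lt hw), zero_smul]
  obtain ⟨Φ, hΦ, hev⟩ := exists_contDiffAt_flow_of_contDiff hk hg z₀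
  refine ⟨Φ, hΦ, ?_⟩
  have h0 : Φ (z₀, 0) = z₀ := hev.self_of_nhds.1
  have h1 : ∀ᶠ p in 𝓝 ((z₀, 0) : E × ℝ), χ (Φ p) = 1 := by
    have := hΦ.continuousAt
    rw [ContinuousAt, h0] at this
    exact this.eventually χ.eventuallyEq_one
  filter_upwards [hev, h1] with p hp hp1
  rw [hp1, one_smul] at hp
  exact hp

end SmoothFlow

/-! ### Induction on compact intervals and uniqueness for differential equations -/

section IntervalTools

/-- Clopen induction on a compact interval. -/
theorem Icc_clopen_induction {a b t₀ : ℝ} (ht₀ : t₀ ∈ Icc a b) {P : ℝ → Prop} (h₀ : P t₀)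
    (hopen : ∀ t ∈ Icc a b, P t → ∀ᶠ s in 𝓝[Icc a b] t, P s)
    (hclosed : ∀ t ∈ Icc a b, (∃ᶠ s in 𝓝[Icc a b] t, P s) → P t) :
    ∀ t ∈ Icc a b, P t := by
  intro t ht
  refine (isPreconnected_Icc.induction₂ (fun s t => P s ↔ P t) (fun x hx => ?_)
    (fun _ _ _ _ _ _ h h' => h.trans h') (fun _ _ _ _ h => h.symm) ht₀ ht).1 h₀
  by_cases h : P x
  · exact (hopen x hx h).mono fun y hy => iff_of_true h hy
  · have : ∀ᶠ s in 𝓝[Icc a b] x, ¬ P s := by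
      by_contra hcon
      exact h (hclosed x hx hcon)
    exact this.mono fun y hy => iff_of_false h hy

/-- Forward induction on a compact interval. -/
theorem Icc_forward_induction {a b : ℝ} {P : ℝ → Prop} (h₀ : P a)
    (hstep : ∀ t ∈ Icc a b, ∃ η > 0, ∀ s₁ ∈ Icc a b, ∀ s₂ ∈ Icc a b, t - η < s₁ → s₁ < s₂ →
      s₂ < t + η → P s₁ → P s₂) : ∀ t ∈ Icc a b, P t := by
  intro t ht
  -- Connectedness is applied to the equivalence of "`P` holds up to `s`" and "`P` holds up to `t`".
  -- This relation is symmetric and transitive, and it holds locally although `P` propagates only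
  -- forwards.
  have key := isPreconnected_Icc.induction₂ (s := Icc a b)
    (fun s t => (∀ r ∈ Icc a s, P r) ↔ (∀ r ∈ Icc a t, P r)) (fun x hx => ?_)
    (fun _ _ _ _ _ _ h h' => h.trans h') (fun _ _ _ _ h => h.symm)
    (left_mem_Icc.2 (ht.1.trans ht.2)) ht
  · refine key.1 (fun r hr => ?_) t (right_mem_Icc.2 ht.1)
    rw [le_antisymm hr.2 hr.1]
    exact h₀
  · obtain ⟨η, hη, h⟩ := hstep x hx
    have hmem : Ioo (x - η) (x + η) ∈ 𝓝 x := Ioo_mem_nhds (by linarith) (by linarith)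
    have key2 : ∀ y z, y ∈ Icc a b → z ∈ Icc a b → y ∈ Ioo (x - η) (x + η) →
        z ∈ Ioo (x - η) (x + η) → (∀ r ∈ Icc a y, P r) → (∀ r ∈ Icc a z, P r) := by
      intro y z hy hz hy' hz' hP r hr
      rcases le_or_gt r y with hry | hry
      · exact hP r ⟨hr.1, hry⟩
      · exact h y hy r ⟨hr.1, hr.2.trans hz.2⟩ hy'.1 hry (hr.2.trans_lt hz'.2)
          (hP y (right_mem_Icc.2 hy.1))
    filter_upwards [self_mem_nhdsWithin, mem_nhdsWithin_of_mem_nhds hmem] with y hy hy'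
    have hx' : x ∈ Ioo (x - η) (x + η) := ⟨by linarith, by linarith⟩
    exact ⟨key2 x y hx hy hx' hy', key2 y x hy hx hy' hx'⟩

theorem ODE_eqOn_Icc {E : Type*} [NormedAddCommGroup E] [NormedSpace ℝ E] {v : E → E} {s : Set E}
    {K : NNReal} (hv : LipschitzOnWith K v s) {f g : ℝ → E} {a b t₀ : ℝ} (ht₀ : t₀ ∈ Icc a b)
    (hf : ∀ t ∈ Icc a b, HasDerivWithinAt f (v (f t)) (Icc a b) t) (hfs : ∀ t ∈ Icc a b, f t ∈ s)
    (hg : ∀ t ∈ Icc a b, HasDerivWithinAt g (v (g t)) (Icc a b) t) (hgs : ∀ t ∈ Icc a b, g t ∈ s)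
    (heq : f t₀ = g t₀) : EqOn f g (Icc a b) := by
  have hL : Icc a t₀ ⊆ Icc a b := Icc_subset_Icc_right ht₀.2
  have hR : Icc t₀ b ⊆ Icc a b := Icc_subset_Icc_left ht₀.1
  have hcont : ∀ {f : ℝ → E}, (∀ t ∈ Icc a b, HasDerivWithinAt f (v (f t)) (Icc a b) t) →
      ContinuousOn f (Icc a b) := fun h t ht => (h t ht).continuousWithinAt
  have hl : ∀ {f : ℝ → E}, (∀ t ∈ Icc a b, HasDerivWithinAt f (v (f t)) (Icc a b) t) →
      ∀ t ∈ Ioc a t₀, HasDerivWithinAt f (v (f t)) (Iic t) t := fun h t ht =>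
    (h t (hL (Ioc_subset_Icc_self ht))).mono_of_mem_nhdsWithin
      (Icc_mem_nhdsLE_of_mem ⟨ht.1, ht.2.trans ht₀.2⟩)
  have hr : ∀ {f : ℝ → E}, (∀ t ∈ Icc a b, HasDerivWithinAt f (v (f t)) (Icc a b) t) →
      ∀ t ∈ Ico t₀ b, HasDerivWithinAt f (v (f t)) (Ici t) t := fun h t ht =>
    (h t (hR (Ico_subset_Icc_self ht))).mono_of_mem_nhdsWithin
      (Icc_mem_nhdsGE_of_mem ⟨ht₀.1.trans ht.1, ht.2⟩)
  rw [← Icc_union_Icc_eq_Icc ht₀.1 ht₀.2]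
  refine EqOn.union ?_ ?_
  · exact ODE_solution_unique_of_mem_Icc_left (v := fun _ => v) (s := fun _ => s) (fun _ _ => hv)
      ((hcont hf).mono hL) (hl hf) (fun t ht => hfs t (hL (Ioc_subset_Icc_self ht)))
      ((hcont hg).mono hL) (hl hg) (fun t ht => hgs t (hL (Ioc_subset_Icc_self ht))) heq
  · exact ODE_solution_unique_of_mem_Icc_right (v := fun _ => v) (s := fun _ => s) (fun _ _ => hv)
      ((hcont hf).mono hR) (hr hf) (fun t ht => hfs t (hR (Ico_subset_Icc_self ht)))
      ((hcont hg).mono hR) (hr hg) (fun t ht => hgs t (hR (Ico_subset_Icc_self ht))) heq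

end IntervalTools

/-! ### Interior and boundary points in charts modelled on a half-space -/

section HalfSpace

variable {E : Type*} [NormedAddCommGroup E] [NormedSpace ℝ E] {ℓ : E →L[ℝ] ℝ} {e : E}

theorem interior_halfSpace (he : ℓ e = 1) : interior {z | 0 ≤ ℓ z} = {z | 0 < ℓ z} := by
  refine subset_antisymm (fun z hz => ?_) (interior_maximal (fun z (hz : 0 < ℓ z) => hz.le)
    (isOpen_lt continuous_const ℓ.continuous))
  have hc : ContinuousAt (fun r : ℝ => z - r • e) 0 := by fun_prop
  have hmem : {z | 0 ≤ ℓ z} ∈ 𝓝 (z - (0 : ℝ) • e) := by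
    rw [zero_smul, sub_zero]
    exact mem_interior_iff_mem_nhds.1 hz
  obtain ⟨δ, hδ, h⟩ := Metric.eventually_nhds_iff_ball.1 (hc.eventually hmem)
  have := h (δ / 2) (by rw [Metric.mem_ball, dist_zero_right, Real.norm_eq_abs, abs_of_pos (by positivity)]; linarith)
  have h2 : 0 ≤ ℓ (z - (δ / 2) • e) := this
  rw [map_sub, map_smul, he, smul_eq_mul, mul_one] at h2
  show 0 < ℓ z
  linarith

variable {H : Type*} [TopologicalSpace H] {I : ModelWithCorners ℝ E H}
  {N : Type*} [TopologicalSpace N] [ChartedSpace H N] [IsManifold I ∞ N]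

/-- The chart need not be the preferred one at `q`: being an interior point does not depend on the
chart, so `ℓ` is a boundary defining function in every preferred chart around `q`. -/
theorem mem_interior_iff_pos (he : ℓ e = 1) (hI : range I = {z | 0 ≤ ℓ z}) {q₀ q : N}
    (hq : q ∈ (extChartAt I q₀).source) : q ∈ I.interior N ↔ 0 < ℓ (extChartAt I q₀ q) := by
  rw [extChartAt_source] at hq
  have h1 := I.isInteriorPoint_iff_of_mem_atlas (n := ∞) (by simp) (chart_mem_atlas H q₀) hq
  refine h1.trans ⟨fun h => ?_, fun h => ?_⟩
  · have := interior_mono (extChartAt_target_subset_range q₀) h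
    rw [hI, interior_halfSpace he] at this
    exact this
  · refine (chartAt H q₀).mem_interior_extend_target ((chartAt H q₀).map_source hq) ?_
    rw [hI, interior_halfSpace he]
    exact h

theorem nonneg_extChartAt (hI : range I = {z | 0 ≤ ℓ z}) (q₀ q : N) :
    0 ≤ ℓ (extChartAt I q₀ q) := by
  have : extChartAt I q₀ q ∈ range I := mem_range_self _
  rwa [hI] at this

theorem mem_boundary_iff_eq_zero (he : ℓ e = 1) (hI : range I = {z | 0 ≤ ℓ z}) {q₀ q : N}
    (hq : q ∈ (extChartAt I q₀).source) : q ∈ I.boundary N ↔ ℓ (extChartAt I q₀ q) = 0 := by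
  rw [← I.compl_interior, mem_compl_iff, mem_interior_iff_pos he hI hq, not_lt]
  exact ⟨fun h => le_antisymm h (nonneg_extChartAt hI q₀ q), fun h => h.le⟩

end HalfSpace

/-! ### Vector fields on manifolds with boundary: local flows and uniqueness of integral curves -/

section VectorFields

universe u

variable {E : Type u} [NormedAddCommGroup E] [NormedSpace ℝ E]
  {H : Type*} [TopologicalSpace H] {I : ModelWithCorners ℝ E H}
  {N : Type*} [TopologicalSpace N] [ChartedSpace H N] [IsManifold I ∞ N]

variable (I) in
/-- A vector field in the coordinates of the preferred chart at `q₀`. -/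
def chartField (X : (q : N) → TangentSpace I q) (q₀ : N) (z : E) : E :=
  tangentCoordChange I ((extChartAt I q₀).symm z) q₀ ((extChartAt I q₀).symm z)
    (X ((extChartAt I q₀).symm z))

variable (I) in
/-- The vector field `X` is smooth near `q₀`. -/
def SmoothFieldAt (X : (q : N) → TangentSpace I q) (q₀ : N) : Prop :=
  ContDiffWithinAt ℝ ∞ (chartField I X q₀) (range I) (extChartAt I q₀ q₀)

theorem chartField_extChartAt (X : (q : N) → TangentSpace I q) {q₀ q : N}
    (hq : q ∈ (extChartAt I q₀).source) :
    chartField I X q₀ (extChartAt I q₀ q) = tangentCoordChange I q q₀ q (X q) := by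
  rw [chartField, (extChartAt I q₀).left_inv hq]

theorem chartField_self (X : (q : N) → TangentSpace I q) (q₀ : N) :
    chartField I X q₀ (extChartAt I q₀ q₀) = X q₀ := by
  rw [chartField_extChartAt X (mem_extChartAt_source q₀)]
  exact tangentCoordChange_self (mem_extChartAt_source q₀)

theorem hasMFDerivWithinAt_curve_iff {c : ℝ → N} {S : Set ℝ} {t : ℝ} {v : TangentSpace I (c t)} :
    HasMFDerivWithinAt 𝓘(ℝ, ℝ) I c S t ((1 : ℝ →L[ℝ] ℝ).smulRight v) ↔
      ContinuousWithinAt c S t ∧ HasDerivWithinAt (fun s => extChartAt I (c t) (c s)) v S t := by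
  refine and_congr Iff.rfl ?_
  simp only [writtenInExtChartAt, extChartAt_model_space_eq_id, PartialEquiv.refl_symm,
    PartialEquiv.refl_coe, Function.comp_id, modelWithCornersSelf_coe, range_id, preimage_id,
    inter_univ, id_eq]
  have h1 : ∀ w : E, ContinuousLinearMap.toSpanSingleton ℝ w = (1 : ℝ →L[ℝ] ℝ).smulRight w :=
    fun w => by ext; simp
  have h2 : ∀ (f : ℝ → E) (w : E), HasFDerivWithinAt f ((1 : ℝ →L[ℝ] ℝ).smulRight w) S t ↔
      HasDerivWithinAt f w S t := fun f w => by
    rw [hasDerivWithinAt_iff_hasFDerivWithinAt, h1]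
  exact h2 _ _

theorem hasDerivWithinAt_extChartAt_of_hasMFDerivWithinAt {c : ℝ → N} {S : Set ℝ} {t : ℝ} {q₀ : N}
    {v : TangentSpace I (c t)} (hq : c t ∈ (extChartAt I q₀).source)
    (h : HasMFDerivWithinAt 𝓘(ℝ, ℝ) I c S t ((1 : ℝ →L[ℝ] ℝ).smulRight v)) :
    HasDerivWithinAt (fun s => extChartAt I q₀ (c s)) (tangentCoordChange I (c t) q₀ (c t) v)
      S t := by
  rw [hasMFDerivWithinAt_curve_iff] at h
  have h1 := (hasFDerivWithinAt_tangentCoordChange (I := I) (x := c t) (y := q₀) (z := c t)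
    ⟨mem_extChartAt_source _, hq⟩)
  have h2 := h1.comp_hasDerivWithinAt t h.2
    (show MapsTo (fun s => extChartAt I (c t) (c s)) S (range I) from fun s _ => mem_range_self _)
  refine h2.congr_of_eventuallyEq ?_ ?_
  · filter_upwards [h.1.preimage_mem_nhdsWithin
      (extChartAt_source_mem_nhds (I := I) (c t))] with s hs
    simp only [Function.comp_apply]
    rw [(extChartAt I (c t)).left_inv hs]
  · simp only [Function.comp_apply]
    rw [(extChartAt I (c t)).left_inv (mem_extChartAt_source _)]

theorem hasMFDerivWithinAt_of_hasDerivWithinAt_extChartAt {c : ℝ → N} {S : Set ℝ} {t : ℝ} {q₀ : N}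
    {v : E} (hq : c t ∈ (extChartAt I q₀).source) (hc : ContinuousWithinAt c S t)
    (h : HasDerivWithinAt (fun s => extChartAt I q₀ (c s)) v S t) :
    HasMFDerivWithinAt 𝓘(ℝ, ℝ) I c S t ((1 : ℝ →L[ℝ] ℝ).smulRight
      (tangentCoordChange I q₀ (c t) (c t) v : TangentSpace I (c t))) := by
  refine hasMFDerivWithinAt_curve_iff.2 ⟨hc, ?_⟩
  have h1 := (hasFDerivWithinAt_tangentCoordChange (I := I) (x := q₀) (y := c t) (z := c t)
    ⟨hq, mem_extChartAt_source _⟩)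
  have h2 := h1.comp_hasDerivWithinAt t h
    (show MapsTo (fun s => extChartAt I q₀ (c s)) S (range I) from fun s _ => mem_range_self _)
  refine h2.congr_of_eventuallyEq ?_ ?_
  · filter_upwards [hc.preimage_mem_nhdsWithin (extChartAt_source_mem_nhds' (I := I) hq)] with s hs
    simp only [Function.comp_apply]
    rw [(extChartAt I q₀).left_inv hs]
  · simp only [Function.comp_apply]
    rw [(extChartAt I q₀).left_inv hq]

/-- A local flow of class `C^k`, in the preferred chart at `q₀`, of the vector field `X`, or rather
of an extension `X'` of `X` across the boundary. -/
structure LocalFlow (X : (q : N) → TangentSpace I q) (q₀ : N) (k : ℕ) (X' : E → E) where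
  Φ : E × ℝ → E
  U : Set E
  V : Set E
  ε : ℝ
  K : NNReal
  isOpen_U : IsOpen U
  isOpen_V : IsOpen V
  mem_V : extChartAt I q₀ q₀ ∈ V
  V_subset : V ⊆ U
  ε_pos : 0 < ε
  lipschitz : LipschitzOnWith K X' U
  mem_target : ∀ z ∈ U, z ∈ range I → z ∈ (extChartAt I q₀).target
  field_eq : ∀ z ∈ U, z ∈ range I → X' z = chartField I X q₀ z
  Φ_zero : ∀ z ∈ V, Φ (z, 0) = z
  Φ_mem : ∀ z ∈ V, ∀ t, |t| < ε → Φ (z, t) ∈ U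
  Φ_deriv : ∀ z ∈ V, ∀ t, |t| < ε → HasDerivAt (fun t => Φ (z, t)) (X' (Φ (z, t))) t
  contDiffAt : ∀ z ∈ V, ∀ t, |t| < ε → ContDiffAt ℝ k Φ (z, t)

/-- Every requirement of the structure holds near `(z₀, 0)`, so it suffices to shrink. The set `O`
is at the disposal of the caller: it serves to impose a sign on the normal coordinate, or on the
normal component of the field, throughout the flow domain. -/
theorem exists_localFlow [FiniteDimensional ℝ E] {X : (q : N) → TangentSpace I q} {q₀ : N} {k : ℕ}
    (hk : 1 ≤ k) {X' : E → E} (hX' : ContDiffAt ℝ k X' (extChartAt I q₀ q₀))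
    (hXX' : ∀ᶠ z in 𝓝[range I] (extChartAt I q₀ q₀), X' z = chartField I X q₀ z)
    {O : Set E} (hO : O ∈ 𝓝 (extChartAt I q₀ q₀)) :
    ∃ L : LocalFlow X q₀ k X', L.U ⊆ O := by
  set z₀ := extChartAt I q₀ q₀
  obtain ⟨Φ, hΦ, hev⟩ := exists_contDiffAt_flow hk hX'
  have hX1 : ContDiffAt ℝ 1 X' z₀ := hX'.of_le (by exact_mod_cast hk)
  obtain ⟨K, s, hs, hlip⟩ := hX1.exists_lipschitzOnWith
  have htgt : ∀ᶠ z in 𝓝[range I] z₀, z ∈ (extChartAt I q₀).target :=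
    extChartAt_target_mem_nhdsWithin q₀
  obtain ⟨W, hWo, hzW, hW⟩ := mem_nhdsWithin.1 (hXX'.and htgt)
  obtain ⟨U, hUsub, hUo, hzU⟩ := mem_nhds_iff.1 (inter_mem hO (inter_mem hs (hWo.mem_nhds hzW)))
  have hΦ0 : Φ (z₀, 0) = z₀ := hev.self_of_nhds.1
  have hΦU : ∀ᶠ p in 𝓝 ((z₀, 0) : E × ℝ), Φ p ∈ U := by
    have := hΦ.continuousAt
    rw [ContinuousAt, hΦ0] at this
    exact this.eventually (hUo.mem_nhds hzU)
  have hCD := hΦ.eventually (by simp)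
  obtain ⟨V₀, hV₀, T₀, hT₀, hprod⟩ := mem_nhds_prod_iff.1 (hev.and (hΦU.and hCD))
  obtain ⟨ε, hε, hεT⟩ := Metric.mem_nhds_iff.1 hT₀
  obtain ⟨V, hVsub, hVo, hzV⟩ := mem_nhds_iff.1 (inter_mem hV₀ (hUo.mem_nhds hzU))
  have hmem : ∀ z ∈ V, ∀ t, |t| < ε → ((z, t) : E × ℝ) ∈ V₀ ×ˢ T₀ := fun z hz t ht =>
    ⟨(hVsub hz).1, hεT (by simpa using ht)⟩
  exact ⟨⟨Φ, U, V, ε, K, hUo, hVo, hzV, fun z hz => (hVsub hz).2, hε,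
    hlip.mono fun z hz => (hUsub hz).2.1, fun z hz hzI => (hW ⟨(hUsub hz).2.2, hzI⟩).2,
    fun z hz hzI => (hW ⟨(hUsub hz).2.2, hzI⟩).1,
    fun z hz => (hprod (hmem z hz 0 (by simpa using hε))).1.1,
    fun z hz t ht => (hprod (hmem z hz t ht)).2.1,
    fun z hz t ht => (hprod (hmem z hz t ht)).1.2,
    fun z hz t ht => (hprod (hmem z hz t ht)).2.2⟩, fun z hz => (hUsub hz).1⟩

theorem SmoothFieldAt.exists_extension {ℓ : E →L[ℝ] ℝ} {e : E} (he : ℓ e = 1)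
    (hI : range I = {z | 0 ≤ ℓ z}) {X : (q : N) → TangentSpace I q} {q₀ : N}
    (hX : SmoothFieldAt I X q₀) (k : ℕ) :
    ∃ X' : E → E, ContDiffAt ℝ k X' (extChartAt I q₀ q₀) ∧
      ∀ᶠ z in 𝓝[range I] (extChartAt I q₀ q₀), X' z = chartField I X q₀ z := by
  have hX' : ContDiffWithinAt ℝ k (chartField I X q₀) {z | 0 ≤ ℓ z} (extChartAt I q₀ q₀) := by
    rw [← hI]
    exact ContDiffWithinAt.of_le hX (by exact_mod_cast le_top)
  rw [hI]
  exact exists_contDiffAt_eventuallyEq_halfSpace he (nonneg_extChartAt hI q₀ q₀) hX'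

variable {X : (q : N) → TangentSpace I q} {q₀ : N} {k : ℕ} {X' : E → E}

theorem LocalFlow.eqOn_Icc (L : LocalFlow X q₀ k X') {a b t₀ : ℝ} {f g : ℝ → E}
    (ht₀ : t₀ ∈ Icc a b)
    (hf : ∀ t ∈ Icc a b, HasDerivWithinAt f (X' (f t)) (Icc a b) t)
    (hfs : ∀ t ∈ Icc a b, f t ∈ L.U)
    (hg : ∀ t ∈ Icc a b, HasDerivWithinAt g (X' (g t)) (Icc a b) t)
    (hgs : ∀ t ∈ Icc a b, g t ∈ L.U) (heq : f t₀ = g t₀) : EqOn f g (Icc a b) :=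
  ODE_eqOn_Icc L.lipschitz ht₀ hf hfs hg hgs heq

/-- Integral curves follow the local flow. -/
theorem LocalFlow.tracking [T2Space N] (hIc : IsClosed (range I)) (L : LocalFlow X q₀ k X')
    {a b t₀ : ℝ} {c : ℝ → N}
    (hc : IsMIntegralCurveOn c X (Icc a b)) (ht₀ : t₀ ∈ Icc a b)
    (hs : c t₀ ∈ (extChartAt I q₀).source) (hV : extChartAt I q₀ (c t₀) ∈ L.V)
    (hε : ∀ t ∈ Icc a b, |t - t₀| < L.ε) :
    ∀ t ∈ Icc a b, c t ∈ (extChartAt I q₀).source ∧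
      extChartAt I q₀ (c t) = L.Φ (extChartAt I q₀ (c t₀), t - t₀) := by
  set z := extChartAt I q₀ (c t₀)
  have hΦd : ∀ t, |t - t₀| < L.ε →
      HasDerivAt (fun t => L.Φ (z, t - t₀)) (X' (L.Φ (z, t - t₀))) t := fun t ht => by
    have := (L.Φ_deriv z hV (t - t₀) ht).scomp t ((hasDerivAt_id t).sub_const t₀)
    simpa using! this
  refine Icc_clopen_induction ht₀ ⟨hs, by rw [sub_self, L.Φ_zero z hV]⟩ ?_ ?_
  · intro t ht ⟨h1, h2⟩
    have hcont := (hc t ht).1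
    have hev1 : ∀ᶠ s in 𝓝[Icc a b] t, c s ∈ (extChartAt I q₀).source :=
      hcont.preimage_mem_nhdsWithin (extChartAt_source_mem_nhds' (I := I) h1)
    have hev2 : ∀ᶠ s in 𝓝[Icc a b] t, extChartAt I q₀ (c s) ∈ L.U := by
      have h3 : ContinuousWithinAt (fun s => extChartAt I q₀ (c s)) (Icc a b) t :=
        (continuousAt_extChartAt' h1).comp_continuousWithinAt hcont
      refine h3.eventually (L.isOpen_U.mem_nhds ?_)
      show extChartAt I q₀ (c t) ∈ L.U
      rw [h2]
      exact L.Φ_mem z hV _ (hε t ht)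
    obtain ⟨η, hη, hball⟩ := Metric.mem_nhdsWithin_iff.1 (hev1.and hev2)
    set a' := max a (t - η / 2)
    set b' := min b (t + η / 2)
    have hsub : Icc a' b' ⊆ Icc a b := Icc_subset_Icc (le_max_left _ _) (min_le_left _ _)
    have hsub2 : ∀ s ∈ Icc a' b', c s ∈ (extChartAt I q₀).source ∧ extChartAt I q₀ (c s) ∈ L.U := by
      intro s hs
      refine hball ⟨?_, hsub hs⟩
      have h4 := (le_max_right a (t - η / 2)).trans hs.1
      have h5 := hs.2.trans (min_le_right b (t + η / 2))
      rw [Metric.mem_ball, Real.dist_eq, abs_lt]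
      constructor <;> linarith
    have htm : t ∈ Icc a' b' := ⟨max_le ht.1 (by linarith), le_min ht.2 (by linarith)⟩
    have heq := L.eqOn_Icc (f := fun s => extChartAt I q₀ (c s)) (g := fun s => L.Φ (z, s - t₀))
      htm (fun s hs => by
        have h6 := hasDerivWithinAt_extChartAt_of_hasMFDerivWithinAt (hsub2 s hs).1
          (hc s (hsub hs))
        rw [L.field_eq _ (hsub2 s hs).2 (mem_range_self _), chartField_extChartAt X (hsub2 s hs).1]
        exact h6.mono hsub) (fun s hs => (hsub2 s hs).2)
      (fun s hs => (hΦd s (hε s (hsub hs))).hasDerivWithinAt)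
      (fun s hs => L.Φ_mem z hV _ (hε s (hsub hs))) h2
    have hnhd : Icc a' b' ∈ 𝓝[Icc a b] t := by
      rw [Metric.mem_nhdsWithin_iff]
      refine ⟨η / 2, by positivity, fun s hs => ?_⟩
      have h7 := hs.1
      rw [Metric.mem_ball, Real.dist_eq, abs_lt] at h7
      exact ⟨max_le hs.2.1 (by linarith), le_min hs.2.2 (by linarith)⟩
    filter_upwards [hnhd] with s hs
    exact ⟨(hsub2 s hs).1, heq hs⟩
  -- For closedness, the point `w` on the flow line is a limit of points of the half-space and hence
  -- belongs to it, so it lies in the chart target. The curve converges both to `c t` and to the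
  -- point with coordinates `w`, and limits are unique. This excludes that the curve leaves the
  -- chart.
  · intro t ht hfreq
    set w := L.Φ (z, t - t₀)
    have hΦc : ContinuousAt (fun s => L.Φ (z, s - t₀)) t := (hΦd t (hε t ht)).continuousAt
    have hwI : w ∈ range I := by
      refine hIc.closure_subset ?_
      refine mem_closure_of_frequently_of_tendsto (f := fun s => L.Φ (z, s - t₀))
        (b := 𝓝[Icc a b] t) ?_
        (hΦc.mono_left nhdsWithin_le_nhds)
      exact hfreq.mono fun s hs => hs.2 ▸ mem_range_self _
    have hwt : w ∈ (extChartAt I q₀).target := L.mem_target w (L.Φ_mem z hV _ (hε t ht)) hwI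
    have hne : (𝓝[Icc a b] t ⊓ 𝓟 {s | c s ∈ (extChartAt I q₀).source ∧
      extChartAt I q₀ (c s) = L.Φ (z, s - t₀)}).NeBot := by
      exact inf_principal_neBot_iff.2 fun U hU => by
        obtain ⟨s, hs, hsU⟩ := (hfreq.and_eventually hU).exists
        exact ⟨s, hsU, hs⟩
    have ht1 : Tendsto c (𝓝[Icc a b] t ⊓ 𝓟 {s | c s ∈ (extChartAt I q₀).source ∧
      extChartAt I q₀ (c s) = L.Φ (z, s - t₀)}) (𝓝 (c t)) := (hc t ht).1.mono_left inf_le_left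
    have ht2 : Tendsto c (𝓝[Icc a b] t ⊓ 𝓟 {s | c s ∈ (extChartAt I q₀).source ∧
      extChartAt I q₀ (c s) = L.Φ (z, s - t₀)}) (𝓝 ((extChartAt I q₀).symm w)) := by
      have h3 : Tendsto (fun s => L.Φ (z, s - t₀)) (𝓝[Icc a b] t ⊓ 𝓟 {s | c s ∈
          (extChartAt I q₀).source ∧ extChartAt I q₀ (c s) = L.Φ (z, s - t₀)})
          (𝓝[(extChartAt I q₀).target] w) := by
        refine tendsto_nhdsWithin_iff.2
          ⟨hΦc.mono_left (inf_le_left.trans nhdsWithin_le_nhds), ?_⟩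
        filter_upwards [mem_inf_of_right (mem_principal_self _)] with s hs
        rw [← hs.2]
        exact (extChartAt I q₀).map_source hs.1
      have h4 := ((continuousOn_extChartAt_symm q₀) w hwt).tendsto.comp h3
      refine h4.congr' ?_
      filter_upwards [mem_inf_of_right (mem_principal_self _)] with s hs
      simp only [Function.comp_apply]
      rw [← hs.2, (extChartAt I q₀).left_inv hs.1]
    have hct : c t = (extChartAt I q₀).symm w := tendsto_nhds_unique ht1 ht2
    rw [hct]
    exact ⟨(extChartAt I q₀).map_target hwt, (extChartAt I q₀).right_inv hwt⟩

/-- Orbits of the local flow that stay in the half-space are integral curves. -/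
theorem LocalFlow.isMIntegralCurveOn (L : LocalFlow X q₀ k X') {a b τ : ℝ} {z : E} (hz : z ∈ L.V)
    (hε : ∀ t ∈ Icc a b, |t + τ| < L.ε) (hI : ∀ t ∈ Icc a b, L.Φ (z, t + τ) ∈ range I) :
    IsMIntegralCurveOn (fun t => (extChartAt I q₀).symm (L.Φ (z, t + τ))) X (Icc a b) := by
  intro t ht
  have htgt : ∀ s ∈ Icc a b, L.Φ (z, s + τ) ∈ (extChartAt I q₀).target := fun s hs =>
    L.mem_target _ (L.Φ_mem z hz _ (hε s hs)) (hI s hs)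
  have hd : HasDerivAt (fun s => L.Φ (z, s + τ)) (X' (L.Φ (z, t + τ))) t := by
    have := (L.Φ_deriv z hz (t + τ) (hε t ht)).scomp t ((hasDerivAt_id t).add_const τ)
    simpa using! this
  have hcont : ContinuousWithinAt (fun t => (extChartAt I q₀).symm (L.Φ (z, t + τ))) (Icc a b) t :=
    ContinuousWithinAt.comp (f := fun s => L.Φ (z, s + τ))
      ((continuousOn_extChartAt_symm q₀) _ (htgt t ht)) hd.continuousAt.continuousWithinAt htgt
  have hsrc := (extChartAt I q₀).map_target (htgt t ht)
  have h1 := hasMFDerivWithinAt_of_hasDerivWithinAt_extChartAt (I := I)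
    (c := fun t => (extChartAt I q₀).symm (L.Φ (z, t + τ))) (v := X' (L.Φ (z, t + τ)))
    hsrc hcont (by
      refine hd.hasDerivWithinAt.congr_of_eventuallyEq_of_mem ?_ ht
      filter_upwards [self_mem_nhdsWithin] with s hs
      exact (extChartAt I q₀).right_inv (htgt s hs))
  have h2 : tangentCoordChange I q₀ ((extChartAt I q₀).symm (L.Φ (z, t + τ)))
      ((extChartAt I q₀).symm (L.Φ (z, t + τ))) (X' (L.Φ (z, t + τ))) =
      X ((extChartAt I q₀).symm (L.Φ (z, t + τ))) := by
    rw [L.field_eq _ (L.Φ_mem z hz _ (hε t ht)) (hI t ht), chartField]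
    exact (tangentCoordChange_comp
      ⟨⟨mem_extChartAt_source _, hsrc⟩, mem_extChartAt_source _⟩).trans
      (tangentCoordChange_self (mem_extChartAt_source _))
  simp only [h2] at h1
  exact h1

/-- Uniqueness of integral curves, up to the boundary. -/
theorem isMIntegralCurveOn_eqOn [FiniteDimensional ℝ E] [T2Space N] {ℓ : E →L[ℝ] ℝ} {e : E}
    (he : ℓ e = 1) (hI : range I = {z | 0 ≤ ℓ z}) {c₁ c₂ : ℝ → N} {a b t₀ : ℝ}
    (ht₀ : t₀ ∈ Icc a b)
    (h₁ : IsMIntegralCurveOn c₁ X (Icc a b)) (h₂ : IsMIntegralCurveOn c₂ X (Icc a b))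
    (hX : ∀ t ∈ Icc a b, SmoothFieldAt I X (c₁ t)) (h : c₁ t₀ = c₂ t₀) :
    EqOn c₁ c₂ (Icc a b) := by
  have hIc : IsClosed (range I) := by
    rw [hI]; exact isClosed_le continuous_const ℓ.continuous
  refine Icc_clopen_induction (P := fun t => c₁ t = c₂ t) ht₀ h ?_ ?_
  · intro t ht heq
    -- Both curves follow the flow of one extension of `X` across the boundary. Points of that flow
    -- may lie outside the half-space, but those on the curves do not. Regularity of `X` along `c₁`
    -- alone suffices because the curves meet at `t`.
    obtain ⟨X', hX', hXX'⟩ := (hX t ht).exists_extension he hI 1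
    obtain ⟨L, -⟩ := exists_localFlow le_rfl hX' hXX' univ_mem
    set a' := max a (t - L.ε / 2)
    set b' := min b (t + L.ε / 2)
    have hε := L.ε_pos
    have hsub : Icc a' b' ⊆ Icc a b := Icc_subset_Icc (le_max_left _ _) (min_le_left _ _)
    have htm : t ∈ Icc a' b' := ⟨max_le ht.1 (by linarith), le_min ht.2 (by linarith)⟩
    have hε' : ∀ s ∈ Icc a' b', |s - t| < L.ε := by
      intro s hs
      have h4 := (le_max_right a (t - L.ε / 2)).trans hs.1
      have h5 := hs.2.trans (min_le_right b (t + L.ε / 2))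
      rw [abs_lt]
      constructor <;> linarith
    have t1 := L.tracking hIc (h₁.mono hsub) htm (mem_extChartAt_source _) L.mem_V hε'
    have t2 := L.tracking hIc (h₂.mono hsub) htm (by rw [← heq]; exact mem_extChartAt_source _)
      (by rw [← heq]; exact L.mem_V) hε'
    have hnhd : Icc a' b' ∈ 𝓝[Icc a b] t := by
      rw [Metric.mem_nhdsWithin_iff]
      refine ⟨L.ε / 2, by positivity, fun s hs => ?_⟩
      have h7 := hs.1
      rw [Metric.mem_ball, Real.dist_eq, abs_lt] at h7
      exact ⟨max_le hs.2.1 (by linarith), le_min hs.2.2 (by linarith)⟩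
    filter_upwards [hnhd] with s hs
    refine (extChartAt I (c₁ t)).injOn (t1 s hs).1 (t2 s hs).1 ?_
    rw [(t1 s hs).2, (t2 s hs).2]
    exact congrArg (fun q => L.Φ (extChartAt I (c₁ t) q, s - t)) heq
  · intro t ht hfreq
    by_contra hne
    obtain ⟨u, v, hu, hv, hdisj⟩ := t2_separation_nhds hne
    refine hfreq ?_
    filter_upwards [(h₁ t ht).1 hu, (h₂ t ht).1 hv] with s hs1 hs2 heq
    have hs1' : c₁ s ∈ u := hs1
    rw [heq] at hs1'
    exact disjoint_left.1 hdisj hs1' hs2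

end VectorFields

/-! ### Families of orbits that run from boundary to boundary -/

section OrbitFamilies

universe u

variable {E : Type u} [NormedAddCommGroup E] [NormedSpace ℝ E]
  {H : Type*} [TopologicalSpace H] {I : ModelWithCorners ℝ E H}
  {N : Type*} [TopologicalSpace N] [ChartedSpace H N] [IsManifold I ∞ N]
  {N' : Type*} [TopologicalSpace N'] [ChartedSpace H N'] [IsManifold I ∞ N']

/-- Continuity of `κ` need not be assumed. Its values near `q₀` lie in a single chart domain, where
its expression is the continuous map `G`, and the inverse chart is continuous on the chart target.
-/
theorem contMDiffAt_of_eventually_extChartAt_eq {κ : N → N'} {q₁ q₀ : N} {p₀ : N'} {k : WithTop ℕ∞}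
    {G : E → E}
    (hq : q₀ ∈ (chartAt H q₁).source)
    (h : ∀ᶠ q in 𝓝 q₀, κ q ∈ (extChartAt I p₀).source ∧
      extChartAt I p₀ (κ q) = G (extChartAt I q₁ q))
    (hG : ContDiffWithinAt ℝ k G (range I) (extChartAt I q₁ q₀)) [IsManifold I k N]
    [IsManifold I k N'] :
    ContMDiffAt I I k κ q₀ := by
  have h0 := h.self_of_nhds
  have hq' : q₀ ∈ (extChartAt I q₁).source := by rwa [extChartAt_source]
  have hs : κ q₀ ∈ (chartAt H p₀).source := by rw [← extChartAt_source I]; exact h0.1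
  rw [contMDiffAt_iff_of_mem_source hq hs]
  constructor
  · have h1 : Tendsto (fun q => extChartAt I p₀ (κ q)) (𝓝 q₀)
        (𝓝[(extChartAt I p₀).target] (extChartAt I p₀ (κ q₀))) := by
      refine tendsto_nhdsWithin_iff.2 ⟨?_, ?_⟩
      · rw [h0.2]
        have h2 : Tendsto (extChartAt I q₁) (𝓝 q₀) (𝓝[range I] (extChartAt I q₁ q₀)) :=
          tendsto_nhdsWithin_iff.2 ⟨(continuousAt_extChartAt' hq').tendsto,
            Eventually.of_forall fun q => mem_range_self _⟩
        refine (hG.continuousWithinAt.tendsto.comp h2).congr' ?_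
        filter_upwards [h] with q hq
        exact hq.2.symm
      · filter_upwards [h] with q hq
        exact (extChartAt I p₀).map_source hq.1
    have h3 := ((continuousOn_extChartAt_symm p₀) _
      ((extChartAt I p₀).map_source h0.1)).tendsto.comp h1
    rw [(extChartAt I p₀).left_inv h0.1] at h3
    refine h3.congr' ?_
    filter_upwards [h] with q hq
    exact (extChartAt I p₀).left_inv hq.1
  · have h4 : Tendsto (extChartAt I q₁).symm (𝓝[range I] (extChartAt I q₁ q₀)) (𝓝 q₀) := by
      have := continuousAt_extChartAt_symm' (I := I) hq'
      rw [ContinuousAt, (extChartAt I q₁).left_inv hq'] at this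
      exact this.mono_left nhdsWithin_le_nhds
    refine hG.congr_of_eventuallyEq_of_mem ?_ (mem_range_self _)
    filter_upwards [h4.eventually h, extChartAt_target_mem_nhdsWithin' hq'] with z hz hzt
    simp only [Function.comp_apply]
    rw [hz.2, (extChartAt I q₁).right_inv hzt]

/-- A one-sided derivative at a zero of a non-negative function is non-negative. -/
theorem nonneg_of_hasDerivWithinAt_left {f : ℝ → ℝ} {f' a b : ℝ} (hab : a < b)
    (hf : HasDerivWithinAt f f' (Icc a b) a) (h0 : f a = 0) (hpos : ∀ t ∈ Icc a b, 0 ≤ f t) :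
    0 ≤ f' := by
  have h1 := hasDerivWithinAt_iff_tendsto_slope.1 hf
  have hne : (𝓝[Icc a b \ {a}] a).NeBot := by
    rw [Icc_sdiff_left]
    exact left_nhdsWithin_Ioc_neBot hab
  refine ge_of_tendsto h1 ?_
  filter_upwards [self_mem_nhdsWithin] with t ht
  have : a ≤ t := ht.1.1
  rw [slope_def_field, h0, sub_zero]
  exact div_nonneg (hpos t ht.1) (by linarith)

theorem nonpos_of_hasDerivWithinAt_right {f : ℝ → ℝ} {f' a b : ℝ} (hab : a < b)
    (hf : HasDerivWithinAt f f' (Icc a b) b) (h0 : f b = 0) (hpos : ∀ t ∈ Icc a b, 0 ≤ f t) :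
    f' ≤ 0 := by
  have h1 := hasDerivWithinAt_iff_tendsto_slope.1 hf
  have hne : (𝓝[Icc a b \ {b}] b).NeBot := by
    rw [Icc_sdiff_right]
    exact right_nhdsWithin_Ico_neBot hab
  refine le_of_tendsto h1 ?_
  filter_upwards [self_mem_nhdsWithin] with t ht
  have : t ≤ b := ht.1.2
  rw [slope_def_field, h0, sub_zero]
  exact div_nonpos_of_nonneg_of_nonpos (hpos t ht.1) (by linarith)

variable {ℓ : E →L[ℝ] ℝ} {e : E} {X : (q : N) → TangentSpace I q}

theorem hasDerivWithinAt_normal {c : ℝ → N} {S : Set ℝ} {t : ℝ}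
    (hc : IsMIntegralCurveOn c X S) (ht : t ∈ S) :
    HasDerivWithinAt (fun s => ℓ (extChartAt I (c t) (c s))) (ℓ (X (c t))) S t :=
  ℓ.hasFDerivAt.comp_hasDerivWithinAt t (hasMFDerivWithinAt_curve_iff.1 (hc t ht)).2

theorem normal_nonneg_of_left (he : ℓ e = 1) (hI : range I = {z | 0 ≤ ℓ z}) {c : ℝ → N} {a b : ℝ}
    (hab : a < b) (hc : IsMIntegralCurveOn c X (Icc a b)) (hb : c a ∈ I.boundary N) :
    0 ≤ ℓ (X (c a)) :=
  nonneg_of_hasDerivWithinAt_left hab (hasDerivWithinAt_normal hc (left_mem_Icc.2 hab.le))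
    ((mem_boundary_iff_eq_zero he hI (mem_extChartAt_source _)).1 hb)
    (fun _ _ => nonneg_extChartAt hI _ _)

theorem normal_nonpos_of_right (he : ℓ e = 1) (hI : range I = {z | 0 ≤ ℓ z}) {c : ℝ → N} {a b : ℝ}
    (hab : a < b) (hc : IsMIntegralCurveOn c X (Icc a b)) (hb : c b ∈ I.boundary N) :
    ℓ (X (c b)) ≤ 0 :=
  nonpos_of_hasDerivWithinAt_right hab (hasDerivWithinAt_normal hc (right_mem_Icc.2 hab.le))
    ((mem_boundary_iff_eq_zero he hI (mem_extChartAt_source _)).1 hb)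
    (fun _ _ => nonneg_extChartAt hI _ _)

variable (ℓ X) in
/-- A family of integral curves `c b : [0, T b] → N` of `X`, issued from the boundary points
`b ∈ B`, inward pointing at `b`, and running through the interior until they meet the boundary
transversally at time `T b`. -/
structure OrbitFamily (B : Set N) (T : N → ℝ) (c : N → ℝ → N) : Prop where
  boundary : ∀ b ∈ B, b ∈ I.boundary N
  inward : ∀ b ∈ B, 0 < ℓ (X b)
  pos : ∀ b ∈ B, 0 < T b
  zero : ∀ b ∈ B, c b 0 = b
  integral : ∀ b ∈ B, IsMIntegralCurveOn (c b) X (Icc 0 (T b))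
  smooth : ∀ b ∈ B, ∀ s ∈ Icc 0 (T b), SmoothFieldAt I X (c b s)
  interior : ∀ b ∈ B, ∀ s ∈ Ioo 0 (T b), c b s ∈ I.interior N
  exit : ∀ b ∈ B, c b (T b) ∈ I.boundary N
  transversal : ∀ b ∈ B, ℓ (X (c b (T b))) ≠ 0

/-- The set swept out by a family of curves. -/
def sweep (B : Set N) (T : N → ℝ) (c : N → ℝ → N) : Set N :=
  {q | ∃ b ∈ B, ∃ s ∈ Icc 0 (T b), c b s = q}

variable {B : Set N} {T : N → ℝ} {c : N → ℝ → N}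

namespace OrbitFamily

theorem exit_neg (he : ℓ e = 1) (hI : range I = {z | 0 ≤ ℓ z}) (h : OrbitFamily ℓ X B T c) {b : N}
    (hb : b ∈ B) : ℓ (X (c b (T b))) < 0 :=
  lt_of_le_of_ne (normal_nonpos_of_right he hI (h.pos b hb) (h.integral b hb) (h.exit b hb))
    (h.transversal b hb)

variable [FiniteDimensional ℝ E] [T2Space N]

/-- Follow both orbits backwards from the common point. The one with the smaller time reaches the
boundary first, at its initial point. If the times differ, the other orbit is at a positive time
there, so it is either in the interior or at its exit; the first is impossible on the boundary, and
at the exit the field points outwards, while at an initial point it points inwards. -/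
theorem injective (he : ℓ e = 1) (hI : range I = {z | 0 ≤ ℓ z}) (h : OrbitFamily ℓ X B T c)
    {b b' : N} (hb : b ∈ B) (hb' : b' ∈ B) {s s' : ℝ} (hs : s ∈ Icc 0 (T b))
    (hs' : s' ∈ Icc 0 (T b')) (heq : c b s = c b' s') : b = b' ∧ s = s' := by
  have key : ∀ {b b' : N}, b ∈ B → b' ∈ B → ∀ {s s' : ℝ}, s ∈ Icc 0 (T b) → s' ∈ Icc 0 (T b') →
      c b s = c b' s' → s ≤ s' → b = b' ∧ s = s' := by
    intro b b' hb hb' s s' hs hs' heq hle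
    have h1 : IsMIntegralCurveOn (c b) X (Icc 0 s) :=
      (h.integral b hb).mono (Icc_subset_Icc_right hs.2)
    have h2 : IsMIntegralCurveOn (c b' ∘ (· + (s' - s))) X (Icc 0 s) :=
      ((h.integral b' hb').comp_add (s' - s)).mono fun t ht => by
        have := ht.1; have := ht.2; have := hs'.2
        constructor <;> linarith
    have h3 := isMIntegralCurveOn_eqOn he hI (right_mem_Icc.2 hs.1) h1 h2
      (fun t ht => h.smooth b hb t ⟨ht.1, ht.2.trans hs.2⟩) (by simpa using heq)
      (left_mem_Icc.2 hs.1)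
    simp only [Function.comp_apply, zero_add, h.zero b hb] at h3
    rcases hle.eq_or_lt with rfl | hlt
    · rw [sub_self, h.zero b' hb'] at h3
      exact ⟨h3, rfl⟩
    · exfalso
      have hbd := h.boundary b hb
      rcases (show s' - s ≤ T b' by linarith [hs'.2, hs.1]).eq_or_lt with h4 | h4
      · have h5 := h.inward b hb
        have h6 := h.exit_neg he hI hb'
        rw [← h4, ← h3] at h6
        exact lt_asymm h5 h6
      · have h5 := h.interior b' hb' (s' - s) ⟨by linarith, h4⟩
        rw [← h3] at h5
        rw [← I.compl_interior] at hbd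
        exact hbd h5
  rcases le_total s s' with hle | hle
  · exact key hb hb' hs hs' heq hle
  · have := key hb' hb hs' hs heq.symm hle
    exact ⟨this.1.symm, this.2.symm⟩

/-- An integral curve through the interior follows a member of the family, as long as it lasts. -/
theorem continuation (he : ℓ e = 1) (hI : range I = {z | 0 ≤ ℓ z}) (h : OrbitFamily ℓ X B T c)
    {b : N} (hb : b ∈ B) {σ δ : ℝ} (hσ : σ ∈ Icc 0 (T b)) (hδ : 0 ≤ δ) {c₂ : ℝ → N}
    (h₂ : IsMIntegralCurveOn c₂ X (Icc 0 δ)) (h0 : c₂ 0 = c b σ)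
    (hint : ∀ t ∈ Ioo 0 δ, c₂ t ∈ I.interior N) : σ + δ ≤ T b ∧ c₂ δ = c b (σ + δ) := by
  rcases hδ.eq_or_lt with rfl | hδ
  · simpa using! ⟨hσ.2, h0⟩
  -- If the curve starts at the exit point it cannot continue: staying in the half-space would force
  -- a non-negative normal component of the field, which is negative there. Otherwise both curves
  -- agree while they last, and the family member cannot reach the boundary while `c₂` is in the
  -- interior.
  rcases hσ.2.eq_or_lt with rfl | hlt
  · exfalso
    have h1 := normal_nonneg_of_left he hI hδ h₂ (by rw [h0]; exact h.exit b hb)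
    rw [h0] at h1
    exact absurd (h.exit_neg he hI hb) (not_lt.2 h1)
  have hμ : 0 ≤ min δ (T b - σ) := le_min hδ.le (by linarith)
  have h3 : EqOn (c b ∘ (· + σ)) c₂ (Icc 0 (min δ (T b - σ))) := by
    refine isMIntegralCurveOn_eqOn he hI (left_mem_Icc.2 hμ)
      (((h.integral b hb).comp_add σ).mono fun t ht => ?_)
      (h₂.mono (Icc_subset_Icc_right (min_le_left _ _))) (fun t ht => ?_) (by simp [h0])
    · have h4 := ht.2.trans (min_le_right δ (T b - σ))
      have := ht.1; have := hσ.1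
      constructor <;> linarith
    · have h4 := ht.2.trans (min_le_right δ (T b - σ))
      exact h.smooth b hb _ ⟨by linarith [ht.1, hσ.1], by linarith⟩
  have h5 := h3 (right_mem_Icc.2 hμ)
  rcases le_or_gt δ (T b - σ) with hle | hgt
  · rw [min_eq_left hle] at h5
    simp only [Function.comp_apply] at h5
    exact ⟨by linarith, by rw [← h5, add_comm]⟩
  · exfalso
    rw [min_eq_right hgt.le] at h5
    simp only [Function.comp_apply, sub_add_cancel] at h5
    have h6 := hint (T b - σ) ⟨by linarith, hgt⟩
    have h7 := h.exit b hb
    rw [h5, ← I.compl_interior] at h7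
    exact h7 h6

end OrbitFamily

/-- The map that carries the curve `c b` to the curve `c' b`. -/
def orbitMap (B : Set N) (T : N → ℝ) (c : N → ℝ → N) (c' : N → ℝ → N') (q : N) (q' : N') : N' :=
  open Classical in
  if h : ∃ p : N × ℝ, p.1 ∈ B ∧ p.2 ∈ Icc 0 (T p.1) ∧ c p.1 p.2 = q then
    c' h.choose.1 h.choose.2 else q'

theorem OrbitFamily.orbitMap_apply [FiniteDimensional ℝ E] [T2Space N] (he : ℓ e = 1)
    (hI : range I = {z | 0 ≤ ℓ z}) (h : OrbitFamily ℓ X B T c)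
    (c' : N → ℝ → N') (q' : N') {b : N} (hb : b ∈ B) {s : ℝ} (hs : s ∈ Icc 0 (T b)) :
    orbitMap B T c c' (c b s) q' = c' b s := by
  have hex : ∃ p : N × ℝ, p.1 ∈ B ∧ p.2 ∈ Icc 0 (T p.1) ∧ c p.1 p.2 = c b s :=
    ⟨(b, s), hb, hs, rfl⟩
  rw [orbitMap, dif_pos hex]
  obtain ⟨h1, h2⟩ := h.injective he hI hex.choose_spec.1 hb hex.choose_spec.2.1 hs
    hex.choose_spec.2.2
  rw [h1, h2]

end OrbitFamilies

/-! ### Smoothness of the conjugation near the initial points -/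

section Inverse

variable {E : Type*} [NormedAddCommGroup E] [NormedSpace ℝ E] [FiniteDimensional ℝ E]

theorem exists_local_inverse {f : E → E} {z : E} {k : ℕ} (hk : 1 ≤ k) (hf : ContDiffAt ℝ k f z)
    (hinj : ∀ a, fderiv ℝ f z a = 0 → a = 0) :
    ∃ g : E → E, ContDiffAt ℝ k g (f z) ∧ g (f z) = z ∧ (∀ᶠ w in 𝓝 (f z), f (g w) = w) ∧
      ∀ᶠ y in 𝓝 z, g (f y) = y := by
  have : CompleteSpace E := FiniteDimensional.complete ℝ E
  have hk' : ((k : ℕ) : WithTop ℕ∞) ≠ 0 := by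
    have : k ≠ 0 := by omega
    exact_mod_cast this
  have hinj' : Function.Injective (fderiv ℝ f z : E →ₗ[ℝ] E) := by
    rw [← LinearMap.ker_eq_bot, LinearMap.ker_eq_bot']
    exact hinj
  set f' : E ≃L[ℝ] E := (LinearEquiv.ofInjectiveEndo _ hinj').toContinuousLinearEquiv
  have hf' : HasFDerivAt f (f' : E →L[ℝ] E) z := by
    have h1 : (f' : E →L[ℝ] E) = fderiv ℝ f z := by
      ext a
      rfl
    rw [h1]
    exact (hf.differentiableAt hk').hasFDerivAt
  refine ⟨hf.localInverse hf' hk', hf.to_localInverse hf' hk', hf.localInverse_apply_image hf' hk',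
    ?_, ?_⟩
  · exact (hf.hasStrictFDerivAt' hf' hk').eventually_right_inverse
  · exact (hf.hasStrictFDerivAt' hf' hk').eventually_left_inverse

end Inverse

section Conjugation

universe u

variable {E : Type u} [NormedAddCommGroup E] [NormedSpace ℝ E]
  {H : Type*} [TopologicalSpace H] {I : ModelWithCorners ℝ E H}
  {N : Type*} [TopologicalSpace N] [ChartedSpace H N] [IsManifold I ∞ N]
  {N' : Type*} [TopologicalSpace N'] [ChartedSpace H N'] [IsManifold I ∞ N']
  {X : (q : N) → TangentSpace I q} {q₀ : N} {k : ℕ} {Xe : E → E}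

namespace LocalFlow

/-- At time zero the flow is the identity in space and moves with the field in time. This is what
makes boundary point and time valid coordinates when the field is transversal. -/
theorem fderiv_Φ (L : LocalFlow X q₀ k Xe) (hk : 1 ≤ k) (a : E) (τ : ℝ) :
    fderiv ℝ L.Φ (extChartAt I q₀ q₀, 0) (a, τ) = a + τ • Xe (extChartAt I q₀ q₀) := by
  set z := extChartAt I q₀ q₀
  have hk' : ((k : ℕ) : WithTop ℕ∞) ≠ 0 := by
    have : k ≠ 0 := by omega
    exact_mod_cast this
  have h0 : |(0 : ℝ)| < L.ε := by simpa using L.ε_pos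
  have hd : HasFDerivAt L.Φ (fderiv ℝ L.Φ (z, 0)) (z, 0) :=
    ((L.contDiffAt z L.mem_V 0 h0).differentiableAt hk').hasFDerivAt
  have h1 : fderiv ℝ L.Φ (z, 0) (a, 0) = a := by
    have h2 : HasFDerivAt (fun y => L.Φ (y, (0 : ℝ)))
        ((fderiv ℝ L.Φ (z, 0)).comp ((ContinuousLinearMap.id ℝ E).prod 0)) z :=
      hd.comp z ((hasFDerivAt_id z).prodMk (hasFDerivAt_const (0 : ℝ) z))
    have h3 : HasFDerivAt (fun y => L.Φ (y, (0 : ℝ))) (ContinuousLinearMap.id ℝ E) z :=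
      (hasFDerivAt_id z).congr_of_eventuallyEq (by
        filter_upwards [L.isOpen_V.mem_nhds L.mem_V] with y hy
        exact L.Φ_zero y hy)
    simpa using! DFunLike.congr_fun (h2.unique h3) a
  have h4 : fderiv ℝ L.Φ (z, 0) (0, τ) = τ • Xe z := by
    have h2 : HasDerivAt (fun t => L.Φ (z, t)) (fderiv ℝ L.Φ (z, 0) (0, 1)) 0 :=
      hd.comp_hasDerivAt (0 : ℝ) ((hasDerivAt_const (0 : ℝ) z).prodMk (hasDerivAt_id (0 : ℝ)))
    have h3 := L.Φ_deriv z L.mem_V 0 h0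
    rw [L.Φ_zero z L.mem_V] at h3
    rw [← h2.unique h3, ← map_smul]
    simp
  rw [← h1, ← h4, ← map_add, h1]
  simp

/-- Near an inward pointing initial point the normal coordinate increases along the extended flow.
It thus decides the sign of the time at which a boundary point is carried to a point of the
half-space. -/
theorem strictMonoOn_normal (L : LocalFlow X q₀ k Xe) {ℓ : E →L[ℝ] ℝ}
    (hU : L.U ⊆ {z | 0 < ℓ (Xe z)}) {z : E} (hz : z ∈ L.V) :
    StrictMonoOn (fun t => ℓ (L.Φ (z, t))) (Ioo (-L.ε) L.ε) := by
  have hd : ∀ t ∈ Ioo (-L.ε) L.ε, HasDerivAt (fun t => ℓ (L.Φ (z, t))) (ℓ (Xe (L.Φ (z, t)))) t :=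
    fun t ht => ℓ.hasFDerivAt.comp_hasDerivAt t (L.Φ_deriv z hz t (abs_lt.2 ht))
  refine strictMonoOn_of_deriv_pos (convex_Ioo _ _)
    (fun t ht => (hd t ht).continuousAt.continuousWithinAt) fun t ht => ?_
  rw [interior_Ioo] at ht
  rw [(hd t ht).deriv]
  exact hU (L.Φ_mem z hz t (abs_lt.2 ht))

theorem strictAntiOn_normal (L : LocalFlow X q₀ k Xe) {ℓ : E →L[ℝ] ℝ}
    (hU : L.U ⊆ {z | ℓ (Xe z) < 0}) {z : E} (hz : z ∈ L.V) :
    StrictAntiOn (fun t => ℓ (L.Φ (z, t))) (Ioo (-L.ε) L.ε) := by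
  have hd : ∀ t ∈ Ioo (-L.ε) L.ε, HasDerivAt (fun t => ℓ (L.Φ (z, t))) (ℓ (Xe (L.Φ (z, t)))) t :=
    fun t ht => ℓ.hasFDerivAt.comp_hasDerivAt t (L.Φ_deriv z hz t (abs_lt.2 ht))
  refine strictAntiOn_of_deriv_neg (convex_Ioo _ _)
    (fun t ht => (hd t ht).continuousAt.continuousWithinAt) fun t ht => ?_
  rw [interior_Ioo] at ht
  rw [(hd t ht).deriv]
  exact hU (L.Φ_mem z hz t (abs_lt.2 ht))

end LocalFlow

variable {ℓ : E →L[ℝ] ℝ} {e : E}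
variable {B : Set N} {T : N → ℝ} {c : N → ℝ → N}
variable {X' : (q : N') → TangentSpace I q} {c' : N → ℝ → N'} {ψ : N → N'} {κ : N → N'}

variable (I X') in
/-- The curves `c' b` are integral curves of `X'` with initial points `ψ b`, and `κ` maps the
curves `c b` to them. -/
structure Conjugates (B : Set N) (T : N → ℝ) (c : N → ℝ → N) (ψ : N → N') (c' : N → ℝ → N')
    (κ : N → N') : Prop where
  smooth_init : ∀ b ∈ B, ContMDiffAt I I ∞ ψ b
  zero : ∀ b ∈ B, c' b 0 = ψ b
  integral : ∀ b ∈ B, IsMIntegralCurveOn (c' b) X' (Icc 0 (T b))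
  smooth : ∀ b ∈ B, ∀ s ∈ Icc 0 (T b), SmoothFieldAt I X' (c' b s)
  map : ∀ b ∈ B, ∀ s ∈ Icc 0 (T b), κ (c b s) = c' b s

variable [FiniteDimensional ℝ E] [T2Space N] [T2Space N']

/-- Since the field is transversal at `b`, the map (boundary point, time) ↦ point of the flow line
is a local diffeomorphism of the extended picture. Its inverse gives the foot `β` and the time `ℓ ∘
Λ`, and in these terms `κ` is the flow of `X'` issued from `ψ` of the foot. Points of the manifold
have non-negative times and feet in `B`, which is relatively open in the boundary, so they lie on
orbits of the family. -/
theorem OrbitFamily.contMDiffAt_initial (he : ℓ e = 1) (hI : range I = {z | 0 ≤ ℓ z})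
    (h : OrbitFamily ℓ X B T c) (hopen : ∀ b ∈ B, ∀ᶠ b' in 𝓝 b, b' ∈ I.boundary N → b' ∈ B)
    (hC : Conjugates I X' B T c ψ c' κ) {b : N} (hb : b ∈ B) {k : ℕ} (hk : 1 ≤ k) :
    sweep B T c ∈ 𝓝 b ∧ ContMDiffAt I I k κ b := by
  have : IsManifold I k N := IsManifold.of_le (n := ∞) (by exact_mod_cast le_top)
  have : IsManifold I k N' := IsManifold.of_le (n := ∞) (by exact_mod_cast le_top)
  have hIc : IsClosed (range I) := by
    rw [hI]; exact isClosed_le continuous_const ℓ.continuous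
  have h0T : (0 : ℝ) ∈ Icc 0 (T b) := left_mem_Icc.2 (h.pos b hb).le
  have hXb := h.smooth b hb 0 h0T
  rw [h.zero b hb] at hXb
  have hXb' := hC.smooth b hb 0 h0T
  rw [hC.zero b hb] at hXb'
  obtain ⟨Xe, hXe, hXXe⟩ := hXb.exists_extension he hI k
  obtain ⟨Xe', hXe', hXXe'⟩ := hXb'.exists_extension he hI k
  set z₀ := extChartAt I b b with hz₀
  have hXez : Xe z₀ = X b :=
    (hXXe.self_of_nhdsWithin (mem_range_self _)).trans (chartField_self X b)
  have hpos : 0 < ℓ (Xe z₀) := by rw [hXez]; exact h.inward b hb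
  have hℓz : ℓ z₀ = 0 :=
    (mem_boundary_iff_eq_zero he hI (mem_extChartAt_source b)).1 (h.boundary b hb)
  have hO : {z | 0 < ℓ (Xe z)} ∈ 𝓝 z₀ :=
    (ℓ.continuous.continuousAt.comp hXe.continuousAt).eventually (lt_mem_nhds hpos)
  obtain ⟨L, hLU⟩ := exists_localFlow hk hXe hXXe hO
  obtain ⟨L', -⟩ := exists_localFlow hk hXe' hXXe' univ_mem
  have hLε := L.ε_pos
  -- the boundary normal flow coordinates
  set A : E → E × ℝ := fun y => (y - ℓ y • e, ℓ y) with hA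
  have hAd : ContDiff ℝ k A := by fun_prop
  have hAz : A z₀ = (z₀, 0) := by simp [hA, hℓz]
  have hΦ : ContDiffAt ℝ k L.Φ (A z₀) := by
    rw [hAz]; exact L.contDiffAt z₀ L.mem_V 0 (by simpa using hLε)
  have hm : ContDiffAt ℝ k (L.Φ ∘ A) z₀ := hΦ.comp z₀ hAd.contDiffAt
  have hmz : (L.Φ ∘ A) z₀ = z₀ := by
    simp only [Function.comp_apply, hAz]; exact L.Φ_zero z₀ L.mem_V
  have hk' : ((k : ℕ) : WithTop ℕ∞) ≠ 0 := by
    have : k ≠ 0 := by omega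
    exact_mod_cast this
  -- The derivative is `a ↦ a - ℓ a • e + ℓ a • Xe z₀`. Applying `ℓ` leaves `ℓ a * ℓ (Xe z₀)`, so
  -- transversality first gives `ℓ a = 0` and then `a = 0`.
  have hinj : ∀ a, fderiv ℝ (L.Φ ∘ A) z₀ a = 0 → a = 0 := by
    intro a ha
    have hAd' : HasFDerivAt A ((ContinuousLinearMap.id ℝ E - ℓ.smulRight e).prod ℓ) z₀ :=
      ((ContinuousLinearMap.id ℝ E - ℓ.smulRight e).prod ℓ).hasFDerivAt
    rw [((hΦ.differentiableAt hk').hasFDerivAt.comp z₀ hAd').fderiv, hAz] at ha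
    have h1 : fderiv ℝ L.Φ (z₀, 0) (a - ℓ a • e, ℓ a) = 0 := ha
    rw [L.fderiv_Φ hk] at h1
    have h2 := congrArg ℓ h1
    simp only [map_add, map_sub, map_smul, he, smul_eq_mul, mul_one, sub_self, zero_add,
      map_zero] at h2
    have h3 : ℓ a = 0 := (mul_eq_zero.1 h2).resolve_right hpos.ne'
    simpa [h3] using h1
  obtain ⟨Λ, hΛ, hΛz, hΛr, -⟩ := exists_local_inverse hk hm hinj
  rw [hmz] at hΛ hΛz hΛr
  set β : E → E := fun z => Λ z - ℓ (Λ z) • e with hβ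
  have hβd : ContDiffAt ℝ k β z₀ := hΛ.sub ((ℓ.contDiff.contDiffAt.comp z₀ hΛ).smul contDiffAt_const)
  have hβz : β z₀ = z₀ := by simp [hβ, hΛz, hℓz]
  have hβℓ : ∀ z, ℓ (β z) = 0 := fun z => by simp [hβ, he]
  have hβI : ∀ z, β z ∈ range I := fun z => by rw [hI]; exact (hβℓ z).ge
  have hsd : ContDiffAt ℝ k (fun z => ℓ (Λ z)) z₀ := ℓ.contDiff.contDiffAt.comp z₀ hΛ
  have hψ := hC.smooth_init b hb
  have hψc := contMDiffAt_iff.1 hψ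
  set G : E → E := fun z => L'.Φ (extChartAt I (ψ b) (ψ ((extChartAt I b).symm (β z))), ℓ (Λ z))
  have hG : ContDiffWithinAt ℝ k G (range I) z₀ := by
    have h1 : ContDiffWithinAt ℝ k (fun z => extChartAt I (ψ b) (ψ ((extChartAt I b).symm (β z))))
        (range I) z₀ := by
      have h2 : ContDiffWithinAt ℝ k (extChartAt I (ψ b) ∘ ψ ∘ (extChartAt I b).symm) (range I)
          (β z₀) := by
        rw [hβz]
        exact hψc.2.of_le (by exact_mod_cast le_top)
      exact h2.comp z₀ hβd.contDiffWithinAt (fun z _ => hβI z)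
    have h3 : ContDiffAt ℝ k L'.Φ (extChartAt I (ψ b) (ψ ((extChartAt I b).symm (β z₀))), ℓ (Λ z₀)) := by
      rw [hβz, hΛz, hℓz, extChartAt_to_inv]
      exact L'.contDiffAt _ L'.mem_V 0 (by simpa using L'.ε_pos)
    exact h3.comp_contDiffWithinAt z₀ (h1.prodMk hsd.contDiffWithinAt)
  -- points near `b` lie on curves issued from `B`
  have hext : Tendsto (extChartAt I b) (𝓝 b) (𝓝 z₀) := (continuousAt_extChartAt b).tendsto
  have hβt : Tendsto (fun q => β (extChartAt I b q)) (𝓝 b) (𝓝 z₀) := by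
    have := hβd.continuousAt.tendsto.comp hext
    rwa [hβz] at this
  have hst : Tendsto (fun q => ℓ (Λ (extChartAt I b q))) (𝓝 b) (𝓝 0) := by
    have := hsd.continuousAt.tendsto.comp hext
    rwa [hΛz, hℓz] at this
  have hbt : Tendsto (fun q => (extChartAt I b).symm (β (extChartAt I b q))) (𝓝 b) (𝓝 b) := by
    have := (continuousAt_extChartAt_symm (I := I) b).tendsto
    rw [extChartAt_to_inv] at this
    exact this.comp hβt
  have hψt : ∀ᶠ b' in 𝓝 b, ψ b' ∈ (extChartAt I (ψ b)).source ∧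
      extChartAt I (ψ b) (ψ b') ∈ L'.V :=
    (hψc.1.eventually (extChartAt_source_mem_nhds (ψ b))).and
      (((continuousAt_extChartAt (ψ b)).tendsto.comp hψc.1.tendsto).eventually
        (L'.isOpen_V.mem_nhds L'.mem_V))
  have habs : Tendsto (fun q => |ℓ (Λ (extChartAt I b q))|) (𝓝 b) (𝓝 0) := by
    simpa using hst.abs
  have key : ∀ᶠ q in 𝓝 b, q ∈ sweep B T c ∧ κ q ∈ (extChartAt I (ψ b)).source ∧
      extChartAt I (ψ b) (κ q) = G (extChartAt I b q) := by
    filter_upwards [hβt.eventually (L.isOpen_V.mem_nhds L.mem_V),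
      habs.eventually (gt_mem_nhds hLε), habs.eventually (gt_mem_nhds L'.ε_pos),
      hext.eventually hΛr, extChartAt_source_mem_nhds (I := I) b,
      hbt.eventually (hopen b hb), hbt.eventually hψt] with q hqV hqε hqε' hqr hqs hqB hqψ
    set z := extChartAt I b q with hz
    set s := ℓ (Λ z) with hs
    have hΦz : L.Φ (β z, s) = z := hqr
    have hβt : β z ∈ (extChartAt I b).target :=
      L.mem_target _ (L.V_subset hqV) (hβI z)
    have hbs : (extChartAt I b).symm (β z) ∈ (extChartAt I b).source :=
      (extChartAt I b).map_target hβt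
    have hmono := L.strictMonoOn_normal hLU hqV
    have h00 : (0 : ℝ) ∈ Ioo (-L.ε) L.ε := ⟨by linarith, hLε⟩
    have hval0 : ℓ (L.Φ (β z, 0)) = 0 := by rw [L.Φ_zero _ hqV, hβℓ]
    have hsm := abs_lt.1 hqε
    -- A negative time would put the point `z` below the boundary hyperplane, because the normal
    -- coordinate vanishes at the foot and increases with time.
    have hs0 : 0 ≤ s := by
      by_contra hneg
      have h1 := hmono ⟨hsm.1, hsm.2⟩ h00 (not_le.1 hneg)
      simp only [hval0, hΦz] at h1
      exact absurd (nonneg_extChartAt hI b q) (not_le.2 h1)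
    have hmem : ∀ t ∈ Icc 0 s, t ∈ Ioo (-L.ε) L.ε := fun t ht =>
      ⟨by linarith [ht.1], lt_of_le_of_lt ht.2 hsm.2⟩
    have hrange : ∀ t ∈ Icc 0 s, L.Φ (β z, t) ∈ range I := fun t ht => by
      rw [hI]
      show 0 ≤ ℓ _
      rw [← hval0]
      exact hmono.monotoneOn h00 (hmem t ht) ht.1
    have hbb : (extChartAt I b).symm (β z) ∈ B := by
      refine hqB ((mem_boundary_iff_eq_zero he hI hbs).2 ?_)
      rw [(extChartAt I b).right_inv hβt, hβℓ]
    have hcurve : IsMIntegralCurveOn (fun t => (extChartAt I b).symm (L.Φ (β z, t + 0))) X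
        (Icc 0 s) := L.isMIntegralCurveOn hqV
      (fun t ht => by rw [add_zero]; exact abs_lt.2 (hmem t ht))
      (fun t ht => by rw [add_zero]; exact hrange t ht)
    obtain ⟨h1, h2⟩ := h.continuation he hI hbb (σ := 0) (left_mem_Icc.2 (h.pos _ hbb).le) hs0 hcurve
      (by simp only [add_zero]; rw [L.Φ_zero _ hqV, h.zero _ hbb]) (fun t ht => by
        simp only [add_zero]
        have htg := L.mem_target _ (L.Φ_mem _ hqV t (abs_lt.2 (hmem t ⟨ht.1.le, ht.2.le⟩)))
          (hrange t ⟨ht.1.le, ht.2.le⟩)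
        rw [mem_interior_iff_pos he hI ((extChartAt I b).map_target htg),
          (extChartAt I b).right_inv htg, ← hval0]
        exact hmono h00 (hmem t ⟨ht.1.le, ht.2.le⟩) ht.1)
    simp only [add_zero, zero_add, hΦz] at h1 h2
    rw [hz, (extChartAt I b).left_inv hqs, ← hz] at h2
    have h3 := L'.tracking hIc (t₀ := 0) ((hC.integral _ hbb).mono (Icc_subset_Icc_right h1))
      (left_mem_Icc.2 hs0) (by rw [hC.zero _ hbb]; exact hqψ.1) (by rw [hC.zero _ hbb]; exact hqψ.2)
      (fun t ht => by
        rw [sub_zero, abs_of_nonneg ht.1]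
        exact lt_of_le_of_lt (ht.2.trans (le_abs_self s)) hqε') s (right_mem_Icc.2 hs0)
    rw [← hC.map _ hbb s ⟨hs0, h1⟩, ← h2, hC.zero _ hbb, sub_zero] at h3
    exact ⟨⟨_, hbb, s, ⟨hs0, h1⟩, h2.symm⟩, h3⟩
  exact ⟨key.mono fun q hq => hq.1,
    contMDiffAt_of_eventually_extChartAt_eq (mem_chart_source H b)
      (key.mono fun q hq => hq.2) hG⟩

end Conjugation

/-! ### Propagation of smoothness along the orbits -/

section Conjugation

universe u

variable {E : Type u} [NormedAddCommGroup E] [NormedSpace ℝ E]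
  {H : Type*} [TopologicalSpace H] {I : ModelWithCorners ℝ E H}
  {N : Type*} [TopologicalSpace N] [ChartedSpace H N] [IsManifold I ∞ N]
  {N' : Type*} [TopologicalSpace N'] [ChartedSpace H N'] [IsManifold I ∞ N']
  {X : (q : N) → TangentSpace I q} {q₀ : N} {k : ℕ} {Xe : E → E}
  {ℓ : E →L[ℝ] ℝ} {e : E}
  {B : Set N} {T : N → ℝ} {c : N → ℝ → N}
  {X' : (q : N') → TangentSpace I q} {c' : N → ℝ → N'} {ψ : N → N'} {κ : N → N'}
  [FiniteDimensional ℝ E] [T2Space N] [T2Space N']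

theorem eventually_extChartAt_mem {γ : ℝ → N} {S : Set ℝ} {s : ℝ} {V : Set E}
    (hγ : ContinuousWithinAt γ S s) (hV : IsOpen V) (hm : extChartAt I (γ s) (γ s) ∈ V) :
    ∀ᶠ t in 𝓝[S] s, γ t ∈ (extChartAt I (γ s)).source ∧ extChartAt I (γ s) (γ t) ∈ V :=
  (hγ.eventually (extChartAt_source_mem_nhds (γ s))).and
    (((continuousAt_extChartAt (γ s)).tendsto.comp hγ.tendsto).eventually (hV.mem_nhds hm))

/-- Near a point of an orbit with positive time, the flow backwards in time stays in the interior. -/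
theorem OrbitFamily.exists_localFlow (he : ℓ e = 1) (hI : range I = {z | 0 ≤ ℓ z})
    (h : OrbitFamily ℓ X B T c) {b : N} (hb : b ∈ B) {s : ℝ} (hs : s ∈ Ioc 0 (T b)) {k : ℕ}
    (hk : 1 ≤ k) : ∃ (Xe : E → E) (L : LocalFlow X (c b s) k Xe),
      ∀ z ∈ L.V, 0 ≤ ℓ z → ∀ t ∈ Ioo (-L.ε) 0, 0 < ℓ (L.Φ (z, t)) := by
  have hXs := h.smooth b hb s ⟨hs.1.le, hs.2⟩
  obtain ⟨Xe, hXe, hXXe⟩ := hXs.exists_extension he hI k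
  set z₀ := extChartAt I (c b s) (c b s) with hz₀
  rcases hs.2.eq_or_lt with rfl | hlt
  · have hneg : ℓ (Xe z₀) < 0 := by
      rw [(hXXe.self_of_nhdsWithin (mem_range_self _)).trans (chartField_self X (c b (T b)))]
      exact h.exit_neg he hI hb
    have hO : {z | ℓ (Xe z) < 0} ∈ 𝓝 z₀ :=
      (ℓ.continuous.continuousAt.comp hXe.continuousAt).eventually (gt_mem_nhds hneg)
    obtain ⟨L, hLU⟩ := FinslerRigidity.exists_localFlow hk hXe hXXe hO
    refine ⟨Xe, L, fun z hz h0 t ht => ?_⟩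
    have h1 := L.strictAntiOn_normal hLU hz ⟨ht.1, by linarith [ht.2, L.ε_pos]⟩
      (show (0 : ℝ) ∈ Ioo (-L.ε) L.ε from ⟨by linarith [L.ε_pos], L.ε_pos⟩) ht.2
    simp only [L.Φ_zero z hz] at h1
    exact h0.trans_lt h1
  · have hpos : 0 < ℓ z₀ := (mem_interior_iff_pos he hI (mem_extChartAt_source _)).1
      (h.interior b hb s ⟨hs.1, hlt⟩)
    have hO : {z | 0 < ℓ z} ∈ 𝓝 z₀ := ℓ.continuous.continuousAt.eventually (lt_mem_nhds hpos)
    obtain ⟨L, hLU⟩ := FinslerRigidity.exists_localFlow hk hXe hXXe hO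
    exact ⟨Xe, L, fun z hz _ t ht => hLU (L.Φ_mem z hz t (abs_lt.2
      ⟨ht.1, by linarith [ht.2, L.ε_pos]⟩))⟩

/-- With `δ = s₂ - s₁`, near `c b s₂` the map `κ` equals the flow of `X'` for time `δ`, after `κ`
near `c b s₁`, after the flow of `X` for time `-δ`. Flowing backwards keeps points of the half-space
inside it; this is where `0 < s` is needed, as at an initial point the backward flow leaves the
manifold. By `continuation`, flowing forwards again from a swept out point stays on the same member
of the family. -/
theorem OrbitFamily.contMDiffAt_step (he : ℓ e = 1) (hI : range I = {z | 0 ≤ ℓ z})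
    (h : OrbitFamily ℓ X B T c)
    (hC : Conjugates I X' B T c ψ c' κ) {b : N} (hb : b ∈ B) {k : ℕ} (hk : 1 ≤ k) {s : ℝ}
    (hs : s ∈ Ioc 0 (T b)) :
    ∃ η > 0, ∀ s₁ ∈ Icc 0 (T b), ∀ s₂ ∈ Icc 0 (T b), s - η < s₁ → s₁ < s₂ → s₂ < s + η →
      sweep B T c ∈ 𝓝 (c b s₁) ∧ ContMDiffAt I I k κ (c b s₁) →
      sweep B T c ∈ 𝓝 (c b s₂) ∧ ContMDiffAt I I k κ (c b s₂) := by
  have : IsManifold I k N := IsManifold.of_le (n := ∞) (by exact_mod_cast le_top)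
  have : IsManifold I k N' := IsManifold.of_le (n := ∞) (by exact_mod_cast le_top)
  have hIc : IsClosed (range I) := by
    rw [hI]; exact isClosed_le continuous_const ℓ.continuous
  have hs' : s ∈ Icc 0 (T b) := ⟨hs.1.le, hs.2⟩
  obtain ⟨Xe, L, hlow⟩ := h.exists_localFlow he hI hb hs hk
  obtain ⟨Xe', hXe', hXXe'⟩ := (hC.smooth b hb s hs').exists_extension he hI k
  obtain ⟨L', -⟩ := FinslerRigidity.exists_localFlow hk hXe' hXXe' univ_mem
  obtain ⟨η₀, hη₀, hball⟩ := Metric.mem_nhdsWithin_iff.1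
    ((eventually_extChartAt_mem (h.integral b hb s hs').1 L.isOpen_V L.mem_V).and
      (eventually_extChartAt_mem (hC.integral b hb s hs').1 L'.isOpen_V L'.mem_V))
  have hε := L.ε_pos
  have hε' := L'.ε_pos
  refine ⟨min η₀ (min (L.ε / 2) (L'.ε / 2)), by positivity, ?_⟩
  intro s₁ hs₁ s₂ hs₂ hl h12 hr hP
  have hm0 := min_le_left η₀ (min (L.ε / 2) (L'.ε / 2))
  have hm1 := (min_le_right η₀ (min (L.ε / 2) (L'.ε / 2))).trans (min_le_left _ _)
  have hm2 := (min_le_right η₀ (min (L.ε / 2) (L'.ε / 2))).trans (min_le_right _ _)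
  obtain ⟨⟨hq1s, hq1V⟩, hp1s, hp1V⟩ := hball (⟨by
    rw [Metric.mem_ball, Real.dist_eq, abs_lt]; constructor <;> linarith, hs₁⟩ :
      s₁ ∈ Metric.ball s η₀ ∩ Icc 0 (T b))
  obtain ⟨⟨hq2s, hq2V⟩, -⟩ := hball (⟨by
    rw [Metric.mem_ball, Real.dist_eq, abs_lt]; constructor <;> linarith, hs₂⟩ :
      s₂ ∈ Metric.ball s η₀ ∩ Icc 0 (T b))
  set δ := s₂ - s₁ with hδ
  have hδ0 : 0 < δ := by linarith
  have hδε : δ < L.ε := by linarith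
  have hδε' : δ < L'.ε := by linarith
  set z₂ := extChartAt I (c b s) (c b s₂) with hz₂
  set z₁ := extChartAt I (c b s) (c b s₁) with hz₁
  have hback : L.Φ (z₂, -δ) = z₁ := by
    have := (L.tracking hIc ((h.integral b hb).mono (Icc_subset_Icc hs₁.1 hs₂.2))
      (right_mem_Icc.2 h12.le) hq2s hq2V (fun t ht => by
        rw [abs_lt]; constructor <;> linarith [ht.1, ht.2]) s₁ (left_mem_Icc.2 h12.le)).2
    rw [hz₁, this, hδ, neg_sub]
  have hΦ2 : ContDiffAt ℝ k L.Φ (z₂, -δ) :=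
    L.contDiffAt z₂ hq2V (-δ) (by rw [abs_neg, abs_of_pos hδ0]; exact hδε)
  have hf1 : ContDiffAt ℝ k (fun z => L.Φ (z, -δ)) z₂ :=
    hΦ2.comp z₂ (contDiffAt_id.prodMk contDiffAt_const)
  have hκq : κ (c b s₁) = c' b s₁ := hC.map b hb s₁ hs₁
  have hq1c : c b s₁ ∈ (chartAt H (c b s)).source := by rwa [← extChartAt_source I]
  have hq2c : c b s₂ ∈ (chartAt H (c b s)).source := by rwa [← extChartAt_source I]
  have hp1c : κ (c b s₁) ∈ (chartAt H (c' b s)).source := by rw [hκq]; rwa [← extChartAt_source I]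
  have hκ := (contMDiffAt_iff_of_mem_source (I := I) (I' := I) hq1c hp1c).1 hP.2
  set G : E → E := fun z => L'.Φ (extChartAt I (c' b s) (κ ((extChartAt I (c b s)).symm (L.Φ (z, -δ)))), δ)
  have hext : Tendsto (extChartAt I (c b s)) (𝓝 (c b s₂)) (𝓝[range I] z₂) :=
    tendsto_nhdsWithin_iff.2 ⟨(continuousAt_extChartAt' hq2s).tendsto,
      Eventually.of_forall fun q => mem_range_self _⟩
  have hlow' : ∀ᶠ z in 𝓝[range I] z₂, z ∈ L.V ∧ 0 ≤ ℓ z := by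
    filter_upwards [self_mem_nhdsWithin, nhdsWithin_le_nhds (L.isOpen_V.mem_nhds hq2V)] with z hz hzV
    rw [hI] at hz
    exact ⟨hzV, hz⟩
  have hG : ContDiffWithinAt ℝ k G (range I) z₂ := by
    have h1 : ContDiffWithinAt ℝ k (extChartAt I (c' b s) ∘ κ ∘ (extChartAt I (c b s)).symm) (range I)
        (L.Φ (z₂, -δ)) := by rw [hback]; exact hκ.2
    have h2 := h1.comp_of_preimage_mem_nhdsWithin z₂ hf1.contDiffWithinAt (by
      filter_upwards [hlow'] with z hz
      show L.Φ (z, -δ) ∈ range I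
      rw [hI]
      exact (hlow z hz.1 hz.2 (-δ) ⟨by linarith, by linarith⟩).le)
    have h3 : ContDiffAt ℝ k L'.Φ ((extChartAt I (c' b s) ∘ κ ∘ (extChartAt I (c b s)).symm) (L.Φ (z₂, -δ)), δ) := by
      rw [hback]
      simp only [Function.comp_apply]
      rw [(extChartAt I (c b s)).left_inv hq1s, hκq]
      exact L'.contDiffAt _ hp1V δ (by rw [abs_of_pos hδ0]; exact hδε')
    exact h3.comp_contDiffWithinAt z₂ (h2.prodMk contDiffWithinAt_const)
  have hf1t : Tendsto (fun y => (extChartAt I (c b s)).symm (L.Φ (extChartAt I (c b s) y, -δ)))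
      (𝓝 (c b s₂)) (𝓝 (c b s₁)) := by
    have h1 := (continuousAt_extChartAt_symm' (I := I) hq1s).tendsto
    rw [(extChartAt I (c b s)).left_inv hq1s] at h1
    have h2 := hf1.continuousAt.tendsto.comp (hext.mono_right nhdsWithin_le_nhds)
    rw [hback] at h2
    exact h1.comp h2
  have hκt : ∀ᶠ y in 𝓝 (c b s₁), κ y ∈ (extChartAt I (c' b s)).source ∧ extChartAt I (c' b s) (κ y) ∈ L'.V := by
    have h1 : Tendsto κ (𝓝 (c b s₁)) (𝓝 (c' b s₁)) := by rw [← hκq]; exact hκ.1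
    exact (h1.eventually (extChartAt_source_mem_nhds' (I := I) hp1s)).and
      (((continuousAt_extChartAt' hp1s).tendsto.comp h1).eventually (L'.isOpen_V.mem_nhds hp1V))
  have key : ∀ᶠ y in 𝓝 (c b s₂), y ∈ sweep B T c ∧ κ y ∈ (extChartAt I (c' b s)).source ∧
      extChartAt I (c' b s) (κ y) = G (extChartAt I (c b s) y) := by
    filter_upwards [hext.eventually hlow', hf1t.eventually hP.1, hf1t.eventually hκt,
      extChartAt_source_mem_nhds' (I := I) hq2s] with y hy hyS hyκ hys
    set z := extChartAt I (c b s) y with hz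
    have hmem : ∀ t ∈ Icc 0 δ, |t + -δ| < L.ε := fun t ht => by
      rw [abs_lt]; constructor <;> linarith [ht.1, ht.2]
    have hposi : ∀ t ∈ Ico 0 δ, 0 < ℓ (L.Φ (z, t + -δ)) := fun t ht =>
      hlow z hy.1 hy.2 _ ⟨by linarith [ht.1], by linarith [ht.2]⟩
    have hrange : ∀ t ∈ Icc 0 δ, L.Φ (z, t + -δ) ∈ range I := fun t ht => by
      rcases ht.2.eq_or_lt with rfl | h1
      · rw [add_neg_cancel, L.Φ_zero z hy.1]
        exact mem_range_self _
      · rw [hI]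
        exact (hposi t ⟨ht.1, h1⟩).le
    have hcurve := L.isMIntegralCurveOn hy.1 hmem hrange
    obtain ⟨b', hb', σ, hσ, hσq⟩ := hyS
    obtain ⟨h1, h2⟩ := h.continuation he hI hb' hσ hδ0.le hcurve
      (by simp only [zero_add]; exact hσq.symm) (fun t ht => by
        have htg := L.mem_target _ (L.Φ_mem _ hy.1 _ (hmem t ⟨ht.1.le, ht.2.le⟩))
          (hrange t ⟨ht.1.le, ht.2.le⟩)
        rw [mem_interior_iff_pos he hI ((extChartAt I (c b s)).map_target htg),
          (extChartAt I (c b s)).right_inv htg]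
        exact hposi t ⟨ht.1.le, ht.2⟩)
    simp only [add_neg_cancel, L.Φ_zero z hy.1] at h2
    rw [(extChartAt I (c b s)).left_inv hys] at h2
    have hσδ : σ + δ ∈ Icc 0 (T b') := ⟨by linarith [hσ.1], h1⟩
    rw [← hσq, hC.map b' hb' σ hσ] at hyκ
    have h3 := L'.tracking hIc ((hC.integral b' hb').mono (Icc_subset_Icc hσ.1 h1))
      (left_mem_Icc.2 (by linarith)) hyκ.1 hyκ.2
      (fun t ht => by rw [abs_lt]; constructor <;> linarith [ht.1, ht.2]) (σ + δ)
      (right_mem_Icc.2 (by linarith))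
    rw [← hC.map b' hb' _ hσδ, ← h2, ← hC.map b' hb' σ hσ, hσq, add_sub_cancel_left] at h3
    exact ⟨⟨b', hb', _, hσδ, h2.symm⟩, h3⟩
  exact ⟨key.mono fun q hq => hq.1,
    contMDiffAt_of_eventually_extChartAt_eq hq2c (key.mono fun q hq => hq.2) hG⟩

/-- The swept out set is a neighbourhood of each of its points, and the map that conjugates the
two families of orbits is smooth. -/
theorem OrbitFamily.contMDiffAt_conjugation (he : ℓ e = 1) (hI : range I = {z | 0 ≤ ℓ z})
    (h : OrbitFamily ℓ X B T c) (hopen : ∀ b ∈ B, ∀ᶠ b' in 𝓝 b, b' ∈ I.boundary N → b' ∈ B)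
    (hC : Conjugates I X' B T c ψ c' κ) {q : N} (hq : q ∈ sweep B T c) :
    sweep B T c ∈ 𝓝 q ∧ ContMDiffAt I I ∞ κ q := by
  obtain ⟨b, hb, s, hs, rfl⟩ := hq
  -- Each finite order is treated separately, since the extended fields and their local flows depend
  -- on `k`.
  have key : ∀ k : ℕ, 1 ≤ k → sweep B T c ∈ 𝓝 (c b s) ∧ ContMDiffAt I I k κ (c b s) := by
    intro k hk
    have : IsManifold I k N := IsManifold.of_le (n := ∞) (by exact_mod_cast le_top)
    have : IsManifold I k N' := IsManifold.of_le (n := ∞) (by exact_mod_cast le_top)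
    have hinit := h.contMDiffAt_initial he hI hopen hC hb hk
    refine Icc_forward_induction (P := fun s => sweep B T c ∈ 𝓝 (c b s) ∧
      ContMDiffAt I I k κ (c b s)) (by rw [h.zero b hb]; exact hinit) (fun t ht => ?_) s hs
    -- At time `0` the step lemma does not apply. There both properties already hold at every point
    -- near `b`, being open conditions, so nothing has to be propagated.
    rcases ht.1.eq_or_lt with rfl | hpos
    · have h1 : ∀ᶠ q in 𝓝 (c b 0), sweep B T c ∈ 𝓝 q ∧ ContMDiffAt I I k κ q := by
        rw [h.zero b hb]
        exact (eventually_mem_nhds_iff.2 hinit.1).and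
          ((contMDiffAt_iff_contMDiffAt_nhds (by simp)).1 hinit.2)
      obtain ⟨η, hη, hball⟩ := Metric.mem_nhdsWithin_iff.1
        ((h.integral b hb 0 ht).1.eventually h1)
      refine ⟨η, hη, fun s₁ hs₁ s₂ hs₂ _ _ h3 _ => hball ⟨?_, hs₂⟩⟩
      rw [Metric.mem_ball, Real.dist_eq, abs_lt]
      constructor <;> linarith [hs₂.1]
    · exact h.contMDiffAt_step he hI hC hb hk ⟨hpos, ht.2⟩
  exact ⟨(key 1 le_rfl).1, contMDiffAt_infty.2 fun k =>
    ((key (k + 1) (by omega)).2).of_le (by exact_mod_cast Nat.le_succ k)⟩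

end Conjugation

/-! ### Evolution of a pulled back bilinear form -/

section Bilinear

variable {E : Type*} [NormedAddCommGroup E] [NormedSpace ℝ E]

theorem clm_comp_hasDerivWithinAt {F G : Type*} [NormedAddCommGroup F] [NormedSpace ℝ F]
    [NormedAddCommGroup G] [NormedSpace ℝ G] (L : F →L[ℝ] G) {D : ℝ → F} {D' : F} {s : Set ℝ} {t : ℝ}
    (hD : HasDerivWithinAt D D' s t) : HasDerivWithinAt (fun t => L (D t)) (L D') s t :=
  L.hasFDerivAt.comp_hasDerivWithinAt t hD

variable {F G : Type*} [NormedAddCommGroup F] [NormedSpace ℝ F] [NormedAddCommGroup G]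
  [NormedSpace ℝ G]

/-- A shortcut, which keeps the search away from the instances for Riemannian bundles. -/
instance bilinearNormedAddCommGroup : NormedAddCommGroup (E →L[ℝ] F →L[ℝ] G) :=
  ContinuousLinearMap.toNormedAddCommGroup

theorem hasDerivWithinAt_bilinearComp (σ : E →L[ℝ] E →L[ℝ] G) {D : ℝ → E →L[ℝ] E} {D' : E →L[ℝ] E}
    {s : Set ℝ} {t : ℝ} (hD : HasDerivWithinAt D D' s t) :
    HasDerivWithinAt (fun t => σ.bilinearComp (D t) (D t))
      (σ.bilinearComp D' (D t) + σ.bilinearComp (D t) D') s t := by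
  have h1 : HasDerivWithinAt (fun t => σ.comp (D t)) (σ.comp D') s t :=
    clm_comp_hasDerivWithinAt (F := E →L[ℝ] E) (G := E →L[ℝ] E →L[ℝ] G)
      (ContinuousLinearMap.compL ℝ E E (E →L[ℝ] G) σ) hD
  have h2 : HasDerivWithinAt (fun t => (σ.comp (D t)).flip) (σ.comp D').flip s t :=
    clm_comp_hasDerivWithinAt (F := E →L[ℝ] E →L[ℝ] G) (G := E →L[ℝ] E →L[ℝ] G)
      (ContinuousLinearMap.flipₗᵢ ℝ E E G).toContinuousLinearEquiv.toContinuousLinearMap h1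
  have h3 := HasDerivWithinAt.clm_comp (𝕜 := ℝ) (E := E) h2 hD
  exact clm_comp_hasDerivWithinAt (F := E →L[ℝ] E →L[ℝ] G) (G := E →L[ℝ] E →L[ℝ] G)
    (ContinuousLinearMap.flipₗᵢ ℝ E E G).toContinuousLinearEquiv.toContinuousLinearMap h3

/-- The defect `δ`, the pullback of `σ` under `D t` minus `σ`, satisfies `δ'(u, v) = -δ(A u, v) -
δ(u, A v)`: the contributions of `σ` itself cancel because `A` is skew. This equation is linear and
homogeneous with bounded coefficients, so by Grönwall's inequality `δ` vanishes if it vanishes at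
`a`. -/
theorem pullback_bilinear_eq {σ : E →L[ℝ] E →L[ℝ] G} {D D' A : ℝ → E →L[ℝ] E} {a b M : ℝ}
    (hD : ∀ t ∈ Icc a b, HasDerivWithinAt D (D' t) (Icc a b) t)
    (hM : ∀ t ∈ Icc a b, ‖A t‖ ≤ M)
    (h : ∀ t ∈ Icc a b, ∀ u v, σ (D' t u) (D t v) + σ (D t u) (D' t v) =
      -σ (D t (A t u)) (D t v) - σ (D t u) (D t (A t v)))
    (hsk : ∀ t ∈ Icc a b, ∀ u v, σ (A t u) v + σ u (A t v) = 0)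
    (ha : ∀ u v, σ (D a u) (D a v) = σ u v) :
    ∀ t ∈ Icc a b, ∀ u v, σ (D t u) (D t v) = σ u v := by
  set δ : ℝ → E →L[ℝ] E →L[ℝ] G := fun t => σ.bilinearComp (D t) (D t) - σ with hδ
  set δ' : ℝ → E →L[ℝ] E →L[ℝ] G := fun t =>
    σ.bilinearComp (D' t) (D t) + σ.bilinearComp (D t) (D' t) with hδ'
  have hδd : ∀ t ∈ Icc a b, HasDerivWithinAt δ (δ' t) (Icc a b) t := fun t ht => by
    have h1 := hasDerivWithinAt_bilinearComp σ (hD t ht)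
    have h2 := HasDerivWithinAt.sub_const (𝕜 := ℝ) (F := E →L[ℝ] E →L[ℝ] G) σ h1
    exact h2
  have hδa : ∀ t u v, δ t u v = σ (D t u) (D t v) - σ u v := fun t u v => rfl
  have key := eq_zero_of_abs_deriv_le_mul_abs_self_of_eq_zero_right (E := E →L[ℝ] E →L[ℝ] G) (f := δ) (f' := δ')
    (K := 2 * M) (a := a) (b := b) (fun t ht => (hδd t ht).continuousWithinAt)
    (fun t ht => (hδd t (Ico_subset_Icc_self ht)).mono_of_mem_nhdsWithin
      (Icc_mem_nhdsGE_of_mem ⟨ht.1, ht.2⟩)) (by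
        ext u v
        rw [hδa, ha]
        simp) (fun t ht => by
          have ht' := Ico_subset_Icc_self ht
          have hM0 : 0 ≤ M := (norm_nonneg _).trans (hM t ht')
          refine ContinuousLinearMap.opNorm_le_bound₂ _ (by positivity) fun u v => ?_
          have h1 : δ' t u v = -δ t (A t u) v - δ t u (A t v) := by
            have h2 := h t ht' u v
            have h3 := hsk t ht' u v
            have h4 : δ' t u v = σ (D' t u) (D t v) + σ (D t u) (D' t v) := rfl
            rw [h4, h2, hδa, hδa, ← sub_eq_zero]
            rw [← eq_neg_iff_add_eq_zero] at h3
            rw [h3]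
            abel
          rw [h1]
          have h5 : ‖δ t (A t u) v‖ ≤ ‖δ t‖ * (M * ‖u‖) * ‖v‖ :=
            ((δ t).le_opNorm₂ _ _).trans (by
              gcongr
              exact (A t).le_of_opNorm_le (hM t ht') u)
          have h6 : ‖δ t u (A t v)‖ ≤ ‖δ t‖ * ‖u‖ * (M * ‖v‖) :=
            ((δ t).le_opNorm₂ _ _).trans (by
              gcongr
              exact (A t).le_of_opNorm_le (hM t ht') v)
          calc ‖-δ t (A t u) v - δ t u (A t v)‖ ≤ ‖δ t (A t u) v‖ + ‖δ t u (A t v)‖ := by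
                refine (norm_sub_le _ _).trans ?_
                rw [norm_neg]
            _ ≤ ‖δ t‖ * (M * ‖u‖) * ‖v‖ + ‖δ t‖ * ‖u‖ * (M * ‖v‖) := add_le_add h5 h6
            _ = 2 * M * ‖δ t‖ * ‖u‖ * ‖v‖ := by ring)
  intro t ht u v
  have h7 := hδa t u v
  rw [key t ht] at h7
  simp only [zero_apply] at h7
  rw [← sub_eq_zero]
  exact h7.symm

end Bilinear

/-! ### Conjugations of infinitesimal automorphisms of a bilinear form preserve the form -/

section Symplectic

universe u

variable {E : Type u} [NormedAddCommGroup E] [NormedSpace ℝ E]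
  {H : Type*} [TopologicalSpace H] {I : ModelWithCorners ℝ E H}
  {N : Type*} [TopologicalSpace N] [ChartedSpace H N] [IsManifold I ∞ N]
  {N' : Type*} [TopologicalSpace N'] [ChartedSpace H N'] [IsManifold I ∞ N']
  {X : (q : N) → TangentSpace I q} {q₀ : N} {k : ℕ} {Xe : E → E}
  {ℓ : E →L[ℝ] ℝ} {e : E}
  {B : Set N} {T : N → ℝ} {c : N → ℝ → N}
  {X' : (q : N') → TangentSpace I q} {c' : N → ℝ → N'} {ψ : N → N'} {κ : N → N'}

theorem hasFDerivWithinAt_congr_of_mem {F : Type*} [NormedAddCommGroup F] [NormedSpace ℝ F]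
    {f g : E → F} {f' : E →L[ℝ] F} {s : Set E} {x : E} (h : HasFDerivWithinAt f f' s x)
    (hfg : ∀ᶠ z in 𝓝[s] x, g z = f z) (hx : x ∈ s) : HasFDerivWithinAt g f' s x :=
  h.congr_of_eventuallyEq hfg (hfg.self_of_nhdsWithin hx)

/-- The derivative of a map in charts. -/
theorem hasFDerivWithinAt_extChartAt_of_hasMFDerivAt {q : N} {p₀ : N'}
    {D : TangentSpace I q →L[ℝ] TangentSpace I (κ q)} (hκ : HasMFDerivAt I I κ q D)
    (hq : q ∈ (extChartAt I q₀).source) (hp : κ q ∈ (extChartAt I p₀).source) :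
    HasFDerivWithinAt (extChartAt I p₀ ∘ κ ∘ (extChartAt I q₀).symm)
      ((tangentCoordChange I (κ q) p₀ (κ q)).comp
        ((show E →L[ℝ] E from D).comp (tangentCoordChange I q₀ q q)))
      (range I) (extChartAt I q₀ q) := by
  have h1 := hasFDerivWithinAt_tangentCoordChange (I := I) (x := q₀) (y := q) (z := q)
    ⟨hq, mem_extChartAt_source _⟩
  have h3 := hasFDerivWithinAt_tangentCoordChange (I := I) (x := κ q) (y := p₀) (z := κ q)
    ⟨mem_extChartAt_source _, hp⟩
  have h2 : HasFDerivWithinAt (extChartAt I (κ q) ∘ κ ∘ (extChartAt I q).symm)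
      (show E →L[ℝ] E from D) (range I) (extChartAt I q q) := hκ.2
  have e1 : (extChartAt I q ∘ (extChartAt I q₀).symm) (extChartAt I q₀ q) = extChartAt I q q := by
    simp only [Function.comp_apply, (extChartAt I q₀).left_inv hq]
  have h2' : HasFDerivWithinAt (extChartAt I (κ q) ∘ κ ∘ (extChartAt I q).symm)
      (show E →L[ℝ] E from D) (range I)
      ((extChartAt I q ∘ (extChartAt I q₀).symm) (extChartAt I q₀ q)) := by rw [e1]; exact h2
  have h12 := h2'.comp (extChartAt I q₀ q) h1 (fun _ _ => mem_range_self _)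
  have e2 : ((extChartAt I (κ q) ∘ κ ∘ (extChartAt I q).symm) ∘
      (extChartAt I q ∘ (extChartAt I q₀).symm)) (extChartAt I q₀ q) = extChartAt I (κ q) (κ q) := by
    simp only [Function.comp_apply, (extChartAt I q₀).left_inv hq, extChartAt_to_inv]
  have h3' : HasFDerivWithinAt (extChartAt I p₀ ∘ (extChartAt I (κ q)).symm)
      (tangentCoordChange I (κ q) p₀ (κ q)) (range I)
      (((extChartAt I (κ q) ∘ κ ∘ (extChartAt I q).symm) ∘
      (extChartAt I q ∘ (extChartAt I q₀).symm)) (extChartAt I q₀ q)) := by rw [e2]; exact h3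
  have h123 := h3'.comp (extChartAt I q₀ q) h12 (fun _ _ => mem_range_self _)
  refine hasFDerivWithinAt_congr_of_mem h123 ?_ (mem_range_self _)
  have ht : Tendsto (extChartAt I q₀).symm (𝓝[range I] (extChartAt I q₀ q)) (𝓝 q) := by
    have := (continuousAt_extChartAt_symm' (I := I) hq).tendsto
    rw [(extChartAt I q₀).left_inv hq] at this
    exact this.mono_left nhdsWithin_le_nhds
  filter_upwards [ht.eventually (extChartAt_source_mem_nhds (I := I) q),
    ht.eventually (hκ.1.eventually (extChartAt_source_mem_nhds (I := I) (κ q)))] with z hz hz'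
  simp only [Function.comp_apply]
  rw [(extChartAt I q).left_inv hz, (extChartAt I (κ q)).left_inv hz']

variable (I N) in
/-- The chart changes of `N` preserve the constant bilinear form `σ`. -/
def ChartsPreserve (σ : E →L[ℝ] E →L[ℝ] ℝ) : Prop :=
  ∀ q₀ q : N, q ∈ (extChartAt I q₀).source → ∀ a b : E,
    σ (tangentCoordChange I q q₀ q a) (tangentCoordChange I q q₀ q b) = σ a b

variable (I) in
/-- The vector field `X` is smooth near `q₀` and an infinitesimal automorphism of `σ`. -/
def SymplecticFieldAt (σ : E →L[ℝ] E →L[ℝ] ℝ) (X : (q : N) → TangentSpace I q) (q₀ : N) : Prop :=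
  SmoothFieldAt I X q₀ ∧ ∀ᶠ z in 𝓝[range I] (extChartAt I q₀ q₀), ∀ a b : E,
    σ (fderivWithin ℝ (chartField I X q₀) (range I) z a) b +
      σ a (fderivWithin ℝ (chartField I X q₀) (range I) z b) = 0

variable {σ : E →L[ℝ] E →L[ℝ] ℝ}

/-- The conjugating map carries `X` to `X'`. -/
theorem OrbitFamily.mfderiv_conjugation (h : OrbitFamily ℓ X B T c)
    (hC : Conjugates I X' B T c ψ c' κ) {b : N} (hb : b ∈ B) {s : ℝ} (hs : s ∈ Icc 0 (T b))
    {D : E →L[ℝ] E} (hκ : HasMFDerivAt I I κ (c b s) D) : D (X (c b s)) = X' (c' b s) := by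
  have hκs : κ (c b s) = c' b s := hC.map b hb s hs
  have h1 := hasMFDerivWithinAt_curve_iff.1 (h.integral b hb s hs)
  have h2 := hasMFDerivWithinAt_curve_iff.1 (hC.integral b hb s hs)
  have h3 : HasFDerivWithinAt (extChartAt I (κ (c b s)) ∘ κ ∘ (extChartAt I (c b s)).symm)
    D (range I) (extChartAt I (c b s) (c b s)) := hκ.2
  have h4 := h3.comp_hasDerivWithinAt s h1.2
    (show MapsTo (fun t => extChartAt I (c b s) (c b t)) _ (range I) from fun t _ => mem_range_self _)
  have h5 : HasDerivWithinAt (fun t => extChartAt I (c' b s) (c' b t))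
      (D (X (c b s))) (Icc 0 (T b)) s := by
    refine h4.congr_of_eventuallyEq_of_mem ?_ hs
    filter_upwards [self_mem_nhdsWithin, h1.1.eventually (extChartAt_source_mem_nhds (I := I) (c b s))]
      with t ht ht'
    simp only [Function.comp_apply]
    rw [(extChartAt I (c b s)).left_inv ht', hC.map b hb t ht, hκs]
  exact (uniqueDiffOn_Icc (h.pos b hb) s hs).eq_deriv _ h5 h2.2

/-- The chart changes on both sides preserve `σ`, so invariance may be tested in any charts. It may
also be tested on an extension `κe` across the boundary, whose derivative at a point of the
half-space is determined by its values in the half-space. -/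
theorem bilinear_extChartAt_iff (hN : ChartsPreserve I N σ) (hN' : ChartsPreserve I N' σ)
    {q : N} {p₀ : N'} {D : E →L[ℝ] E} (hκ : HasMFDerivAt I I κ q D)
    (hq : q ∈ (extChartAt I q₀).source) (hp : κ q ∈ (extChartAt I p₀).source) {κe : E → E}
    (hκe : DifferentiableAt ℝ κe (extChartAt I q₀ q))
    (hκκe : ∀ᶠ z in 𝓝[range I] (extChartAt I q₀ q),
      κe z = (extChartAt I p₀ ∘ κ ∘ (extChartAt I q₀).symm) z) :
    (∀ u v : E, σ (D u) (D v) = σ u v) ↔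
    ∀ u v, σ (fderiv ℝ κe (extChartAt I q₀ q) u) (fderiv ℝ κe (extChartAt I q₀ q) v) = σ u v := by
  have h1 := hasFDerivWithinAt_extChartAt_of_hasMFDerivAt hκ hq hp
  have h2 := hκe.hasFDerivAt.hasFDerivWithinAt (s := range I)
  have h3 := (I.uniqueDiffOn _ (mem_range_self _)).eq h2
    (hasFDerivWithinAt_congr_of_mem h1 hκκe (mem_range_self _))
  have h3' : ∀ u, fderiv ℝ κe (extChartAt I q₀ q) u =
      tangentCoordChange I (κ q) p₀ (κ q) (D (tangentCoordChange I q₀ q q u)) := fun u => by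
    rw [h3]
    rfl
  simp only [h3']
  have key : ∀ u v : E, σ (tangentCoordChange I q₀ q q u) (tangentCoordChange I q₀ q q v) =
      σ u v := by
    intro u v
    have hinv : ∀ w : E, tangentCoordChange I q q₀ q (tangentCoordChange I q₀ q q w) = w :=
      fun w => (tangentCoordChange_comp ⟨⟨hq, mem_extChartAt_source _⟩, hq⟩).trans
        (tangentCoordChange_self hq)
    rw [← hN q₀ q hq, hinv, hinv]
  have hinv' : ∀ w : E, tangentCoordChange I q₀ q q (tangentCoordChange I q q₀ q w) = w :=
    fun w => (tangentCoordChange_comp ⟨⟨mem_extChartAt_source _, hq⟩, mem_extChartAt_source _⟩).trans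
      (tangentCoordChange_self (mem_extChartAt_source _))
  constructor
  · intro h u v
    rw [hN' p₀ (κ q) hp, h, key]
  · intro h u v
    have := h (tangentCoordChange I q q₀ q u) (tangentCoordChange I q q₀ q v)
    rw [hN' p₀ (κ q) hp, hinv', hinv', hN q₀ q hq] at this
    exact this

end Symplectic

section Symplectic

universe u

variable {E : Type u} [NormedAddCommGroup E] [NormedSpace ℝ E]
  {H : Type*} [TopologicalSpace H] {I : ModelWithCorners ℝ E H}
  {N : Type*} [TopologicalSpace N] [ChartedSpace H N] [IsManifold I ∞ N]
  {N' : Type*} [TopologicalSpace N'] [ChartedSpace H N'] [IsManifold I ∞ N']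
  {X : (q : N) → TangentSpace I q} {q₀ : N} {k : ℕ} {Xe : E → E}
  {ℓ : E →L[ℝ] ℝ} {e : E}
  {B : Set N} {T : N → ℝ} {c : N → ℝ → N}
  {X' : (q : N') → TangentSpace I q} {c' : N → ℝ → N'} {ψ : N → N'} {κ : N → N'}
  {σ : E →L[ℝ] E →L[ℝ] ℝ}

variable (I) in
/-- The derivative of `κ` at `q` preserves the bilinear form `σ`. -/
def PreservesAt (σ : E →L[ℝ] E →L[ℝ] ℝ) (κ : N → N') (q : N) : Prop :=
  ∃ D : E →L[ℝ] E, HasMFDerivAt I I κ q D ∧ ∀ u v, σ (D u) (D v) = σ u v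

theorem fderiv_extension_apply {q : N} {p₀ : N'} {D : E →L[ℝ] E} (hκ : HasMFDerivAt I I κ q D)
    (hq : q ∈ (extChartAt I q₀).source) (hp : κ q ∈ (extChartAt I p₀).source) {κe : E → E}
    (hκe : DifferentiableAt ℝ κe (extChartAt I q₀ q))
    (hκκe : ∀ᶠ z in 𝓝[range I] (extChartAt I q₀ q),
      κe z = (extChartAt I p₀ ∘ κ ∘ (extChartAt I q₀).symm) z) (u : E) :
    fderiv ℝ κe (extChartAt I q₀ q) u =
      tangentCoordChange I (κ q) p₀ (κ q) (D (tangentCoordChange I q₀ q q u)) := by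
  have h1 := hasFDerivWithinAt_extChartAt_of_hasMFDerivAt hκ hq hp
  have h2 := hκe.hasFDerivAt.hasFDerivWithinAt (s := range I)
  have h3 := (I.uniqueDiffOn _ (mem_range_self _)).eq h2
    (hasFDerivWithinAt_congr_of_mem h1 hκκe (mem_range_self _))
  rw [h3]
  rfl

/-- The linearized conjugation equation, and its consequence for the pulled back form. -/
theorem bilinear_derivative_identity {κe Xe Xe' : E → E} {S : Set E} {z : E}
    (hS : UniqueDiffOn ℝ S) (hz : z ∈ S) (hκe : ContDiffAt ℝ 2 κe z)
    (hXe : DifferentiableAt ℝ Xe z) (hXe' : DifferentiableAt ℝ Xe' (κe z))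
    (hid : ∀ᶠ w in 𝓝[S] z, fderiv ℝ κe w (Xe w) = Xe' (κe w))
    (hskew : ∀ u v, σ (fderiv ℝ Xe' (κe z) u) v + σ u (fderiv ℝ Xe' (κe z) v) = 0) (u v : E) :
    σ (fderiv ℝ (fderiv ℝ κe) z (Xe z) u) (fderiv ℝ κe z v) +
        σ (fderiv ℝ κe z u) (fderiv ℝ (fderiv ℝ κe) z (Xe z) v) =
      -σ (fderiv ℝ κe z (fderiv ℝ Xe z u)) (fderiv ℝ κe z v) -
        σ (fderiv ℝ κe z u) (fderiv ℝ κe z (fderiv ℝ Xe z v)) := by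
  have hd : DifferentiableAt ℝ κe z := hκe.differentiableAt (by norm_num)
  have hdd : DifferentiableAt ℝ (fderiv ℝ κe) z :=
    (hκe.fderiv_right (m := 1) (by norm_num)).differentiableAt (by norm_num)
  have hsymm : IsSymmSndFDerivAt ℝ κe z := hκe.isSymmSndFDerivAt (by simp)
  have h1 := (hdd.hasFDerivAt.clm_apply hXe.hasFDerivAt).hasFDerivWithinAt (s := S)
  have h2 := (hXe'.hasFDerivAt.comp z hd.hasFDerivAt).hasFDerivWithinAt (s := S)
  -- Differentiate the conjugation equation `κe' (Xe) = Xe' ∘ κe` within `S`. Symmetry of the second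
  -- derivative then expresses the derivative of `fderiv ℝ κe` along the field as a commutator-like
  -- difference, in which the infinitesimal automorphism `Xe'` drops out.
  have h3 := (hS z hz).eq h1 (hasFDerivWithinAt_congr_of_mem h2 hid hz)
  have key : ∀ w, fderiv ℝ (fderiv ℝ κe) z (Xe z) w =
      fderiv ℝ Xe' (κe z) (fderiv ℝ κe z w) - fderiv ℝ κe z (fderiv ℝ Xe z w) := by
    intro w
    have h4 := DFunLike.congr_fun h3 w
    simp only [add_apply, ContinuousLinearMap.comp_apply,
      ContinuousLinearMap.flip_apply] at h4
    rw [hsymm.eq (Xe z) w, ← h4]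
    abel
  rw [key u, key v]
  have h5 := hskew (fderiv ℝ κe z u) (fderiv ℝ κe z v)
  simp only [map_sub, sub_apply]
  linarith

variable [FiniteDimensional ℝ E] [T2Space N] [T2Space N']

/-- In fixed charts near `c b s`, the derivative of the conjugation along an orbit satisfies the
hypothesis of `pullback_bilinear_eq`, with `A` the derivative of the field. The map and both fields
are replaced by extensions across the boundary, so that ordinary derivatives and the symmetry of the
second derivative are available up to the ends of the orbit. -/
theorem OrbitFamily.preservesAt_step (he : ℓ e = 1) (hI : range I = {z | 0 ≤ ℓ z})
    (h : OrbitFamily ℓ X B T c) (hC : Conjugates I X' B T c ψ c' κ)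
    (hsm : ∀ q ∈ sweep B T c, sweep B T c ∈ 𝓝 q ∧ ContMDiffAt I I ∞ κ q)
    (hN : ChartsPreserve I N σ) (hN' : ChartsPreserve I N' σ)
    (hX : ∀ b ∈ B, ∀ s ∈ Icc 0 (T b), SymplecticFieldAt I σ X (c b s))
    (hX' : ∀ b ∈ B, ∀ s ∈ Icc 0 (T b), SymplecticFieldAt I σ X' (c' b s))
    {b : N} (hb : b ∈ B) {s : ℝ} (hs : s ∈ Icc 0 (T b)) :
    ∃ η > 0, ∀ s₁ ∈ Icc 0 (T b), ∀ s₂ ∈ Icc 0 (T b), s - η < s₁ → s₁ < s₂ → s₂ < s + η →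
      PreservesAt I σ κ (c b s₁) → PreservesAt I σ κ (c b s₂) := by
  have hqsw : c b s ∈ sweep B T c := ⟨b, hb, s, hs, rfl⟩
  have hκs : κ (c b s) = c' b s := hC.map b hb s hs
  obtain ⟨hsw, hκsm⟩ := hsm _ hqsw
  set z₀ := extChartAt I (c b s) (c b s) with hz₀
  set κh : E → E := extChartAt I (c' b s) ∘ κ ∘ (extChartAt I (c b s)).symm with hκh
  have hκh2 : ContDiffWithinAt ℝ 2 κh (range I) z₀ := by
    have := (contMDiffAt_iff.1 hκsm).2.of_le (m := 2) (by norm_cast)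
    rw [hκs] at this
    exact this
  have hUD := I.uniqueDiffOn
  obtain ⟨κe, hκe, hκκe⟩ : ∃ g : E → E, ContDiffAt ℝ 2 g z₀ ∧ ∀ᶠ z in 𝓝[range I] z₀, g z = κh z := by
    rw [hI] at hκh2 ⊢
    exact exists_contDiffAt_eventuallyEq_halfSpace (k := 2) he (nonneg_extChartAt hI _ _) hκh2
  obtain ⟨Xe, hXe, hXXe⟩ := (hX b hb s hs).1.exists_extension he hI 1
  obtain ⟨Xe', hXe', hXXe'⟩ := (hX' b hb s hs).1.exists_extension he hI 1
  have hκez : κe z₀ = extChartAt I (c' b s) (c' b s) := by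
    rw [hκκe.self_of_nhdsWithin (mem_range_self _), hκh, hz₀]
    simp only [Function.comp_apply]
    rw [extChartAt_to_inv, hκs]
  have hκet : Tendsto κe (𝓝[range I] z₀) (𝓝[range I] (extChartAt I (c' b s) (c' b s))) := by
    refine tendsto_nhdsWithin_iff.2 ⟨?_, ?_⟩
    · rw [← hκez]
      exact hκe.continuousAt.tendsto.mono_left nhdsWithin_le_nhds
    · filter_upwards [hκκe] with z hz
      rw [hz]
      exact mem_range_self _
  have hsymmt : Tendsto (extChartAt I (c b s)).symm (𝓝[range I] z₀) (𝓝 (c b s)) := by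
    have := (continuousAt_extChartAt_symm (I := I) (c b s)).tendsto
    rw [extChartAt_to_inv] at this
    exact this.mono_left nhdsWithin_le_nhds
  have hκc : ∀ᶠ q in 𝓝 (c b s), κ q ∈ (extChartAt I (c' b s)).source := by
    have := hκsm.continuousAt.eventually (extChartAt_source_mem_nhds (I := I) (κ (c b s)))
    rwa [hκs] at this
  have hnw : ∀ {p : E → Prop}, (∀ᶠ z in 𝓝 z₀, p z) → ∀ᶠ z in 𝓝[range I] z₀, p z :=
    fun h => nhdsWithin_le_nhds h
  -- the conjugation equation in charts
  have hid : ∀ᶠ z in 𝓝[range I] z₀, fderiv ℝ κe z (Xe z) = Xe' (κe z) ∧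
      (PreservesAt I σ κ ((extChartAt I (c b s)).symm z) ↔
        ∀ u v, σ (fderiv ℝ κe z u) (fderiv ℝ κe z v) = σ u v) := by
    filter_upwards [eventually_eventually_nhdsWithin.2 hκκe, hXXe, hκet.eventually hXXe',
      hnw (hκe.eventually (by simp)), hsymmt.eventually hsw, hsymmt.eventually hκc,
      extChartAt_target_mem_nhdsWithin (I := I) (c b s), self_mem_nhdsWithin]
      with z h1 h2 h3 h4 h5 h6 h7 h8
    set q := (extChartAt I (c b s)).symm z with hq
    have hzq : extChartAt I (c b s) q = z := (extChartAt I (c b s)).right_inv h7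
    have hqs : q ∈ (extChartAt I (c b s)).source := (extChartAt I (c b s)).map_target h7
    have hmd : MDifferentiableAt I I κ q := (hsm q h5).2.mdifferentiableAt (by simp)
    obtain ⟨b', hb', s', hs', hq'⟩ := id h5
    obtain ⟨D, hD⟩ : ∃ D : E →L[ℝ] E, HasMFDerivAt I I κ q D := ⟨_, hmd.hasMFDerivAt⟩
    have hX1 : D (X q) = X' (κ q) := by
      rw [← hq'] at hD ⊢
      rw [h.mfderiv_conjugation hC hb' hs' hD, hC.map b' hb' s' hs']
    have hd : DifferentiableAt ℝ κe (extChartAt I (c b s) q) := by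
      rw [hzq]; exact h4.differentiableAt (by norm_num)
    have hev : ∀ᶠ z in 𝓝[range I] (extChartAt I (c b s) q), κe z = κh z := by rw [hzq]; exact h1
    have h9 := fderiv_extension_apply hD hqs h6 hd hev
    rw [hzq] at h9
    constructor
    · have h10 : κe z = extChartAt I (c' b s) (κ q) := h1.self_of_nhdsWithin h8
      have h11 : ∀ w : E, tangentCoordChange I (c b s) q q (tangentCoordChange I q (c b s) q w) = w :=
        fun w => (tangentCoordChange_comp ⟨⟨mem_extChartAt_source _, hqs⟩,
          mem_extChartAt_source _⟩).trans (tangentCoordChange_self (mem_extChartAt_source _))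
      rw [h9, h2, h3, h10, chartField_extChartAt X' h6, ← hzq, chartField_extChartAt X hqs]
      exact (congrArg _ (congrArg D (h11 _))).trans (congrArg _ hX1)
    · have h12 := bilinear_extChartAt_iff hN hN' hD hqs h6 hd hev
      rw [hzq] at h12
      rw [← h12]
      constructor
      · rintro ⟨D', hD', hσ⟩
        have h13 : D' = D := hasMFDerivAt_unique hD' hD
        rw [← h13]
        exact hσ
      · intro hσ
        exact ⟨D, hD, hσ⟩
  have hskew' : ∀ᶠ w in 𝓝[range I] (extChartAt I (c' b s) (c' b s)), DifferentiableAt ℝ Xe' w ∧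
      ∀ u v, σ (fderiv ℝ Xe' w u) v + σ u (fderiv ℝ Xe' w v) = 0 := by
    filter_upwards [(hX' b hb s hs).2, eventually_eventually_nhdsWithin.2 hXXe',
      nhdsWithin_le_nhds (hXe'.eventually (by simp)), self_mem_nhdsWithin] with w h1 h2 h3 h4
    have hd : DifferentiableAt ℝ Xe' w := ContDiffAt.differentiableAt h3 (by norm_num)
    have h5 : fderivWithin ℝ (chartField I X' (c' b s)) (range I) w = fderiv ℝ Xe' w := by
      rw [← hd.fderivWithin (hUD w h4)]
      exact (Filter.EventuallyEq.fderivWithin_eq h2 (h2.self_of_nhdsWithin h4)).symm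
    rw [h5] at h1
    exact ⟨hd, h1⟩
  have hskew : ∀ᶠ z in 𝓝[range I] z₀, DifferentiableAt ℝ Xe z ∧
      ∀ u v, σ (fderiv ℝ Xe z u) v + σ u (fderiv ℝ Xe z v) = 0 := by
    filter_upwards [(hX b hb s hs).2, eventually_eventually_nhdsWithin.2 hXXe,
      nhdsWithin_le_nhds (hXe.eventually (by simp)), self_mem_nhdsWithin] with w h1 h2 h3 h4
    have hd : DifferentiableAt ℝ Xe w := ContDiffAt.differentiableAt h3 (by norm_num)
    have h5 : fderivWithin ℝ (chartField I X (c b s)) (range I) w = fderiv ℝ Xe w := by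
      rw [← hd.fderivWithin (hUD w h4)]
      exact (Filter.EventuallyEq.fderivWithin_eq h2 (h2.self_of_nhdsWithin h4)).symm
    rw [h5] at h1
    exact ⟨hd, h1⟩
  have hA : ∀ᶠ z in 𝓝 z₀, ‖fderiv ℝ Xe z‖ ≤ ‖fderiv ℝ Xe z₀‖ + 1 := by
    have h1 : ContinuousAt (fderiv ℝ Xe) z₀ :=
      (ContDiffAt.fderiv_right (m := 0) hXe (by norm_num)).continuousAt
    exact (h1.norm.eventually (gt_mem_nhds (lt_add_one _))).mono fun z hz => le_of_lt hz
  have hall : ∀ᶠ z in 𝓝[range I] z₀,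
      ContDiffAt ℝ 2 κe z ∧ ‖fderiv ℝ Xe z‖ ≤ ‖fderiv ℝ Xe z₀‖ + 1 ∧
      Xe z = chartField I X (c b s) z ∧
      (∀ u v, σ (fderiv ℝ Xe z u) v + σ u (fderiv ℝ Xe z v) = 0) ∧
      (∀ u v, σ (fderiv ℝ (fderiv ℝ κe) z (Xe z) u) (fderiv ℝ κe z v) +
        σ (fderiv ℝ κe z u) (fderiv ℝ (fderiv ℝ κe) z (Xe z) v) =
      -σ (fderiv ℝ κe z (fderiv ℝ Xe z u)) (fderiv ℝ κe z v) -
        σ (fderiv ℝ κe z u) (fderiv ℝ κe z (fderiv ℝ Xe z v))) ∧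
      (PreservesAt I σ κ ((extChartAt I (c b s)).symm z) ↔
        ∀ u v, σ (fderiv ℝ κe z u) (fderiv ℝ κe z v) = σ u v) := by
    filter_upwards [eventually_eventually_nhdsWithin.2 hid, hnw (hκe.eventually (by simp)), hnw hA,
      hskew, hκet.eventually hskew', hXXe, self_mem_nhdsWithin] with z h1 h2 h3 h4 h5 h6 h7
    exact ⟨h2, h3, h6, h4.2, bilinear_derivative_identity hUD h7 h2 h4.1 h5.1
      (h1.mono fun z hz => hz.1) h5.2, (h1.self_of_nhdsWithin h7).2⟩
  have hct := (h.integral b hb s hs).1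
  have hζt : Tendsto (fun t => extChartAt I (c b s) (c b t)) (𝓝[Icc 0 (T b)] s) (𝓝[range I] z₀) :=
    tendsto_nhdsWithin_iff.2 ⟨(continuousAt_extChartAt (c b s)).tendsto.comp hct.tendsto,
      Eventually.of_forall fun t => mem_range_self _⟩
  obtain ⟨η, hη, hball⟩ := Metric.mem_nhdsWithin_iff.1
    ((hζt.eventually hall).and (hct.eventually (extChartAt_source_mem_nhds (I := I) (c b s))))
  refine ⟨η, hη, fun s₁ hs₁ s₂ hs₂ hl h12 hr hP => ?_⟩
  have hsub : Icc s₁ s₂ ⊆ Icc 0 (T b) := Icc_subset_Icc hs₁.1 hs₂.2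
  have hgood := fun t (ht : t ∈ Icc s₁ s₂) => hball (⟨by
    rw [Metric.mem_ball, Real.dist_eq, abs_lt]; constructor <;> linarith [ht.1, ht.2], hsub ht⟩ :
      t ∈ Metric.ball s η ∩ Icc 0 (T b))
  have hiff := fun t (ht : t ∈ Icc s₁ s₂) => (hgood t ht).1.2.2.2.2.2
  have hl1 := left_mem_Icc.2 h12.le
  have hr1 := right_mem_Icc.2 h12.le
  have hi1 := hiff s₁ hl1
  have hi2 := hiff s₂ hr1
  rw [(extChartAt I (c b s)).left_inv (hgood s₁ hl1).2] at hi1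
  rw [(extChartAt I (c b s)).left_inv (hgood s₂ hr1).2] at hi2
  rw [hi2]
  refine pullback_bilinear_eq (σ := σ) (D := fun t => fderiv ℝ κe (extChartAt I (c b s) (c b t)))
    (D' := fun t => fderiv ℝ (fderiv ℝ κe) (extChartAt I (c b s) (c b t))
      (Xe (extChartAt I (c b s) (c b t))))
    (A := fun t => fderiv ℝ Xe (extChartAt I (c b s) (c b t))) (a := s₁) (b := s₂)
    (M := ‖fderiv ℝ Xe z₀‖ + 1) (fun t ht => ?_) (fun t ht => (hgood t ht).1.2.1)
    (fun t ht => (hgood t ht).1.2.2.2.2.1) (fun t ht => (hgood t ht).1.2.2.2.1) (hi1.1 hP) s₂ hr1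
  have h1 := hasDerivWithinAt_extChartAt_of_hasMFDerivWithinAt (hgood t ht).2
    (h.integral b hb t (hsub ht))
  rw [← chartField_extChartAt X (hgood t ht).2, ← (hgood t ht).1.2.2.1] at h1
  have h2 : DifferentiableAt ℝ (fderiv ℝ κe) (extChartAt I (c b s) (c b t)) :=
    ((hgood t ht).1.1.fderiv_right (m := 1) (by norm_num)).differentiableAt (by norm_num)
  exact h2.hasFDerivAt.comp_hasDerivWithinAt t (h1.mono hsub)

/-- The conjugating map preserves the form at the initial points. -/
theorem OrbitFamily.preservesAt_initial (he : ℓ e = 1) (hI : range I = {z | 0 ≤ ℓ z})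
    (h : OrbitFamily ℓ X B T c) (hopen : ∀ b ∈ B, ∀ᶠ b' in 𝓝 b, b' ∈ I.boundary N → b' ∈ B)
    (hC : Conjugates I X' B T c ψ c' κ) (hσ : ∀ u v, σ u v = -σ v u)
    {b : N} (hb : b ∈ B) (hκ : MDifferentiableAt I I κ b) {Dψ : E →L[ℝ] E}
    (hψ : HasMFDerivAt I I ψ b Dψ)
    (hψσ : ∀ u v, ℓ u = 0 → ℓ v = 0 → σ (Dψ u) (Dψ v) = σ u v)
    (hψX : ∀ u, ℓ u = 0 → σ (Dψ u) (X' (ψ b)) = σ u (X b)) :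
    PreservesAt I σ κ b := by
  have h0T : (0 : ℝ) ∈ Icc 0 (T b) := left_mem_Icc.2 (h.pos b hb).le
  have hb0 := h.zero b hb
  have hκψ : ∀ b' ∈ B, κ b' = ψ b' := fun b' hb' => by
    have := hC.map b' hb' 0 (left_mem_Icc.2 (h.pos b' hb').le)
    rwa [h.zero b' hb', hC.zero b' hb'] at this
  set D : E →L[ℝ] E := mfderiv I I κ b with hD
  have hDX : D (X b) = X' (ψ b) := by
    have h1 : HasMFDerivAt I I κ (c b 0) D := by rw [hb0]; exact hκ.hasMFDerivAt
    have h2 := h.mfderiv_conjugation hC hb h0T h1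
    rwa [hb0, hC.zero b hb] at h2
  refine ⟨D, hκ.hasMFDerivAt, ?_⟩
  have hℓz : ℓ (extChartAt I b b) = 0 :=
    (mem_boundary_iff_eq_zero he hI (mem_extChartAt_source b)).1 (h.boundary b hb)
  -- The maps `κ` and `ψ` agree on `B`, which contains all boundary points near `b`. Differentiating
  -- along a straight line in the boundary hyperplane shows that their derivatives agree on
  -- tangential vectors. Nothing is claimed about other vectors.
  have hDψ : ∀ u, ℓ u = 0 → D u = Dψ u := by
    intro u hu
    have h1 : HasFDerivWithinAt (extChartAt I (κ b) ∘ κ ∘ (extChartAt I b).symm) D (range I)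
      (extChartAt I b b) := hκ.hasMFDerivAt.2
    have h2 : HasFDerivWithinAt (extChartAt I (ψ b) ∘ ψ ∘ (extChartAt I b).symm) Dψ (range I)
      (extChartAt I b b) := hψ.2
    have hγ : HasDerivWithinAt (fun τ : ℝ => extChartAt I b b + τ • u) u univ 0 := by
      have := (((hasDerivAt_id (0 : ℝ)).smul_const u).const_add (extChartAt I b b))
      simpa only [one_smul] using! this.hasDerivWithinAt (s := univ)
    have hγI : ∀ τ : ℝ, extChartAt I b b + τ • u ∈ range I := fun τ => by
      rw [hI]
      show 0 ≤ ℓ _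
      rw [map_add, map_smul, hu, hℓz]
      simp
    have h0 : extChartAt I b b + (0 : ℝ) • u = extChartAt I b b := by simp
    have h1' := HasFDerivWithinAt.comp_hasDerivWithinAt (f := fun τ : ℝ => extChartAt I b b + τ • u)
      (0 : ℝ) (by rw [h0]; exact h1) hγ (fun τ _ => hγI τ)
    have h2' := HasFDerivWithinAt.comp_hasDerivWithinAt (f := fun τ : ℝ => extChartAt I b b + τ • u)
      (0 : ℝ) (by rw [h0]; exact h2) hγ (fun τ _ => hγI τ)
    rw [hasDerivWithinAt_univ] at h1' h2'
    refine h1'.unique (h2'.congr_of_eventuallyEq ?_)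
    have hγt : Tendsto (fun τ : ℝ => extChartAt I b b + τ • u) (𝓝 0) (𝓝[range I] (extChartAt I b b)) := by
      refine tendsto_nhdsWithin_iff.2 ⟨?_, Eventually.of_forall hγI⟩
      have : Continuous fun τ : ℝ => extChartAt I b b + τ • u := by fun_prop
      have h3 := this.tendsto 0
      rwa [h0] at h3
    have hst : Tendsto (fun τ : ℝ => (extChartAt I b).symm (extChartAt I b b + τ • u)) (𝓝 0) (𝓝 b) := by
      have := (continuousAt_extChartAt_symm (I := I) b).tendsto
      rw [extChartAt_to_inv] at this
      exact this.comp (hγt.mono_right nhdsWithin_le_nhds)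
    filter_upwards [hst.eventually (hopen b hb),
      hγt.eventually (extChartAt_target_mem_nhdsWithin (I := I) b)] with τ h4 h5
    have h6 : (extChartAt I b).symm (extChartAt I b b + τ • u) ∈ B := by
      refine h4 ((mem_boundary_iff_eq_zero he hI ((extChartAt I b).map_target h5)).2 ?_)
      rw [(extChartAt I b).right_inv h5, map_add, map_smul, hu, hℓz]
      simp
    simp only [Function.comp_apply]
    rw [hκψ _ h6, hκψ b hb]
  set Y : E := X b with hY
  have hpos : 0 < ℓ Y := h.inward b hb
  -- The transversal direction is taken to be the field itself, because the derivative of `κ` on it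
  -- is known. It remains to compare `σ` on two tangential vectors and on a tangential vector paired
  -- with the field.
  have hdec : ∀ u, ∃ t r, ℓ t = 0 ∧ u = t + r • Y := fun u =>
    ⟨u - (ℓ u / ℓ Y) • Y, ℓ u / ℓ Y, by
      rw [map_sub, map_smul, smul_eq_mul, div_mul_cancel₀ _ hpos.ne', sub_self], by abel⟩
  have hDY : ∀ u, ℓ u = 0 → σ (D u) (D Y) = σ u Y := fun u hu => by
    rw [hDX, hDψ u hu]
    exact hψX u hu
  have hself : ∀ u, σ u u = 0 := fun u => by linarith [hσ u u]
  intro u v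
  obtain ⟨t, r, ht, rfl⟩ := hdec u
  obtain ⟨t', r', ht', rfl⟩ := hdec v
  have h7 : σ (D t) (D t') = σ t t' := by rw [hDψ t ht, hDψ t' ht']; exact hψσ t t' ht ht'
  have h8 := hDY t ht
  have h9 := hDY t' ht'
  simp only [map_add, map_smul, add_apply, smul_apply,
    smul_eq_mul, h7, h8, hself, hσ (D Y) (D t'), hσ Y t', h9]

/-- A map which conjugates two families of orbits of infinitesimal automorphisms of `σ`, and which
preserves `σ` initially, preserves `σ`. -/
theorem OrbitFamily.preservesAt (he : ℓ e = 1) (hI : range I = {z | 0 ≤ ℓ z})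
    (h : OrbitFamily ℓ X B T c) (hopen : ∀ b ∈ B, ∀ᶠ b' in 𝓝 b, b' ∈ I.boundary N → b' ∈ B)
    (hC : Conjugates I X' B T c ψ c' κ) (hσ : ∀ u v, σ u v = -σ v u)
    (hN : ChartsPreserve I N σ) (hN' : ChartsPreserve I N' σ)
    (hX : ∀ b ∈ B, ∀ s ∈ Icc 0 (T b), SymplecticFieldAt I σ X (c b s))
    (hX' : ∀ b ∈ B, ∀ s ∈ Icc 0 (T b), SymplecticFieldAt I σ X' (c' b s))
    (hψ : ∀ b ∈ B, ∃ Dψ : E →L[ℝ] E, HasMFDerivAt I I ψ b Dψ ∧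
      (∀ u v, ℓ u = 0 → ℓ v = 0 → σ (Dψ u) (Dψ v) = σ u v) ∧
      ∀ u, ℓ u = 0 → σ (Dψ u) (X' (ψ b)) = σ u (X b))
    {q : N} (hq : q ∈ sweep B T c) : PreservesAt I σ κ q := by
  have hsm := fun q (hq : q ∈ sweep B T c) => h.contMDiffAt_conjugation he hI hopen hC hq
  obtain ⟨b, hb, s, hs, rfl⟩ := hq
  refine Icc_forward_induction (P := fun s => PreservesAt I σ κ (c b s)) ?_
    (fun t ht => h.preservesAt_step he hI hC hsm hN hN' hX hX' hb ht) s hs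
  rw [h.zero b hb]
  obtain ⟨Dψ, h1, h2, h3⟩ := hψ b hb
  refine h.preservesAt_initial he hI hopen hC hσ hb ?_ h1 h2 h3
  exact (hsm b ⟨b, hb, 0, left_mem_Icc.2 (h.pos b hb).le, h.zero b hb⟩).2.mdifferentiableAt (by simp)

end Symplectic

/-! ### Charts of the tangent and cotangent bundles -/

theorem t2Space_totalSpace {B F : Type*} {E : B → Type*} [TopologicalSpace B] [TopologicalSpace F]
    [TopologicalSpace (TotalSpace F E)] [∀ b, TopologicalSpace (E b)] [FiberBundle F E] [T2Space B]
    [T2Space F] : T2Space (TotalSpace F E) := by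
  refine ⟨fun p q hpq => ?_⟩
  by_cases h : p.proj = q.proj
  · set t := trivializationAt F E p.proj
    have hp : p ∈ t.source := FiberBundle.mem_trivializationAt_proj_source
    have hq : q ∈ t.source := by
      rw [t.mem_source, ← h]
      exact mem_baseSet_trivializationAt F E p.proj
    have hne : t p ≠ t q := fun heq => hpq (t.injOn hp hq heq)
    obtain ⟨u, v, hu, hv, hpu, hqv, hd⟩ := t2_separation hne
    exact ⟨t.source ∩ t ⁻¹' u, t.source ∩ t ⁻¹' v,
      t.continuousOn.isOpen_inter_preimage t.open_source hu,
      t.continuousOn.isOpen_inter_preimage t.open_source hv, ⟨hp, hpu⟩, ⟨hq, hqv⟩,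
      (hd.preimage t).mono inter_subset_right inter_subset_right⟩
  · obtain ⟨u, v, hu, hv, hpu, hqv, hd⟩ := t2_separation h
    have hc : Continuous (TotalSpace.proj : TotalSpace F E → B) := FiberBundle.continuous_proj F E
    exact ⟨_, _, hu.preimage hc, hv.preimage hc, hpu, hqv, hd.preimage _⟩

section Charts

variable {n : ℕ} [NeZero n] {M : Type*} [TopologicalSpace M]
  [ChartedSpace (EuclideanHalfSpace n) M] [IsManifold (𝓡∂ n) ∞ M]

/-- A shortcut for instance search. -/
@[reducible] def cotTopology : TopologicalSpace (CotB n M) := inferInstance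

instance [T2Space M] : T2Space (TanB n M) := t2Space_totalSpace

instance [T2Space M] : T2Space (CotB n M) := t2Space_totalSpace

/-- The chart domain of the preferred chart at `x₀`. -/
abbrev dom (x₀ : M) : Set M := (chartAt (EuclideanHalfSpace n) x₀).source

/-- From the coordinates of `T_x M` to those of the preferred chart at `x₀`. -/
abbrev toChart (x₀ x : M) : Vec n →L[ℝ] Vec n := tangentCoordChange (𝓡∂ n) x x₀ x

/-- From the coordinates of the preferred chart at `x₀` to those of `T_x M`. -/
abbrev ofChart (x₀ x : M) : Vec n →L[ℝ] Vec n := tangentCoordChange (𝓡∂ n) x₀ x x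

variable {x₀ x : M}

theorem mem_dom_iff : x ∈ dom (n := n) x₀ ↔ x ∈ (extChartAt (𝓡∂ n) x₀).source := by
  rw [extChartAt_source]

theorem toChart_ofChart (hx : x ∈ dom (n := n) x₀) (w : Vec n) : toChart x₀ x (ofChart x₀ x w) = w := by
  rw [mem_dom_iff] at hx
  exact (tangentCoordChange_comp ⟨⟨hx, mem_extChartAt_source _⟩, hx⟩).trans
    (tangentCoordChange_self hx)

theorem ofChart_toChart (hx : x ∈ dom (n := n) x₀) (w : Vec n) : ofChart x₀ x (toChart x₀ x w) = w := by
  rw [mem_dom_iff] at hx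
  exact (tangentCoordChange_comp ⟨⟨mem_extChartAt_source _, hx⟩, mem_extChartAt_source _⟩).trans
    (tangentCoordChange_self (mem_extChartAt_source _))

theorem toChart_self (w : Vec n) : toChart x x w = w :=
  tangentCoordChange_self (mem_extChartAt_source _)

theorem ofChart_self (w : Vec n) : ofChart x x w = w :=
  tangentCoordChange_self (mem_extChartAt_source _)

theorem ofChart_self_eq_id : ofChart x x = ContinuousLinearMap.id ℝ (Vec n) := by
  ext1 w; exact ofChart_self w

theorem tan_mem_source (p₀ p : TanB n M) :
    p ∈ (extChartAt (𝓡∂ n).tangent p₀).source ↔ p.proj ∈ dom (n := n) p₀.proj := by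
  rw [extChartAt_source]
  exact TangentBundle.mem_chart_source_iff p p₀

theorem tan_extChartAt (p₀ p : TanB n M) :
    extChartAt (𝓡∂ n).tangent p₀ p =
      (extChartAt (𝓡∂ n) p₀.proj p.proj, toChart p₀.proj p.proj (TanB.vec p)) := by
  rw [FiberBundle.extChartAt]
  rfl

theorem tan_extChartAt_symm (p₀ : TanB n M) {y : Vec n} (hy : y ∈ (extChartAt (𝓡∂ n) p₀.proj).target)
    (w : Vec n) : (extChartAt (𝓡∂ n).tangent p₀).symm (y, w) =
      tvec ((extChartAt (𝓡∂ n) p₀.proj).symm y)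
        (ofChart p₀.proj ((extChartAt (𝓡∂ n) p₀.proj).symm y) w) := by
  have hx : (extChartAt (𝓡∂ n) p₀.proj).symm y ∈ dom (n := n) p₀.proj := by
    rw [mem_dom_iff]; exact (extChartAt (𝓡∂ n) p₀.proj).map_target hy
  have h1 : tvec ((extChartAt (𝓡∂ n) p₀.proj).symm y)
        (ofChart p₀.proj ((extChartAt (𝓡∂ n) p₀.proj).symm y) w) ∈
      (extChartAt (𝓡∂ n).tangent p₀).source := (tan_mem_source _ _).2 hx
  have h2 : extChartAt (𝓡∂ n).tangent p₀ (tvec ((extChartAt (𝓡∂ n) p₀.proj).symm y)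
        (ofChart p₀.proj ((extChartAt (𝓡∂ n) p₀.proj).symm y) w)) = (y, w) := by
    rw [tan_extChartAt]
    exact Prod.ext ((extChartAt (𝓡∂ n) p₀.proj).right_inv hy) (toChart_ofChart hx w)
  rw [← h2, (extChartAt (𝓡∂ n).tangent p₀).left_inv h1]

theorem cot_mem_source (p₀ p : CotB n M) :
    p ∈ (extChartAt (cotModel n) p₀).source ↔ p.proj ∈ dom (n := n) p₀.proj := by
  rw [FiberBundle.extChartAt]
  simp only [mfld_simps]
  exact ⟨fun h => h.1.1, fun h => ⟨⟨h, mem_univ _⟩, h⟩⟩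

theorem cot_extChartAt (p₀ p : CotB n M) (h : p.proj ∈ dom (n := n) p₀.proj) :
    extChartAt (cotModel n) p₀ p =
      (extChartAt (𝓡∂ n) p₀.proj p.proj, (CotB.covec p).comp (ofChart p₀.proj p.proj)) := by
  rw [FiberBundle.extChartAt]
  refine Prod.ext rfl ?_
  show (trivializationAt (Covec n) (fun x : M => TangentSpace (𝓡∂ n) x →L[ℝ] Trivial M ℝ x)
    p₀.proj p).2 = _
  rw [hom_trivializationAt_apply]
  show ContinuousLinearMap.inCoordinates _ _ _ _ _ _ _ _ _ = _
  rw [ContinuousLinearMap.inCoordinates, TangentBundle.symmL_trivializationAt_eq_core h]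
  ext w
  exact congrFun (congrArg DFunLike.coe (Trivial.continuousLinearMapAt_trivialization ℝ M ℝ p.proj)) _

theorem cot_extChartAt_symm (p₀ : CotB n M) {y : Vec n} (hy : y ∈ (extChartAt (𝓡∂ n) p₀.proj).target)
    (η : Covec n) : (extChartAt (cotModel n) p₀).symm (y, η) =
      cvec ((extChartAt (𝓡∂ n) p₀.proj).symm y)
        (η.comp (toChart p₀.proj ((extChartAt (𝓡∂ n) p₀.proj).symm y))) := by
  have hx : (extChartAt (𝓡∂ n) p₀.proj).symm y ∈ dom (n := n) p₀.proj := by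
    rw [mem_dom_iff]; exact (extChartAt (𝓡∂ n) p₀.proj).map_target hy
  have h1 : cvec ((extChartAt (𝓡∂ n) p₀.proj).symm y)
        (η.comp (toChart p₀.proj ((extChartAt (𝓡∂ n) p₀.proj).symm y))) ∈
      (extChartAt (cotModel n) p₀).source := (cot_mem_source _ _).2 hx
  have h2 : extChartAt (cotModel n) p₀ (cvec ((extChartAt (𝓡∂ n) p₀.proj).symm y)
        (η.comp (toChart p₀.proj ((extChartAt (𝓡∂ n) p₀.proj).symm y)))) = (y, η) := by
    rw [cot_extChartAt _ _ hx]
    refine Prod.ext ((extChartAt (𝓡∂ n) p₀.proj).right_inv hy) ?_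
    ext w
    exact congrArg η (toChart_ofChart hx w)
  rw [← h2, (extChartAt (cotModel n) p₀).left_inv h1]

theorem cot_mem_target (p₀ : CotB n M) {y : Vec n} (η : Covec n) :
    (y, η) ∈ (extChartAt (cotModel n) p₀).target ↔ y ∈ (extChartAt (𝓡∂ n) p₀.proj).target := by
  rw [FiberBundle.extChartAt_target]
  refine ⟨fun h => h.1.1, fun h => ⟨⟨h, ?_, mem_univ _⟩, mem_univ _⟩⟩
  exact mem_dom_iff.2 ((extChartAt (𝓡∂ n) p₀.proj).map_target h)

theorem tan_mem_target (p₀ : TanB n M) {y : Vec n} (η : Vec n) :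
    (y, η) ∈ (extChartAt (𝓡∂ n).tangent p₀).target ↔ y ∈ (extChartAt (𝓡∂ n) p₀.proj).target := by
  rw [FiberBundle.extChartAt_target]
  refine ⟨fun h => h.1.1, fun h => ⟨⟨h, ?_⟩, mem_univ _⟩⟩
  exact mem_dom_iff.2 ((extChartAt (𝓡∂ n) p₀.proj).map_target h)

theorem range_cotModel : range (cotModel n) = (range (𝓡∂ n)) ×ˢ (univ : Set (Covec n)) := by
  rw [ModelWithCorners.range_prod]
  simp

theorem range_tanModel : range (𝓡∂ n).tangent = (range (𝓡∂ n)) ×ˢ (univ : Set (Vec n)) := by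
  rw [ModelWithCorners.range_prod]
  simp

theorem range_base : range (𝓡∂ n) = {y : Vec n | 0 ≤ y 0} := range_modelWithCornersEuclideanHalfSpace n

end Charts

attribute [local instance] cotTopology

/-! ### Linear symplectic algebra of the model space -/

section Linear

variable {n : ℕ}

/-- The symplectic form of `ℝⁿ × (ℝⁿ)*`. -/
def sympForm (n : ℕ) : (Vec n × Covec n) →L[ℝ] (Vec n × Covec n) →L[ℝ] ℝ :=
  let A : (Vec n × Covec n) →L[ℝ] (Vec n × Covec n) →L[ℝ] ℝ :=
    (ContinuousLinearMap.id ℝ (Covec n)).bilinearComp (ContinuousLinearMap.snd ℝ (Vec n) (Covec n))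
      (ContinuousLinearMap.fst ℝ (Vec n) (Covec n))
  A - A.flip

theorem sympForm_apply (a b : Vec n × Covec n) : sympForm n a b = a.2 b.1 - b.2 a.1 := rfl

theorem sympForm_antisymm (a b : Vec n × Covec n) : sympForm n a b = -sympForm n b a := by
  simp only [sympForm_apply]; ring

/-- The boundary defining function of the model of `T*M`. -/
def bdf (n : ℕ) [NeZero n] : (Vec n × Covec n) →L[ℝ] ℝ :=
  (EuclideanSpace.proj (𝕜 := ℝ) (0 : Fin n)).comp (ContinuousLinearMap.fst ℝ (Vec n) (Covec n))

theorem bdf_apply [NeZero n] (a : Vec n × Covec n) : bdf n a = a.1 0 := rfl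

theorem bdf_inward [NeZero n] : bdf n (EuclideanSpace.single 0 1, 0) = 1 := by
  simp [bdf_apply]

/-- The Hamiltonian vector `(∂_ξ, -∂_x)` of a covector on `ℝⁿ × (ℝⁿ)*`. -/
def sharp (n : ℕ) : ((Vec n × Covec n) →L[ℝ] ℝ) →L[ℝ] (Vec n × Covec n) :=
  ContinuousLinearMap.prod
    (∑ i : Fin n, (ContinuousLinearMap.apply ℝ ℝ
      ((0, EuclideanSpace.proj i) : Vec n × Covec n)).smulRight (EuclideanSpace.single i (1 : ℝ)))
    (-((ContinuousLinearMap.compL ℝ (Vec n) (Vec n × Covec n) ℝ).flip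
      (ContinuousLinearMap.inl ℝ (Vec n) (Covec n))))

theorem sharp_snd_apply (l : (Vec n × Covec n) →L[ℝ] ℝ) (w : Vec n) :
    (sharp n l).2 w = -l (w, 0) := rfl

theorem apply_sharp_fst (l : (Vec n × Covec n) →L[ℝ] ℝ) (θ : Covec n) :
    θ (sharp n l).1 = l (0, θ) := by
  have h1 : (sharp n l).1 = ∑ i : Fin n,
      l ((0, EuclideanSpace.proj i) : Vec n × Covec n) • EuclideanSpace.single i (1 : ℝ) := by
    show (∑ i : Fin n, (ContinuousLinearMap.apply ℝ ℝ
      ((0, EuclideanSpace.proj i) : Vec n × Covec n)).smulRight (EuclideanSpace.single i (1 : ℝ))) l = _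
    rw [sum_apply]
    rfl
  have h2 : θ = ∑ i : Fin n, θ (EuclideanSpace.single i 1) • (EuclideanSpace.proj i : Covec n) := by
    ext1 w
    have hw : w = ∑ i : Fin n, w i • EuclideanSpace.single i (1 : ℝ) := by
      ext j; simp [Finset.sum_apply, Pi.single_apply]
    conv_lhs => rw [hw, map_sum]
    rw [sum_apply]
    refine Finset.sum_congr rfl fun i _ => ?_
    rw [map_smul, smul_eq_mul, mul_comm]; rfl
  have h3 : ((0, θ) : Vec n × Covec n) = ∑ i : Fin n, θ (EuclideanSpace.single i 1) •
      ((0, EuclideanSpace.proj i) : Vec n × Covec n) := by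
    refine Prod.ext ?_ ?_
    · rw [Prod.fst_sum]; simp
    · rw [Prod.snd_sum]; exact h2
  rw [h3, map_sum, h1, map_sum]
  refine Finset.sum_congr rfl fun i _ => ?_
  rw [map_smul, map_smul, smul_eq_mul, smul_eq_mul, mul_comm]

theorem sympForm_sharp (b : Vec n × Covec n) (l : (Vec n × Covec n) →L[ℝ] ℝ) :
    sympForm n b (sharp n l) = l b := by
  rw [sympForm_apply, apply_sharp_fst, sharp_snd_apply, sub_neg_eq_add, ← map_add]
  congr 1
  simp

theorem sympForm_nondegenerate {a a' : Vec n × Covec n}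
    (h : ∀ b, sympForm n b a = sympForm n b a') : a = a' := by
  have h1 : ∀ θ : Covec n, θ a.1 = θ a'.1 := fun θ => by
    simpa [sympForm_apply] using h (0, θ)
  refine Prod.ext ?_ ?_
  · ext i; exact h1 (EuclideanSpace.proj i)
  · ext1 w
    simpa [sympForm_apply] using h (w, 0)

theorem eq_sharp {a : Vec n × Covec n} {l : (Vec n × Covec n) →L[ℝ] ℝ}
    (h : ∀ b, sympForm n b a = l b) : a = sharp n l :=
  sympForm_nondegenerate fun b => (h b).trans (sympForm_sharp b l).symm

end Linear

/-! ### Cotangent lifts are symplectic -/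

section Lift

variable {n : ℕ} {R : Set (Vec n)} {g h : Vec n → Vec n} {y : Vec n} {η : Covec n}

/-- The cotangent lift, in coordinates, of a map `g` with inverse `h`. -/
def cotLift (g h : Vec n → Vec n) (R : Set (Vec n)) (z : Vec n × Covec n) : Vec n × Covec n :=
  (g z.1, z.2.comp (fderivWithin ℝ h R (g z.1)))

theorem contDiffWithinAt_cotLift (hR : UniqueDiffOn ℝ R) (hgR : ∀ y, g y ∈ R)
    (hg : ContDiffWithinAt ℝ ∞ g R y) (hh : ContDiffWithinAt ℝ ∞ h R (g y)) :
    ContDiffWithinAt ℝ ∞ (cotLift g h R) (R ×ˢ univ) (y, η) := by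
  have h1 : ContDiffWithinAt ℝ ∞ (fun z : Vec n × Covec n => g z.1) (R ×ˢ univ) (y, η) :=
    ContDiffWithinAt.comp (y, η) (g := g) hg contDiffWithinAt_fst fun z hz => hz.1
  have h2 : ContDiffWithinAt ℝ ∞ (fderivWithin ℝ h R) R (g y) :=
    hh.fderivWithin_right hR le_rfl (hgR y)
  have h3 : ContDiffWithinAt ℝ ∞ (fun z : Vec n × Covec n => fderivWithin ℝ h R (g z.1))
      (R ×ˢ univ) (y, η) :=
    ContDiffWithinAt.comp (y, η) (g := fderivWithin ℝ h R) h2 h1 fun z _ => hgR _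
  exact h1.prodMk (contDiffWithinAt_snd.clm_comp h3)

/-- The derivative of the fibre component contains the term `η (h'' (g' a) ·)`. It is symmetric in
the two arguments and cancels in the antisymmetric form; what remains is paired correctly because
`h' ∘ g' = id`. Symmetry of second derivatives at boundary points is the reason for requiring that
`R` lie in the closure of its interior. -/
theorem cotLift_symplectic (hR : UniqueDiffOn ℝ R) (hRi : R ⊆ closure (interior R))
    (hy : y ∈ R) (hgR : ∀ y, g y ∈ R)
    (hg : ContDiffWithinAt ℝ ∞ g R y) (hh : ContDiffWithinAt ℝ ∞ h R (g y))
    (hgh : ∀ᶠ x in 𝓝[R] y, h (g x) = x) :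
    ∃ D : (Vec n × Covec n) →L[ℝ] (Vec n × Covec n),
      HasFDerivWithinAt (cotLift g h R) D (R ×ˢ univ) (y, η) ∧
      ∀ a b, sympForm n (D a) (D b) = sympForm n a b := by
  set g' := fderivWithin ℝ g R y
  set m := fderivWithin ℝ h R (g y)
  set D₂ := fderivWithin ℝ (fderivWithin ℝ h R) R (g y)
  have hg' : HasFDerivWithinAt g g' R y := (hg.differentiableWithinAt (by simp)).hasFDerivWithinAt
  have hm : HasFDerivWithinAt h m R (g y) := (hh.differentiableWithinAt (by simp)).hasFDerivWithinAt
  have h2 : ContDiffWithinAt ℝ ∞ (fderivWithin ℝ h R) R (g y) :=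
    hh.fderivWithin_right hR le_rfl (hgR y)
  have hD₂ : HasFDerivWithinAt (fderivWithin ℝ h R) D₂ R (g y) :=
    (h2.differentiableWithinAt (by simp)).hasFDerivWithinAt
  have hsymm : IsSymmSndFDerivWithinAt ℝ h R (g y) :=
    hh.isSymmSndFDerivWithinAt (by simp; norm_cast) hR (hRi (hgR y)) (hgR y)
  have hmg : ∀ w, m (g' w) = w := by
    have h1 : HasFDerivWithinAt (h ∘ g) (m.comp g') R y := hm.comp y hg' fun x _ => hgR x
    have h3 : HasFDerivWithinAt id (m.comp g') R y :=
      hasFDerivWithinAt_congr_of_mem h1 (hgh.mono fun x hx => hx.symm) hy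
    have h4 := (hR y hy).eq h3 (hasFDerivWithinAt_id y R)
    exact fun w => congrArg (fun A : Vec n →L[ℝ] Vec n => A w) h4
  have hfst : HasFDerivWithinAt (fun z : Vec n × Covec n => g z.1)
      (g'.comp (ContinuousLinearMap.fst ℝ (Vec n) (Covec n))) (R ×ˢ univ) (y, η) :=
    HasFDerivWithinAt.comp (y, η) (g := g) hg' hasFDerivWithinAt_fst fun z hz => hz.1
  have hM : HasFDerivWithinAt (fun z : Vec n × Covec n => fderivWithin ℝ h R (g z.1))
      (D₂.comp (g'.comp (ContinuousLinearMap.fst ℝ (Vec n) (Covec n)))) (R ×ˢ univ) (y, η) :=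
    HasFDerivWithinAt.comp (y, η) (g := fderivWithin ℝ h R) hD₂ hfst fun z _ => hgR _
  have hsnd : HasFDerivWithinAt (fun z : Vec n × Covec n => z.2)
      (ContinuousLinearMap.snd ℝ (Vec n) (Covec n)) (R ×ˢ univ) (y, η) := hasFDerivWithinAt_snd
  refine ⟨_, hfst.prodMk (hsnd.clm_comp hM), fun a b => ?_⟩
  have hs : D₂ (g' a.1) (g' b.1) = D₂ (g' b.1) (g' a.1) := hsymm (g' a.1) (g' b.1)
  show (η (D₂ (g' a.1) (g' b.1)) + a.2 (m (g' b.1))) - (η (D₂ (g' b.1) (g' a.1)) + b.2 (m (g' a.1)))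
    = a.2 b.1 - b.2 a.1
  rw [hs, hmg, hmg]
  ring

end Lift

/-! ### The symplectic structure of the cotangent bundle and lifts of diffeomorphisms -/

section

variable {n : ℕ} [NeZero n]

theorem range_cotModel_eq : range (cotModel n) = {z | 0 ≤ bdf n z} := by
  rw [range_cotModel, range_base]
  ext z
  simp [bdf_apply]

theorem uniqueDiffOn_base : UniqueDiffOn ℝ (range (𝓡∂ n)) := (𝓡∂ n).uniqueDiffOn

theorem range_base_subset : range (𝓡∂ n) ⊆ closure (interior (range (𝓡∂ n))) :=
  (𝓡∂ n).range_subset_closure_interior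

variable {M M' : Type*}
  [TopologicalSpace M] [ChartedSpace (EuclideanHalfSpace n) M] [IsManifold (𝓡∂ n) ∞ M]
  [TopologicalSpace M'] [ChartedSpace (EuclideanHalfSpace n) M'] [IsManifold (𝓡∂ n) ∞ M']

theorem extChartAt_mem_range (x₀ : M) (x : M) : extChartAt (𝓡∂ n) x₀ x ∈ range (𝓡∂ n) :=
  ⟨_, rfl⟩

theorem eventually_proj {q : CotB n M} {S : Set M} (hS : S ∈ 𝓝 q.proj) :
    ∀ᶠ q' : CotB n M in 𝓝 q, q'.proj ∈ S :=
  (FiberBundle.continuous_proj (Covec n)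
    (fun x : M => TangentSpace (𝓡∂ n) x →L[ℝ] Trivial M ℝ x)).continuousAt hS

theorem dom_mem_nhds {x₀ x : M} (hx : x ∈ dom (n := n) x₀) : dom (n := n) x₀ ∈ 𝓝 x :=
  (chartAt (EuclideanHalfSpace n) x₀).open_source.mem_nhds hx

theorem eventually_symm_extChartAt {q : CotB n M} {P : CotB n M → Prop} (hP : ∀ᶠ q' in 𝓝 q, P q')
    {q₀ : CotB n M} (hq : q ∈ (extChartAt (cotModel n) q₀).source) :
    ∀ᶠ z in 𝓝[range (cotModel n)] (extChartAt (cotModel n) q₀ q),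
      z ∈ (extChartAt (cotModel n) q₀).target ∧ P ((extChartAt (cotModel n) q₀).symm z) := by
  have h1 : (extChartAt (cotModel n) q₀).target ∈
      𝓝[range (cotModel n)] (extChartAt (cotModel n) q₀ q) :=
    extChartAt_target_mem_nhdsWithin' hq
  have h2 : Tendsto (extChartAt (cotModel n) q₀).symm
      (𝓝[range (cotModel n)] (extChartAt (cotModel n) q₀ q)) (𝓝 q) := by
    have := continuousAt_extChartAt_symm' (I := cotModel n) hq
    have h3 := this.tendsto
    rw [(extChartAt (cotModel n) q₀).left_inv hq] at h3
    exact h3.mono_left nhdsWithin_le_nhds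
  exact (eventually_mem_set.2 h1).and (h2.eventually hP)

/-- A change of charts of `T*M` is the cotangent lift of the change of charts of `M`. -/
theorem cot_extChartAt_change {q₀ q₁ q : CotB n M} (h₀ : q.proj ∈ dom (n := n) q₀.proj)
    (h₁ : q.proj ∈ dom (n := n) q₁.proj) :
    extChartAt (cotModel n) q₀ q =
      cotLift (extChartAt (𝓡∂ n) q₀.proj ∘ (extChartAt (𝓡∂ n) q₁.proj).symm)
        (extChartAt (𝓡∂ n) q₁.proj ∘ (extChartAt (𝓡∂ n) q₀.proj).symm) (range (𝓡∂ n))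
        (extChartAt (cotModel n) q₁ q) := by
  rw [cot_extChartAt q₀ q h₀, cot_extChartAt q₁ q h₁, cotLift]
  have hx := (extChartAt (𝓡∂ n) q₁.proj).left_inv (mem_dom_iff.1 h₁)
  simp only [Function.comp_apply, hx]
  refine Prod.ext rfl ?_
  ext1 w
  refine congrArg (CotB.covec q) ?_
  exact (tangentCoordChange_comp ⟨⟨mem_dom_iff.1 h₀, mem_dom_iff.1 h₁⟩,
    mem_extChartAt_source _⟩).symm

theorem contDiffWithinAt_coordChange {x₀ x₁ x : M} (h₀ : x ∈ dom (n := n) x₀)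
    (h₁ : x ∈ dom (n := n) x₁) :
    ContDiffWithinAt ℝ ∞ (extChartAt (𝓡∂ n) x₀ ∘ (extChartAt (𝓡∂ n) x₁).symm) (range (𝓡∂ n))
      (extChartAt (𝓡∂ n) x₁ x) := by
  refine contDiffWithinAt_ext_coord_change _ _ ?_
  rw [PartialEquiv.trans_source]
  refine ⟨(extChartAt (𝓡∂ n) x₁).map_source (mem_dom_iff.1 h₁), ?_⟩
  rw [mem_preimage, (extChartAt (𝓡∂ n) x₁).left_inv (mem_dom_iff.1 h₁)]
  exact mem_dom_iff.1 h₀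

theorem eventually_extChartAt_symm_mem {x₁ x : M} (h₁ : x ∈ dom (n := n) x₁) {S : Set M}
    (hS : S ∈ 𝓝 x) : ∀ᶠ y in 𝓝[range (𝓡∂ n)] (extChartAt (𝓡∂ n) x₁ x),
      y ∈ (extChartAt (𝓡∂ n) x₁).target ∧ (extChartAt (𝓡∂ n) x₁).symm y ∈ S := by
  have hq := mem_dom_iff.1 h₁
  have h2 : Tendsto (extChartAt (𝓡∂ n) x₁).symm
      (𝓝[range (𝓡∂ n)] (extChartAt (𝓡∂ n) x₁ x)) (𝓝 x) := by
    have h3 := (continuousAt_extChartAt_symm' (I := 𝓡∂ n) hq).tendsto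
    rw [(extChartAt (𝓡∂ n) x₁).left_inv hq] at h3
    exact h3.mono_left nhdsWithin_le_nhds
  exact (eventually_mem_set.2 (extChartAt_target_mem_nhdsWithin' hq)).and (h2.eventually hS)

/-- By `cot_extChartAt_change` the transition maps are cotangent lifts of transition maps of the
base. Thus the form that is constant in one chart is the same constant form in every other, and
`symp` is well defined. -/
theorem chartsPreserve_cot : ChartsPreserve (cotModel n) (CotB n M) (sympForm n) := by
  intro q₀ q hq a b
  have h₀ : q.proj ∈ dom (n := n) q₀.proj := (cot_mem_source _ _).1 hq
  have h₁ : q.proj ∈ dom (n := n) q.proj := mem_chart_source _ _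
  have hx := (extChartAt (𝓡∂ n) q.proj).left_inv (mem_dom_iff.1 h₁)
  obtain ⟨D, hD, hDs⟩ := cotLift_symplectic (n := n) (R := range (𝓡∂ n))
    (g := extChartAt (𝓡∂ n) q₀.proj ∘ (extChartAt (𝓡∂ n) q.proj).symm)
    (h := extChartAt (𝓡∂ n) q.proj ∘ (extChartAt (𝓡∂ n) q₀.proj).symm)
    (y := extChartAt (𝓡∂ n) q.proj q.proj) (η := CotB.covec q)
    uniqueDiffOn_base range_base_subset (extChartAt_mem_range _ _)
    (fun y => extChartAt_mem_range _ _)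
    (contDiffWithinAt_coordChange h₀ h₁)
    (by
      rw [Function.comp_apply, hx]
      exact contDiffWithinAt_coordChange h₁ h₀)
    (by
      filter_upwards [eventually_extChartAt_symm_mem h₁ (dom_mem_nhds h₀)] with y hy
      simp only [Function.comp_apply]
      rw [(extChartAt (𝓡∂ n) q₀.proj).left_inv (mem_dom_iff.1 hy.2),
        (extChartAt (𝓡∂ n) q.proj).right_inv hy.1])
  have hev : ∀ᶠ z in 𝓝[range (cotModel n)] (extChartAt (cotModel n) q q),
      (extChartAt (cotModel n) q₀ ∘ (extChartAt (cotModel n) q).symm) z =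
      cotLift (extChartAt (𝓡∂ n) q₀.proj ∘ (extChartAt (𝓡∂ n) q.proj).symm)
        (extChartAt (𝓡∂ n) q.proj ∘ (extChartAt (𝓡∂ n) q₀.proj).symm) (range (𝓡∂ n)) z := by
    filter_upwards [eventually_symm_extChartAt (eventually_proj (Filter.inter_mem (dom_mem_nhds h₀)
      (dom_mem_nhds h₁))) (mem_extChartAt_source q)] with z hz
    rw [Function.comp_apply, cot_extChartAt_change hz.2.1 hz.2.2,
      (extChartAt (cotModel n) q).right_inv hz.1]
  have hz : extChartAt (cotModel n) q q = (extChartAt (𝓡∂ n) q.proj q.proj, CotB.covec q) := by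
    rw [cot_extChartAt q q h₁, ofChart_self_eq_id, ContinuousLinearMap.comp_id]
  have h3 : HasFDerivWithinAt (extChartAt (cotModel n) q₀ ∘ (extChartAt (cotModel n) q).symm) D
      (range (cotModel n)) (extChartAt (cotModel n) q q) := by
    refine hasFDerivWithinAt_congr_of_mem ?_ hev ⟨_, rfl⟩
    rw [hz, range_cotModel]; exact hD
  have h4 : tangentCoordChange (cotModel n) q q₀ q = D :=
    h3.fderivWithin ((cotModel n).uniqueDiffOn _ ⟨_, rfl⟩)
  rw [h4, hDs]

/-! ### The identification of the cotangent bundles over the boundary -/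

theorem hasFDerivWithinAt_written {f : M → M'} {x x₀ : M} {x' x₀' : M'} (hx' : f x = x')
    (hf : MDifferentiableAt (𝓡∂ n) (𝓡∂ n) f x)
    (h₀ : x ∈ dom (n := n) x₀) (h₀' : x' ∈ dom (n := n) x₀') :
    HasFDerivWithinAt (extChartAt (𝓡∂ n) x₀' ∘ f ∘ (extChartAt (𝓡∂ n) x₀).symm)
      ((toChart x₀' x').comp ((show Vec n →L[ℝ] Vec n from mfderiv (𝓡∂ n) (𝓡∂ n) f x).comp
        (ofChart x₀ x))) (range (𝓡∂ n)) (extChartAt (𝓡∂ n) x₀ x) := by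
  subst hx'
  exact hasFDerivWithinAt_extChartAt_of_hasMFDerivAt hf.hasMFDerivAt (mem_dom_iff.1 h₀)
    (mem_dom_iff.1 h₀')

theorem contDiffWithinAt_written {f : M → M'} {x x₀ : M} {x' x₀' : M'} (hx' : f x = x')
    (hf : ContMDiffAt (𝓡∂ n) (𝓡∂ n) ∞ f x)
    (h₀ : x ∈ dom (n := n) x₀) (h₀' : x' ∈ dom (n := n) x₀') :
    ContDiffWithinAt ℝ ∞ (extChartAt (𝓡∂ n) x₀' ∘ f ∘ (extChartAt (𝓡∂ n) x₀).symm)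
      (range (𝓡∂ n)) (extChartAt (𝓡∂ n) x₀ x) := by
  subst hx'
  exact ((contMDiffAt_iff_of_mem_source h₀ h₀').1 hf).2

variable {Ψ : OpenPartialHomeomorph M M'}

/-- The coordinate expressions of `Ψ` and of its inverse. -/
def coordMap (Ψ : OpenPartialHomeomorph M M') (x₀ : M) (x₀' : M') : Vec n → Vec n :=
  extChartAt (𝓡∂ n) x₀' ∘ Ψ ∘ (extChartAt (𝓡∂ n) x₀).symm

theorem contMDiffAt_of_mem (h1 : ContMDiffOn (𝓡∂ n) (𝓡∂ n) ∞ Ψ Ψ.source) {x : M} (hx : x ∈ Ψ.source) :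
    ContMDiffAt (𝓡∂ n) (𝓡∂ n) ∞ Ψ x := h1.contMDiffAt (Ψ.open_source.mem_nhds hx)

theorem extChartAt_cotId (h2 : ContMDiffOn (𝓡∂ n) (𝓡∂ n) ∞ Ψ.symm Ψ.target) {q q₀ : CotB n M}
    {q₀' : CotB n M'} (hΨ : q.proj ∈ Ψ.source) (h₀ : q.proj ∈ dom (n := n) q₀.proj)
    (h₀' : Ψ q.proj ∈ dom (n := n) q₀'.proj) :
    extChartAt (cotModel n) q₀' (cotId Ψ q) =
      cotLift (coordMap Ψ q₀.proj q₀'.proj) (coordMap Ψ.symm q₀'.proj q₀.proj) (range (𝓡∂ n))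
        (extChartAt (cotModel n) q₀ q) := by
  rw [cot_extChartAt q₀' (cotId Ψ q) h₀', cot_extChartAt q₀ q h₀, cotLift]
  have hx := (extChartAt (𝓡∂ n) q₀.proj).left_inv (mem_dom_iff.1 h₀)
  have hd : fderivWithin ℝ (coordMap Ψ.symm q₀'.proj q₀.proj) (range (𝓡∂ n))
      (extChartAt (𝓡∂ n) q₀'.proj (Ψ q.proj)) = _ :=
    (hasFDerivWithinAt_written (f := Ψ.symm) (Ψ.left_inv hΨ)
    ((contMDiffAt_of_mem (Ψ := Ψ.symm) h2 (Ψ.map_source hΨ)).mdifferentiableAt (by simp)) h₀'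
    h₀).fderivWithin (uniqueDiffOn_base _ (extChartAt_mem_range _ _))
  have he : coordMap Ψ q₀.proj q₀'.proj (extChartAt (𝓡∂ n) q₀.proj q.proj) =
    extChartAt (𝓡∂ n) q₀'.proj (Ψ q.proj) := by simp only [coordMap, Function.comp_apply, hx]
  simp only [he, hd]
  refine Prod.ext rfl ?_
  ext1 w
  exact congrArg (CotB.covec q) (ofChart_toChart h₀ _).symm

theorem cotLift_hypotheses (h1 : ContMDiffOn (𝓡∂ n) (𝓡∂ n) ∞ Ψ Ψ.source)
    (h2 : ContMDiffOn (𝓡∂ n) (𝓡∂ n) ∞ Ψ.symm Ψ.target) {x x₀ : M} {x₀' : M'}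
    (hΨ : x ∈ Ψ.source) (h₀ : x ∈ dom (n := n) x₀) (h₀' : Ψ x ∈ dom (n := n) x₀') :
    ContDiffWithinAt ℝ ∞ (coordMap (n := n) Ψ x₀ x₀') (range (𝓡∂ n)) (extChartAt (𝓡∂ n) x₀ x) ∧
    ContDiffWithinAt ℝ ∞ (coordMap (n := n) Ψ.symm x₀' x₀) (range (𝓡∂ n))
      (coordMap Ψ x₀ x₀' (extChartAt (𝓡∂ n) x₀ x)) ∧
    ∀ᶠ y in 𝓝[range (𝓡∂ n)] (extChartAt (𝓡∂ n) x₀ x),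
      coordMap (n := n) Ψ.symm x₀' x₀ (coordMap Ψ x₀ x₀' y) = y := by
  have hx := (extChartAt (𝓡∂ n) x₀).left_inv (mem_dom_iff.1 h₀)
  have he : coordMap Ψ x₀ x₀' (extChartAt (𝓡∂ n) x₀ x) =
    extChartAt (𝓡∂ n) x₀' (Ψ x) := by simp only [coordMap, Function.comp_apply, hx]
  refine ⟨contDiffWithinAt_written rfl (contMDiffAt_of_mem h1 hΨ) h₀ h₀', ?_, ?_⟩
  · rw [he]
    exact contDiffWithinAt_written (Ψ.left_inv hΨ)
      (contMDiffAt_of_mem (Ψ := Ψ.symm) h2 (Ψ.map_source hΨ)) h₀' h₀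
  · have h3 : Ψ.source ∩ Ψ ⁻¹' (dom (n := n) x₀') ∈ 𝓝 x :=
      Filter.inter_mem (Ψ.open_source.mem_nhds hΨ)
        ((Ψ.continuousAt hΨ).preimage_mem_nhds (dom_mem_nhds h₀'))
    filter_upwards [eventually_extChartAt_symm_mem h₀ h3] with y hy
    simp only [coordMap, Function.comp_apply]
    rw [(extChartAt (𝓡∂ n) x₀').left_inv (mem_dom_iff.1 hy.2.2), Ψ.left_inv hy.2.1,
      (extChartAt (𝓡∂ n) x₀).right_inv hy.1]

theorem cot_extChartAt_self (q : CotB n M) :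
    extChartAt (cotModel n) q q = (extChartAt (𝓡∂ n) q.proj q.proj, CotB.covec q) := by
  rw [cot_extChartAt q q (mem_chart_source _ _), ofChart_self_eq_id, ContinuousLinearMap.comp_id]

theorem eventually_extChartAt_cotId
    (h2 : ContMDiffOn (𝓡∂ n) (𝓡∂ n) ∞ Ψ.symm Ψ.target) {q : CotB n M} (hΨ : q.proj ∈ Ψ.source) :
    ∀ᶠ q' in 𝓝 q, cotId Ψ q' ∈ (extChartAt (cotModel n) (cotId Ψ q)).source ∧
      extChartAt (cotModel n) (cotId Ψ q) (cotId Ψ q') =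
      cotLift (coordMap Ψ q.proj (Ψ q.proj)) (coordMap Ψ.symm (Ψ q.proj) q.proj) (range (𝓡∂ n))
        (extChartAt (cotModel n) q q') := by
  have h3 : (Ψ.source ∩ Ψ ⁻¹' (dom (n := n) (Ψ q.proj))) ∩ dom (n := n) q.proj ∈ 𝓝 q.proj :=
    Filter.inter_mem (Filter.inter_mem (Ψ.open_source.mem_nhds hΨ)
      ((Ψ.continuousAt hΨ).preimage_mem_nhds (dom_mem_nhds (mem_chart_source _ _))))
      (dom_mem_nhds (mem_chart_source _ _))
  filter_upwards [eventually_proj h3] with q' hq'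
  exact ⟨(cot_mem_source _ _).2 hq'.1.2, extChartAt_cotId (q₀ := q) (q₀' := cotId Ψ q) h2 hq'.1.1
    hq'.2 hq'.1.2⟩

/-- Although only points over the boundary matter, the lift is considered over all of `Ψ.source`:
differentiability at a boundary point also involves nearby interior points. -/
theorem contMDiffAt_cotId (h1 : ContMDiffOn (𝓡∂ n) (𝓡∂ n) ∞ Ψ Ψ.source)
    (h2 : ContMDiffOn (𝓡∂ n) (𝓡∂ n) ∞ Ψ.symm Ψ.target) {q : CotB n M} (hΨ : q.proj ∈ Ψ.source) :
    ContMDiffAt (cotModel n) (cotModel n) ∞ (cotId Ψ) q := by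
  obtain ⟨hg, hh, -⟩ := cotLift_hypotheses h1 h2 hΨ (mem_chart_source _ q.proj)
    (mem_chart_source _ (Ψ q.proj))
  refine contMDiffAt_of_eventually_extChartAt_eq (mem_chart_source _ q)
    (eventually_extChartAt_cotId h2 hΨ) ?_
  rw [cot_extChartAt_self, range_cotModel]
  exact contDiffWithinAt_cotLift uniqueDiffOn_base (fun y => extChartAt_mem_range _ _) hg hh

theorem cotId_symplectic (h1 : ContMDiffOn (𝓡∂ n) (𝓡∂ n) ∞ Ψ Ψ.source)
    (h2 : ContMDiffOn (𝓡∂ n) (𝓡∂ n) ∞ Ψ.symm Ψ.target) {q : CotB n M} (hΨ : q.proj ∈ Ψ.source) :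
    PreservesAt (cotModel n) (sympForm n) (cotId Ψ) q := by
  obtain ⟨hg, hh, hgh⟩ := cotLift_hypotheses h1 h2 hΨ (mem_chart_source _ q.proj)
    (mem_chart_source _ (Ψ q.proj))
  obtain ⟨D, hD, hDs⟩ := cotLift_symplectic (η := CotB.covec q) uniqueDiffOn_base range_base_subset
    (extChartAt_mem_range _ _) (fun y => extChartAt_mem_range _ _) hg hh hgh
  refine ⟨D, ⟨(contMDiffAt_cotId h1 h2 hΨ).continuousAt, ?_⟩, hDs⟩
  refine hasFDerivWithinAt_congr_of_mem (f := cotLift (coordMap Ψ q.proj (Ψ q.proj))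
    (coordMap Ψ.symm (Ψ q.proj) q.proj) (range (𝓡∂ n))) ?_ ?_ ⟨_, rfl⟩
  · rw [cot_extChartAt_self, range_cotModel]
    exact hD
  · filter_upwards [eventually_symm_extChartAt (eventually_extChartAt_cotId h2 hΨ)
      (mem_extChartAt_source q)] with z hz
    simp only [writtenInExtChartAt, Function.comp_apply]
    rw [hz.2.2, (extChartAt (cotModel n) q).right_inv hz.1]

end

/-! ### Hamiltonian vector fields -/

section

/-- The field is `J dG` and its derivative is `J d²G`. Since `σ b (J l) = l b` and `σ` is
antisymmetric, the asserted skewness is the symmetry of the second derivative of `G`. -/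
theorem hamiltonian_smooth_skew {E : Type*} [NormedAddCommGroup E] [NormedSpace ℝ E]
    {σ : E →L[ℝ] E →L[ℝ] ℝ} (J : (E →L[ℝ] ℝ) →L[ℝ] E) (hJ : ∀ b l, σ b (J l) = l b)
    (hσ : ∀ a b, σ a b = -σ b a) {G : E → ℝ} {R : Set E} {z₀ : E} (hR : UniqueDiffOn ℝ R)
    (hRi : R ⊆ closure (interior R)) (hz₀ : z₀ ∈ R) (hG : ContDiffWithinAt ℝ ∞ G R z₀) {f : E → E}
    (hev : ∀ᶠ z in 𝓝[R] z₀, f z = J (fderivWithin ℝ G R z)) :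
    ContDiffWithinAt ℝ ∞ f R z₀ ∧
      ∀ᶠ z in 𝓝[R] z₀, ∀ a b, σ (fderivWithin ℝ f R z a) b + σ a (fderivWithin ℝ f R z b) = 0 := by
  have hdG : ContDiffWithinAt ℝ ∞ (fderivWithin ℝ G R) R z₀ :=
    hG.fderivWithin_right hR le_rfl hz₀
  have hs : ContDiffWithinAt ℝ ∞ (fun z => J (fderivWithin ℝ G R z)) R z₀ :=
    J.contDiff.comp_contDiffWithinAt hdG
  refine ⟨hs.congr_of_eventuallyEq_of_mem hev hz₀, ?_⟩
  have h2 : ∀ᶠ z in 𝓝[R] z₀, ContDiffWithinAt ℝ 2 G R z := by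
    have := (hG.of_le (m := 2) (by norm_cast)).eventually (by simp)
    rwa [insert_eq_of_mem hz₀] at this
  filter_upwards [eventually_eventually_nhdsWithin.2 hev, h2, self_mem_nhdsWithin] with z hz hz2 hzR
  intro a b
  have hd : HasFDerivWithinAt (fderivWithin ℝ G R) (fderivWithin ℝ (fderivWithin ℝ G R) R z) R z :=
    ((hz2.fderivWithin_right (m := 1) hR (by norm_num) hzR).differentiableWithinAt
      (by simp)).hasFDerivWithinAt
  have hsymm : IsSymmSndFDerivWithinAt ℝ G R z :=
    hz2.isSymmSndFDerivWithinAt (by simp) hR (hRi hzR) hzR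
  have h4 : HasFDerivWithinAt (fun z => J (fderivWithin ℝ G R z))
      (J.comp (fderivWithin ℝ (fderivWithin ℝ G R) R z)) R z :=
    J.hasFDerivAt.comp_hasFDerivWithinAt z hd
  rw [(hasFDerivWithinAt_congr_of_mem h4 hz hzR).fderivWithin (hR z hzR)]
  show σ (J (fderivWithin ℝ (fderivWithin ℝ G R) R z a)) b +
    σ a (J (fderivWithin ℝ (fderivWithin ℝ G R) R z b)) = 0
  rw [hσ, hJ, hJ, hsymm a b]
  ring

variable {n : ℕ} [NeZero n]
variable {M M' : Type*}
  [TopologicalSpace M] [ChartedSpace (EuclideanHalfSpace n) M] [IsManifold (𝓡∂ n) ∞ M]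
  [TopologicalSpace M'] [ChartedSpace (EuclideanHalfSpace n) M'] [IsManifold (𝓡∂ n) ∞ M']

/-- The differential of a function on `T*M`. -/
def cotDeriv (G : CotB n M → ℝ) (q : CotB n M) : (Vec n × Covec n) →L[ℝ] ℝ :=
  fderivWithin ℝ (G ∘ (extChartAt (cotModel n) q).symm) (range (cotModel n))
    (extChartAt (cotModel n) q q)

/-- The Hamiltonian vector field of `G`. -/
def hamField (G : CotB n M → ℝ) (q : CotB n M) : TangentSpace (cotModel n) q :=
  (sharp n (cotDeriv G q) : Vec n × Covec n)

theorem cotDeriv_eq {G : CotB n M → ℝ} {q : CotB n M} {l : (Vec n × Covec n) →L[ℝ] ℝ}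
    (h : HasFDerivWithinAt (G ∘ (extChartAt (cotModel n) q).symm) l (range (cotModel n))
      (extChartAt (cotModel n) q q)) : cotDeriv G q = l :=
  h.fderivWithin ((cotModel n).uniqueDiffOn _ ⟨_, rfl⟩)

theorem hasFDerivWithinAt_cotDeriv {G : CotB n M → ℝ} {q : CotB n M}
    (h : MDifferentiableAt (cotModel n) 𝓘(ℝ, ℝ) G q) :
    HasFDerivWithinAt (G ∘ (extChartAt (cotModel n) q).symm) (cotDeriv G q) (range (cotModel n))
      (extChartAt (cotModel n) q q) :=
  ((mdifferentiableAt_iff _ _).1 h).2.hasFDerivWithinAt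

theorem hasFDerivWithinAt_chart {G : CotB n M → ℝ} {q q₀ : CotB n M}
    (h : MDifferentiableAt (cotModel n) 𝓘(ℝ, ℝ) G q) (hq : q ∈ (extChartAt (cotModel n) q₀).source) :
    HasFDerivWithinAt (G ∘ (extChartAt (cotModel n) q₀).symm)
      ((cotDeriv G q).comp (tangentCoordChange (cotModel n) q₀ q q)) (range (cotModel n))
      (extChartAt (cotModel n) q₀ q) := by
  have h1 := hasFDerivWithinAt_tangentCoordChange (I := cotModel n)
    ⟨hq, mem_extChartAt_source (I := cotModel n) q⟩
  have h2 := hasFDerivWithinAt_cotDeriv h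
  have h3 : HasFDerivWithinAt ((G ∘ (extChartAt (cotModel n) q).symm) ∘
      (extChartAt (cotModel n) q ∘ (extChartAt (cotModel n) q₀).symm))
      ((cotDeriv G q).comp (tangentCoordChange (cotModel n) q₀ q q)) (range (cotModel n))
      (extChartAt (cotModel n) q₀ q) := by
    refine HasFDerivWithinAt.comp (t := range (cotModel n)) _ ?_ h1 fun z _ => ⟨_, rfl⟩
    rw [Function.comp_apply, (extChartAt (cotModel n) q₀).left_inv hq]
    exact h2
  refine hasFDerivWithinAt_congr_of_mem h3 ?_ ⟨_, rfl⟩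
  filter_upwards [eventually_symm_extChartAt (extChartAt_source_mem_nhds (I := cotModel n) q) hq]
    with z hz
  simp only [Function.comp_apply]
  rw [(extChartAt (cotModel n) q).left_inv hz.2]

/-- Hamilton's equations have the same form in every bundle chart, because chart changes are
symplectic and `sharp` is determined by the form. -/
theorem chartField_hamField {G : CotB n M → ℝ} {q q₀ : CotB n M}
    (h : MDifferentiableAt (cotModel n) 𝓘(ℝ, ℝ) G q) (hq : q ∈ (extChartAt (cotModel n) q₀).source) :
    chartField (cotModel n) (hamField G) q₀ (extChartAt (cotModel n) q₀ q) =
      sharp n (fderivWithin ℝ (G ∘ (extChartAt (cotModel n) q₀).symm) (range (cotModel n))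
        (extChartAt (cotModel n) q₀ q)) := by
  rw [chartField_extChartAt _ hq, (hasFDerivWithinAt_chart h hq).fderivWithin
    ((cotModel n).uniqueDiffOn _ ⟨_, rfl⟩)]
  refine eq_sharp fun b => ?_
  have hb : b = tangentCoordChange (cotModel n) q q₀ q (tangentCoordChange (cotModel n) q₀ q q b) :=
    ((tangentCoordChange_comp ⟨⟨hq, mem_extChartAt_source (I := cotModel n) q⟩, hq⟩).trans
      (tangentCoordChange_self hq)).symm
  conv_lhs => rw [hb]
  exact (chartsPreserve_cot q₀ q hq _ _).trans (sympForm_sharp _ _)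

theorem eventually_chartField_hamField {G : CotB n M → ℝ} {q₀ : CotB n M}
    (h : ContMDiffAt (cotModel n) 𝓘(ℝ, ℝ) ∞ G q₀) :
    ∀ᶠ z in 𝓝[range (cotModel n)] (extChartAt (cotModel n) q₀ q₀),
      chartField (cotModel n) (hamField G) q₀ z =
      sharp n (fderivWithin ℝ (G ∘ (extChartAt (cotModel n) q₀).symm) (range (cotModel n)) z) := by
  have h1 : ∀ᶠ q in 𝓝 q₀, ContMDiffAt (cotModel n) 𝓘(ℝ, ℝ) 1 G q :=
    contMDiffAt_iff_contMDiffAt_nhds (by simp) |>.1 (h.of_le (by norm_cast))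
  have h2 := h1.and (extChartAt_source_mem_nhds (I := cotModel n) q₀)
  filter_upwards [eventually_symm_extChartAt h2 (mem_extChartAt_source q₀)] with z hz
  have h3 := chartField_hamField (hz.2.1.mdifferentiableAt (by simp)) hz.2.2
  rwa [(extChartAt (cotModel n) q₀).right_inv hz.1] at h3

theorem symplecticFieldAt_hamField {G : CotB n M → ℝ} {q₀ : CotB n M}
    (h : ContMDiffAt (cotModel n) 𝓘(ℝ, ℝ) ∞ G q₀) :
    SymplecticFieldAt (cotModel n) (sympForm n) (hamField G) q₀ :=
  hamiltonian_smooth_skew (sharp n) sympForm_sharp sympForm_antisymm (cotModel n).uniqueDiffOn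
    (cotModel n).range_subset_closure_interior ⟨_, rfl⟩ (contMDiffAt_iff.1 h).2
    (eventually_chartField_hamField h)

/-- A symplectic map carries the Hamiltonian field of `G'` pulled back to that of `G'`. -/
theorem hamField_conj {G : CotB n M → ℝ} {G' : CotB n M' → ℝ} {κ : CotB n M → CotB n M'}
    {q : CotB n M} {D D' : (Vec n × Covec n) →L[ℝ] (Vec n × Covec n)}
    (hκ : HasMFDerivAt (cotModel n) (cotModel n) κ q D) (hD : ∀ a b, sympForm n (D a) (D b) = sympForm n a b)
    (hDD' : ∀ b, D (D' b) = b)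
    (hG' : MDifferentiableAt (cotModel n) 𝓘(ℝ, ℝ) G' (κ q)) (hG : ∀ᶠ p in 𝓝 q, G p = G' (κ p)) :
    D (hamField G q) = hamField G' (κ q) := by
  refine eq_sharp fun b => ?_
  have h1 : HasMFDerivAt (cotModel n) 𝓘(ℝ, ℝ) (G' ∘ κ) q ((cotDeriv G' (κ q)).comp D) :=
    HasMFDerivAt.comp q (g := G') (g' := cotDeriv G' (κ q)) ⟨hG'.continuousAt, hasFDerivWithinAt_cotDeriv hG'⟩ hκ
  have h2 : HasMFDerivAt (cotModel n) 𝓘(ℝ, ℝ) G q ((cotDeriv G' (κ q)).comp D) :=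
    h1.congr_of_eventuallyEq hG
  have h3 : cotDeriv G q = (cotDeriv G' (κ q)).comp D := cotDeriv_eq h2.2
  have h4 : sympForm n (D (D' b)) (D (sharp n (cotDeriv G q))) = cotDeriv G' (κ q) (D (D' b)) := by
    rw [hD, sympForm_sharp, h3]
    rfl
  rw [hDD'] at h4
  exact h4

theorem isMIntegralCurveOn_comp {X : (q : CotB n M) → TangentSpace (cotModel n) q}
    {X' : (q : CotB n M') → TangentSpace (cotModel n) q}
    {κ : CotB n M → CotB n M'} {c : ℝ → CotB n M} {S : Set ℝ} (hc : IsMIntegralCurveOn c X S)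
    (h : ∀ t ∈ S, ∃ D : (Vec n × Covec n) →L[ℝ] (Vec n × Covec n),
      HasMFDerivAt (cotModel n) (cotModel n) κ (c t) D ∧ D (X (c t)) = X' (κ (c t))) :
    IsMIntegralCurveOn (fun t => κ (c t)) X' S := by
  intro t ht
  obtain ⟨D, hD, hX⟩ := h t ht
  have h1 := HasMFDerivAt.comp_hasMFDerivWithinAt t hD (hc t ht)
  refine h1.congr_mfderiv ?_
  ext1
  show D ((1 : ℝ) • X (c t)) = (1 : ℝ) • X' (κ (c t))
  rw [one_smul, one_smul, hX]

end

/-! ### Minkowski norms and their Legendre transform -/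

section

variable {V : Type*} [NormedAddCommGroup V] [NormedSpace ℝ V]

/-- Euler's identity for functions that are homogeneous of degree two. -/
theorem euler_two {L : V → ℝ} {v : V} {D : V →L[ℝ] ℝ} (hL : HasFDerivAt L D v)
    (hom : ∀ r : ℝ, 0 < r → L (r • v) = r ^ 2 * L v) : D v = 2 * L v := by
  have h1 : HasDerivAt (fun r : ℝ => r • v) ((1 : ℝ) • v) 1 := (hasDerivAt_id 1).smul_const v
  have h2 : HasDerivAt (fun r : ℝ => L (r • v)) (D ((1 : ℝ) • v)) 1 := by
    have h3 : HasFDerivAt L D ((fun r : ℝ => r • v) 1) := by simpa using hL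
    exact h3.comp_hasDerivAt 1 h1
  have h4 : HasDerivAt (fun r : ℝ => r ^ 2 * L v) (2 * L v) 1 := by
    simpa using (hasDerivAt_pow 2 (1 : ℝ)).mul_const (L v)
  have h5 : (fun r : ℝ => L (r • v)) =ᶠ[𝓝 1] fun r => r ^ 2 * L v := by
    filter_upwards [lt_mem_nhds (zero_lt_one)] with r hr using hom r hr
  simpa using (h2.congr_of_eventuallyEq h5.symm).unique h4

theorem fderiv_homogeneous_two {L : V → ℝ} {v : V} {r : ℝ} (hr : 0 < r)
    (hom : ∀ᶠ w in 𝓝 v, L (r • w) = r ^ 2 * L w) (hL : DifferentiableAt ℝ L v)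
    (hL' : DifferentiableAt ℝ L (r • v)) :
    fderiv ℝ L (r • v) = r • fderiv ℝ L v := by
  have h1 : HasFDerivAt (fun w : V => r • w) (r • ContinuousLinearMap.id ℝ V) v :=
    (hasFDerivAt_id v).const_smul r
  have h2 : HasFDerivAt (fun w => L (r • w)) ((fderiv ℝ L (r • v)).comp
      (r • ContinuousLinearMap.id ℝ V)) v := HasFDerivAt.comp v (g := L) hL'.hasFDerivAt h1
  have h3 : HasFDerivAt (fun w => r ^ 2 * L w) (r ^ 2 • fderiv ℝ L v) v :=
    hL.hasFDerivAt.const_mul (r ^ 2)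
  have h4 := (h2.congr_of_eventuallyEq (hom.mono fun w hw => hw.symm)).unique h3
  ext1 w
  have h5 : fderiv ℝ L (r • v) (r • w) = r ^ 2 * fderiv ℝ L v w :=
    congrArg (fun A : V →L[ℝ] ℝ => A w) h4
  rw [map_smul, smul_eq_mul] at h5
  show fderiv ℝ L (r • v) w = r * fderiv ℝ L v w
  have : r * fderiv ℝ L (r • v) w = r * (r * fderiv ℝ L v w) := by rw [h5]; ring
  exact mul_left_cancel₀ hr.ne' this

/-- A function with positive definite Hessian along a segment lies strictly above its tangent. -/
theorem tangent_lt {L : V → ℝ} {v w : V}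
    (hL : ∀ t ∈ Icc (0 : ℝ) 1, ContDiffAt ℝ 2 L (v + t • (w - v)))
    (hpos : ∀ t ∈ Icc (0 : ℝ) 1, 0 < fderiv ℝ (fderiv ℝ L) (v + t • (w - v)) (w - v) (w - v)) :
    L v + fderiv ℝ L v (w - v) < L w := by
  have hline : ∀ t : ℝ, HasDerivAt (fun t : ℝ => v + t • (w - v)) (w - v) t := fun t => by
    simpa using ((hasDerivAt_id t).smul_const (w - v)).const_add v
  have h1 : ∀ t ∈ Icc (0 : ℝ) 1, HasDerivAt (fun t : ℝ => L (v + t • (w - v)))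
      (fderiv ℝ L (v + t • (w - v)) (w - v)) t := fun t ht =>
    ((hL t ht).differentiableAt (by simp)).hasFDerivAt.comp_hasDerivAt t (hline t)
  have h2 : ∀ t ∈ Icc (0 : ℝ) 1, HasDerivAt (fun t : ℝ => fderiv ℝ L (v + t • (w - v)) (w - v))
      (fderiv ℝ (fderiv ℝ L) (v + t • (w - v)) (w - v) (w - v)) t := fun t ht => by
    have h3 : HasFDerivAt (fderiv ℝ L) (fderiv ℝ (fderiv ℝ L) (v + t • (w - v)))
        (v + t • (w - v)) :=
      (((hL t ht).fderiv_right (m := 1) (by norm_num)).differentiableAt (by simp)).hasFDerivAt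
    exact (h3.comp_hasDerivAt t (hline t)).clm_apply (hasDerivAt_const t (w - v)) |>.congr_deriv
      (by simp)
  obtain ⟨τ, hτ, hτe⟩ := exists_hasDerivAt_eq_slope _ _ (zero_lt_one' ℝ)
    (fun t ht => (h1 t ht).continuousAt.continuousWithinAt)
    (fun t ht => h1 t (Ioo_subset_Icc_self ht))
  have hsub : Icc 0 τ ⊆ Icc (0 : ℝ) 1 := Icc_subset_Icc_right hτ.2.le
  obtain ⟨ζ, hζ, hζe⟩ := exists_hasDerivAt_eq_slope _ _ hτ.1
    (fun t ht => (h2 t (hsub ht)).continuousAt.continuousWithinAt)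
    (fun t ht => h2 t (hsub (Ioo_subset_Icc_self ht)))
  have h5 := hpos ζ (hsub (Ioo_subset_Icc_self hζ))
  rw [hζe, sub_zero, lt_div_iff₀ hτ.1] at h5
  simp only [zero_smul, add_zero, one_smul, add_sub_cancel, sub_zero, div_one] at hτe h5
  linarith

/-- A Minkowski norm: a (not necessarily reversible) norm which is smooth and strongly convex. -/
structure IsMinkowski (f : V → ℝ) : Prop where
  map_zero : f 0 = 0
  pos : ∀ v, v ≠ 0 → 0 < f v
  homogeneous : ∀ v, v ≠ 0 → ∀ r : ℝ, 0 < r → f (r • v) = r * f v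
  smooth : ∀ v, v ≠ 0 → ContDiffAt ℝ ∞ f v
  posDef : ∀ v, v ≠ 0 → ∀ w, w ≠ 0 → 0 < fderiv ℝ (fderiv ℝ fun u => f u ^ 2 / 2) v w w

namespace IsMinkowski

variable {f : V → ℝ} (h : IsMinkowski f) {v w : V}

include h

theorem contDiffAt_energy (hv : v ≠ 0) : ContDiffAt ℝ ∞ (fun u => f u ^ 2 / 2) v :=
  ((h.smooth v hv).pow 2).div_const 2

theorem differentiableAt_energy (hv : v ≠ 0) : DifferentiableAt ℝ (fun u => f u ^ 2 / 2) v :=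
  (h.contDiffAt_energy hv).differentiableAt (by simp)

theorem energy_smul (hv : v ≠ 0) {r : ℝ} (hr : 0 < r) :
    f (r • v) ^ 2 / 2 = r ^ 2 * (f v ^ 2 / 2) := by
  rw [h.homogeneous v hv r hr]; ring

theorem euler (hv : v ≠ 0) : fderiv ℝ (fun u => f u ^ 2 / 2) v v = f v ^ 2 := by
  have := euler_two (h.differentiableAt_energy hv).hasFDerivAt fun r hr => h.energy_smul hv hr
  rw [this]; ring

theorem fderiv_smul (hv : v ≠ 0) {r : ℝ} (hr : 0 < r) :
    fderiv ℝ (fun u => f u ^ 2 / 2) (r • v) = r • fderiv ℝ (fun u => f u ^ 2 / 2) v :=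
  fderiv_homogeneous_two hr ((eventually_mem_set.2 (isOpen_ne.mem_nhds hv)).mono fun _ hw => h.energy_smul hw hr)
    (h.differentiableAt_energy hv) (h.differentiableAt_energy (smul_ne_zero hr.ne' hv))

/-- Strict convexity along the segment gives the inequality as long as the segment avoids the
origin, where `f² / 2` need not be twice differentiable. If it meets the origin, then `w - v = -t⁻¹
v` with `t ≤ 1`, and Euler's identity makes the left side negative. -/
theorem energy_tangent_lt (hv : v ≠ 0) (hvw : v ≠ w) :
    f v ^ 2 / 2 + fderiv ℝ (fun u => f u ^ 2 / 2) v (w - v) < f w ^ 2 / 2 := by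
  by_cases h0 : ∃ t ∈ Icc (0 : ℝ) 1, v + t • (w - v) = 0
  · obtain ⟨t, ht, he⟩ := h0
    have hpos := h.pos v hv
    have ht0 : t ≠ 0 := by rintro rfl; simp at he; exact hv he
    have htp : 0 < t := lt_of_le_of_ne ht.1 (Ne.symm ht0)
    have hE := h.euler hv
    have h1 : w - v = (-t⁻¹) • v := by
      have h2 : t • (w - v) = -v := by rw [eq_neg_iff_add_eq_zero, add_comm]; exact he
      rw [neg_smul, ← smul_neg, ← h2, smul_smul, inv_mul_cancel₀ ht0, one_smul]
    rw [h1, map_smul, hE, smul_eq_mul]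
    have h2 : 1 ≤ t⁻¹ := (one_le_inv₀ htp).2 ht.2
    have h3 := sq_nonneg (f w)
    have h4 : 0 < f v ^ 2 := by positivity
    nlinarith
  · push Not at h0
    refine tangent_lt (fun t ht => (h.contDiffAt_energy (h0 t ht)).of_le (by norm_cast)) ?_
    exact fun t ht => h.posDef _ (h0 t ht) _ (sub_ne_zero.2 hvw.symm)

/-- With equal derivatives, the strict tangent inequalities at the two points add up to a
contradiction. -/
theorem fderiv_injective (hv : v ≠ 0) (hw : w ≠ 0)
    (he : fderiv ℝ (fun u => f u ^ 2 / 2) v = fderiv ℝ (fun u => f u ^ 2 / 2) w) : v = w := by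
  by_contra hne
  have h1 := h.energy_tangent_lt hv hne
  have h2 := h.energy_tangent_lt hw (Ne.symm hne)
  rw [he, map_sub] at h1
  rw [map_sub] at h2
  linarith

/-- This is the Cauchy–Schwarz inequality of Finsler geometry: rescale `w` to the length of `v` and
use that the energy lies above its tangent at `v`. -/
theorem fderiv_apply_le (hv : v ≠ 0) (w : V) :
    fderiv ℝ (fun u => f u ^ 2 / 2) v w ≤ f v * f w := by
  by_cases hw : w = 0
  · simp [hw, h.map_zero]
  have hfw := h.pos w hw
  have hfv := h.pos v hv
  have hr : 0 < f v / f w := by positivity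
  have h1 : f ((f v / f w) • w) = f v := by
    rw [h.homogeneous w hw _ hr, div_mul_cancel₀ _ hfw.ne']
  have h2 : fderiv ℝ (fun u => f u ^ 2 / 2) v ((f v / f w) • w) ≤ f v ^ 2 := by
    by_cases hne : v = (f v / f w) • w
    · rw [← hne, h.euler hv]
    · have := h.energy_tangent_lt hv hne
      rw [map_sub, h.euler hv, h1] at this
      linarith
  rw [map_smul, smul_eq_mul, div_mul_eq_mul_div, div_le_iff₀ hfw] at h2
  have h3 : f v * fderiv ℝ (fun u => f u ^ 2 / 2) v w ≤ f v * (f v * f w) := by linarith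
  exact le_of_mul_le_mul_left h3 hfv

theorem isGreatest_fderiv (hv : v ≠ 0) :
    IsGreatest {s | ∃ w, f w = 1 ∧ s = fderiv ℝ (fun u => f u ^ 2 / 2) v w} (f v) := by
  have hfv := h.pos v hv
  refine ⟨⟨(f v)⁻¹ • v, ?_, ?_⟩, ?_⟩
  · rw [h.homogeneous v hv _ (by positivity), inv_mul_cancel₀ hfv.ne']
  · rw [map_smul, h.euler hv, smul_eq_mul, sq, inv_mul_cancel_left₀ hfv.ne']
  · rintro s ⟨w, hw, rfl⟩
    simpa [hw] using h.fderiv_apply_le hv w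

theorem young (hv : v ≠ 0) (w : V) :
    fderiv ℝ (fun u => f u ^ 2 / 2) v w ≤ f v ^ 2 / 2 + f w ^ 2 / 2 := by
  have := h.fderiv_apply_le hv w
  nlinarith [sq_nonneg (f v - f w)]

/-- A critical point of `f² / 2 - ξ` is sought. The quotient `ξ / f` attains a maximum `m` on the
compact unit sphere, so `ξ ≤ m f` everywhere, and hence `f² / 2 - ξ ≥ -m² / 2`, with equality at a
suitable multiple of the maximizer. -/
theorem exists_fderiv_eq [FiniteDimensional ℝ V] {ξ : V →L[ℝ] ℝ} (hξ : ξ ≠ 0) :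
    ∃ v, v ≠ 0 ∧ fderiv ℝ (fun u => f u ^ 2 / 2) v = ξ := by
  obtain ⟨u, hu⟩ : ∃ u, 0 < ξ u := by
    by_contra! hcon
    refine hξ (ContinuousLinearMap.ext fun u => le_antisymm (hcon u) ?_)
    have := hcon (-u)
    simpa using this
  have hu0 : u ≠ 0 := by rintro rfl; simp at hu
  have hne : (Metric.sphere (0 : V) 1).Nonempty :=
    ⟨‖u‖⁻¹ • u, by simp [norm_smul, inv_mul_cancel₀ (norm_ne_zero_iff.2 hu0)]⟩
  have hs0 : ∀ w ∈ Metric.sphere (0 : V) 1, w ≠ 0 := by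
    rintro w hw rfl
    simp at hw
  have hcont : ContinuousOn (fun w => ξ w / f w) (Metric.sphere (0 : V) 1) := fun w hw =>
    (ξ.continuous.continuousAt.div (h.smooth w (hs0 w hw)).continuousAt
      (h.pos w (hs0 w hw)).ne').continuousWithinAt
  obtain ⟨w₀, hw₀, hmax⟩ := (isCompact_sphere (0 : V) 1).exists_isMaxOn hne hcont
  set m := ξ w₀ / f w₀ with hm
  have hle : ∀ w, ξ w ≤ m * f w := by
    intro w
    by_cases hw : w = 0
    · simp [hw, h.map_zero]
    have hn : 0 < ‖w‖⁻¹ := inv_pos.2 (norm_pos_iff.2 hw)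
    have h1 : ‖w‖⁻¹ • w ∈ Metric.sphere (0 : V) 1 := by
      simp [norm_smul, inv_mul_cancel₀ (norm_ne_zero_iff.2 hw)]
    have h2 : ξ (‖w‖⁻¹ • w) / f (‖w‖⁻¹ • w) ≤ m := hmax h1
    rw [h.homogeneous w hw _ hn, map_smul, smul_eq_mul, mul_div_mul_left _ _ hn.ne',
      div_le_iff₀ (h.pos w hw)] at h2
    exact h2
  have hw00 := hs0 w₀ hw₀
  have hf0 := h.pos w₀ hw00
  have hmpos : 0 < m := by
    have h1 := hle u
    have h2 := h.pos u hu0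
    by_contra hcon
    nlinarith
  -- This factor makes both `f v = m` and `ξ v = m ^ 2`, the case of equality in `(m - f w)² ≥ 0`.
  have hc : 0 < m / f w₀ := by positivity
  have hv0 : (m / f w₀) • w₀ ≠ 0 := smul_ne_zero hc.ne' hw00
  have hfv : f ((m / f w₀) • w₀) = m := by
    rw [h.homogeneous w₀ hw00 _ hc, div_mul_cancel₀ _ hf0.ne']
  have hξv : ξ ((m / f w₀) • w₀) = m ^ 2 := by
    have h1 : ξ w₀ = m * f w₀ := by rw [hm, div_mul_cancel₀ _ hf0.ne']
    rw [map_smul, h1, smul_eq_mul]; field_simp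
  refine ⟨(m / f w₀) • w₀, hv0, ?_⟩
  have hmin : IsLocalMin (fun w => f w ^ 2 / 2 - ξ w) ((m / f w₀) • w₀) := by
    refine Filter.Eventually.of_forall fun w => ?_
    simp only [hfv, hξv]
    nlinarith [hle w, sq_nonneg (m - f w)]
  have hd := (h.differentiableAt_energy hv0).hasFDerivAt.sub ξ.hasFDerivAt
  exact sub_eq_zero.1 (hmin.hasFDerivAt_eq_zero hd)

end IsMinkowski

end

/-! ### Fibre derivatives and Legendre duality with parameters -/

section

variable {V W : Type*} [NormedAddCommGroup V] [NormedSpace ℝ V] [NormedAddCommGroup W]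
  [NormedSpace ℝ W]

/-- The derivative of `f : V × W → ℝ` in the second variable. -/
def fibDeriv (f : V × W → ℝ) (z : V × W) : W →L[ℝ] ℝ := fderiv ℝ (fun w => f (z.1, w)) z.2

variable {f g : V × W → ℝ} {z : V × W} {R : Set V}

theorem hasFDerivAt_slice {D : V × W →L[ℝ] ℝ} (hf : HasFDerivWithinAt f D (R ×ˢ univ) z)
    (hz : z.1 ∈ R) : HasFDerivAt (fun w => f (z.1, w)) (D.comp (ContinuousLinearMap.inr ℝ V W)) z.2 := by
  rw [← hasFDerivWithinAt_univ]
  have h1 : HasFDerivWithinAt (fun w : W => (z.1, w)) (ContinuousLinearMap.inr ℝ V W) univ z.2 :=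
    (hasFDerivAt_prodMk_right z.1 z.2).hasFDerivWithinAt
  exact HasFDerivWithinAt.comp z.2 (g := f) (t := R ×ˢ univ) hf h1 fun w _ => ⟨hz, mem_univ _⟩

theorem hasFDerivWithinAt_slice {D : V × W →L[ℝ] ℝ} (hf : HasFDerivWithinAt f D (R ×ˢ univ) z) :
    HasFDerivWithinAt (fun y => f (y, z.2)) (D.comp (ContinuousLinearMap.inl ℝ V W)) R z.1 := by
  have h1 : HasFDerivWithinAt (fun y : V => (y, z.2)) (ContinuousLinearMap.inl ℝ V W) R z.1 :=
    (hasFDerivAt_prodMk_left z.1 z.2).hasFDerivWithinAt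
  exact HasFDerivWithinAt.comp z.1 (g := f) (t := R ×ˢ univ) hf h1 fun w hw => ⟨hw, mem_univ _⟩

theorem fibDeriv_eq (hf : DifferentiableAt ℝ f z) :
    fibDeriv f z = (fderiv ℝ f z).comp (ContinuousLinearMap.inr ℝ V W) :=
  (hasFDerivAt_slice (R := univ) hf.hasFDerivAt.hasFDerivWithinAt (mem_univ _)).fderiv

theorem contDiffAt_slice {k : WithTop ℕ∞} (hf : ContDiffWithinAt ℝ k f (R ×ˢ univ) z) (hz : z.1 ∈ R) :
    ContDiffAt ℝ k (fun w => f (z.1, w)) z.2 := by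
  rw [← contDiffWithinAt_univ]
  exact ContDiffWithinAt.comp z.2 (g := f) (t := R ×ˢ univ) hf
    (contDiffWithinAt_const.prodMk contDiffWithinAt_id) fun w _ => ⟨hz, mem_univ _⟩

theorem contDiffAt_fibDeriv {k : ℕ} (hf : ContDiffAt ℝ (k + 1 : ℕ) f z) :
    ContDiffAt ℝ k (fibDeriv f) z := by
  have h1 : ∀ᶠ y in 𝓝 z, DifferentiableAt ℝ f y :=
    (hf.eventually (by simp)).mono fun y hy => hy.differentiableAt (by simp)
  have h2 : ContDiffAt ℝ k (fderiv ℝ f) z := hf.fderiv_right (by norm_cast)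
  have h3 : ContDiffAt ℝ k (fun y => (fderiv ℝ f y).comp (ContinuousLinearMap.inr ℝ V W)) z :=
    h2.clm_comp contDiffAt_const
  exact h3.congr_of_eventuallyEq (h1.mono fun y hy => fibDeriv_eq hy)

theorem tendsto_slice (hz : z.1 ∈ R) : Tendsto (fun w => (z.1, w)) (𝓝 z.2) (𝓝[R ×ˢ univ] z) := by
  refine tendsto_nhdsWithin_iff.2 ⟨?_, Eventually.of_forall fun w => ⟨hz, mem_univ _⟩⟩
  exact (continuous_const.prodMk continuous_id).tendsto' _ _ rfl

theorem fibDeriv_congr (h : ∀ᶠ y in 𝓝[R ×ˢ univ] z, g y = f y) :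
    ∀ᶠ y in 𝓝[R ×ˢ univ] z, fibDeriv g y = fibDeriv f y := by
  filter_upwards [eventually_eventually_nhdsWithin.2 h, self_mem_nhdsWithin] with y hy hyR
  exact Filter.EventuallyEq.fderiv_eq ((tendsto_slice hyR.1).eventually hy)

variable {ℓ : V →L[ℝ] ℝ} {e : V}

theorem prod_halfSpace (hR : R = {y | 0 ≤ ℓ y}) :
    R ×ˢ (univ : Set W) = {y | 0 ≤ (ℓ.comp (ContinuousLinearMap.fst ℝ V W)) y} := by
  ext y; simp [hR]

theorem exists_extension [FiniteDimensional ℝ V] [FiniteDimensional ℝ W]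
    (he : ℓ e = 1) (hR : R = {y | 0 ≤ ℓ y}) (hz : z.1 ∈ R)
    (hf : ContDiffWithinAt ℝ ∞ f (R ×ˢ univ) z) (k : ℕ) :
    ∃ g : V × W → ℝ, ContDiffAt ℝ k g z ∧ ∀ᶠ y in 𝓝[R ×ˢ univ] z, g y = f y := by
  rw [prod_halfSpace hR] at hf ⊢
  refine exists_contDiffAt_eventuallyEq_halfSpace (e := (e, 0)) (by simpa using he) ?_
    (hf.of_le (by exact_mod_cast le_top))
  rw [hR] at hz
  exact hz

/-- An extension of one order more across the boundary has a fibre derivative of class `C^k`. On the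
half-space it agrees with that of `f`, since the fibres over points of `R` are full linear spaces
and the slices see no boundary. -/
theorem contDiffWithinAt_fibDeriv [FiniteDimensional ℝ V] [FiniteDimensional ℝ W]
    (he : ℓ e = 1) (hR : R = {y | 0 ≤ ℓ y}) (hz : z.1 ∈ R)
    (hf : ContDiffWithinAt ℝ ∞ f (R ×ˢ univ) z) :
    ContDiffWithinAt ℝ ∞ (fibDeriv f) (R ×ˢ univ) z := by
  refine contDiffWithinAt_infty.2 fun k => ?_
  obtain ⟨g, hg, hgf⟩ := exists_extension he hR hz hf (k + 1)
  exact (contDiffAt_fibDeriv hg).contDiffWithinAt.congr_of_eventuallyEq_of_mem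
    ((fibDeriv_congr hgf).mono fun y hy => hy.symm) ⟨hz, mem_univ _⟩

theorem exists_local_inverse_equiv [FiniteDimensional ℝ V] (ι : W ≃L[ℝ] V) {f : V → W} {z : V}
    {k : ℕ} (hk : 1 ≤ k) (hf : ContDiffAt ℝ k f z) (hinj : ∀ a, fderiv ℝ f z a = 0 → a = 0) :
    ∃ g : W → V, ContDiffAt ℝ k g (f z) ∧ g (f z) = z ∧ (∀ᶠ w in 𝓝 (f z), f (g w) = w) ∧
      ∀ᶠ y in 𝓝 z, g (f y) = y := by
  have hk' : ((k : ℕ) : WithTop ℕ∞) ≠ 0 := by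
    have : k ≠ 0 := by omega
    exact_mod_cast this
  have hd : fderiv ℝ (fun y => ι (f y)) z = (ι : W →L[ℝ] V).comp (fderiv ℝ f z) :=
    (ι.hasFDerivAt.comp z (hf.differentiableAt hk').hasFDerivAt).fderiv
  obtain ⟨g, hg, hgz, h1, h2⟩ := exists_local_inverse (f := fun y => ι (f y)) hk
    (ι.contDiff.contDiffAt.comp z hf) fun a ha => hinj a (by
      rw [hd] at ha
      exact ι.map_eq_zero_iff.1 ha)
  refine ⟨fun w => g (ι w), hg.comp (f z) ι.contDiff.contDiffAt, hgz, ?_, h2⟩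
  filter_upwards [(ι.continuous.tendsto (f z)).eventually h1] with w hw
  exact ι.injective hw

/-- The Legendre dual of a smooth fibrewise strictly convex function is smooth. -/
theorem contDiffWithinAt_dual [FiniteDimensional ℝ V] (ι : (V →L[ℝ] ℝ) ≃L[ℝ] V)
    (he : ℓ e = 1) (hR : R = {y | 0 ≤ ℓ y}) {f : V × V → ℝ} {z : V × V} (hz : z.1 ∈ R)
    (hf : ContDiffWithinAt ℝ ∞ f (R ×ˢ univ) z)
    (hpos : ∀ w, w ≠ 0 → 0 < fderiv ℝ (fderiv ℝ fun u => f (z.1, u)) z.2 w w)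
    {G : V × (V →L[ℝ] ℝ) → ℝ}
    (hG : ∀ᶠ y in 𝓝[R ×ˢ univ] z, G (y.1, fibDeriv f y) = f y) :
    ContDiffWithinAt ℝ ∞ G (R ×ˢ univ) (z.1, fibDeriv f z) := by
  refine contDiffWithinAt_infty.2 fun k => ?_
  -- One order is lost in taking the fibre derivative; another is kept so that the inverse function
  -- theorem applies even for `k = 0`.
  obtain ⟨g, hg, hgf⟩ := exists_extension he hR hz hf (k + 1 + 1)
  have hzR : z ∈ R ×ˢ (univ : Set V) := ⟨hz, mem_univ _⟩
  have hgf' := fibDeriv_congr hgf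
  have hgz : fibDeriv g z = fibDeriv f z := hgf'.self_of_nhdsWithin hzR
  have hΛ : ContDiffAt ℝ (k + 1 : ℕ) (fun y : V × V => (y.1, fibDeriv g y)) z :=
    contDiffAt_fst.prodMk (contDiffAt_fibDeriv hg)
  have hdg : DifferentiableAt ℝ (fibDeriv g) z :=
    (contDiffAt_fibDeriv hg).differentiableAt (by simp)
  have hess : ∀ b, fderiv ℝ (fibDeriv g) z (0, b) =
      fderiv ℝ (fderiv ℝ fun u => f (z.1, u)) z.2 b := by
    intro b
    have h1 : HasFDerivAt (fun u => fibDeriv g (z.1, u))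
        ((fderiv ℝ (fibDeriv g) z).comp (ContinuousLinearMap.inr ℝ V V)) z.2 :=
      HasFDerivAt.comp z.2 (g := fibDeriv g) hdg.hasFDerivAt (hasFDerivAt_prodMk_right z.1 z.2)
    have h2 : (fun u => fibDeriv g (z.1, u)) =ᶠ[𝓝 z.2] fderiv ℝ fun u => f (z.1, u) :=
      (tendsto_slice hz).eventually hgf'
    rw [← h2.fderiv_eq, h1.fderiv]
    rfl
  -- The Legendre map `(y, w) ↦ (y, fibDeriv g (y, w))` has a block triangular derivative whose
  -- fibre block is the Hessian, so it is injective. The dual function is `g` composed with the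
  -- local inverse `γ`.
  obtain ⟨γ, hγ, hγz, hγr, -⟩ := exists_local_inverse_equiv
    ((ContinuousLinearEquiv.refl ℝ V).prodCongr ι) (by omega) hΛ (by
      intro a ha
      have hd : HasFDerivAt (fun y : V × V => (y.1, fibDeriv g y))
        ((ContinuousLinearMap.fst ℝ V V).prod (fderiv ℝ (fibDeriv g) z)) z :=
        hasFDerivAt_fst.prodMk hdg.hasFDerivAt
      rw [hd.fderiv] at ha
      have h1 : a.1 = 0 := congrArg Prod.fst ha
      have h2 : fderiv ℝ (fibDeriv g) z a = 0 := congrArg Prod.snd ha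
      have h3 : a = (0, a.2) := Prod.ext h1 rfl
      rw [h3, hess] at h2
      by_contra hne
      have h4 : a.2 ≠ 0 := fun h => hne (by rw [h3, h]; rfl)
      have := hpos _ h4
      rw [h2] at this
      exact lt_irrefl _ this)
  simp only [hgz] at hγ hγz hγr
  have hcomp : ContDiffAt ℝ k (fun w => g (γ w)) (z.1, fibDeriv f z) := by
    refine ContDiffAt.comp _ (g := g) ?_ (hγ.of_le (by norm_cast; omega))
    rw [hγz]
    exact hg.of_le (by norm_cast; omega)
  refine hcomp.contDiffWithinAt.congr_of_eventuallyEq_of_mem ?_ ⟨hz, mem_univ _⟩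
  -- The inverse preserves the base point and therefore the half-space, so `g` may be replaced by
  -- `f` after composition.
  have hγt : Tendsto γ (𝓝[R ×ˢ univ] (z.1, fibDeriv f z)) (𝓝[R ×ˢ univ] z) := by
    refine tendsto_nhdsWithin_iff.2 ⟨?_, ?_⟩
    · have := hγ.continuousAt.tendsto
      rw [hγz] at this
      exact this.mono_left nhdsWithin_le_nhds
    · filter_upwards [hγr.filter_mono nhdsWithin_le_nhds, self_mem_nhdsWithin] with w hw hwR
      refine ⟨?_, mem_univ _⟩
      have : (γ w).1 = w.1 := congrArg Prod.fst hw
      rw [this]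
      exact hwR.1
  filter_upwards [hγr.filter_mono nhdsWithin_le_nhds, hγt.eventually hgf, hγt.eventually hgf',
    hγt.eventually hG] with w hw h1 h2 h3
  rw [h2] at hw
  rw [hw] at h3
  rw [h3, h1]

/-- The derivative of a dual function in the base variable. -/
theorem fderivWithin_dual_base (hR : UniqueDiffOn ℝ R) {A : Type*} {F : V × A → ℝ} {G : V × W → ℝ}
    {y₀ : V} {a₀ : A} {m : V → W} {m' : V →L[ℝ] W} {dF : V →L[ℝ] ℝ}
    (hy : y₀ ∈ R) (hG : DifferentiableWithinAt ℝ G (R ×ˢ univ) (y₀, m y₀))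
    (hm : HasFDerivWithinAt m m' R y₀) (hF : HasFDerivWithinAt (fun y => F (y, a₀)) dF R y₀)
    (hGF : ∀ᶠ y in 𝓝[R] y₀, G (y, m y) = F (y, a₀))
    (hE : ∀ a, fibDeriv G (y₀, m y₀) (m' a) = 2 * dF a) :
    HasFDerivWithinAt G (-(dF.comp (ContinuousLinearMap.fst ℝ V W)) +
      (fibDeriv G (y₀, m y₀)).comp (ContinuousLinearMap.snd ℝ V W)) (R ×ˢ univ) (y₀, m y₀) := by
  have hD := hG.hasFDerivWithinAt
  set D := fderivWithin ℝ G (R ×ˢ univ) (y₀, m y₀)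
  have h1 : fibDeriv G (y₀, m y₀) = D.comp (ContinuousLinearMap.inr ℝ V W) :=
    (hasFDerivAt_slice hD hy).fderiv
  have h2 : HasFDerivWithinAt (fun y => G (y, m y)) (D.comp ((ContinuousLinearMap.id ℝ V).prod m'))
      R y₀ :=
    HasFDerivWithinAt.comp y₀ (g := G) (t := R ×ˢ univ) hD
      ((hasFDerivWithinAt_id y₀ R).prodMk hm) fun y hy => ⟨hy, mem_univ _⟩
  have h3 := hasFDerivWithinAt_congr_of_mem h2 (hGF.mono fun y hy => hy.symm) hy
  have h4 := (hR y₀ hy).eq h3 hF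
  -- By the chain rule along `m`, the base derivative of `G` plus the fibre derivative applied to
  -- `m'` equals `dF`. The second term is `2 dF` by `hE`, which stems from homogeneity, so the base
  -- derivative is `-dF`.
  have h5 : ∀ a, D (a, m' a) = dF a := fun a => congrArg (fun B : V →L[ℝ] ℝ => B a) h4
  have hdec : ∀ a w, D (a, w) = D (a, 0) + D (0, w) := fun a w => by
    rw [← map_add]; simp
  have h6 : ∀ w, D (0, w) = fibDeriv G (y₀, m y₀) w := fun w => by rw [h1]; rfl
  refine hD.congr_fderiv ?_
  refine ContinuousLinearMap.ext fun a => ?_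
  obtain ⟨a, w⟩ := a
  have h7 := h5 a
  rw [hdec, h6, hE] at h7
  show D (a, w) = -dF a + fibDeriv G (y₀, m y₀) w
  rw [hdec, h6]
  linarith

end

/-! ### Functions on the bundles, the Legendre transform and the velocity map in charts -/

section

variable {E : Type*} [NormedAddCommGroup E] [NormedSpace ℝ E] {H : Type*} [TopologicalSpace H]
  {I : ModelWithCorners ℝ E H} {N : Type*} [TopologicalSpace N] [ChartedSpace H N]
  [IsManifold I ∞ N]

theorem contMDiffAt_real_iff {G : N → ℝ} {q q₀ : N} (hq : q ∈ (extChartAt I q₀).source) :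
    ContMDiffAt I 𝓘(ℝ, ℝ) ∞ G q ↔ ContinuousAt G q ∧
      ContDiffWithinAt ℝ ∞ (G ∘ (extChartAt I q₀).symm) (range I) (extChartAt I q₀ q) := by
  rw [extChartAt_source] at hq
  exact contMDiffAt_iff_of_mem_source hq (mem_chart_source ℝ (G q))

theorem continuousAt_of_extChartAt {X : Type*} [TopologicalSpace X] {f : X → N} {x : X} {q₀ : N}
    (h1 : ∀ᶠ y in 𝓝 x, f y ∈ (extChartAt I q₀).source)
    (h2 : ContinuousAt (fun y => extChartAt I q₀ (f y)) x) : ContinuousAt f x := by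
  have h3 : ContinuousAt (extChartAt I q₀).symm (extChartAt I q₀ (f x)) :=
    continuousAt_extChartAt_symm' h1.self_of_nhds
  refine (ContinuousAt.comp (x := x) h3 h2).congr (h1.mono fun y hy => ?_)
  exact (extChartAt I q₀).left_inv hy

theorem continuousAt_real_of_chart {G : N → ℝ} {q q₀ : N} (hq : q ∈ (extChartAt I q₀).source)
    (h : ContinuousWithinAt (G ∘ (extChartAt I q₀).symm) (range I) (extChartAt I q₀ q)) :
    ContinuousAt G q := by
  have h1 : Tendsto (extChartAt I q₀) (𝓝 q) (𝓝[range I] (extChartAt I q₀ q)) :=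
    tendsto_nhdsWithin_iff.2 ⟨continuousAt_extChartAt' hq, Eventually.of_forall fun _ => ⟨_, rfl⟩⟩
  have h2 := h.tendsto.comp h1
  have h3 : (G ∘ (extChartAt I q₀).symm) (extChartAt I q₀ q) = G q := by
    rw [Function.comp_apply, (extChartAt I q₀).left_inv hq]
  rw [h3] at h2
  refine h2.congr' ?_
  filter_upwards [(isOpen_extChartAt_source q₀).mem_nhds hq] with y hy
  simp only [Function.comp_apply, (extChartAt I q₀).left_inv hy]

end

section

variable {n : ℕ} [NeZero n] {M : Type*} [TopologicalSpace M]
  [ChartedSpace (EuclideanHalfSpace n) M] [IsManifold (𝓡∂ n) ∞ M]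

/-- The range of the model of `M`, a closed half-space. -/
abbrev halfRange (n : ℕ) [NeZero n] : Set (Vec n) := range (𝓡∂ n)

theorem halfRange_eq : halfRange n = {y | 0 ≤ (EuclideanSpace.proj (𝕜 := ℝ) (0 : Fin n)) y} :=
  range_base

theorem proj_single : (EuclideanSpace.proj (𝕜 := ℝ) (0 : Fin n)) (EuclideanSpace.single 0 1) = 1 := by
  simp

/-- The canonical map from the bidual to `ℝⁿ`. -/
def bidual (n : ℕ) : (Covec n →L[ℝ] ℝ) →L[ℝ] Vec n :=
  ∑ i : Fin n, (ContinuousLinearMap.apply ℝ ℝ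
    (EuclideanSpace.proj i : Covec n)).smulRight (EuclideanSpace.single i (1 : ℝ))

theorem apply_bidual (l : Covec n →L[ℝ] ℝ) (θ : Covec n) : θ (bidual n l) = l θ := by
  have h1 := apply_sharp_fst (l.comp (ContinuousLinearMap.snd ℝ (Vec n) (Covec n))) θ
  have h2 : (sharp n (l.comp (ContinuousLinearMap.snd ℝ (Vec n) (Covec n)))).1 = bidual n l := by
    show (∑ i : Fin n, (ContinuousLinearMap.apply ℝ ℝ
      ((0, EuclideanSpace.proj i) : Vec n × Covec n)).smulRight (EuclideanSpace.single i (1 : ℝ))) _ = _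
    rw [bidual, sum_apply, sum_apply]
    rfl
  rw [h2] at h1
  exact h1

theorem eq_of_forall_covec {v w : Vec n} (h : ∀ θ : Covec n, θ v = θ w) : v = w := by
  ext i; exact h (EuclideanSpace.proj i)

theorem eq_bidual {l : Covec n →L[ℝ] ℝ} {v : Vec n} (h : ∀ θ : Covec n, l θ = θ v) :
    v = bidual n l := eq_of_forall_covec fun θ => by rw [apply_bidual, h]

/-- The vector `∂_ξ G` at a point of `T*M`. -/
def velocity (G : CotB n M → ℝ) (q : CotB n M) : TanB n M :=
  tvec q.proj (bidual n (fderiv ℝ (fun ζ : Covec n => G (cvec q.proj ζ)) (CotB.covec q)))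

/-! ### Functions on the bundles in charts -/

theorem tan_symm_extChartAt {p₀ : TanB n M} {x : M} (hx : x ∈ dom (n := n) p₀.proj) (w : Vec n) :
    (extChartAt (𝓡∂ n).tangent p₀).symm (extChartAt (𝓡∂ n) p₀.proj x, w) =
      tvec x (ofChart p₀.proj x w) := by
  rw [tan_extChartAt_symm p₀ ((extChartAt (𝓡∂ n) p₀.proj).map_source (mem_dom_iff.1 hx)),
    (extChartAt (𝓡∂ n) p₀.proj).left_inv (mem_dom_iff.1 hx)]

theorem cot_symm_extChartAt {q₀ : CotB n M} {x : M} (hx : x ∈ dom (n := n) q₀.proj) (η : Covec n) :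
    (extChartAt (cotModel n) q₀).symm (extChartAt (𝓡∂ n) q₀.proj x, η) =
      cvec x (η.comp (toChart q₀.proj x)) := by
  rw [cot_extChartAt_symm q₀ ((extChartAt (𝓡∂ n) q₀.proj).map_source (mem_dom_iff.1 hx)),
    (extChartAt (𝓡∂ n) q₀.proj).left_inv (mem_dom_iff.1 hx)]

variable {F : TanB n M → ℝ} {G : CotB n M → ℝ}

/-- The Lagrangian `½F²`. -/
abbrev energy (F : TanB n M → ℝ) (p : TanB n M) : ℝ := F p ^ 2 / 2

theorem contMDiffAt_energy {p : TanB n M} (hF : ContMDiffAt (𝓡∂ n).tangent 𝓘(ℝ, ℝ) ∞ F p) :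
    ContMDiffAt (𝓡∂ n).tangent 𝓘(ℝ, ℝ) ∞ (energy F) p := by
  have h : ContDiff ℝ ∞ fun t : ℝ => t ^ 2 / 2 := (contDiff_id.pow 2).div_const 2
  exact h.contMDiff.contMDiffAt.comp p hF

theorem contDiffWithinAt_tan {L : TanB n M → ℝ} {p p₀ : TanB n M}
    (hL : ContMDiffAt (𝓡∂ n).tangent 𝓘(ℝ, ℝ) ∞ L p) (hp : p.proj ∈ dom (n := n) p₀.proj) :
    ContDiffWithinAt ℝ ∞ (L ∘ (extChartAt (𝓡∂ n).tangent p₀).symm) (halfRange n ×ˢ univ)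
      (extChartAt (𝓡∂ n).tangent p₀ p) := by
  rw [← range_tanModel]
  exact ((contMDiffAt_real_iff ((tan_mem_source _ _).2 hp)).1 hL).2

theorem contDiffWithinAt_cot {q q₀ : CotB n M}
    (hG : ContMDiffAt (cotModel n) 𝓘(ℝ, ℝ) ∞ G q) (hq : q.proj ∈ dom (n := n) q₀.proj) :
    ContDiffWithinAt ℝ ∞ (G ∘ (extChartAt (cotModel n) q₀).symm) (halfRange n ×ˢ univ)
      (extChartAt (cotModel n) q₀ q) := by
  rw [← range_cotModel]
  exact ((contMDiffAt_real_iff ((cot_mem_source _ _).2 hq)).1 hG).2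

theorem tan_extChartAt_self (p : TanB n M) :
    extChartAt (𝓡∂ n).tangent p p = (extChartAt (𝓡∂ n) p.proj p.proj, TanB.vec p) := by
  rw [tan_extChartAt]
  exact Prod.ext rfl (toChart_self _)

theorem contDiffAt_fibre_tan {L : TanB n M → ℝ} {p : TanB n M}
    (hL : ContMDiffAt (𝓡∂ n).tangent 𝓘(ℝ, ℝ) ∞ L p) :
    ContDiffAt ℝ ∞ (fun w => L (tvec p.proj w)) (TanB.vec p) := by
  have h1 := contDiffWithinAt_tan hL (mem_chart_source _ p.proj)
  rw [tan_extChartAt_self] at h1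
  have h2 := contDiffAt_slice h1 (extChartAt_mem_range _ _)
  refine h2.congr_of_eventuallyEq (Eventually.of_forall fun w => ?_)
  simp only [Function.comp_apply]
  rw [tan_symm_extChartAt (mem_chart_source _ p.proj), ofChart_self]

theorem toChart_self_eq_id {x : M} : toChart x x = ContinuousLinearMap.id ℝ (Vec n) := by
  ext1 w; exact toChart_self w

theorem contDiffAt_fibre_cot {q : CotB n M} (hG : ContMDiffAt (cotModel n) 𝓘(ℝ, ℝ) ∞ G q) :
    ContDiffAt ℝ ∞ (fun ζ => G (cvec q.proj ζ)) (CotB.covec q) := by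
  have h1 := contDiffWithinAt_cot hG (mem_chart_source _ q.proj)
  rw [cot_extChartAt_self] at h1
  have h2 := contDiffAt_slice h1 (extChartAt_mem_range _ _)
  refine h2.congr_of_eventuallyEq (Eventually.of_forall fun w => ?_)
  simp only [Function.comp_apply]
  rw [cot_symm_extChartAt (mem_chart_source _ q.proj), toChart_self_eq_id,
    ContinuousLinearMap.comp_id]

/-- The fibre derivative of a Lagrangian in a chart. -/
theorem fibDeriv_tan {L : TanB n M → ℝ} {p p₀ : TanB n M} (hp : p.proj ∈ dom (n := n) p₀.proj)
    (hL : DifferentiableAt ℝ (fun w => L (tvec p.proj w)) (TanB.vec p)) :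
    fibDeriv (L ∘ (extChartAt (𝓡∂ n).tangent p₀).symm) (extChartAt (𝓡∂ n).tangent p₀ p) =
      (fderiv ℝ (fun w => L (tvec p.proj w)) (TanB.vec p)).comp (ofChart p₀.proj p.proj) := by
  rw [tan_extChartAt, fibDeriv]
  simp only [Function.comp_apply, tan_symm_extChartAt hp]
  refine HasFDerivAt.fderiv ?_
  refine HasFDerivAt.comp (toChart p₀.proj p.proj (TanB.vec p))
    (g := fun w => L (tvec p.proj w)) ?_ (ofChart p₀.proj p.proj).hasFDerivAt
  rw [ofChart_toChart hp]
  exact hL.hasFDerivAt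

theorem fibDeriv_cot {q q₀ : CotB n M} (hq : q.proj ∈ dom (n := n) q₀.proj)
    (hG : DifferentiableAt ℝ (fun ζ => G (cvec q.proj ζ)) (CotB.covec q)) (θ : Covec n) :
    fibDeriv (G ∘ (extChartAt (cotModel n) q₀).symm) (extChartAt (cotModel n) q₀ q) θ =
      fderiv ℝ (fun ζ => G (cvec q.proj ζ)) (CotB.covec q) (θ.comp (toChart q₀.proj q.proj)) := by
  rw [cot_extChartAt _ _ hq, fibDeriv]
  simp only [Function.comp_apply, cot_symm_extChartAt hq]
  set Λ : Covec n →L[ℝ] Covec n :=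
    (ContinuousLinearMap.compL ℝ (Vec n) (Vec n) ℝ).flip (toChart q₀.proj q.proj)
  have h1 : HasFDerivAt (fun η : Covec n => G (cvec q.proj (Λ η)))
      ((fderiv ℝ (fun ζ => G (cvec q.proj ζ)) (CotB.covec q)).comp Λ)
      ((CotB.covec q).comp (ofChart q₀.proj q.proj)) := by
    refine HasFDerivAt.comp ((CotB.covec q).comp (ofChart q₀.proj q.proj))
      (g := fun ζ => G (cvec q.proj ζ)) ?_ Λ.hasFDerivAt
    have h2 : Λ ((CotB.covec q).comp (ofChart q₀.proj q.proj)) = CotB.covec q := by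
      ext1 w
      exact congrArg (CotB.covec q) (ofChart_toChart hq w)
    rw [h2]
    exact hG.hasFDerivAt
  exact congrArg (fun A : Covec n →L[ℝ] ℝ => A θ) h1.fderiv

theorem extChartAt_legendre {p p₀ : TanB n M} {q₀ : CotB n M} (hpq : q₀.proj = p₀.proj)
    (hp : p.proj ∈ dom (n := n) p₀.proj) (hL : DifferentiableAt ℝ (halfSq F p.proj) (TanB.vec p)) :
    extChartAt (cotModel n) q₀ (legendre F p) = ((extChartAt (𝓡∂ n).tangent p₀ p).1,
      fibDeriv (energy F ∘ (extChartAt (𝓡∂ n).tangent p₀).symm)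
        (extChartAt (𝓡∂ n).tangent p₀ p)) := by
  rw [fibDeriv_tan hp hL, tan_extChartAt, cot_extChartAt q₀ (legendre F p) (by rw [hpq]; exact hp),
    hpq]
  rfl

theorem extChartAt_velocity {q q₀ : CotB n M} {p₀ : TanB n M} (hpq : p₀.proj = q₀.proj)
    (hq : q.proj ∈ dom (n := n) q₀.proj)
    (hG : DifferentiableAt ℝ (fun ζ => G (cvec q.proj ζ)) (CotB.covec q)) :
    extChartAt (𝓡∂ n).tangent p₀ (velocity G q) = ((extChartAt (cotModel n) q₀ q).1,
      bidual n (fibDeriv (G ∘ (extChartAt (cotModel n) q₀).symm) (extChartAt (cotModel n) q₀ q))) := by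
  rw [tan_extChartAt, cot_extChartAt _ _ hq, hpq, ← cot_extChartAt _ _ hq]
  refine Prod.ext rfl (eq_bidual fun θ => ?_)
  rw [fibDeriv_cot hq hG]
  exact (apply_bidual _ (θ.comp (toChart q₀.proj q.proj))).symm

theorem eventually_proj_tan {p : TanB n M} {S : Set M} (hS : S ∈ 𝓝 p.proj) :
    ∀ᶠ p' : TanB n M in 𝓝 p, p'.proj ∈ S :=
  (FiberBundle.continuous_proj (Vec n) (TangentSpace (𝓡∂ n) : M → Type _)).continuousAt hS

theorem tendsto_extChartAt_tan (p : TanB n M) : Tendsto (extChartAt (𝓡∂ n).tangent p) (𝓝 p)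
    (𝓝[halfRange n ×ˢ univ] (extChartAt (𝓡∂ n).tangent p p)) := by
  rw [← range_tanModel]
  exact tendsto_nhdsWithin_iff.2 ⟨continuousAt_extChartAt p, Eventually.of_forall fun _ => ⟨_, rfl⟩⟩

theorem tendsto_extChartAt_cot (q : CotB n M) : Tendsto (extChartAt (cotModel n) q) (𝓝 q)
    (𝓝[halfRange n ×ˢ univ] (extChartAt (cotModel n) q q)) := by
  rw [← range_cotModel]
  exact tendsto_nhdsWithin_iff.2 ⟨continuousAt_extChartAt q, Eventually.of_forall fun _ => ⟨_, rfl⟩⟩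

theorem continuousAt_legendre {p : TanB n M}
    (hF : ∀ᶠ p' in 𝓝 p, ContMDiffAt (𝓡∂ n).tangent 𝓘(ℝ, ℝ) ∞ F p') :
    ContinuousAt (legendre F) p := by
  have h0 := eventually_proj_tan (dom_mem_nhds (mem_chart_source (EuclideanHalfSpace n) p.proj))
  refine continuousAt_of_extChartAt (I := cotModel n) (q₀ := legendre F p)
    (h0.mono fun p' hp' => (cot_mem_source _ _).2 hp') ?_
  have hL := contMDiffAt_energy hF.self_of_nhds
  have h1 := contDiffWithinAt_fibDeriv proj_single halfRange_eq (extChartAt_mem_range _ _)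
    (contDiffWithinAt_tan (p₀ := p) hL (mem_chart_source _ _))
  have h2 := h1.continuousWithinAt.tendsto.comp (tendsto_extChartAt_tan p)
  have h3 : ContinuousAt (fun p' => ((extChartAt (𝓡∂ n).tangent p p').1,
      fibDeriv (energy F ∘ (extChartAt (𝓡∂ n).tangent p).symm)
        (extChartAt (𝓡∂ n).tangent p p'))) p :=
    (continuousAt_fst.comp (continuousAt_extChartAt (I := (𝓡∂ n).tangent) p)).prodMk h2
  refine h3.congr ?_
  filter_upwards [h0, hF] with p' hp' hF'
  exact (extChartAt_legendre rfl hp'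
    ((contDiffAt_fibre_tan (contMDiffAt_energy hF')).differentiableAt (by simp))).symm

theorem continuousAt_velocity {q : CotB n M}
    (hG : ∀ᶠ q' in 𝓝 q, ContMDiffAt (cotModel n) 𝓘(ℝ, ℝ) ∞ G q') :
    ContinuousAt (velocity G) q := by
  have h0 := eventually_proj (dom_mem_nhds (mem_chart_source (EuclideanHalfSpace n) q.proj))
  refine continuousAt_of_extChartAt (I := (𝓡∂ n).tangent) (q₀ := velocity G q)
    (h0.mono fun p' hp' => (tan_mem_source _ _).2 hp') ?_
  have h1 := contDiffWithinAt_fibDeriv proj_single halfRange_eq (extChartAt_mem_range _ _)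
    (contDiffWithinAt_cot (q₀ := q) hG.self_of_nhds (mem_chart_source _ _))
  have h2 := h1.continuousWithinAt.tendsto.comp (tendsto_extChartAt_cot q)
  have h3 : ContinuousAt (fun q' => ((extChartAt (cotModel n) q q').1,
      bidual n (fibDeriv (G ∘ (extChartAt (cotModel n) q).symm)
        (extChartAt (cotModel n) q q')))) q :=
    (continuousAt_fst.comp (continuousAt_extChartAt (I := cotModel n) q)).prodMk
      ((bidual n).continuous.continuousAt.comp h2)
  refine h3.congr ?_
  filter_upwards [h0, hG] with q' hq' hG'
  exact (extChartAt_velocity rfl hq' ((contDiffAt_fibre_cot hG').differentiableAt (by simp))).symm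

end

/-! ### The Euler–Lagrange equations are Hamilton's equations -/

section

variable {n : ℕ} [NeZero n] {M : Type*} [TopologicalSpace M]
  [ChartedSpace (EuclideanHalfSpace n) M] [IsManifold (𝓡∂ n) ∞ M]
  {F : TanB n M → ℝ} {G : CotB n M → ℝ}

/-- The derivative `∂_x (½F²)` in the preferred chart at `p`. -/
def baseDeriv (F : TanB n M → ℝ) (p : TanB n M) : Covec n :=
  fderivWithin ℝ (fun y => energy F ((extChartAt (𝓡∂ n).tangent p).symm (y, TanB.vec p)))
    (halfRange n) (extChartAt (𝓡∂ n) p.proj p.proj)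

/-- The Hamiltonian `G` and the Lagrangian `½F²` are dual to first order at `p`. -/
def IsDualAt (F : TanB n M → ℝ) (G : CotB n M → ℝ) (p : TanB n M) : Prop :=
  ∀ a θ, cotDeriv G (legendre F p) (a, θ) = θ (TanB.vec p) - baseDeriv F p a

theorem IsDualAt.hamField_eq {p : TanB n M} (h : IsDualAt F G p) :
    (hamField G (legendre F p) : Vec n × Covec n) = (TanB.vec p, baseDeriv F p) := by
  refine (eq_sharp fun b => ?_).symm
  rw [sympForm_apply, ← Prod.mk.eta (p := b), h]

theorem differentiableAt_halfSq {p : TanB n M} (hF : ContMDiffAt (𝓡∂ n).tangent 𝓘(ℝ, ℝ) ∞ F p) :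
    DifferentiableAt ℝ (halfSq F p.proj) (TanB.vec p) :=
  (contDiffAt_fibre_tan (contMDiffAt_energy hF)).differentiableAt (by simp)

/-- The Euler–Lagrange equations at one time are Hamilton's equations for the dual Hamiltonian. -/
theorem hasMFDerivWithinAt_legendre_iff {c : ℝ → TanB n M} {S : Set ℝ} {t : ℝ} (ht : t ∈ S)
    (hc : ContinuousWithinAt c S t)
    (hF : ∀ᶠ p in 𝓝 (c t), ContMDiffAt (𝓡∂ n).tangent 𝓘(ℝ, ℝ) ∞ F p) (hd : IsDualAt F G (c t)) :
    (HasMFDerivWithinAt 𝓘(ℝ, ℝ) (cotModel n) (fun t => legendre F (c t)) S t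
      ((1 : ℝ →L[ℝ] ℝ).smulRight (hamField G (legendre F (c t))))) ↔
    (HasDerivWithinAt (fun s => (extChartAt (𝓡∂ n).tangent (c t) (c s)).1) (TanB.vec (c t)) S t ∧
    HasDerivWithinAt (fun s => fibDeriv (energy F ∘ (extChartAt (𝓡∂ n).tangent (c t)).symm)
      (extChartAt (𝓡∂ n).tangent (c t) (c s))) (baseDeriv F (c t)) S t) := by
  rw [hasMFDerivWithinAt_curve_iff]
  have h1 : ContinuousWithinAt (fun t => legendre F (c t)) S t :=
    ContinuousAt.comp_continuousWithinAt (g := legendre F) (continuousAt_legendre hF) hc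
  have h2 : ∀ᶠ s in 𝓝[S] t, (c s).proj ∈ dom (n := n) (c t).proj ∧
      ContMDiffAt (𝓡∂ n).tangent 𝓘(ℝ, ℝ) ∞ F (c s) :=
    hc.eventually ((eventually_proj_tan (dom_mem_nhds (mem_chart_source _ _))).and hF)
  have h3 : ∀ᶠ s in 𝓝[S] t,
      extChartAt (cotModel n) (legendre F (c t)) (legendre F (c s)) =
      ((extChartAt (𝓡∂ n).tangent (c t) (c s)).1,
      fibDeriv (energy F ∘ (extChartAt (𝓡∂ n).tangent (c t)).symm)
        (extChartAt (𝓡∂ n).tangent (c t) (c s))) :=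
    h2.mono fun s hs => extChartAt_legendre rfl hs.1 (differentiableAt_halfSq hs.2)
  have h4 : (HasDerivWithinAt (fun s => extChartAt (cotModel n) (legendre F (c t))
      (legendre F (c s))) (hamField G (legendre F (c t))) S t) ↔
      HasDerivWithinAt (fun s => ((extChartAt (𝓡∂ n).tangent (c t) (c s)).1,
        fibDeriv (energy F ∘ (extChartAt (𝓡∂ n).tangent (c t)).symm)
        (extChartAt (𝓡∂ n).tangent (c t) (c s)))) (TanB.vec (c t), baseDeriv F (c t)) S t := by
    rw [← hd.hamField_eq]
    exact ⟨fun h => h.congr_of_eventuallyEq (h3.mono fun s hs => hs.symm)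
      (h3.self_of_nhdsWithin ht).symm,
      fun h => h.congr_of_eventuallyEq h3 (h3.self_of_nhdsWithin ht)⟩
  refine ⟨fun h => ?_, fun h => ⟨h1, h4.2 (h.1.prodMk h.2)⟩⟩
  have h5 := h4.1 h.2
  exact ⟨clm_comp_hasDerivWithinAt (ContinuousLinearMap.fst ℝ (Vec n) (Covec n)) h5,
    clm_comp_hasDerivWithinAt (ContinuousLinearMap.snd ℝ (Vec n) (Covec n)) h5⟩

theorem solvesEulerLagrange_iff {c : ℝ → TanB n M} {T : ℝ} :
    SolvesEulerLagrange (energy F) c T ↔ ContinuousOn c (Icc 0 T) ∧ ∀ t ∈ Icc 0 T,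
    (HasDerivWithinAt (fun s => (extChartAt (𝓡∂ n).tangent (c t) (c s)).1) (TanB.vec (c t))
      (Icc 0 T) t ∧
    HasDerivWithinAt (fun s => fibDeriv (energy F ∘ (extChartAt (𝓡∂ n).tangent (c t)).symm)
      (extChartAt (𝓡∂ n).tangent (c t) (c s))) (baseDeriv F (c t)) (Icc 0 T) t) := by
  have hself : ∀ t, extChartAt (𝓡∂ n).tangent (c t) (c t) =
    (extChartAt (𝓡∂ n) (c t).proj (c t).proj, TanB.vec (c t)) := fun t => tan_extChartAt_self _
  refine and_congr_right fun _ => forall₂_congr fun t ht => ?_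
  simp only [hself]
  exact Iff.rfl

/-- The Euler–Lagrange equations are Hamilton's equations for the dual Hamiltonian. -/
theorem solvesEulerLagrange_iff_isMIntegralCurveOn {c : ℝ → TanB n M} {T : ℝ}
    (hc : ContinuousOn c (Icc 0 T))
    (hF : ∀ t ∈ Icc 0 T, ∀ᶠ p in 𝓝 (c t), ContMDiffAt (𝓡∂ n).tangent 𝓘(ℝ, ℝ) ∞ F p)
    (hd : ∀ t ∈ Icc 0 T, IsDualAt F G (c t)) :
    SolvesEulerLagrange (energy F) c T ↔
      IsMIntegralCurveOn (fun t => legendre F (c t)) (hamField G) (Icc 0 T) := by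
  rw [solvesEulerLagrange_iff]
  exact ⟨fun h t ht => (hasMFDerivWithinAt_legendre_iff ht (hc t ht) (hF t ht) (hd t ht)).2 (h.2 t ht),
    fun h => ⟨hc, fun t ht =>
      (hasMFDerivWithinAt_legendre_iff ht (hc t ht) (hF t ht) (hd t ht)).1 (h t ht)⟩⟩

theorem cotDeriv_eq_of_hasFDerivWithinAt {q : CotB n M} {D : (Vec n × Covec n) →L[ℝ] ℝ}
    (h : HasFDerivWithinAt (G ∘ (extChartAt (cotModel n) q).symm) D (halfRange n ×ˢ univ)
      (extChartAt (cotModel n) q q)) : cotDeriv G q = D :=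
  cotDeriv_eq (by rw [range_cotModel]; exact h)

theorem tendsto_tan_symm (p : TanB n M) :
    Tendsto (fun y => (extChartAt (𝓡∂ n).tangent p).symm (y, TanB.vec p))
      (𝓝[halfRange n] (extChartAt (𝓡∂ n) p.proj p.proj)) (𝓝 p) := by
  have h1 : Tendsto (fun y => (y, TanB.vec p)) (𝓝[halfRange n] (extChartAt (𝓡∂ n) p.proj p.proj))
      (𝓝 (extChartAt (𝓡∂ n).tangent p p)) := by
    rw [tan_extChartAt_self]
    exact ((continuous_id.prodMk continuous_const).tendsto' _ _ rfl).mono_left nhdsWithin_le_nhds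
  have h2 := (continuousAt_extChartAt_symm (I := (𝓡∂ n).tangent) p).tendsto.comp h1
  rwa [extChartAt_to_inv] at h2

theorem tendsto_cot_symm (q : CotB n M) :
    Tendsto (fun y => (extChartAt (cotModel n) q).symm (y, CotB.covec q))
      (𝓝[halfRange n] (extChartAt (𝓡∂ n) q.proj q.proj)) (𝓝 q) := by
  have h1 : Tendsto (fun y => (y, CotB.covec q)) (𝓝[halfRange n] (extChartAt (𝓡∂ n) q.proj q.proj))
      (𝓝 (extChartAt (cotModel n) q q)) := by
    rw [cot_extChartAt_self]
    exact ((continuous_id.prodMk continuous_const).tendsto' _ _ rfl).mono_left nhdsWithin_le_nhds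
  have h2 := (continuousAt_extChartAt_symm (I := cotModel n) q).tendsto.comp h1
  rwa [extChartAt_to_inv] at h2

theorem base_mem_target (x : M) : ∀ᶠ y in 𝓝[halfRange n] (extChartAt (𝓡∂ n) x x),
    y ∈ (extChartAt (𝓡∂ n) x).target :=
  eventually_mem_set.2 (extChartAt_target_mem_nhdsWithin x)

theorem extChartAt_tan_symm {p : TanB n M} {y w : Vec n} (hy : y ∈ (extChartAt (𝓡∂ n) p.proj).target) :
    extChartAt (𝓡∂ n).tangent p ((extChartAt (𝓡∂ n).tangent p).symm (y, w)) = (y, w) :=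
  (extChartAt (𝓡∂ n).tangent p).right_inv ((tan_mem_target p w).2 hy)

theorem extChartAt_cot_symm {q : CotB n M} {y : Vec n} {η : Covec n}
    (hy : y ∈ (extChartAt (𝓡∂ n) q.proj).target) :
    extChartAt (cotModel n) q ((extChartAt (cotModel n) q).symm (y, η)) = (y, η) :=
  (extChartAt (cotModel n) q).right_inv ((cot_mem_target q η).2 hy)

theorem fibDeriv_tan_self {L : TanB n M → ℝ} {p : TanB n M}
    (hL : DifferentiableAt ℝ (fun w => L (tvec p.proj w)) (TanB.vec p)) :
    fibDeriv (L ∘ (extChartAt (𝓡∂ n).tangent p).symm) (extChartAt (𝓡∂ n).tangent p p) =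
      fderiv ℝ (fun w => L (tvec p.proj w)) (TanB.vec p) := by
  rw [fibDeriv_tan (mem_chart_source _ _) hL, ofChart_self_eq_id, ContinuousLinearMap.comp_id]

theorem fibDeriv_cot_self {q : CotB n M}
    (hG : DifferentiableAt ℝ (fun ζ => G (cvec q.proj ζ)) (CotB.covec q)) :
    fibDeriv (G ∘ (extChartAt (cotModel n) q).symm) (extChartAt (cotModel n) q q) =
      fderiv ℝ (fun ζ => G (cvec q.proj ζ)) (CotB.covec q) := by
  ext1 θ
  rw [fibDeriv_cot (mem_chart_source _ _) hG, toChart_self_eq_id, ContinuousLinearMap.comp_id]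

/-- Euler's identity for the Lagrangian in a chart. -/
theorem fibDeriv_tan_euler {p p' : TanB n M} (hp : p'.proj ∈ dom (n := n) p.proj)
    (hF : DifferentiableAt ℝ (halfSq F p'.proj) (TanB.vec p'))
    (hE : fderiv ℝ (halfSq F p'.proj) (TanB.vec p') (TanB.vec p') = F p' ^ 2) :
    fibDeriv (energy F ∘ (extChartAt (𝓡∂ n).tangent p).symm) (extChartAt (𝓡∂ n).tangent p p')
      (extChartAt (𝓡∂ n).tangent p p').2 = 2 * energy F p' := by
  rw [fibDeriv_tan hp hF, tan_extChartAt]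
  show fderiv ℝ (halfSq F p'.proj) (TanB.vec p') (ofChart p.proj p'.proj
    (toChart p.proj p'.proj (TanB.vec p'))) = _
  rw [ofChart_toChart hp, hE, energy]
  ring

theorem fibDeriv_cot_euler {q q' : CotB n M} (hq : q'.proj ∈ dom (n := n) q.proj)
    (hG : DifferentiableAt ℝ (fun ζ => G (cvec q'.proj ζ)) (CotB.covec q'))
    (hE : fderiv ℝ (fun ζ => G (cvec q'.proj ζ)) (CotB.covec q') (CotB.covec q') = 2 * G q') :
    fibDeriv (G ∘ (extChartAt (cotModel n) q).symm) (extChartAt (cotModel n) q q')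
      (extChartAt (cotModel n) q q').2 = 2 * G q' := by
  rw [fibDeriv_cot hq hG, cot_extChartAt _ _ hq, ← hE]
  congr 1
  ext1 w
  exact congrArg (CotB.covec q') (ofChart_toChart hq w)

/-- Freeze the vector `v` and let `m y` be the fibre derivative of `½F²` at `(y, v)` in a chart.
Duality gives `G (y, m y) = ½F² (y, v)`, and Euler's identity gives `m y v = F² (y, v)`. Together
with `∂_ξ G = v` this is the input of `fderivWithin_dual_base`, which yields `∂_x G = -∂_x (½F²)`.
-/
theorem isDualAt_of_eventually {p : TanB n M}
    (hF : ∀ᶠ p' in 𝓝 p, ContMDiffAt (𝓡∂ n).tangent 𝓘(ℝ, ℝ) ∞ F p')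
    (hE : ∀ᶠ p' in 𝓝 p, fderiv ℝ (halfSq F p'.proj) (TanB.vec p') (TanB.vec p') = F p' ^ 2)
    (hG : ContMDiffAt (cotModel n) 𝓘(ℝ, ℝ) ∞ G (legendre F p))
    (hGF : ∀ᶠ p' in 𝓝 p, G (legendre F p') = energy F p')
    (hv : ∀ θ, fderiv ℝ (fun ζ => G (cvec p.proj ζ)) (CotB.covec (legendre F p)) θ =
      θ (TanB.vec p)) : IsDualAt F G p := by
  set q := legendre F p
  set y₀ := extChartAt (𝓡∂ n) p.proj p.proj
  set f := energy F ∘ (extChartAt (𝓡∂ n).tangent p).symm with hf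
  set Ĝ := G ∘ (extChartAt (cotModel n) q).symm with hĜ
  set m : Vec n → Covec n := fun y => fibDeriv f (y, TanB.vec p) with hm
  have hy₀ : y₀ ∈ halfRange n := extChartAt_mem_range _ _
  have hpself : extChartAt (𝓡∂ n).tangent p p = (y₀, TanB.vec p) := tan_extChartAt_self p
  have hLd := differentiableAt_halfSq hF.self_of_nhds
  have hm0 : m y₀ = CotB.covec q := by
    rw [hm]; simp only; rw [← hpself]; exact fibDeriv_tan_self hLd
  have hqself : extChartAt (cotModel n) q q = (y₀, m y₀) := by
    rw [hm0]; exact cot_extChartAt_self q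
  have hfs : ContDiffWithinAt ℝ ∞ f (halfRange n ×ˢ univ) (y₀, TanB.vec p) := by
    rw [← hpself]
    exact contDiffWithinAt_tan (contMDiffAt_energy hF.self_of_nhds) (mem_chart_source _ _)
  have hGs : ContDiffWithinAt ℝ ∞ Ĝ (halfRange n ×ˢ univ) (y₀, m y₀) := by
    rw [← hqself]
    exact contDiffWithinAt_cot hG (mem_chart_source _ _)
  have hms : DifferentiableWithinAt ℝ m (halfRange n) y₀ := by
    have h1 := contDiffWithinAt_fibDeriv proj_single halfRange_eq hy₀ hfs
    exact (ContDiffWithinAt.comp y₀ (g := fibDeriv f) (t := halfRange n ×ˢ univ) h1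
      (contDiffWithinAt_id.prodMk contDiffWithinAt_const)
      fun y hy => ⟨hy, mem_univ _⟩).differentiableWithinAt (by simp)
  have hev : ∀ᶠ y in 𝓝[halfRange n] y₀, ∃ p' : TanB n M, p'.proj ∈ dom (n := n) p.proj ∧
      DifferentiableAt ℝ (halfSq F p'.proj) (TanB.vec p') ∧
      fderiv ℝ (halfSq F p'.proj) (TanB.vec p') (TanB.vec p') = F p' ^ 2 ∧
      G (legendre F p') = energy F p' ∧ (extChartAt (𝓡∂ n).tangent p).symm (y, TanB.vec p) = p' ∧
      extChartAt (𝓡∂ n).tangent p p' = (y, TanB.vec p) := by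
    filter_upwards [(tendsto_tan_symm p).eventually ((eventually_proj_tan (dom_mem_nhds
      (mem_chart_source (EuclideanHalfSpace n) p.proj))).and (hF.and (hE.and hGF))), base_mem_target p.proj] with y hy hyt
    exact ⟨_, hy.1, differentiableAt_halfSq hy.2.1, hy.2.2.1, hy.2.2.2, rfl, extChartAt_tan_symm hyt⟩
  have hGF' : ∀ᶠ y in 𝓝[halfRange n] y₀, Ĝ (y, m y) = f (y, TanB.vec p) := by
    filter_upwards [hev] with y ⟨p', h1, h2, h3, h4, h5, h6⟩
    have h7 := extChartAt_legendre (F := F) (p₀ := p) (q₀ := q) rfl h1 h2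
    rw [h6] at h7
    simp only [hĜ, hf, Function.comp_apply, h5]
    rw [hm, ← h4]
    simp only [hf]
    have h8 : legendre F p' ∈ (extChartAt (cotModel n) q).source :=
      (cot_mem_source q (legendre F p')).2 h1
    rw [← h7, (extChartAt (cotModel n) q).left_inv h8]
  have hmE : ∀ᶠ y in 𝓝[halfRange n] y₀, m y (TanB.vec p) = 2 * f (y, TanB.vec p) := by
    filter_upwards [hev] with y ⟨p', h1, h2, h3, h4, h5, h6⟩
    have h7 := fibDeriv_tan_euler h1 h2 h3
    rw [h6] at h7
    rw [hm]
    simp only [hf, Function.comp_apply, h5]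
    exact h7
  have hdF : HasFDerivWithinAt (fun y => f (y, TanB.vec p)) (baseDeriv F p) (halfRange n) y₀ :=
    ((hasFDerivWithinAt_slice (hfs.differentiableWithinAt
      (by simp)).hasFDerivWithinAt).differentiableWithinAt).hasFDerivWithinAt
  have hfG : ∀ θ, fibDeriv Ĝ (y₀, m y₀) θ = θ (TanB.vec p) := by
    intro θ
    rw [← hqself, fibDeriv_cot_self ((contDiffAt_fibre_cot hG).differentiableAt (by simp))]
    exact hv θ
  have hmd := hms.hasFDerivWithinAt
  have hE' : ∀ a, fibDeriv Ĝ (y₀, m y₀) (fderivWithin ℝ m (halfRange n) y₀ a) =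
      2 * baseDeriv F p a := by
    intro a
    rw [hfG]
    have h1 : HasFDerivWithinAt (fun y => m y (TanB.vec p))
        ((ContinuousLinearMap.apply ℝ ℝ (TanB.vec p)).comp (fderivWithin ℝ m (halfRange n) y₀))
        (halfRange n) y₀ :=
      (ContinuousLinearMap.apply ℝ ℝ (TanB.vec p)).hasFDerivAt.comp_hasFDerivWithinAt y₀ hmd
    have h2 := hasFDerivWithinAt_congr_of_mem h1 (hmE.mono fun y hy => hy.symm) hy₀
    have h3 := (uniqueDiffOn_base y₀ hy₀).eq h2 (hdF.const_mul 2)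
    exact congrArg (fun A : Covec n => A a) h3
  have hfin := fderivWithin_dual_base uniqueDiffOn_base hy₀ (hGs.differentiableWithinAt (by simp))
    hmd hdF hGF' hE'
  rw [← hqself] at hfin
  intro a θ
  rw [cotDeriv_eq_of_hasFDerivWithinAt hfin, hqself]
  show -(baseDeriv F p a) + fibDeriv Ĝ (y₀, m y₀) θ = _
  rw [hfG]
  ring

end

/-! ### The Hamiltonian of a Finsler metric -/

section

theorem fderiv_eq_of_isLocalMin_sub {W : Type*} [NormedAddCommGroup W] [NormedSpace ℝ W] {g : W → ℝ}
    {l : W →L[ℝ] ℝ} {z : W} (hd : DifferentiableAt ℝ g z)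
    (hmin : IsLocalMin (fun w => g w - l w) z) : fderiv ℝ g z = l :=
  sub_eq_zero.1 (hmin.hasFDerivAt_eq_zero (hd.hasFDerivAt.sub l.hasFDerivAt))

/-- The Hessians of dual functions are inverse to each other. -/
theorem hessian_dual {V : Type*} [NormedAddCommGroup V] [NormedSpace ℝ V] {W : Type*}
    [NormedAddCommGroup W] [NormedSpace ℝ W] {Z : Type*} [NormedAddCommGroup Z] [NormedSpace ℝ Z]
    {m : V → W} {g : W → Z} (B : Z →L[ℝ] V) {v : V} (hm : DifferentiableAt ℝ m v)
    (hg : DifferentiableAt ℝ g (m v)) (h : ∀ᶠ w in 𝓝 v, B (g (m w)) = w) (w : V) :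
    B (fderiv ℝ g (m v) (fderiv ℝ m v w)) = w := by
  have h1 : HasFDerivAt (fun w => B (g (m w))) (B.comp ((fderiv ℝ g (m v)).comp (fderiv ℝ m v))) v :=
    B.hasFDerivAt.comp v (hg.hasFDerivAt.comp v hm.hasFDerivAt)
  have h2 : (fun w => B (g (m w))) =ᶠ[𝓝 v] id := h
  exact congrArg (fun A : V →L[ℝ] V => A w)
    ((h1.congr_of_eventuallyEq h2.symm).unique (hasFDerivAt_id v))

variable {n : ℕ} [NeZero n] {M : Type*} [TopologicalSpace M]
  [ChartedSpace (EuclideanHalfSpace n) M] [IsManifold (𝓡∂ n) ∞ M]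
  {F : TanB n M → ℝ} {D : Set (TanB n M)} {G : CotB n M → ℝ}

/-- `ℝⁿ` and its dual. -/
def dualEquiv (n : ℕ) : Covec n ≃L[ℝ] Vec n :=
  (InnerProductSpace.toDual ℝ (Vec n)).symm.toContinuousLinearEquiv

theorem covec_surjective_of_injective {A : Vec n →L[ℝ] Covec n} (hA : ∀ w, A w = 0 → w = 0) :
    Function.Surjective A := by
  have h1 : Function.Injective (((dualEquiv n : Covec n →L[ℝ] Vec n).comp A : Vec n →L[ℝ] Vec n) :
      Vec n →ₗ[ℝ] Vec n) := by
    rw [← LinearMap.ker_eq_bot, LinearMap.ker_eq_bot']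
    intro w hw
    exact hA w ((dualEquiv n).map_eq_zero_iff.1 hw)
  have h2 := LinearMap.injective_iff_surjective.1 h1
  intro θ
  obtain ⟨w, hw⟩ := h2 (dualEquiv n θ)
  exact ⟨w, (dualEquiv n).injective hw⟩

theorem vec_surjective_of_injective {A : Covec n →L[ℝ] Vec n} (hA : ∀ w, A w = 0 → w = 0) :
    Function.Surjective A := by
  have h1 : Function.Injective ((A.comp ((dualEquiv n).symm : Vec n →L[ℝ] Covec n) : Vec n →L[ℝ] Vec n) :
      Vec n →ₗ[ℝ] Vec n) := by
    rw [← LinearMap.ker_eq_bot, LinearMap.ker_eq_bot']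
    intro w hw
    exact (dualEquiv n).symm.map_eq_zero_iff.1 (hA _ hw)
  have h2 := LinearMap.injective_iff_surjective.1 h1
  intro v
  obtain ⟨w, hw⟩ := h2 v
  exact ⟨_, hw⟩

variable (n M) in
/-- `T*M` without the zero section. -/
def coslit : Set (CotB n M) := {q | CotB.covec q ≠ 0}

theorem isOpen_coslit : IsOpen (coslit n M) := by
  refine isOpen_iff_mem_nhds.2 fun q hq => ?_
  have h1 : ContinuousAt (fun q' => (extChartAt (cotModel n) q q').2) q :=
    continuousAt_snd.comp (continuousAt_extChartAt q)
  have h2 : (extChartAt (cotModel n) q q).2 ≠ 0 := by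
    rw [cot_extChartAt_self]; exact hq
  filter_upwards [h1.eventually_ne h2,
    eventually_proj (dom_mem_nhds (mem_chart_source (EuclideanHalfSpace n) q.proj))] with q' hq' hd
  intro h0
  refine hq' ?_
  rw [cot_extChartAt _ _ hd]
  show (CotB.covec q').comp _ = 0
  rw [h0, ContinuousLinearMap.zero_comp]

theorem IsFinslerOn.contMDiffAt (hF : IsFinslerOn F D) {p : TanB n M} (hp : p ∈ D) :
    ContMDiffAt (𝓡∂ n).tangent 𝓘(ℝ, ℝ) ∞ F p := hF.smooth.contMDiffAt (hF.isOpen.mem_nhds hp)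

theorem IsFinslerOn.eventually_contMDiffAt (hF : IsFinslerOn F D) {p : TanB n M} (hp : p ∈ D) :
    ∀ᶠ p' in 𝓝 p, ContMDiffAt (𝓡∂ n).tangent 𝓘(ℝ, ℝ) ∞ F p' :=
  (eventually_mem_set.2 (hF.isOpen.mem_nhds hp)).mono fun _ h => hF.contMDiffAt h

theorem IsFinslerOn.euler (hF : IsFinslerOn F D) {p : TanB n M} (hp : p ∈ D) :
    fderiv ℝ (halfSq F p.proj) (TanB.vec p) (TanB.vec p) = F p ^ 2 := by
  have h1 := euler_two (differentiableAt_halfSq (hF.contMDiffAt hp)).hasFDerivAt fun r hr => by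
    have h2 : F (tvec p.proj (r • TanB.vec p)) = r * F p := hF.homogeneous p hp r hr
    show F (tvec p.proj (r • TanB.vec p)) ^ 2 / 2 = r ^ 2 * (F p ^ 2 / 2)
    rw [h2]; ring
  rw [h1]
  show 2 * (F p ^ 2 / 2) = F p ^ 2
  ring

namespace IsFinsler

variable (hF : IsFinsler F) {p p' : TanB n M} {q : CotB n M}

include hF

theorem isMinkowski (x : M) : IsMinkowski fun w => F (tvec x w) where
  map_zero := hF.map_zero x
  pos v hv := hF.isFinslerOn.pos (tvec x v) hv
  homogeneous v hv r hr := hF.isFinslerOn.homogeneous (tvec x v) hv r hr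
  smooth v hv := contDiffAt_fibre_tan (p := tvec x v) (hF.isFinslerOn.contMDiffAt hv)
  posDef v hv w hw := hF.isFinslerOn.posDef (tvec x v) hv w hw

theorem legendre_mem_coslit (hp : p ∈ slit n M) : legendre F p ∈ coslit n M := by
  intro h0
  have h1 := hF.isFinslerOn.euler hp
  have h2 : fderiv ℝ (halfSq F p.proj) (TanB.vec p) = 0 := h0
  rw [h2] at h1
  have h3 := hF.isFinslerOn.pos p hp
  have h4 : (0 : ℝ) = F p ^ 2 := h1
  exact (pow_pos h3 2).ne h4

theorem dualNorm_legendre (hp : p ∈ slit n M) : dualNorm F (legendre F p) = F p :=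
  ((hF.isMinkowski p.proj).isGreatest_fderiv hp).csSup_eq

theorem hamiltonian_legendre (hp : p ∈ slit n M) : hamiltonian F (legendre F p) = energy F p := by
  rw [hamiltonian, hF.dualNorm_legendre hp]

theorem exists_legendre_eq (hq : q ∈ coslit n M) : ∃ p ∈ slit n M, p.proj = q.proj ∧ legendre F p = q := by
  obtain ⟨v, hv, hvq⟩ := (hF.isMinkowski q.proj).exists_fderiv_eq (ξ := CotB.covec q) hq
  refine ⟨tvec q.proj v, hv, rfl, ?_⟩
  show cvec q.proj (fderiv ℝ (fun u => F (tvec q.proj u) ^ 2 / 2) v) = q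
  rw [hvq]
  rfl

theorem legendre_injOn : InjOn (legendre F) (slit n M) := by
  intro p hp p' hp' h
  obtain ⟨x, v⟩ := p
  obtain ⟨x', v'⟩ := p'
  have hx : x = x' := congrArg TotalSpace.proj h
  subst hx
  have h1 : fderiv ℝ (halfSq F x) v = fderiv ℝ (halfSq F x) v' := by
    have h2 : CotB.covec (legendre F ⟨x, v⟩) = CotB.covec (legendre F ⟨x, v'⟩) := by rw [h]
    exact h2
  have h3 : v = v' := (hF.isMinkowski x).fderiv_injective hp hp' h1
  rw [h3]

theorem hamiltonian_pos (hq : q ∈ coslit n M) : 0 < hamiltonian F q := by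
  obtain ⟨p, hp, -, rfl⟩ := hF.exists_legendre_eq hq
  rw [hF.hamiltonian_legendre hp]
  have := hF.isFinslerOn.pos p hp
  simp only [energy]
  positivity

theorem legendre_tdil (hp : p ∈ slit n M) {r : ℝ} (hr : 0 < r) :
    legendre F (tdil r p) = cdil r (legendre F p) := by
  have h1 := (hF.isMinkowski p.proj).fderiv_smul hp hr
  show cvec p.proj _ = cvec p.proj _
  exact congrArg _ h1

theorem eventually_mem_slit (hp : p ∈ slit n M) : ∀ᶠ p' in 𝓝 p, p' ∈ slit n M :=
  eventually_mem_set.2 (hF.isFinslerOn.isOpen.mem_nhds hp)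

/-- Composed with the Legendre transform the Hamiltonian becomes `½F²`. Thus it is the Legendre dual
of a smooth fibrewise strictly convex function, and `contDiffWithinAt_dual` applies in charts. A
supremum by definition, `dualNorm` has no evident smoothness otherwise. -/
theorem contMDiffAt_hamiltonian_legendre (hp : p ∈ slit n M) :
    ContMDiffAt (cotModel n) 𝓘(ℝ, ℝ) ∞ (hamiltonian F) (legendre F p) := by
  have hFp := hF.isFinslerOn.contMDiffAt hp
  have hFL := differentiableAt_halfSq hFp
  have hy : (extChartAt (𝓡∂ n).tangent p p).1 ∈ halfRange n := extChartAt_mem_range _ _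
  have hpself := tan_extChartAt_self p
  have hsm : ContDiffWithinAt ℝ ∞ (energy F ∘ (extChartAt (𝓡∂ n).tangent p).symm)
      (halfRange n ×ˢ univ) (extChartAt (𝓡∂ n).tangent p p) :=
    contDiffWithinAt_tan (contMDiffAt_energy hFp) (mem_chart_source _ _)
  have hq : extChartAt (cotModel n) (legendre F p) (legendre F p) =
      ((extChartAt (𝓡∂ n).tangent p p).1,
      fibDeriv (energy F ∘ (extChartAt (𝓡∂ n).tangent p).symm) (extChartAt (𝓡∂ n).tangent p p)) :=
    extChartAt_legendre rfl (mem_chart_source _ _) hFL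
  have hsm' : ContDiffWithinAt ℝ ∞ (hamiltonian F ∘ (extChartAt (cotModel n) (legendre F p)).symm)
      (halfRange n ×ˢ univ) (extChartAt (cotModel n) (legendre F p) (legendre F p)) := by
    rw [hq]
    refine contDiffWithinAt_dual (dualEquiv n) proj_single halfRange_eq hy hsm ?_ ?_
    · intro w hw
      have h1 := hF.isFinslerOn.posDef p hp w hw
      have h2 : (fun u => (energy F ∘ (extChartAt (𝓡∂ n).tangent p).symm)
          ((extChartAt (𝓡∂ n).tangent p p).1, u)) = halfSq F p.proj := by
        funext u
        rw [hpself, Function.comp_apply, tan_symm_extChartAt (mem_chart_source _ p.proj), ofChart_self]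
        rfl
      rw [h2, hpself]
      exact h1
    · have h1 : Tendsto (extChartAt (𝓡∂ n).tangent p).symm
          (𝓝[halfRange n ×ˢ univ] (extChartAt (𝓡∂ n).tangent p p)) (𝓝 p) := by
        have := (continuousAt_extChartAt_symm (I := (𝓡∂ n).tangent) p).tendsto
        rw [extChartAt_to_inv] at this
        exact this.mono_left nhdsWithin_le_nhds
      have h2 : ∀ᶠ y in 𝓝[halfRange n ×ˢ univ] (extChartAt (𝓡∂ n).tangent p p),
          y ∈ (extChartAt (𝓡∂ n).tangent p).target := by
        rw [← range_tanModel]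
        exact eventually_mem_set.2 (extChartAt_target_mem_nhdsWithin p)
      filter_upwards [h1.eventually ((hF.eventually_mem_slit hp).and (eventually_proj_tan
        (dom_mem_nhds (mem_chart_source (EuclideanHalfSpace n) p.proj)))), h2] with y hy hyt
      have h3 : legendre F ((extChartAt (𝓡∂ n).tangent p).symm y) ∈
          (extChartAt (cotModel n) (legendre F p)).source :=
        (cot_mem_source (legendre F p) _).2 hy.2
      have h4 := extChartAt_legendre (F := F) (p₀ := p) (q₀ := legendre F p) rfl hy.2
        (differentiableAt_halfSq (hF.isFinslerOn.contMDiffAt hy.1))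
      rw [(extChartAt (𝓡∂ n).tangent p).right_inv hyt] at h4
      rw [← h4, Function.comp_apply, (extChartAt (cotModel n) (legendre F p)).left_inv h3,
        hF.hamiltonian_legendre hy.1]
      rfl
  refine (contMDiffAt_real_iff (mem_extChartAt_source _)).2 ⟨?_, ?_⟩
  · refine continuousAt_real_of_chart (I := cotModel n) (mem_extChartAt_source (legendre F p)) ?_
    rw [range_cotModel]
    exact hsm'.continuousWithinAt
  · rw [range_cotModel]
    exact hsm'

theorem contMDiffAt_hamiltonian (hq : q ∈ coslit n M) :
    ContMDiffAt (cotModel n) 𝓘(ℝ, ℝ) ∞ (hamiltonian F) q := by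
  obtain ⟨p, hp, -, rfl⟩ := hF.exists_legendre_eq hq
  exact hF.contMDiffAt_hamiltonian_legendre hp

theorem eventually_contMDiffAt_hamiltonian (hq : q ∈ coslit n M) :
    ∀ᶠ q' in 𝓝 q, ContMDiffAt (cotModel n) 𝓘(ℝ, ℝ) ∞ (hamiltonian F) q' :=
  (eventually_mem_set.2 (isOpen_coslit.mem_nhds hq)).mono fun _ h => hF.contMDiffAt_hamiltonian h

/-- By Young's inequality `ζ ↦ H(ζ) - ζ(v)` has a local minimum at the Legendre image of `v`. The
derivative of `H` there is therefore evaluation at `v`. -/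
theorem fderiv_hamiltonian_legendre (hp : p ∈ slit n M) (θ : Covec n) :
    fderiv ℝ (fun ζ => hamiltonian F (cvec p.proj ζ)) (CotB.covec (legendre F p)) θ =
      θ (TanB.vec p) := by
  have hm := hF.isMinkowski p.proj
  have hd : DifferentiableAt ℝ (fun ζ => hamiltonian F (cvec p.proj ζ)) (CotB.covec (legendre F p)) :=
    (contDiffAt_fibre_cot (hF.contMDiffAt_hamiltonian_legendre hp)).differentiableAt (by simp)
  have hev : ∀ᶠ ζ in 𝓝 (CotB.covec (legendre F p)), ζ ≠ 0 :=
    isOpen_ne.mem_nhds (hF.legendre_mem_coslit hp)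
  have hval : hamiltonian F (cvec p.proj (CotB.covec (legendre F p))) = F p ^ 2 / 2 :=
    hF.hamiltonian_legendre hp
  have heu : CotB.covec (legendre F p) (TanB.vec p) = F p ^ 2 := hF.isFinslerOn.euler hp
  have hmin : IsLocalMin (fun ζ : Covec n => hamiltonian F (cvec p.proj ζ) -
      ContinuousLinearMap.apply ℝ ℝ (TanB.vec p) ζ) (CotB.covec (legendre F p)) := by
    filter_upwards [hev] with ζ hζ
    obtain ⟨p', hp', hpx, hpe⟩ := hF.exists_legendre_eq (q := cvec p.proj ζ) hζ
    have h1 : hamiltonian F (cvec p.proj ζ) = F p' ^ 2 / 2 := by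
      rw [← hpe]; exact hF.hamiltonian_legendre hp'
    have hpx' : p'.proj = p.proj := hpx
    have h2 : ζ (TanB.vec p) ≤ F p' ^ 2 / 2 + F p ^ 2 / 2 := by
      obtain ⟨x', v'⟩ := p'
      obtain rfl : x' = p.proj := hpx'
      have h3 := hm.young (v := v') hp' (TanB.vec p)
      have h4 : CotB.covec (legendre F ⟨p.proj, v'⟩) = CotB.covec (cvec p.proj ζ) := by rw [hpe]
      have h5 : fderiv ℝ (fun u => F (tvec p.proj u) ^ 2 / 2) v' = ζ := h4
      rw [h5] at h3
      exact h3
    rw [hval, h1]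
    show F p ^ 2 / 2 - CotB.covec (legendre F p) (TanB.vec p) ≤ F p' ^ 2 / 2 - ζ (TanB.vec p)
    rw [heu]
    linarith
  rw [fderiv_eq_of_isLocalMin_sub hd hmin]
  rfl

theorem velocity_legendre (hp : p ∈ slit n M) : velocity (hamiltonian F) (legendre F p) = p := by
  have h1 := eq_bidual (hF.fderiv_hamiltonian_legendre hp)
  show tvec p.proj _ = p
  exact (congrArg (tvec p.proj) h1).symm

theorem isDualAt (hp : p ∈ slit n M) : IsDualAt F (hamiltonian F) p := by
  have hs := hF.eventually_mem_slit hp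
  exact isDualAt_of_eventually (hF.isFinslerOn.eventually_contMDiffAt hp)
    (hs.mono fun p' h => hF.isFinslerOn.euler h) (hF.contMDiffAt_hamiltonian_legendre hp)
    (hs.mono fun p' h => hF.hamiltonian_legendre h) (hF.fderiv_hamiltonian_legendre hp)

/-- The fibre Hessians of `H` and of `½F²` are inverse to each other. If `w` is the vector whose
image under the Hessian of `½F²` is `θ`, both quadratic forms take the value `θ w`. -/
theorem strictConvexFiberOn : StrictConvexFiberOn (hamiltonian F) (coslit n M) := by
  intro q hq θ hθ
  obtain ⟨p, hp, -, rfl⟩ := hF.exists_legendre_eq hq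
  have hm := hF.isMinkowski p.proj
  set x := p.proj with hx
  set g : Covec n → ℝ := fun ζ => hamiltonian F (cvec x ζ) with hg
  set L : Vec n → ℝ := fun u => F (tvec x u) ^ 2 / 2 with hL
  set v := TanB.vec p with hv
  have hv0 : v ≠ 0 := hp
  have hLs : ContDiffAt ℝ ∞ L v := hm.contDiffAt_energy hv0
  have hgs : ContDiffAt ℝ ∞ g (fderiv ℝ L v) :=
    contDiffAt_fibre_cot (hF.contMDiffAt_hamiltonian_legendre hp)
  have h3 := hessian_dual (m := fderiv ℝ L) (g := fderiv ℝ g) (bidual n) (v := v)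
    ((hLs.fderiv_right (m := 1) (by norm_cast)).differentiableAt (by simp))
    ((hgs.fderiv_right (m := 1) (by norm_cast)).differentiableAt (by simp)) (by
      filter_upwards [isOpen_ne.mem_nhds hv0] with w hw
      exact (eq_bidual (hF.fderiv_hamiltonian_legendre (p := tvec x w) hw)).symm)
  obtain ⟨w, hw⟩ := covec_surjective_of_injective (A := fderiv ℝ (fderiv ℝ L) v) (fun w hw => by
    by_contra hne
    have := hm.posDef v hv0 w hne
    rw [show fderiv ℝ (fderiv ℝ fun u => F (tvec x u) ^ 2 / 2) v w = 0 from hw] at this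
    exact lt_irrefl _ this) θ
  have h4 : bidual n (fderiv ℝ (fderiv ℝ g) (fderiv ℝ L v) θ) = w := by
    rw [← hw]
    exact h3 w
  have hw0 : w ≠ 0 := by
    intro h0
    rw [h0, ContinuousLinearMap.map_zero] at hw
    exact hθ hw.symm
  have h5 : fderiv ℝ (fderiv ℝ g) (fderiv ℝ L v) θ θ = θ w := by rw [← apply_bidual, h4]
  have h6 := hm.posDef v hv0 w hw0
  have h7 : fderiv ℝ (fderiv ℝ L) v w w = θ w := by rw [hw]
  show 0 < fderiv ℝ (fderiv ℝ g) (fderiv ℝ L v) θ θ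
  rw [h5, ← h7]
  exact h6

theorem hamiltonian_cdil (hq : q ∈ coslit n M) {r : ℝ} (hr : 0 < r) :
    hamiltonian F (cdil r q) = r ^ 2 * hamiltonian F q := by
  obtain ⟨p, hp, -, rfl⟩ := hF.exists_legendre_eq hq
  rw [← hF.legendre_tdil hp hr, hF.hamiltonian_legendre hp,
    hF.hamiltonian_legendre (hF.isFinslerOn.conic p hp r hr), energy, energy,
    hF.isFinslerOn.homogeneous p hp r hr]
  ring

end IsFinsler

end

/-! ### From a convex Hamiltonian back to a Lagrangian -/

section

theorem differentiableWithinAt_clm_fibDeriv {V W Z : Type*} [NormedAddCommGroup V]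
    [NormedSpace ℝ V] [NormedAddCommGroup W] [NormedSpace ℝ W] [NormedAddCommGroup Z]
    [NormedSpace ℝ Z] [FiniteDimensional ℝ V] [FiniteDimensional ℝ W] {ℓ : V →L[ℝ] ℝ} {e : V}
    {R : Set V} {f : V × W → ℝ} {y : V} {w : W} (he : ℓ e = 1) (hR : R = {y | 0 ≤ ℓ y}) (hy : y ∈ R)
    (hf : ContDiffWithinAt ℝ ∞ f (R ×ˢ univ) (y, w)) (B : (W →L[ℝ] ℝ) →L[ℝ] Z) :
    DifferentiableWithinAt ℝ (fun y => B (fibDeriv f (y, w))) R y := by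
  have h1 := contDiffWithinAt_fibDeriv he hR hy hf
  have h2 : DifferentiableWithinAt ℝ (fun y => fibDeriv f (y, w)) R y :=
    (ContDiffWithinAt.comp y (g := fibDeriv f) (t := R ×ˢ univ) h1
      (contDiffWithinAt_id.prodMk contDiffWithinAt_const)
      fun y hy => ⟨hy, mem_univ _⟩).differentiableWithinAt (by simp)
  exact B.differentiableAt.comp_differentiableWithinAt y h2

/-- Differentiate `L ∘ B ∘ g' = g` and Euler's identity `g' ζ ζ = 2 g ζ` in a direction `α`. The
first gives `L' (B (g'' α)) = g' α`, the second `g'' α ζ₀ = g' α`. So `L'` and `η` agree on all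
vectors `B (g'' α)`, and these exhaust the space. -/
theorem fderiv_dual_eq {V W : Type*} [NormedAddCommGroup V] [NormedSpace ℝ V]
    [NormedAddCommGroup W] [NormedSpace ℝ W] (B : (W →L[ℝ] ℝ) →L[ℝ] V) {g : W → ℝ} {L : V → ℝ}
    {ζ₀ : W} {η : V →L[ℝ] ℝ} (hη : ∀ l : W →L[ℝ] ℝ, η (B l) = l ζ₀)
    (hg : ContDiffAt ℝ 2 g ζ₀) (hE : ∀ᶠ ζ in 𝓝 ζ₀, fderiv ℝ g ζ ζ = 2 * g ζ)
    (hL : DifferentiableAt ℝ L (B (fderiv ℝ g ζ₀)))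
    (hLg : ∀ᶠ ζ in 𝓝 ζ₀, L (B (fderiv ℝ g ζ)) = g ζ)
    (hs : ∀ v, ∃ α, B (fderiv ℝ (fderiv ℝ g) ζ₀ α) = v) :
    fderiv ℝ L (B (fderiv ℝ g ζ₀)) = η := by
  have hg1 : HasFDerivAt g (fderiv ℝ g ζ₀) ζ₀ := (hg.differentiableAt (by simp)).hasFDerivAt
  have hg2 : HasFDerivAt (fderiv ℝ g) (fderiv ℝ (fderiv ℝ g) ζ₀) ζ₀ :=
    ((hg.fderiv_right (m := 1) (by norm_num)).differentiableAt (by simp)).hasFDerivAt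
  have h1 : HasFDerivAt (fun ζ => B (fderiv ℝ g ζ)) (B.comp (fderiv ℝ (fderiv ℝ g) ζ₀)) ζ₀ :=
    B.hasFDerivAt.comp ζ₀ hg2
  have h2 : HasFDerivAt (fun ζ => L (B (fderiv ℝ g ζ)))
      ((fderiv ℝ L (B (fderiv ℝ g ζ₀))).comp (B.comp (fderiv ℝ (fderiv ℝ g) ζ₀))) ζ₀ :=
    HasFDerivAt.comp ζ₀ (g := L) hL.hasFDerivAt h1
  have h3 := (h2.congr_of_eventuallyEq (hLg.mono fun ζ hζ => hζ.symm)).unique hg1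
  have h4 := hg2.clm_apply (hasFDerivAt_id ζ₀)
  have h5 : HasFDerivAt (fun ζ => 2 * g ζ) ((2 : ℝ) • fderiv ℝ g ζ₀) ζ₀ := hg1.const_mul 2
  have h6 := (h4.congr_of_eventuallyEq (hE.mono fun ζ hζ => hζ.symm)).unique h5
  ext1 v
  obtain ⟨α, rfl⟩ := hs v
  rw [hη]
  have h7 : fderiv ℝ L (B (fderiv ℝ g ζ₀)) (B (fderiv ℝ (fderiv ℝ g) ζ₀ α)) = fderiv ℝ g ζ₀ α :=
    congrArg (fun A : W →L[ℝ] ℝ => A α) h3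
  have h8 : fderiv ℝ g ζ₀ α + fderiv ℝ (fderiv ℝ g) ζ₀ α ζ₀ = 2 * fderiv ℝ g ζ₀ α :=
    congrArg (fun A : W →L[ℝ] ℝ => A α) h6
  rw [h7]
  linarith

variable {n : ℕ} [NeZero n] {M : Type*} [TopologicalSpace M]
  [ChartedSpace (EuclideanHalfSpace n) M] [IsManifold (𝓡∂ n) ∞ M]
  {F : TanB n M → ℝ} {G : CotB n M → ℝ}

theorem bidual_hessian_surjective {A : Covec n →L[ℝ] Covec n →L[ℝ] ℝ}
    (hA : ∀ θ, θ ≠ 0 → 0 < A θ θ) (v : Vec n) : ∃ α, bidual n (A α) = v := by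
  refine vec_surjective_of_injective (A := (bidual n).comp A) (fun θ hθ => ?_) v
  by_contra hne
  have h1 := hA θ hne
  rw [← apply_bidual] at h1
  have h2 : bidual n (A θ) = 0 := hθ
  rw [h2, map_zero] at h1
  exact lt_irrefl _ h1

theorem continuousAt_cvec (q : CotB n M) : ContinuousAt (fun ζ => cvec q.proj ζ) (CotB.covec q) := by
  refine continuousAt_of_extChartAt (I := cotModel n) (q₀ := q)
    (Eventually.of_forall fun ζ => (cot_mem_source _ _).2 (mem_chart_source _ q.proj)) ?_
  have h1 : (fun ζ => extChartAt (cotModel n) q (cvec q.proj ζ)) =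
      fun ζ => (extChartAt (𝓡∂ n) q.proj q.proj, ζ) := by
    funext ζ
    exact cot_extChartAt_self (cvec q.proj ζ)
  rw [h1]
  exact continuousAt_const.prodMk continuousAt_id

/-- If the Legendre transform of `G` turns `G` into `½F²`, then that of `½F²` is its inverse. -/
theorem legendre_velocity {q₀ : CotB n M} (hG : ContMDiffAt (cotModel n) 𝓘(ℝ, ℝ) ∞ G q₀)
    (hE : ∀ᶠ q in 𝓝 q₀,
      fderiv ℝ (fun ζ => G (cvec q.proj ζ)) (CotB.covec q) (CotB.covec q) = 2 * G q)
    (hpos : ∀ θ : Covec n, θ ≠ 0 →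
      0 < fderiv ℝ (fderiv ℝ fun ζ => G (cvec q₀.proj ζ)) (CotB.covec q₀) θ θ)
    (hF : ContMDiffAt (𝓡∂ n).tangent 𝓘(ℝ, ℝ) ∞ F (velocity G q₀))
    (hFG : ∀ᶠ q in 𝓝 q₀, energy F (velocity G q) = G q) :
    legendre F (velocity G q₀) = q₀ := by
  have hc := continuousAt_cvec q₀
  have h1 : fderiv ℝ (halfSq F q₀.proj) (bidual n (fderiv ℝ (fun ζ => G (cvec q₀.proj ζ))
      (CotB.covec q₀))) = CotB.covec q₀ :=
    fderiv_dual_eq (bidual n) (fun l => apply_bidual l _)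
      ((contDiffAt_fibre_cot hG).of_le (by norm_cast))
      (hc.eventually hE) (differentiableAt_halfSq hF) (hc.eventually hFG)
      (bidual_hessian_surjective hpos)
  show cvec q₀.proj _ = q₀
  exact congrArg (cvec q₀.proj) h1

/-- The mirror image of `isDualAt_of_eventually`: the covector is frozen, the roles of Lagrangian
and Hamiltonian are exchanged, and the base derivative of `½F²` is computed from that of `G`. The
identities are assumed only for covectors near `q₀`, so `F` may be a metric on a cone. -/
theorem isDualAt_velocity {q₀ : CotB n M} (hG : ∀ᶠ q in 𝓝 q₀, ContMDiffAt (cotModel n) 𝓘(ℝ, ℝ) ∞ G q)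
    (hE : ∀ᶠ q in 𝓝 q₀,
      fderiv ℝ (fun ζ => G (cvec q.proj ζ)) (CotB.covec q) (CotB.covec q) = 2 * G q)
    (hF : ContMDiffAt (𝓡∂ n).tangent 𝓘(ℝ, ℝ) ∞ F (velocity G q₀))
    (hFG : ∀ᶠ q in 𝓝 q₀, energy F (velocity G q) = G q)
    (hleg : legendre F (velocity G q₀) = q₀) : IsDualAt F G (velocity G q₀) := by
  set p := velocity G q₀
  set y₀ := extChartAt (𝓡∂ n) q₀.proj q₀.proj
  set f := energy F ∘ (extChartAt (𝓡∂ n).tangent p).symm with hf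
  set Ĝ := G ∘ (extChartAt (cotModel n) q₀).symm with hĜ
  set m : Vec n → Vec n := fun y => bidual n (fibDeriv Ĝ (y, CotB.covec q₀)) with hm
  have hy₀ : y₀ ∈ halfRange n := extChartAt_mem_range _ _
  have hG₀ := hG.self_of_nhds
  have hqself : extChartAt (cotModel n) q₀ q₀ = (y₀, CotB.covec q₀) := cot_extChartAt_self q₀
  have hGd := (contDiffAt_fibre_cot hG₀).differentiableAt (by simp)
  have hm0 : m y₀ = TanB.vec p := by
    rw [hm]; simp only; rw [← hqself, fibDeriv_cot_self hGd]; rfl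
  have hpself : extChartAt (𝓡∂ n).tangent p p = (y₀, m y₀) := by
    rw [hm0]; exact tan_extChartAt_self p
  have hGs : ContDiffWithinAt ℝ ∞ Ĝ (halfRange n ×ˢ univ) (y₀, CotB.covec q₀) := by
    rw [← hqself]
    exact contDiffWithinAt_cot hG₀ (mem_chart_source _ _)
  have hfs : ContDiffWithinAt ℝ ∞ f (halfRange n ×ˢ univ) (y₀, m y₀) := by
    rw [← hpself]
    exact contDiffWithinAt_tan (contMDiffAt_energy hF) (mem_chart_source _ _)
  have hms : DifferentiableWithinAt ℝ m (halfRange n) y₀ :=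
    differentiableWithinAt_clm_fibDeriv proj_single halfRange_eq hy₀ hGs (bidual n)
  have hev : ∀ᶠ y in 𝓝[halfRange n] y₀, ∃ q : CotB n M, q.proj ∈ dom (n := n) q₀.proj ∧
      DifferentiableAt ℝ (fun ζ => G (cvec q.proj ζ)) (CotB.covec q) ∧
      fderiv ℝ (fun ζ => G (cvec q.proj ζ)) (CotB.covec q) (CotB.covec q) = 2 * G q ∧
      energy F (velocity G q) = G q ∧ (extChartAt (cotModel n) q₀).symm (y, CotB.covec q₀) = q ∧
      extChartAt (cotModel n) q₀ q = (y, CotB.covec q₀) := by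
    filter_upwards [(tendsto_cot_symm q₀).eventually ((eventually_proj (dom_mem_nhds
      (mem_chart_source (EuclideanHalfSpace n) q₀.proj))).and (hG.and (hE.and hFG))),
      base_mem_target q₀.proj] with y hy hyt
    exact ⟨_, hy.1, (contDiffAt_fibre_cot hy.2.1).differentiableAt (by simp), hy.2.2.1, hy.2.2.2,
      rfl, extChartAt_cot_symm hyt⟩
  have hGF' : ∀ᶠ y in 𝓝[halfRange n] y₀, f (y, m y) = Ĝ (y, CotB.covec q₀) := by
    filter_upwards [hev] with y ⟨q, h1, h2, h3, h4, h5, h6⟩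
    have h7 := extChartAt_velocity (G := G) (p₀ := p) (q₀ := q₀) rfl h1 h2
    rw [h6] at h7
    simp only [hĜ, hf, Function.comp_apply, h5]
    rw [hm, ← h4]
    simp only [hĜ]
    have h8 : velocity G q ∈ (extChartAt (𝓡∂ n).tangent p).source :=
      (tan_mem_source p (velocity G q)).2 h1
    rw [← h7, (extChartAt (𝓡∂ n).tangent p).left_inv h8]
  have hmE : ∀ᶠ y in 𝓝[halfRange n] y₀, CotB.covec q₀ (m y) = 2 * Ĝ (y, CotB.covec q₀) := by
    filter_upwards [hev] with y ⟨q, h1, h2, h3, h4, h5, h6⟩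
    have h7 := fibDeriv_cot_euler h1 h2 h3
    rw [h6] at h7
    rw [hm]
    simp only [hĜ, Function.comp_apply, h5, apply_bidual]
    exact h7
  set dG : Vec n →L[ℝ] ℝ := fderivWithin ℝ (fun y => Ĝ (y, CotB.covec q₀)) (halfRange n) y₀
  have hĜd : HasFDerivWithinAt Ĝ _ (halfRange n ×ˢ univ) (y₀, CotB.covec q₀) :=
    (hGs.differentiableWithinAt (by simp)).hasFDerivWithinAt
  have hdG : HasFDerivWithinAt (fun y => Ĝ (y, CotB.covec q₀)) dG (halfRange n) y₀ :=
    (hasFDerivWithinAt_slice hĜd).differentiableWithinAt.hasFDerivWithinAt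
  have hfG : ∀ w, fibDeriv f (y₀, m y₀) w = CotB.covec q₀ w := by
    intro w
    rw [← hpself, fibDeriv_tan_self (differentiableAt_halfSq hF)]
    have h1 : CotB.covec (legendre F p) = CotB.covec q₀ := by rw [hleg]
    exact congrArg (fun A : Covec n => A w) h1
  have hmd := hms.hasFDerivWithinAt
  have hE' : ∀ a, fibDeriv f (y₀, m y₀) (fderivWithin ℝ m (halfRange n) y₀ a) = 2 * dG a := by
    intro a
    rw [hfG]
    have h1 : HasFDerivWithinAt (fun y => CotB.covec q₀ (m y))
        ((CotB.covec q₀).comp (fderivWithin ℝ m (halfRange n) y₀)) (halfRange n) y₀ :=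
      (CotB.covec q₀).hasFDerivAt.comp_hasFDerivWithinAt y₀ hmd
    have h2 := hasFDerivWithinAt_congr_of_mem h1 (hmE.mono fun y hy => hy.symm) hy₀
    have h3 := (uniqueDiffOn_base y₀ hy₀).eq h2 (hdG.const_mul 2)
    exact congrArg (fun A : Covec n => A a) h3
  have hfin := fderivWithin_dual_base uniqueDiffOn_base hy₀ (hfs.differentiableWithinAt (by simp))
    hmd hdG hGF' hE'
  have hbase : baseDeriv F p = -dG := by
    have h1 := (hasFDerivWithinAt_slice hfin).fderivWithin (uniqueDiffOn_base y₀ hy₀)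
    have h2 : baseDeriv F p = fderivWithin ℝ (fun y => f (y, m y₀)) (halfRange n) y₀ := by
      rw [hm0]; rfl
    rw [h2]
    refine h1.trans ?_
    ext1 a
    show -(dG a) + fibDeriv f (y₀, m y₀) 0 = -(dG a)
    rw [map_zero, add_zero]
  intro a θ
  rw [hleg, hbase]
  rw [← hqself] at hĜd
  rw [cotDeriv_eq_of_hasFDerivWithinAt hĜd, hqself]
  rw [hqself] at hĜd
  set D := fderivWithin ℝ Ĝ (halfRange n ×ˢ univ) (y₀, CotB.covec q₀)
  have h1 : dG = D.comp (ContinuousLinearMap.inl ℝ (Vec n) (Covec n)) :=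
    (hasFDerivWithinAt_slice hĜd).fderivWithin (uniqueDiffOn_base y₀ hy₀)
  have h2 : fibDeriv Ĝ (y₀, CotB.covec q₀) = D.comp (ContinuousLinearMap.inr ℝ (Vec n) (Covec n)) :=
    (hasFDerivAt_slice hĜd hy₀).fderiv
  have h3 : θ (TanB.vec p) = D (0, θ) := by
    rw [← hm0, hm]
    simp only [apply_bidual]
    rw [h2]
    rfl
  have h4 : dG a = D (a, 0) := by rw [h1]; rfl
  rw [h3]
  show D (a, θ) = D (0, θ) - -(dG a)
  rw [h4, sub_neg_eq_add, ← map_add]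
  simp

end

/-! ### The identification of the bundles over the boundary -/

section

variable {n : ℕ} [NeZero n] {M M' : Type*}
  [TopologicalSpace M] [ChartedSpace (EuclideanHalfSpace n) M] [IsManifold (𝓡∂ n) ∞ M]
  [TopologicalSpace M'] [ChartedSpace (EuclideanHalfSpace n) M'] [IsManifold (𝓡∂ n) ∞ M']

/-! ### Interior and boundary of the cotangent bundle -/

theorem mem_boundary_iff {x₀ x : M} (hx : x ∈ dom (n := n) x₀) :
    x ∈ (𝓡∂ n).boundary M ↔ extChartAt (𝓡∂ n) x₀ x 0 = 0 :=
  mem_boundary_iff_eq_zero proj_single halfRange_eq (mem_dom_iff.1 hx)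

theorem mem_interior_iff {x₀ x : M} (hx : x ∈ dom (n := n) x₀) :
    x ∈ (𝓡∂ n).interior M ↔ 0 < extChartAt (𝓡∂ n) x₀ x 0 :=
  mem_interior_iff_pos proj_single halfRange_eq (mem_dom_iff.1 hx)

theorem cot_mem_boundary_iff {q : CotB n M} :
    q ∈ (cotModel n).boundary (CotB n M) ↔ q.proj ∈ (𝓡∂ n).boundary M := by
  rw [mem_boundary_iff_eq_zero bdf_inward range_cotModel_eq (mem_extChartAt_source q),
    mem_boundary_iff (mem_chart_source _ q.proj), cot_extChartAt_self]
  rfl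

theorem cot_mem_interior_iff {q : CotB n M} :
    q ∈ (cotModel n).interior (CotB n M) ↔ q.proj ∈ (𝓡∂ n).interior M := by
  rw [mem_interior_iff_pos bdf_inward range_cotModel_eq (mem_extChartAt_source q),
    mem_interior_iff (mem_chart_source _ q.proj), cot_extChartAt_self]
  rfl

theorem not_mem_boundary_of_mem_interior {x : M} (h : x ∈ (𝓡∂ n).interior M) :
    x ∉ (𝓡∂ n).boundary M := by
  rw [mem_interior_iff (mem_chart_source _ x)] at h
  rw [mem_boundary_iff (mem_chart_source _ x)]
  exact h.ne'

/-! ### Dilations -/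

theorem tdil_one (p : TanB n M) : tdil 1 p = p := by
  show tvec p.proj ((1 : ℝ) • TanB.vec p) = p
  rw [one_smul]; rfl

theorem tdil_tdil (r s : ℝ) (p : TanB n M) : tdil r (tdil s p) = tdil (r * s) p := by
  show tvec p.proj (r • s • TanB.vec p) = tvec p.proj _
  rw [smul_smul]

theorem cdil_one (p : CotB n M) : cdil 1 p = p := by
  show cvec p.proj ((1 : ℝ) • CotB.covec p) = p
  rw [one_smul]; rfl

theorem cdil_cdil (r s : ℝ) (p : CotB n M) : cdil r (cdil s p) = cdil (r * s) p := by
  show cvec p.proj (r • s • CotB.covec p) = cvec p.proj _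
  rw [smul_smul]

/-! ### The identification over the boundary -/

/-- The derivative of a map of half-spaces at a boundary point that is mapped to the boundary
preserves the half-space. -/
theorem normal_nonneg_of_hasFDerivWithinAt {g : Vec n → Vec n} {A : Vec n →L[ℝ] Vec n}
    {y₀ v : Vec n} (hd : HasFDerivWithinAt g A (halfRange n) y₀) (hy0 : y₀ 0 = 0)
    (hgy0 : g y₀ 0 = 0) (hg : ∀ y, g y ∈ halfRange n) (hv : 0 ≤ v 0) : 0 ≤ (A v) 0 := by
  have hline : HasDerivWithinAt (fun t : ℝ => y₀ + t • v) v (Icc 0 1) 0 := by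
    simpa using (((hasDerivAt_id (0 : ℝ)).smul_const v).const_add y₀).hasDerivWithinAt
  have hmaps : MapsTo (fun t : ℝ => y₀ + t • v) (Icc 0 1) (halfRange n) := by
    intro t ht
    rw [halfRange_eq]
    show 0 ≤ (y₀ + t • v) 0
    simp only [PiLp.add_apply, PiLp.smul_apply, hy0, zero_add, smul_eq_mul]
    exact mul_nonneg ht.1 hv
  have h2 : HasDerivWithinAt (fun t : ℝ => g (y₀ + t • v)) (A v) (Icc 0 1) 0 := by
    refine HasFDerivWithinAt.comp_hasDerivWithinAt (t := halfRange n) (l := g) 0 ?_ hline hmaps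
    simpa using hd
  have h3 := clm_comp_hasDerivWithinAt (EuclideanSpace.proj (𝕜 := ℝ) (0 : Fin n)) h2
  refine nonneg_of_hasDerivWithinAt_left zero_lt_one h3 (by simpa using hgy0) fun t _ => ?_
  have h4 : g (y₀ + t • v) ∈ halfRange n := hg _
  rw [halfRange_eq] at h4
  exact h4

theorem normal_nonneg_of_mapsTo_boundary {f : M → M'} {x : M} {v : Vec n}
    (hf : MDifferentiableAt (𝓡∂ n) (𝓡∂ n) f x) (hx : x ∈ (𝓡∂ n).boundary M)
    (hfx : f x ∈ (𝓡∂ n).boundary M') (hv : 0 ≤ v 0) :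
    0 ≤ (show Vec n from mfderiv (𝓡∂ n) (𝓡∂ n) f x v) 0 := by
  have h1 := hasFDerivWithinAt_written rfl hf (mem_chart_source _ x) (mem_chart_source _ (f x))
  rw [toChart_self_eq_id, ofChart_self_eq_id, ContinuousLinearMap.id_comp,
    ContinuousLinearMap.comp_id] at h1
  refine normal_nonneg_of_hasFDerivWithinAt h1 ((mem_boundary_iff (mem_chart_source _ x)).1 hx) ?_
    (fun y => extChartAt_mem_range _ _) hv
  simp only [Function.comp_apply]
  rw [extChartAt_to_inv]
  exact (mem_boundary_iff (mem_chart_source _ (f x))).1 hfx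

namespace IsBoundaryIdentification

variable {Ψ : OpenPartialHomeomorph M M'} (hΨ : IsBoundaryIdentification (n := n) Ψ)

include hΨ

theorem symm : IsBoundaryIdentification (n := n) Ψ.symm where
  smooth := hΨ.smooth_symm
  smooth_symm := hΨ.smooth
  subset_source := by
    rw [← hΨ.image_boundary]
    rintro _ ⟨x, hx, rfl⟩
    exact Ψ.map_source (hΨ.subset_source hx)
  image_boundary := by
    rw [← hΨ.image_boundary]
    ext x
    constructor
    · rintro ⟨_, ⟨y, hy, rfl⟩, rfl⟩
      rwa [Ψ.left_inv (hΨ.subset_source hy)]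
    · intro hx
      exact ⟨_, ⟨x, hx, rfl⟩, Ψ.left_inv (hΨ.subset_source hx)⟩

theorem map_boundary {x : M} (hx : x ∈ (𝓡∂ n).boundary M) : Ψ x ∈ (𝓡∂ n).boundary M' := by
  rw [← hΨ.image_boundary]; exact ⟨x, hx, rfl⟩

theorem contMDiffAt {x : M} (hx : x ∈ Ψ.source) : ContMDiffAt (𝓡∂ n) (𝓡∂ n) ∞ Ψ x :=
  contMDiffAt_of_mem hΨ.smooth hx

theorem mfderiv_symm_mfderiv {x : M} (hx : x ∈ Ψ.source) (v : Vec n) :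
    (show Vec n from mfderiv (𝓡∂ n) (𝓡∂ n) Ψ.symm (Ψ x) (mfderiv (𝓡∂ n) (𝓡∂ n) Ψ x v)) = v := by
  have h1 := ((hΨ.contMDiffAt hx).mdifferentiableAt (by simp)).hasMFDerivAt
  have h2 := ((hΨ.symm.contMDiffAt (Ψ.map_source hx)).mdifferentiableAt (by simp)).hasMFDerivAt
  have h3 := h2.comp x h1
  have h4 : Ψ.symm ∘ Ψ =ᶠ[𝓝 x] id := by
    filter_upwards [Ψ.open_source.mem_nhds hx] with y hy using Ψ.left_inv hy
  have h5 : HasMFDerivAt (𝓡∂ n) (𝓡∂ n) id x _ := h3.congr_of_eventuallyEq h4.symm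
  have h6 := hasMFDerivAt_unique h5 (hasMFDerivAt_id x)
  exact congrArg (fun A : Vec n →L[ℝ] Vec n => A v) h6

theorem mfderiv_mfderiv_symm {x : M} (hx : x ∈ Ψ.source) (v : Vec n) :
    (show Vec n from mfderiv (𝓡∂ n) (𝓡∂ n) Ψ x (mfderiv (𝓡∂ n) (𝓡∂ n) Ψ.symm (Ψ x) v)) = v := by
  have h := hΨ.symm.mfderiv_symm_mfderiv (x := Ψ x) (Ψ.map_source hx) v
  have h1 : Ψ.symm (Ψ x) = x := Ψ.left_inv hx
  simp only [OpenPartialHomeomorph.symm_symm] at h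
  have h2 : ∀ y, y = x → (show Vec n from mfderiv (𝓡∂ n) (𝓡∂ n) Ψ y
      ((show Vec n from mfderiv (𝓡∂ n) (𝓡∂ n) Ψ.symm (Ψ x) v))) = v →
      (show Vec n from mfderiv (𝓡∂ n) (𝓡∂ n) Ψ x (mfderiv (𝓡∂ n) (𝓡∂ n) Ψ.symm (Ψ x) v)) = v := by
    rintro y rfl hy
    exact hy
  exact h2 _ h1 h

theorem tanId_symm_tanId {p : TanB n M} (hp : p.proj ∈ Ψ.source) :
    tanId Ψ.symm (tanId Ψ p) = p := by
  have h1 : Ψ.symm (Ψ p.proj) = p.proj := Ψ.left_inv hp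
  have h2 : tanId Ψ.symm (tanId Ψ p) = tvec (Ψ.symm (Ψ p.proj)) (TanB.vec p) := by
    show tvec (Ψ.symm (Ψ p.proj)) _ = _
    exact congrArg _ (hΨ.mfderiv_symm_mfderiv hp (TanB.vec p))
  rw [h2, h1]
  rfl

theorem cotId_symm_cotId {q : CotB n M} (hq : q.proj ∈ Ψ.source) :
    cotId Ψ.symm (cotId Ψ q) = q := by
  have h1 : Ψ.symm (Ψ q.proj) = q.proj := Ψ.left_inv hq
  have h2 : cotId Ψ.symm (cotId Ψ q) = cvec (Ψ.symm (Ψ q.proj)) (CotB.covec q) := by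
    show cvec (Ψ.symm (Ψ q.proj)) _ = _
    refine congrArg _ ?_
    ext1 w
    show CotB.covec q (mfderiv (𝓡∂ n) (𝓡∂ n) Ψ.symm (Ψ q.proj)
      (mfderiv (𝓡∂ n) (𝓡∂ n) Ψ (Ψ.symm (Ψ q.proj)) w)) = _
    rw [h1]
    exact congrArg (CotB.covec q) (hΨ.mfderiv_symm_mfderiv hq w)
  rw [h2, h1]
  rfl

theorem tanId_mem_slit {p : TanB n M} (hp : p.proj ∈ Ψ.source) (h : p ∈ slit n M) :
    tanId Ψ p ∈ slit n M' := by
  intro h0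
  refine h ?_
  have h1 := hΨ.mfderiv_symm_mfderiv hp (TanB.vec p)
  have h2 : (show Vec n from mfderiv (𝓡∂ n) (𝓡∂ n) Ψ p.proj (TanB.vec p)) = 0 := h0
  rw [← h1]
  exact (congrArg (fun w : Vec n => (show Vec n from mfderiv (𝓡∂ n) (𝓡∂ n) Ψ.symm (Ψ p.proj) w))
    h2).trans (map_zero (mfderiv (𝓡∂ n) (𝓡∂ n) Ψ.symm (Ψ p.proj)))

theorem tanId_normal_nonneg {p : TanB n M} (hp : p.proj ∈ (𝓡∂ n).boundary M)
    (h : 0 ≤ TanB.vec p 0) : 0 ≤ TanB.vec (tanId Ψ p) 0 :=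
  normal_nonneg_of_mapsTo_boundary
    ((hΨ.contMDiffAt (hΨ.subset_source hp)).mdifferentiableAt (by simp)) hp (hΨ.map_boundary hp) h

/-- Apply the inequality for the normal component to the vector and to its negative. Together with
the inverse identification this shows that inward and transversal vectors keep these properties. -/
theorem tanId_normal_eq_zero {p : TanB n M} (hp : p.proj ∈ (𝓡∂ n).boundary M)
    (h : TanB.vec p 0 = 0) : TanB.vec (tanId Ψ p) 0 = 0 := by
  have h1 := hΨ.tanId_normal_nonneg hp h.ge
  have h2 := hΨ.tanId_normal_nonneg (p := tvec p.proj (-TanB.vec p)) hp (by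
    show 0 ≤ (-TanB.vec p) 0
    simp [h])
  have h3 : TanB.vec (tanId Ψ (tvec p.proj (-TanB.vec p))) = -TanB.vec (tanId Ψ p) :=
    map_neg (mfderiv (𝓡∂ n) (𝓡∂ n) Ψ p.proj) (TanB.vec p)
  rw [h3] at h2
  have h4 : 0 ≤ -(TanB.vec (tanId Ψ p) 0) := h2
  linarith

theorem tanId_normal_ne_zero {p : TanB n M} (hp : p.proj ∈ (𝓡∂ n).boundary M)
    (h : TanB.vec p 0 ≠ 0) : TanB.vec (tanId Ψ p) 0 ≠ 0 := by
  intro h0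
  have h1 := hΨ.symm.tanId_normal_eq_zero (p := tanId Ψ p) (hΨ.map_boundary hp) h0
  rw [hΨ.tanId_symm_tanId (hΨ.subset_source hp)] at h1
  exact h h1

theorem tanId_normal_pos {p : TanB n M} (hp : p.proj ∈ (𝓡∂ n).boundary M)
    (h : 0 < TanB.vec p 0) : 0 < TanB.vec (tanId Ψ p) 0 :=
  lt_of_le_of_ne (hΨ.tanId_normal_nonneg hp h.le) (hΨ.tanId_normal_ne_zero hp h.ne').symm

theorem tanId_tdil (r : ℝ) (p : TanB n M) : tanId Ψ (tdil r p) = tdil r (tanId Ψ p) := by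
  show tvec (Ψ p.proj) _ = tvec (Ψ p.proj) _
  exact congrArg _ (map_smul (mfderiv (𝓡∂ n) (𝓡∂ n) Ψ p.proj) r (TanB.vec p))

theorem cotId_cdil (r : ℝ) (q : CotB n M) : cotId Ψ (cdil r q) = cdil r (cotId Ψ q) := rfl

end IsBoundaryIdentification

end

/-! ### Hamiltonians transported by canonical transformations -/

section

variable {n : ℕ} [NeZero n] {M M' : Type*}
  [TopologicalSpace M] [ChartedSpace (EuclideanHalfSpace n) M] [IsManifold (𝓡∂ n) ∞ M]
  [TopologicalSpace M'] [ChartedSpace (EuclideanHalfSpace n) M'] [IsManifold (𝓡∂ n) ∞ M']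
  {F : TanB n M → ℝ} {κ : OpenPartialHomeomorph (CotB n M) (CotB n M')}
  {F' : TanB n M' → ℝ} {D' : Set (TanB n M')}

namespace IsHomogeneousCanonical

variable (hκ : IsHomogeneousCanonical κ)

include hκ

theorem contMDiffAt {q : CotB n M} (hq : q ∈ κ.source) :
    ContMDiffAt (cotModel n) (cotModel n) ∞ κ q :=
  hκ.smooth.contMDiffAt (κ.open_source.mem_nhds hq)

theorem contMDiffAt_symm {q : CotB n M'} (hq : q ∈ κ.target) :
    ContMDiffAt (cotModel n) (cotModel n) ∞ κ.symm q :=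
  hκ.smooth_symm.contMDiffAt (κ.open_target.mem_nhds hq)

/-- Differentiating `κ ∘ κ.symm = id` gives a right inverse of the derivative. Surjectivity is
needed in order to identify the image of the Hamiltonian field, and to see that interior points stay
interior. -/
theorem exists_hasMFDerivAt {q : CotB n M} (hq : q ∈ κ.source) :
    ∃ D D' : (Vec n × Covec n) →L[ℝ] (Vec n × Covec n),
      HasMFDerivAt (cotModel n) (cotModel n) κ q D ∧
      (∀ a b, sympForm n (D a) (D b) = sympForm n a b) ∧ ∀ b, D (D' b) = b := by
  have h1 := ((hκ.contMDiffAt hq).mdifferentiableAt (by simp)).hasMFDerivAt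
  have h2 := ((hκ.contMDiffAt_symm (κ.map_source hq)).mdifferentiableAt (by simp)).hasMFDerivAt
  refine ⟨_, mfderiv (cotModel n) (cotModel n) κ.symm (κ q), h1, fun a b => hκ.symplectic q hq a b,
    fun b => ?_⟩
  have h1' : HasMFDerivAt (cotModel n) (cotModel n) κ (κ.symm (κ q))
      (mfderiv (cotModel n) (cotModel n) κ (κ.symm (κ q))) :=
    ((hκ.contMDiffAt (q := κ.symm (κ q)) (by rwa [κ.left_inv hq])).mdifferentiableAt
      (by simp)).hasMFDerivAt
  have h3 := h1'.comp (κ q) h2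
  have h4 : κ ∘ κ.symm =ᶠ[𝓝 (κ q)] id := by
    filter_upwards [κ.open_target.mem_nhds (κ.map_source hq)] with y hy using κ.right_inv hy
  have h5 : HasMFDerivAt (cotModel n) (cotModel n) id (κ q) _ := h3.congr_of_eventuallyEq h4.symm
  have h6 := hasMFDerivAt_unique h5 (hasMFDerivAt_id (κ q))
  have h7 := congrArg (fun A : (Vec n × Covec n) →L[ℝ] (Vec n × Covec n) => A b) h6
  have h8 : ∀ y, y = q → (show Vec n × Covec n from mfderiv (cotModel n) (cotModel n) κ y
      (show Vec n × Covec n from mfderiv (cotModel n) (cotModel n) κ.symm (κ q) b)) = b →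
      (show Vec n × Covec n from mfderiv (cotModel n) (cotModel n) κ q
      (show Vec n × Covec n from mfderiv (cotModel n) (cotModel n) κ.symm (κ q) b)) = b := by
    rintro y rfl hy
    exact hy
  exact h8 _ (κ.left_inv hq) h7

/-- A differentiable map whose derivative at an interior point is onto cannot send this point to the
boundary. This makes transported geodesics run over the interior until their last moment. -/
theorem proj_mem_interior {q : CotB n M} (hq : q ∈ κ.source) (h : q.proj ∈ (𝓡∂ n).interior M) :
    (κ q).proj ∈ (𝓡∂ n).interior M' := by
  obtain ⟨D, D', hD, -, hDD'⟩ := hκ.exists_hasMFDerivAt hq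
  rw [← cot_mem_interior_iff] at h ⊢
  refine hD.mdifferentiableAt.isInteriorPoint_of_surjective_mfderiv ?_ h
  rw [hD.mfderiv]
  exact fun b => ⟨D' b, hDD' b⟩

theorem symm_cdil {q : CotB n M'} (hq : q ∈ κ.target) {r : ℝ} (hr : 0 < r) :
    cdil r q ∈ κ.target ∧ κ.symm (cdil r q) = cdil r (κ.symm q) := by
  obtain ⟨h1, h2⟩ := hκ.homogeneous _ (κ.map_target hq) r hr
  rw [κ.right_inv hq] at h2
  refine ⟨?_, ?_⟩
  · rw [← h2]; exact κ.map_source h1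
  · rw [← h2, κ.left_inv h1]

end IsHomogeneousCanonical

section Pushforward

variable (hF : IsFinsler F) (hΓ : κ.source ⊆ coslit n M) (hκ : IsHomogeneousCanonical κ)

include hF hΓ hκ

theorem contMDiffAt_pushforward {q : CotB n M'} (hq : q ∈ κ.target) :
    ContMDiffAt (cotModel n) 𝓘(ℝ, ℝ) ∞ (fun q => hamiltonian F (κ.symm q)) q :=
  (hF.contMDiffAt_hamiltonian (hΓ (κ.map_target hq))).comp q (hκ.contMDiffAt_symm hq)

theorem eventually_contMDiffAt_pushforward {q : CotB n M'} (hq : q ∈ κ.target) :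
    ∀ᶠ q' in 𝓝 q, ContMDiffAt (cotModel n) 𝓘(ℝ, ℝ) ∞ (fun q => hamiltonian F (κ.symm q)) q' :=
  (eventually_mem_set.2 (κ.open_target.mem_nhds hq)).mono fun _ h =>
    contMDiffAt_pushforward hF hΓ hκ h

theorem euler_pushforward {q : CotB n M'} (hq : q ∈ κ.target) :
    fderiv ℝ (fun ζ => hamiltonian F (κ.symm (cvec q.proj ζ))) (CotB.covec q) (CotB.covec q) =
      2 * hamiltonian F (κ.symm q) := by
  refine euler_two ((contDiffAt_fibre_cot (contMDiffAt_pushforward hF hΓ hκ hq)).differentiableAt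
    (by simp)).hasFDerivAt fun r hr => ?_
  show hamiltonian F (κ.symm (cdil r q)) = r ^ 2 * hamiltonian F (κ.symm q)
  rw [(hκ.symm_cdil hq hr).2, hF.hamiltonian_cdil (hΓ (κ.map_target hq)) hr]

theorem hamField_pushforward {q : CotB n M} (hq : q ∈ κ.source) :
    ∃ D : (Vec n × Covec n) →L[ℝ] (Vec n × Covec n),
      HasMFDerivAt (cotModel n) (cotModel n) κ q D ∧
      D (hamField (hamiltonian F) q) = hamField (fun q => hamiltonian F (κ.symm q)) (κ q) := by
  obtain ⟨D, D', hD, hs, hDD'⟩ := hκ.exists_hasMFDerivAt hq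
  refine ⟨D, hD, hamField_conj hD hs hDD'
    ((contMDiffAt_pushforward hF hΓ hκ (κ.map_source hq)).mdifferentiableAt (by simp)) ?_⟩
  filter_upwards [κ.open_source.mem_nhds hq] with p hp
  rw [κ.left_inv hp]

variable (hconv : StrictConvexFiberOn (fun q => hamiltonian F (κ.symm q)) κ.target)
  (hF' : IsFinslerOn F' D')
  (hdual : IsLegendreDualOn F' D' (fun q => hamiltonian F (κ.symm q)) κ.target)

omit hF hΓ hκ

include hdual in
theorem velocity_mem {q : CotB n M'} (hq : q ∈ κ.target) :
    velocity (fun q => hamiltonian F (κ.symm q)) q ∈ D' ∧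
      energy F' (velocity (fun q => hamiltonian F (κ.symm q)) q) = hamiltonian F (κ.symm q) :=
  hdual q hq _ fun θ => (apply_bidual _ θ).symm

include hF hΓ hκ hconv hF' hdual

theorem legendre_velocity_pushforward {q : CotB n M'} (hq : q ∈ κ.target) :
    legendre F' (velocity (fun q => hamiltonian F (κ.symm q)) q) = q :=
  legendre_velocity (contMDiffAt_pushforward hF hΓ hκ hq)
    ((eventually_mem_set.2 (κ.open_target.mem_nhds hq)).mono fun _ h =>
      euler_pushforward hF hΓ hκ h)
    (hconv q hq) (hF'.contMDiffAt (velocity_mem hdual hq).1)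
    ((eventually_mem_set.2 (κ.open_target.mem_nhds hq)).mono fun _ h => (velocity_mem hdual h).2)

theorem isDualAt_pushforward {q : CotB n M'} (hq : q ∈ κ.target) :
    IsDualAt F' (fun q => hamiltonian F (κ.symm q))
      (velocity (fun q => hamiltonian F (κ.symm q)) q) :=
  isDualAt_velocity (eventually_contMDiffAt_pushforward hF hΓ hκ hq)
    ((eventually_mem_set.2 (κ.open_target.mem_nhds hq)).mono fun _ h =>
      euler_pushforward hF hΓ hκ h)
    (hF'.contMDiffAt (velocity_mem hdual hq).1)
    ((eventually_mem_set.2 (κ.open_target.mem_nhds hq)).mono fun _ h => (velocity_mem hdual h).2)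
    (legendre_velocity_pushforward hF hΓ hκ hconv hF' hdual hq)

end Pushforward

/-- Geodesics are the projections of the orbits of the Hamiltonian flow. -/
theorem IsFirstHitGeodesic.isMIntegralCurveOn (hF : IsFinsler F) {c : ℝ → TanB n M} {T : ℝ}
    (hc : IsFirstHitGeodesic F (slit n M) c T) :
    IsMIntegralCurveOn (fun t => legendre F (c t)) (hamField (hamiltonian F)) (Icc 0 T) :=
  (solvesEulerLagrange_iff_isMIntegralCurveOn hc.eulerLagrange.1
    (fun t ht => hF.isFinslerOn.eventually_contMDiffAt (hc.mem t ht))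
    (fun t ht => hF.isDualAt (hc.mem t ht))).1 hc.eulerLagrange

/-- The velocity of the transformed Hamiltonian over the boundary. -/
theorem velocity_boundary (hF : IsFinsler F)
    {Ψ : OpenPartialHomeomorph M M'}
    (hΨ : IsBoundaryIdentification (n := n) Ψ) (hid : IsBoundaryIdentity Ψ κ.source κ)
    {p : TanB n M} (hp : p ∈ slit n M)
    (hq : legendre F p ∈ κ.source) (hb : p.proj ∈ (𝓡∂ n).boundary M) :
    velocity (fun q => hamiltonian F (κ.symm q)) (κ (legendre F p)) = tanId Ψ p := by
  have hx := hΨ.subset_source hb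
  set A : Vec n →L[ℝ] Vec n := mfderiv (𝓡∂ n) (𝓡∂ n) Ψ p.proj with hA
  set B : Vec n →L[ℝ] Vec n := mfderiv (𝓡∂ n) (𝓡∂ n) Ψ.symm (Ψ p.proj) with hB
  have hAB : ∀ w, A (B w) = w := fun w => hΨ.mfderiv_mfderiv_symm hx w
  have hBA : ∀ w, B (A w) = w := fun w => hΨ.mfderiv_symm_mfderiv hx w
  have hκq : κ (legendre F p) = cotId Ψ (legendre F p) := hid _ hq hb
  set Λ : Covec n →L[ℝ] Covec n := (ContinuousLinearMap.compL ℝ (Vec n) (Vec n) ℝ).flip A with hΛ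
  have hΛB : ∀ ξ : Covec n, Λ (ξ.comp B) = ξ := fun ξ => by
    ext1 w
    exact congrArg ξ (hBA w)
  set ζ₀ := CotB.covec (cotId Ψ (legendre F p)) with hζ₀
  have hΛζ : Λ ζ₀ = CotB.covec (legendre F p) := hΛB _
  -- Near the point, `κ` agrees with the linear identification on a whole open piece of the fibre.
  -- Restricted to the fibre, the transported Hamiltonian is thus `H ∘ Λ` with `Λ` linear, and its
  -- fibre derivative is that of `H` transformed by the adjoint of `Λ`.
  have hev : ∀ᶠ ζ in 𝓝 ζ₀, hamiltonian F (κ.symm (cvec (Ψ p.proj) ζ)) =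
      hamiltonian F (cvec p.proj (Λ ζ)) := by
    have h1 : Tendsto (fun ζ => cvec (n := n) p.proj (Λ ζ)) (𝓝 ζ₀) (𝓝 (legendre F p)) := by
      have h2 := (continuousAt_cvec (legendre F p)).tendsto
      have h3 : Tendsto Λ (𝓝 ζ₀) (𝓝 (CotB.covec (legendre F p))) := by
        rw [← hΛζ]; exact Λ.continuous.tendsto ζ₀
      exact h2.comp h3
    filter_upwards [h1.eventually (κ.open_source.mem_nhds hq)] with ζ hζ
    have h4 : κ (cvec p.proj (Λ ζ)) = cvec (Ψ p.proj) ζ := by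
      rw [hid _ hζ hb]
      show cvec (Ψ p.proj) _ = _
      refine congrArg _ ?_
      ext1 w
      exact congrArg ζ (hAB w)
    rw [← h4, κ.left_inv hζ]
  have hd : HasFDerivAt (fun ζ => hamiltonian F (cvec p.proj (Λ ζ)))
      ((fderiv ℝ (fun ζ => hamiltonian F (cvec p.proj ζ)) (CotB.covec (legendre F p))).comp Λ)
      ζ₀ := by
    refine HasFDerivAt.comp ζ₀ (g := fun ζ => hamiltonian F (cvec p.proj ζ)) ?_ Λ.hasFDerivAt
    rw [hΛζ]
    exact ((contDiffAt_fibre_cot (hF.contMDiffAt_hamiltonian_legendre hp)).differentiableAt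
      (by simp)).hasFDerivAt
  rw [hκq]
  show tvec (Ψ p.proj) _ = tvec (Ψ p.proj) (A (TanB.vec p))
  refine congrArg _ (eq_bidual fun θ => ?_).symm
  have h5 : fderiv ℝ (fun ζ => hamiltonian F (κ.symm (cvec (Ψ p.proj) ζ))) ζ₀ = _ :=
    (hd.congr_of_eventuallyEq hev).fderiv
  have h6 := congrArg (fun l : Covec n →L[ℝ] ℝ => l θ) h5
  refine h6.trans ?_
  show fderiv ℝ (fun ζ => hamiltonian F (cvec p.proj ζ)) (CotB.covec (legendre F p)) (Λ θ) = _
  rw [hF.fderiv_hamiltonian_legendre hp]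
  rfl

end

/-! ### Geodesics of the transported metric and their uniqueness -/

section

variable {n : ℕ} [NeZero n] {M M' : Type*}
  [TopologicalSpace M] [ChartedSpace (EuclideanHalfSpace n) M] [IsManifold (𝓡∂ n) ∞ M]
  [TopologicalSpace M'] [ChartedSpace (EuclideanHalfSpace n) M'] [IsManifold (𝓡∂ n) ∞ M']
  {F : TanB n M → ℝ} {κ : OpenPartialHomeomorph (CotB n M) (CotB n M')}
  {F' : TanB n M' → ℝ} {D' : Set (TanB n M')}

/-- The Legendre transform is injective on short vertical segments. -/
theorem IsFinslerOn.legendre_injective_near {F : TanB n M → ℝ} {D : Set (TanB n M)}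
    (hF : IsFinslerOn F D) {p₀ : TanB n M} (hp₀ : p₀ ∈ D) :
    ∃ U ∈ 𝓝 p₀, ∀ p ∈ U, ∀ p' ∈ U, p'.proj = p.proj →
      legendre F p' = legendre F p → p' = p := by
  set e := extChartAt (𝓡∂ n).tangent p₀
  have h1 : ∀ᶠ z in 𝓝[halfRange n ×ˢ univ] (e p₀), e.symm z ∈ D := by
    have h2 := (continuousAt_extChartAt_symm (I := (𝓡∂ n).tangent) p₀).tendsto
    rw [extChartAt_to_inv] at h2
    exact (h2.mono_left nhdsWithin_le_nhds).eventually (hF.isOpen.mem_nhds hp₀)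
  obtain ⟨ε, hε, hball⟩ := Metric.mem_nhdsWithin_iff.1 h1
  have hU : ∀ᶠ p in 𝓝 p₀, p.proj ∈ dom (n := n) p₀.proj ∧ e p ∈ Metric.ball (e p₀) ε :=
    (eventually_proj_tan (dom_mem_nhds (mem_chart_source _ p₀.proj))).and
      ((continuousAt_extChartAt p₀).eventually (Metric.ball_mem_nhds _ hε))
  -- The cone `D` need not be fibrewise convex. In the bundle chart a vertical segment between two
  -- points of a small ball stays in the ball and hence in `D`, so the tangent inequality holds
  -- there; two such inequalities with equal derivatives contradict each other.
  have key : ∀ (x : M) (v w : Vec n), x ∈ dom (n := n) p₀.proj →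
      e (tvec x v) ∈ Metric.ball (e p₀) ε → e (tvec x w) ∈ Metric.ball (e p₀) ε → v ≠ w →
      halfSq F x v + fderiv ℝ (halfSq F x) v (w - v) < halfSq F x w := by
    intro x v w hx hv hw hvw
    have hmem : ∀ t ∈ Icc (0 : ℝ) 1, tvec x (v + t • (w - v)) ∈ D := by
      intro t ht
      have h3 := (convex_ball (e p₀) ε).add_smul_sub_mem hv hw ht
      have h4 : e (tvec x v) + t • (e (tvec x w) - e (tvec x v)) =
          e (tvec x (v + t • (w - v))) := by
        have h5 : ∀ w : Vec n, e (tvec x w) = (extChartAt (𝓡∂ n) p₀.proj x, toChart p₀.proj x w) :=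
          fun w => tan_extChartAt p₀ (tvec x w)
        rw [h5, h5, h5]
        refine Prod.ext ?_ ?_
        · show extChartAt (𝓡∂ n) p₀.proj x + t • (extChartAt (𝓡∂ n) p₀.proj x -
            extChartAt (𝓡∂ n) p₀.proj x) = extChartAt (𝓡∂ n) p₀.proj x
          rw [sub_self, smul_zero, add_zero]
        · show toChart p₀.proj x v + t • (toChart p₀.proj x w - toChart p₀.proj x v) =
            toChart p₀.proj x (v + t • (w - v))
          rw [map_add, map_smul, map_sub]
      rw [h4] at h3
      have h6 : e.symm (e (tvec x (v + t • (w - v)))) ∈ D :=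
        hball ⟨h3, extChartAt_mem_range _ _, mem_univ _⟩
      rwa [e.left_inv ((tan_mem_source p₀ (tvec x (v + t • (w - v)))).2 hx)] at h6
    refine tangent_lt (fun t ht => ?_) fun t ht => ?_
    · exact (contDiffAt_fibre_tan (contMDiffAt_energy (hF.contMDiffAt (hmem t ht)))).of_le
        (by norm_cast)
    · exact hF.posDef _ (hmem t ht) _ (sub_ne_zero.2 hvw.symm)
  refine ⟨_, hU, fun p hp p' hp' hproj hleg => ?_⟩
  obtain ⟨x, v⟩ := p
  obtain ⟨x', v'⟩ := p'
  obtain rfl : x' = x := hproj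
  by_contra hne
  have hvv : v ≠ v' := fun h => hne (by rw [h])
  have h7 : fderiv ℝ (halfSq F x') v' = fderiv ℝ (halfSq F x') v := by
    have h8 : CotB.covec (legendre F ⟨x', v'⟩) = CotB.covec (legendre F ⟨x', v⟩) := by rw [hleg]
    exact h8
  have h9 := key x' v v' hp.1 hp.2 hp'.2 hvv
  have h10 := key x' v' v hp.1 hp'.2 hp.2 hvv.symm
  have h11 : ∀ a b : Vec n, fderiv ℝ (halfSq F x') v (a - b) =
      fderiv ℝ (halfSq F x') v a - fderiv ℝ (halfSq F x') v b :=
    fun a b => ContinuousLinearMap.map_sub _ a b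
  rw [h7] at h10
  have h12 := h11 v' v
  have h13 := h11 v v'
  linarith

section Pushforward

variable (hF : IsFinsler F) (hΓ : κ.source ⊆ coslit n M) (hκ : IsHomogeneousCanonical κ)
  (hconv : StrictConvexFiberOn (fun q => hamiltonian F (κ.symm q)) κ.target)
  (hF' : IsFinslerOn F' D')
  (hdual : IsLegendreDualOn F' D' (fun q => hamiltonian F (κ.symm q)) κ.target)

include hF hΓ hκ hconv hF' hdual

/-- Geodesics of `F` are carried to geodesics of the transformed metric. -/
theorem IsFirstHitGeodesic.pushforward {Ψ : OpenPartialHomeomorph M M'}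
    (hΨ : IsBoundaryIdentification (n := n) Ψ) (hid : IsBoundaryIdentity Ψ κ.source κ)
    {c : ℝ → TanB n M} {T : ℝ} (hc : IsFirstHitGeodesic F (slit n M) c T)
    (hcs : ∀ t ∈ Icc 0 T, legendre F (c t) ∈ κ.source) (hb : (c 0).proj ∈ (𝓡∂ n).boundary M) :
    ∃ c' : ℝ → TanB n M', IsFirstHitGeodesic F' D' c' T ∧ c' 0 = tanId Ψ (c 0) ∧
      c' T = tanId Ψ (c T) ∧ ∀ t ∈ Icc 0 T, ∃ q ∈ κ.target,
        c' t = velocity (fun q => hamiltonian F (κ.symm q)) q := by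
  have hkt : ∀ t ∈ Icc 0 T, κ (legendre F (c t)) ∈ κ.target := fun t ht => κ.map_source (hcs t ht)
  have hint := hc.isMIntegralCurveOn hF
  have hint' : IsMIntegralCurveOn (fun t => κ (legendre F (c t)))
      (hamField fun q => hamiltonian F (κ.symm q)) (Icc 0 T) :=
    isMIntegralCurveOn_comp hint fun t ht => hamField_pushforward hF hΓ hκ (hcs t ht)
  have hcont : ContinuousOn
      (fun t => velocity (fun q => hamiltonian F (κ.symm q)) (κ (legendre F (c t)))) (Icc 0 T) := by
    intro t ht
    exact ContinuousAt.comp_continuousWithinAt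
      (g := velocity fun q => hamiltonian F (κ.symm q))
      (continuousAt_velocity (eventually_contMDiffAt_pushforward hF hΓ hκ (hkt t ht)))
      (hint' t ht).continuousWithinAt
  refine ⟨fun t => velocity (fun q => hamiltonian F (κ.symm q)) (κ (legendre F (c t))),
    ⟨hc.pos, fun t ht => (velocity_mem hdual (hkt t ht)).1, ?_, ?_, ?_⟩, ?_, ?_,
    fun t ht => ⟨_, hkt t ht, rfl⟩⟩
  -- The Euler–Lagrange equations for the velocity curve are Hamilton's equations for its Legendre
  -- transform, which is again the transported orbit, a known integral curve.
  · refine (solvesEulerLagrange_iff_isMIntegralCurveOn hcont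
      (fun t ht => hF'.eventually_contMDiffAt (velocity_mem hdual (hkt t ht)).1)
      (fun t ht => isDualAt_pushforward hF hΓ hκ hconv hF' hdual (hkt t ht))).2 ?_
    intro t ht
    have h1 : ∀ s ∈ Icc 0 T, legendre F' (velocity (fun q => hamiltonian F (κ.symm q))
        (κ (legendre F (c s)))) = κ (legendre F (c s)) := fun s hs =>
      legendre_velocity_pushforward hF hΓ hκ hconv hF' hdual (hkt s hs)
    have h2 := HasMFDerivWithinAt.congr_mono (hint' t ht) h1 (h1 t ht) subset_rfl
    have h3 := congrArg (fun q => ContinuousLinearMap.smulRight (1 : ℝ →L[ℝ] ℝ)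
      (hamField (fun q => hamiltonian F (κ.symm q)) q : Vec n × Covec n)) (h1 t ht)
    exact h3 ▸ h2
  · intro t ht
    exact hκ.proj_mem_interior (hcs t (Ioo_subset_Icc_self ht)) (hc.interior t ht)
  · have hT : T ∈ Icc 0 T := ⟨hc.pos.le, le_rfl⟩
    have h1 : κ (legendre F (c T)) = cotId Ψ (legendre F (c T)) := hid _ (hcs T hT) hc.boundary
    show (κ (legendre F (c T))).proj ∈ _
    rw [h1]
    exact hΨ.map_boundary hc.boundary
  · have h0 : (0 : ℝ) ∈ Icc 0 T := ⟨le_rfl, hc.pos.le⟩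
    exact velocity_boundary hF hΨ hid (hc.mem 0 h0) (hcs 0 h0) hb
  · have hT : T ∈ Icc 0 T := ⟨hc.pos.le, le_rfl⟩
    exact velocity_boundary hF hΨ hid (hc.mem T hT) (hcs T hT) hc.boundary

/-- That the Legendre transform is a left inverse of the velocity map is known on all of `κ.target`.
For the other composition, `p` and the velocity of its Legendre image have the same base point and
the same Legendre image, and both are close to `p₀`; local injectivity makes them equal. -/
theorem eventually_velocity_legendre {q : CotB n M'} (hq : q ∈ κ.target) :
    ∀ᶠ p in 𝓝 (velocity (fun q => hamiltonian F (κ.symm q)) q),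
      legendre F' p ∈ κ.target ∧ velocity (fun q => hamiltonian F (κ.symm q)) (legendre F' p) = p := by
  set p₀ := velocity (fun q => hamiltonian F (κ.symm q)) q with hp₀
  have hpD : p₀ ∈ D' := (velocity_mem hdual hq).1
  have hleg : legendre F' p₀ = q := legendre_velocity_pushforward hF hΓ hκ hconv hF' hdual hq
  have hc1 : ContinuousAt (legendre F') p₀ :=
    continuousAt_legendre (hF'.eventually_contMDiffAt hpD)
  have hc2 : ContinuousAt (velocity fun q => hamiltonian F (κ.symm q)) (legendre F' p₀) := by
    rw [hleg]
    exact continuousAt_velocity (eventually_contMDiffAt_pushforward hF hΓ hκ hq)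
  have ht1 : ∀ᶠ p in 𝓝 p₀, legendre F' p ∈ κ.target :=
    hc1.eventually (by rw [hleg]; exact κ.open_target.mem_nhds hq)
  have ht2 : Tendsto (fun p => velocity (fun q => hamiltonian F (κ.symm q)) (legendre F' p))
      (𝓝 p₀) (𝓝 p₀) := by
    have h1 := (ContinuousAt.comp (g := velocity fun q => hamiltonian F (κ.symm q)) hc2 hc1).tendsto
    simp only [Function.comp_def, hleg] at h1
    exact h1
  obtain ⟨U, hU, hUinj⟩ : ∃ U ∈ 𝓝 p₀, ∀ p ∈ U, ∀ p' ∈ U, p'.proj = p.proj →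
      legendre F' p' = legendre F' p → p' = p := hF'.legendre_injective_near hpD
  filter_upwards [ht1, hU, ht2.eventually hU] with p h1 h2 h3
  refine ⟨h1, ?_⟩
  exact hUinj p h2 _ h3 rfl (legendre_velocity_pushforward hF hΓ hκ hconv hF' hdual h1)

variable [T2Space M']

/-- Uniqueness for the geodesic flow of the transformed metric. -/
theorem geodesic_eqOn {c₁ c₂ : ℝ → TanB n M'} {T₁ T₂ S : ℝ} (hS : 0 ≤ S) (hS₁ : S ≤ T₁) (hS₂ : S ≤ T₂)
    (h₁ : SolvesEulerLagrange (energy F') c₁ T₁) (h₂ : SolvesEulerLagrange (energy F') c₂ T₂)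
    (hc₁ : ∀ t ∈ Icc 0 T₁, ∃ q ∈ κ.target,
        c₁ t = velocity (fun q => hamiltonian F (κ.symm q)) q)
    (h0 : c₁ 0 = c₂ 0) : EqOn c₁ c₂ (Icc 0 S) := by
  rw [solvesEulerLagrange_iff] at h₁ h₂
  have hsub₁ : Icc 0 S ⊆ Icc 0 T₁ := Icc_subset_Icc_right hS₁
  have hsub₂ : Icc 0 S ⊆ Icc 0 T₂ := Icc_subset_Icc_right hS₂
  have hcont₁ := h₁.1.mono hsub₁
  have hcont₂ := h₂.1.mono hsub₂
  -- Nothing is assumed about where `c₂` runs. Near a common point of the curves both are velocities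
  -- of covectors in `κ.target`, so both come from orbits of the same smooth Hamiltonian field, for
  -- which uniqueness holds up to the boundary.
  refine Icc_clopen_induction (t₀ := 0) ⟨le_rfl, hS⟩ h0 ?_ ?_
  · intro t ht heq
    obtain ⟨q, hq, hqt⟩ := hc₁ t (hsub₁ ht)
    have hev := eventually_velocity_legendre hF hΓ hκ hconv hF' hdual hq
    rw [← hqt] at hev
    have hev₁ := (hcont₁ t ht).eventually hev
    rw [heq] at hev
    have hev₂ := (hcont₂ t ht).eventually hev
    have hev₃ := hev₁.and hev₂
    rw [eventually_nhdsWithin_iff, Metric.eventually_nhds_iff] at hev₃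
    obtain ⟨ε, hε, hball⟩ := hev₃
    have hnear : ∀ s ∈ Icc (max 0 (t - ε / 2)) (min S (t + ε / 2)), s ∈ Icc 0 S ∧ dist s t < ε := by
      intro s hs
      have a1 := le_max_left 0 (t - ε / 2)
      have a2 := le_max_right 0 (t - ε / 2)
      have a3 := min_le_left S (t + ε / 2)
      have a4 := min_le_right S (t + ε / 2)
      refine ⟨⟨a1.trans hs.1, hs.2.trans a3⟩, ?_⟩
      rw [Real.dist_eq, abs_lt]
      constructor <;> linarith [hs.1, hs.2]
    have htn : t ∈ Icc (max 0 (t - ε / 2)) (min S (t + ε / 2)) :=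
      ⟨max_le ht.1 (by linarith), le_min ht.2 (by linarith)⟩
    have hcurve : ∀ (c : ℝ → TanB n M') (T : ℝ), Icc 0 S ⊆ Icc 0 T →
        (ContinuousOn c (Icc 0 T) ∧ ∀ t ∈ Icc 0 T,
          (HasDerivWithinAt (fun s => (extChartAt (𝓡∂ n).tangent (c t) (c s)).1) (TanB.vec (c t))
            (Icc 0 T) t ∧
          HasDerivWithinAt (fun s => fibDeriv (energy F' ∘ (extChartAt (𝓡∂ n).tangent (c t)).symm)
            (extChartAt (𝓡∂ n).tangent (c t) (c s))) (baseDeriv F' (c t)) (Icc 0 T) t)) →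
        (∀ s ∈ Icc (max 0 (t - ε / 2)) (min S (t + ε / 2)), legendre F' (c s) ∈ κ.target ∧
          velocity (fun q => hamiltonian F (κ.symm q)) (legendre F' (c s)) = c s) →
        IsMIntegralCurveOn (fun s => legendre F' (c s)) (hamField fun q => hamiltonian F (κ.symm q))
          (Icc (max 0 (t - ε / 2)) (min S (t + ε / 2))) := by
      intro c T hT hc hv s hs
      have hss : Icc (max 0 (t - ε / 2)) (min S (t + ε / 2)) ⊆ Icc 0 T := fun s hs =>
        hT (hnear s hs).1
      have hvs := hv s hs
      have hD : c s ∈ D' := by rw [← hvs.2]; exact (velocity_mem hdual hvs.1).1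
      have hdl : IsDualAt F' (fun q => hamiltonian F (κ.symm q)) (c s) := by
        rw [← hvs.2]; exact isDualAt_pushforward hF hΓ hκ hconv hF' hdual hvs.1
      exact (hasMFDerivWithinAt_legendre_iff hs ((hc.1 s (hss hs)).mono hss)
        (hF'.eventually_contMDiffAt hD) hdl).2
        ⟨(hc.2 s (hss hs)).1.mono hss, (hc.2 s (hss hs)).2.mono hss⟩
    have hv₁ : ∀ s ∈ Icc (max 0 (t - ε / 2)) (min S (t + ε / 2)), legendre F' (c₁ s) ∈ κ.target ∧
          velocity (fun q => hamiltonian F (κ.symm q)) (legendre F' (c₁ s)) = c₁ s := fun s hs =>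
      (hball (hnear s hs).2 (hnear s hs).1).1
    have hv₂ : ∀ s ∈ Icc (max 0 (t - ε / 2)) (min S (t + ε / 2)), legendre F' (c₂ s) ∈ κ.target ∧
          velocity (fun q => hamiltonian F (κ.symm q)) (legendre F' (c₂ s)) = c₂ s := fun s hs =>
      (hball (hnear s hs).2 (hnear s hs).1).2
    have hE := isMIntegralCurveOn_eqOn bdf_inward range_cotModel_eq htn (hcurve c₁ T₁ hsub₁ h₁ hv₁)
      (hcurve c₂ T₂ hsub₂ h₂ hv₂) (fun s hs => (symplecticFieldAt_hamField
        (contMDiffAt_pushforward hF hΓ hκ (hv₁ s hs).1)).1) (by rw [heq])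
    have hfin : ∀ s ∈ Icc 0 S, dist s t < ε / 2 → c₁ s = c₂ s := by
      intro s hs hd
      rw [Real.dist_eq, abs_lt] at hd
      have hsn : s ∈ Icc (max 0 (t - ε / 2)) (min S (t + ε / 2)) :=
        ⟨max_le hs.1 (by linarith), le_min hs.2 (by linarith)⟩
      have h3 : legendre F' (c₁ s) = legendre F' (c₂ s) := hE hsn
      rw [← (hv₁ s hsn).2, ← (hv₂ s hsn).2, h3]
    rw [eventually_nhdsWithin_iff, Metric.eventually_nhds_iff]
    exact ⟨ε / 2, by linarith, fun s hd hs => hfin s hs hd⟩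
  · intro t ht hfr
    by_contra hne
    obtain ⟨u, v, hu, hv, hxu, hxv, hd⟩ := t2_separation hne
    have h3 : ∀ᶠ s in 𝓝[Icc 0 S] t, c₁ s ∈ u ∧ c₂ s ∈ v :=
      ((hcont₁ t ht).eventually (hu.mem_nhds hxu)).and ((hcont₂ t ht).eventually (hv.mem_nhds hxv))
    obtain ⟨s, hs1, hs2⟩ := (hfr.and_eventually h3).exists
    exact disjoint_left.1 hd hs2.1 (by rw [hs1]; exact hs2.2)

end Pushforward

end

/-! ### The direct problem -/

section

variable {n : ℕ} [NeZero n] {M M' : Type*}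
  [TopologicalSpace M] [ChartedSpace (EuclideanHalfSpace n) M] [IsManifold (𝓡∂ n) ∞ M]
  [TopologicalSpace M'] [ChartedSpace (EuclideanHalfSpace n) M'] [IsManifold (𝓡∂ n) ∞ M']
  {F : TanB n M → ℝ} {𝒰 : Set (TanB n M)}

theorem geodesicCone_subset_slit (hF : IsFinsler F) : geodesicCone F 𝒰 ⊆ slit n M := by
  rintro p ⟨c, T, hc, -, t, ht, r, hr, rfl⟩
  exact hF.isFinslerOn.conic _ (hc.mem t ht) r hr

theorem legendre_geodesicCone_subset_coslit (hF : IsFinsler F) :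
    legendre F '' geodesicCone F 𝒰 ⊆ coslit n M := by
  rintro _ ⟨p, hp, rfl⟩
  exact hF.legendre_mem_coslit (geodesicCone_subset_slit hF hp)

theorem IsFirstHitGeodesic.mem_geodesicCone {c : ℝ → TanB n M} {T : ℝ}
    (hc : IsFirstHitGeodesic F (slit n M) c T) (h0 : c 0 ∈ 𝒰) {t : ℝ} (ht : t ∈ Icc 0 T) :
    c t ∈ geodesicCone F 𝒰 :=
  ⟨c, T, hc, h0, t, ht, 1, one_pos, (tdil_one _).symm⟩

theorem IsAdmissible.proj_mem_boundary (h𝒰 : IsAdmissible F 𝒰) {u : TanB n M} (hu : u ∈ 𝒰) :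
    u.proj ∈ (𝓡∂ n).boundary M := by
  obtain ⟨O, -, h⟩ := h𝒰.relOpen
  rw [h] at hu
  exact hu.2.1

/-- Two geodesics that agree as long as both are defined hit the boundary at the same time. -/
theorem IsFirstHitGeodesic.time_eq {F F' : TanB n M → ℝ} {D D' : Set (TanB n M)}
    {c₁ c₂ : ℝ → TanB n M} {T₁ T₂ : ℝ} (h₁ : IsFirstHitGeodesic F D c₁ T₁)
    (h₂ : IsFirstHitGeodesic F' D' c₂ T₂) (h : EqOn c₁ c₂ (Icc 0 (min T₁ T₂))) : T₁ = T₂ := by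
  have hm : min T₁ T₂ ∈ Icc 0 (min T₁ T₂) := ⟨le_min h₁.pos.le h₂.pos.le, le_rfl⟩
  have h3 := h hm
  rcases lt_trichotomy T₁ T₂ with hlt | heq | hlt
  · rw [min_eq_left hlt.le] at h3
    have h4 := h₂.interior T₁ ⟨h₁.pos, hlt⟩
    rw [← h3] at h4
    exact absurd h₁.boundary (not_mem_boundary_of_mem_interior h4)
  · exact heq
  · rw [min_eq_right hlt.le] at h3
    have h4 := h₁.interior T₂ ⟨h₂.pos, hlt⟩
    rw [h3] at h4
    exact absurd h₂.boundary (not_mem_boundary_of_mem_interior h4)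

/-- Transport of geodesics by `κ` gives one implication. Conversely, a geodesic of the new metric
issued from the identified vector is compared with the transported geodesic of `F`, which exists by
admissibility; by uniqueness they agree and hit the boundary at the same time. Injectivity of the
identification over the boundary then recovers the exit vector. -/
theorem sameLensData_of_isLegendreDualOn [T2Space M'] {Ψ : OpenPartialHomeomorph M M'}
    (hΨ : IsBoundaryIdentification (n := n) Ψ) (hF : IsFinsler F) (h𝒰 : IsAdmissible F 𝒰)
    {κ : OpenPartialHomeomorph (CotB n M) (CotB n M')}
    (hκ : IsConvexCanonical (legendre F '' geodesicCone F 𝒰) (hamiltonian F) κ)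
    (hid : IsBoundaryIdentity Ψ (legendre F '' geodesicCone F 𝒰) κ)
    {F' : TanB n M' → ℝ} {D' : Set (TanB n M')} (hF' : IsFinslerOn F' D')
    (hdual : IsLegendreDualOn F' D' (fun q => hamiltonian F (κ.symm q)) κ.target) :
    SameLensData Ψ F (slit n M) F' D' 𝒰 := by
  have hΓ : κ.source ⊆ coslit n M := by
    rw [hκ.source_eq]; exact legendre_geodesicCone_subset_coslit hF
  rw [← hκ.source_eq] at hid
  have push : ∀ {c : ℝ → TanB n M} {T : ℝ}, IsFirstHitGeodesic F (slit n M) c T → c 0 ∈ 𝒰 →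
      ∃ c' : ℝ → TanB n M', IsFirstHitGeodesic F' D' c' T ∧ c' 0 = tanId Ψ (c 0) ∧
      c' T = tanId Ψ (c T) ∧ ∀ t ∈ Icc 0 T, ∃ q ∈ κ.target,
        c' t = velocity (fun q => hamiltonian F (κ.symm q)) q := by
    intro c T hc h0
    refine hc.pushforward hF hΓ hκ.canonical hκ.convex hF' hdual hΨ hid (fun t ht => ?_)
      (h𝒰.proj_mem_boundary h0)
    rw [hκ.source_eq]
    exact mem_image_of_mem _ (hc.mem_geodesicCone h0 ht)
  intro u hu T w hw
  constructor
  · rintro ⟨c, hc, rfl, rfl⟩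
    obtain ⟨c', hc', h1, h2, -⟩ := push hc hu
    exact ⟨c', hc', h1, h2⟩
  · rintro ⟨c₂, hc₂, h3, h4⟩
    obtain ⟨T₀, w₀, ⟨c, hc, rfl, rfl⟩, -⟩ := h𝒰.hits u hu
    obtain ⟨c', hc', h1, h2, h5⟩ := push hc hu
    have hE : EqOn c' c₂ (Icc 0 (min T₀ T)) :=
      geodesic_eqOn hF hΓ hκ.canonical hκ.convex hF' hdual (le_min hc'.pos.le hc₂.pos.le)
        (min_le_left _ _) (min_le_right _ _) hc'.eulerLagrange hc₂.eulerLagrange h5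
        (h1.trans h3.symm)
    obtain rfl := hc'.time_eq hc₂ hE
    have h6 : tanId Ψ (c T₀) = tanId Ψ w := by
      rw [← h2, ← h4]
      exact hE (by rw [min_self]; exact right_mem_Icc.2 hc.pos.le)
    have h7 := congrArg (tanId Ψ.symm) h6
    rw [hΨ.tanId_symm_tanId (hΨ.subset_source hc.boundary),
      hΨ.tanId_symm_tanId (hΨ.subset_source hw)] at h7
    exact ⟨c, hc, rfl, h7⟩

/-- This reduces a metric on all of `M'` to the case of a metric on a cone. Positivity of `G` keeps
`S` away from the zero section, and elsewhere every covector is the Legendre image of a vector,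
namely of its velocity. -/
theorem IsFinsler.isLegendreDualOn {F' : TanB n M' → ℝ} (hF' : IsFinsler F') {G : CotB n M' → ℝ}
    {S : Set (CotB n M')} (hS : IsOpen S) (hpos : ∀ q ∈ S, 0 < G q)
    (h : ∀ q ∈ S, G q = hamiltonian F' q) : IsLegendreDualOn F' (slit n M') G S := by
  intro q hq v hv
  have hne : q ∈ coslit n M' := by
    intro h0
    have h1 := hpos q hq
    rw [h q hq] at h1
    -- At the zero covector the supremum is over values that are all `0`. The two inequalities used
    -- also cover an empty set of values.
    have h2 : dualNorm F' q = 0 := by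
      rw [dualNorm]
      refine le_antisymm (Real.sSup_nonpos ?_) (Real.sSup_nonneg ?_) <;>
      · rintro s ⟨v, -, rfl⟩
        rw [h0]
        exact le_rfl
    rw [hamiltonian, h2] at h1
    norm_num at h1
  obtain ⟨p, hp, hproj, rfl⟩ := hF'.exists_legendre_eq hne
  have hev : (fun ζ => G (cvec (legendre F' p).proj ζ)) =ᶠ[𝓝 (CotB.covec (legendre F' p))]
      fun ζ => hamiltonian F' (cvec p.proj ζ) := by
    filter_upwards [(continuousAt_cvec (legendre F' p)).eventually (hS.mem_nhds hq)] with ζ hζ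
    exact h _ hζ
  have hvp : v = TanB.vec p := eq_of_forall_covec fun θ => by
    rw [← hv θ, hev.fderiv_eq, hF'.fderiv_hamiltonian_legendre hp]
  have h3 : tvec (legendre F' p).proj v = p := by rw [hvp]; rfl
  rw [h3, h _ hq, hF'.hamiltonian_legendre hp]
  exact ⟨hp, rfl⟩

end

/-! ### Inward pointing vectors, and dilations of Hamiltonian orbits -/

section

variable {n : ℕ} [NeZero n] {M : Type*}
  [TopologicalSpace M] [ChartedSpace (EuclideanHalfSpace n) M] [IsManifold (𝓡∂ n) ∞ M]

/-! ### Inward pointing vectors -/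

/-- Chart changes map the half-space to itself and boundary to boundary, so their derivatives
preserve the sign of the normal component. Without this, `inwardUnit`, which uses a different chart
at each point, would not define an open condition. -/
theorem normal_nonneg_of_chart_change {x x₁ x₂ : M} (hx : x ∈ (𝓡∂ n).boundary M)
    (h₁ : x ∈ dom (n := n) x₁) (h₂ : x ∈ dom (n := n) x₂) {v : Vec n} (hv : 0 ≤ v 0) :
    0 ≤ (toChart x₂ x (ofChart x₁ x v)) 0 := by
  have hd : HasFDerivWithinAt (extChartAt (𝓡∂ n) x₂ ∘ id ∘ (extChartAt (𝓡∂ n) x₁).symm)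
      ((toChart x₂ x).comp (ofChart x₁ x)) (halfRange n) (extChartAt (𝓡∂ n) x₁ x) := by
    have h := hasFDerivWithinAt_written (f := id) rfl mdifferentiableAt_id h₁ h₂
    rw [mfderiv_id] at h
    exact h
  refine normal_nonneg_of_hasFDerivWithinAt (A := (toChart x₂ x).comp (ofChart x₁ x))
    (g := extChartAt (𝓡∂ n) x₂ ∘ id ∘ (extChartAt (𝓡∂ n) x₁).symm) hd ((mem_boundary_iff h₁).1 hx) ?_
    (fun y => extChartAt_mem_range _ _) hv
  simp only [Function.comp_apply, id_eq]
  rw [(extChartAt (𝓡∂ n) x₁).left_inv (mem_dom_iff.1 h₁)]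
  exact (mem_boundary_iff h₂).1 hx

theorem normal_pos_of_toChart {x x₀ : M} (hx : x ∈ (𝓡∂ n).boundary M)
    (h₀ : x ∈ dom (n := n) x₀) {v : Vec n} (hv : 0 < (toChart x₀ x v) 0) : 0 < v 0 := by
  have h1 := normal_nonneg_of_chart_change hx h₀ (mem_chart_source _ x) hv.le
  rw [toChart_self, ofChart_toChart h₀] at h1
  refine lt_of_le_of_ne h1 fun h2 => ?_
  have h3 := normal_nonneg_of_chart_change hx (mem_chart_source _ x) h₀ (v := -v) (by simp [← h2])
  rw [ofChart_self, map_neg] at h3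
  have h4 : 0 ≤ -((toChart x₀ x v) 0) := h3
  linarith

/-- Over the boundary, inward pointing vectors form an open set. -/
theorem eventually_normal_pos {p₀ : TanB n M} (h : 0 < TanB.vec p₀ 0) :
    ∀ᶠ p : TanB n M in 𝓝 p₀, p.proj ∈ (𝓡∂ n).boundary M → 0 < TanB.vec p 0 := by
  have h1 : ContinuousAt (fun p : TanB n M => (extChartAt (𝓡∂ n).tangent p₀ p).2 0) p₀ :=
    ((EuclideanSpace.proj (𝕜 := ℝ) (0 : Fin n)).continuous.continuousAt).comp
      (continuous_snd.continuousAt.comp (continuousAt_extChartAt p₀))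
  have h2 : 0 < (extChartAt (𝓡∂ n).tangent p₀ p₀).2 0 := by
    rw [tan_extChartAt_self]; exact h
  filter_upwards [h1.eventually (lt_mem_nhds h2), eventually_proj_tan (dom_mem_nhds
    (mem_chart_source (EuclideanHalfSpace n) p₀.proj))] with p hp hd hb
  rw [tan_extChartAt] at hp
  exact normal_pos_of_toChart hb hd hp

/-! ### Dilations -/

theorem continuousAt_tdil {Z : Type*} [TopologicalSpace Z] {r : Z → ℝ} {p : Z → TanB n M} {z₀ : Z}
    (hr : ContinuousAt r z₀) (hp : ContinuousAt p z₀) :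
    ContinuousAt (fun z => tdil (r z) (p z)) z₀ := by
  have hd : ∀ᶠ z in 𝓝 z₀, (p z).proj ∈ dom (n := n) (p z₀).proj :=
    hp.eventually (eventually_proj_tan (dom_mem_nhds
      (mem_chart_source (EuclideanHalfSpace n) (p z₀).proj)))
  refine continuousAt_of_extChartAt (I := (𝓡∂ n).tangent) (q₀ := p z₀)
    (hd.mono fun z hz => (tan_mem_source (p z₀) (tdil (r z) (p z))).2 hz) ?_
  have h1 : ContinuousAt (fun z => extChartAt (𝓡∂ n).tangent (p z₀) (p z)) z₀ :=
    ContinuousAt.comp (g := extChartAt (𝓡∂ n).tangent (p z₀)) (continuousAt_extChartAt (p z₀)) hp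
  have h2 : (fun z => extChartAt (𝓡∂ n).tangent (p z₀) (tdil (r z) (p z))) = fun z =>
      ((extChartAt (𝓡∂ n).tangent (p z₀) (p z)).1,
        r z • (extChartAt (𝓡∂ n).tangent (p z₀) (p z)).2) := by
    funext z
    rw [tan_extChartAt, tan_extChartAt]
    exact Prod.ext rfl (map_smul (toChart (p z₀).proj (p z).proj) (r z) (TanB.vec (p z)))
  rw [h2]
  exact h1.fst.prodMk (hr.smul h1.snd)

/-- The derivative of the dilation of the cotangent bundle. -/
def cdilDeriv (n : ℕ) (r : ℝ) : (Vec n × Covec n) →L[ℝ] (Vec n × Covec n) :=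
  (ContinuousLinearMap.fst ℝ (Vec n) (Covec n)).prod (r • ContinuousLinearMap.snd ℝ (Vec n) (Covec n))

theorem cdilDeriv_apply (r : ℝ) (a : Vec n × Covec n) : cdilDeriv n r a = (a.1, r • a.2) := rfl

theorem sympForm_cdilDeriv (r : ℝ) (a b : Vec n × Covec n) :
    sympForm n (cdilDeriv n r a) (cdilDeriv n r b) = r * sympForm n a b := by
  show r • a.2 b.1 - r • b.2 a.1 = r * (a.2 b.1 - b.2 a.1)
  simp only [smul_eq_mul]
  ring

theorem hasMFDerivAt_cdil (r : ℝ) (q : CotB n M) :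
    HasMFDerivAt (cotModel n) (cotModel n) (cdil r) q (cdilDeriv n r) := by
  have h1 : ∀ᶠ q' in 𝓝 q, cdil r q' ∈ (extChartAt (cotModel n) (cdil r q)).source ∧
      extChartAt (cotModel n) (cdil r q) (cdil r q') =
        cdilDeriv n r (extChartAt (cotModel n) q q') := by
    filter_upwards [eventually_proj (dom_mem_nhds
      (mem_chart_source (EuclideanHalfSpace n) q.proj))] with q' hq'
    refine ⟨(cot_mem_source (cdil r q) (cdil r q')).2 hq', ?_⟩
    rw [cot_extChartAt _ _ hq', cot_extChartAt (cdil r q) (cdil r q') hq']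
    rfl
  refine ⟨?_, ?_⟩
  · refine continuousAt_of_extChartAt (I := cotModel n) (q₀ := cdil r q)
      (h1.mono fun _ h => h.1) ?_
    refine ContinuousAt.congr ?_ (h1.mono fun _ h => h.2.symm)
    exact (cdilDeriv n r).continuous.continuousAt.comp (continuousAt_extChartAt q)
  · refine hasFDerivWithinAt_congr_of_mem (f := cdilDeriv n r)
      (cdilDeriv n r).hasFDerivWithinAt ?_ ⟨_, rfl⟩
    filter_upwards [eventually_symm_extChartAt h1 (mem_extChartAt_source q)] with z hz
    simp only [writtenInExtChartAt, Function.comp_apply]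
    rw [hz.2.2, (extChartAt (cotModel n) q).right_inv hz.1]

theorem fderivWithin_const_mul_apply {V : Type*} [NormedAddCommGroup V] [NormedSpace ℝ V]
    {g : V → ℝ} {l l' : V →L[ℝ] ℝ} {s : Set V} {z : V} {a : ℝ} (hs : UniqueDiffWithinAt ℝ s z)
    (hg : HasFDerivWithinAt g l s z) (hg' : HasFDerivWithinAt (fun z => a * g z) l' s z) (b : V) :
    l' b = a * l b :=
  DFunLike.congr_fun (hs.eq hg' (hg.const_mul a)) b

/-- Dilation by `r` multiplies the symplectic form by `r` and a Hamiltonian of degree two by `r ^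
2`. It therefore carries `r` times the Hamiltonian field to the field at the dilated point, and
dilated orbits are orbits run `r` times as fast. -/
theorem cdilDeriv_hamField {G : CotB n M → ℝ} {q : CotB n M} {r : ℝ} (hr : 0 < r)
    (hG : MDifferentiableAt (cotModel n) 𝓘(ℝ, ℝ) G q)
    (hG' : MDifferentiableAt (cotModel n) 𝓘(ℝ, ℝ) G (cdil r q))
    (h : ∀ᶠ p in 𝓝 q, G (cdil r p) = r ^ 2 * G p) :
    cdilDeriv n r (r • sharp n (cotDeriv G q)) = hamField G (cdil r q) := by
  have h0 : HasMFDerivAt (cotModel n) 𝓘(ℝ, ℝ) (G ∘ cdil r) q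
      ((cotDeriv G (cdil r q)).comp (cdilDeriv n r)) :=
    HasMFDerivAt.comp q (g := G) (g' := cotDeriv G (cdil r q))
      ⟨hG'.continuousAt, hasFDerivWithinAt_cotDeriv hG'⟩ (hasMFDerivAt_cdil r q)
  have h1 : HasMFDerivAt (cotModel n) 𝓘(ℝ, ℝ) (fun p => r ^ 2 * G p) q
      ((cotDeriv G (cdil r q)).comp (cdilDeriv n r)) := h0.congr_of_eventuallyEq
        (h.mono fun _ h => h.symm)
  have h2 : ∀ b, cotDeriv G (cdil r q) (cdilDeriv n r b) = r ^ 2 * cotDeriv G q b := fun b =>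
    fderivWithin_const_mul_apply (l' := (cotDeriv G (cdil r q)).comp (cdilDeriv n r))
      ((cotModel n).uniqueDiffOn _ ⟨_, rfl⟩) (hasFDerivWithinAt_cotDeriv hG) h1.2 b
  refine eq_sharp fun b => ?_
  have hb : b = cdilDeriv n r (b.1, r⁻¹ • b.2) := by
    rw [cdilDeriv_apply, smul_inv_smul₀ hr.ne']
  rw [hb, sympForm_cdilDeriv, h2]
  have h5 : sympForm n (b.1, r⁻¹ • b.2) (r • sharp n (cotDeriv G q)) =
      r * cotDeriv G q (b.1, r⁻¹ • b.2) := by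
    rw [← sympForm_sharp (b.1, r⁻¹ • b.2) (cotDeriv G q)]
    exact map_smul (sympForm n (b.1, r⁻¹ • b.2)) r _
  rw [h5]
  ring

theorem isMIntegralCurveOn_cdil {G : CotB n M → ℝ} {c : ℝ → CotB n M} {T r : ℝ} (hr : 0 < r)
    (hc : IsMIntegralCurveOn c (hamField G) (Icc 0 T))
    (hG : ∀ t ∈ Icc 0 T, MDifferentiableAt (cotModel n) 𝓘(ℝ, ℝ) G (c t) ∧
      MDifferentiableAt (cotModel n) 𝓘(ℝ, ℝ) G (cdil r (c t)) ∧
      ∀ᶠ p in 𝓝 (c t), G (cdil r p) = r ^ 2 * G p) :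
    IsMIntegralCurveOn (fun s => cdil r (c (r * s))) (hamField G) (Icc 0 (T / r)) := by
  intro t ht
  have hrt : r * t ∈ Icc 0 T := ⟨mul_nonneg hr.le ht.1, by
    rw [mul_comm]; exact (le_div_iff₀ hr).1 ht.2⟩
  have hmaps : MapsTo (fun s => r * s) (Icc 0 (T / r)) (Icc 0 T) := fun s hs =>
    ⟨mul_nonneg hr.le hs.1, by
      show r * s ≤ T
      rw [mul_comm]; exact (le_div_iff₀ hr).1 hs.2⟩
  obtain ⟨h3, h4, h5⟩ := hG (r * t) hrt
  have h6 := hasMFDerivWithinAt_curve_iff.1 (hc (r * t) hrt)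
  have h7 : HasDerivWithinAt (fun s : ℝ => r * s) r (Icc 0 (T / r)) t := by
    simpa using ((hasDerivAt_id t).const_mul r).hasDerivWithinAt
  have h8 : HasMFDerivWithinAt 𝓘(ℝ, ℝ) (cotModel n) (fun s => c (r * s)) (Icc 0 (T / r)) t
      (ContinuousLinearMap.smulRight (1 : ℝ →L[ℝ] ℝ) (r • sharp n (cotDeriv G (c (r * t))))) :=
    hasMFDerivWithinAt_curve_iff.2
      ⟨ContinuousWithinAt.comp h6.1 h7.continuousWithinAt hmaps, h6.2.scomp t h7 hmaps⟩
  refine (HasMFDerivAt.comp_hasMFDerivWithinAt t (hasMFDerivAt_cdil r _) h8).congr_mfderiv ?_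
  ext1
  show cdilDeriv n r ((1 : ℝ) • r • sharp n (cotDeriv G (c (r * t)))) =
    (1 : ℝ) • hamField G (cdil r (c (r * t)))
  rw [one_smul, one_smul, cdilDeriv_hamField hr h3 h4 h5]

end

/-! ### Conjugation of two families of orbits by a diffeomorphism -/

section Conjugation

universe u

variable {E : Type u} [NormedAddCommGroup E] [NormedSpace ℝ E] [FiniteDimensional ℝ E]
  {H : Type*} [TopologicalSpace H] {I : ModelWithCorners ℝ E H}
  {N : Type*} [TopologicalSpace N] [ChartedSpace H N] [IsManifold I ∞ N] [T2Space N]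
  {N' : Type*} [TopologicalSpace N'] [ChartedSpace H N'] [IsManifold I ∞ N'] [T2Space N']
  {X : (q : N) → TangentSpace I q} {X' : (q : N') → TangentSpace I q}
  {ℓ : E →L[ℝ] ℝ} {e : E}
  {B : Set N} {T : N → ℝ} {c : N → ℝ → N} {B' : Set N'} {T' : N' → ℝ} {c' : N' → ℝ → N'}
  {ψ : N → N'} {ψ' : N' → N}

theorem OrbitFamily.conjugates_orbitMap (he : ℓ e = 1) (hI : range I = {z | 0 ≤ ℓ z})
    (h : OrbitFamily ℓ X B T c) (h' : OrbitFamily ℓ X' B' T' c')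
    (hψ : ∀ b ∈ B, ψ b ∈ B' ∧ T' (ψ b) = T b) (hs : ∀ b ∈ B, ContMDiffAt I I ∞ ψ b) :
    Conjugates I X' B T c ψ (fun b => c' (ψ b))
      (fun q => orbitMap B T c (fun b => c' (ψ b)) q (ψ q)) where
  smooth_init := hs
  zero b hb := h'.zero _ (hψ b hb).1
  integral b hb := by
    have := h'.integral _ (hψ b hb).1
    rwa [(hψ b hb).2] at this
  smooth b hb s hs := h'.smooth _ (hψ b hb).1 s (by rwa [(hψ b hb).2])
  map b hb s hs := h.orbitMap_apply he hI _ _ hb hs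

/-- Two families of orbits with the same travel times, whose initial points are identified by a
diffeomorphism, are conjugate by a diffeomorphism of the sets that they sweep out. -/
theorem OrbitFamily.exists_conjugation (he : ℓ e = 1) (hI : range I = {z | 0 ≤ ℓ z})
    (h : OrbitFamily ℓ X B T c) (h' : OrbitFamily ℓ X' B' T' c')
    (hopen : ∀ b ∈ B, ∀ᶠ b' in 𝓝 b, b' ∈ I.boundary N → b' ∈ B)
    (hopen' : ∀ b ∈ B', ∀ᶠ b' in 𝓝 b, b' ∈ I.boundary N' → b' ∈ B')
    (hψ : ∀ b ∈ B, ψ b ∈ B' ∧ T' (ψ b) = T b) (hs : ∀ b ∈ B, ContMDiffAt I I ∞ ψ b)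
    (hψ' : ∀ b ∈ B', ψ' b ∈ B ∧ T (ψ' b) = T' b) (hs' : ∀ b ∈ B', ContMDiffAt I I ∞ ψ' b)
    (hl : ∀ b ∈ B, ψ' (ψ b) = b) (hr : ∀ b ∈ B', ψ (ψ' b) = b) :
    ∃ κ : OpenPartialHomeomorph N N', κ.source = sweep B T c ∧ κ.target = sweep B' T' c' ∧
      ContMDiffOn I I ∞ κ κ.source ∧ ContMDiffOn I I ∞ κ.symm κ.target ∧
      Conjugates I X' B T c ψ (fun b => c' (ψ b)) κ := by
  -- Both maps keep the time along the orbits, so they are inverse to each other once the initial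
  -- points are identified. Smoothness of the inverse is the same theorem with the two families
  -- exchanged. Off the swept out sets the values `ψ q` and `ψ' q` are mere defaults.
  set f : N → N' := fun q => orbitMap B T c (fun b => c' (ψ b)) q (ψ q)
  set g : N' → N := fun q => orbitMap B' T' c' (fun b => c (ψ' b)) q (ψ' q)
  have hC := h.conjugates_orbitMap he hI h' hψ hs
  have hC' := h'.conjugates_orbitMap he hI h hψ' hs'
  have hf := fun q (hq : q ∈ sweep B T c) => h.contMDiffAt_conjugation he hI hopen hC hq
  have hg := fun q (hq : q ∈ sweep B' T' c') => h'.contMDiffAt_conjugation he hI hopen' hC' hq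
  have hfs : ∀ b ∈ B, ∀ s ∈ Icc 0 (T b), f (c b s) = c' (ψ b) s := hC.map
  have hgs : ∀ b ∈ B', ∀ s ∈ Icc 0 (T' b), g (c' b s) = c (ψ' b) s := hC'.map
  have hT : ∀ b ∈ B, ∀ s ∈ Icc 0 (T b), s ∈ Icc 0 (T' (ψ b)) := fun b hb s hs => by
    rwa [(hψ b hb).2]
  have hT' : ∀ b ∈ B', ∀ s ∈ Icc 0 (T' b), s ∈ Icc 0 (T (ψ' b)) := fun b hb s hs => by
    rwa [(hψ' b hb).2]
  refine ⟨{
    toFun := f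
    invFun := g
    source := sweep B T c
    target := sweep B' T' c'
    map_source' := ?_
    map_target' := ?_
    left_inv' := ?_
    right_inv' := ?_
    open_source := isOpen_iff_mem_nhds.2 fun q hq => (hf q hq).1
    open_target := isOpen_iff_mem_nhds.2 fun q hq => (hg q hq).1
    continuousOn_toFun := fun q hq => (hf q hq).2.continuousAt.continuousWithinAt
    continuousOn_invFun := fun q hq => (hg q hq).2.continuousAt.continuousWithinAt },
    rfl, rfl, fun q hq => (hf q hq).2.contMDiffWithinAt, fun q hq => (hg q hq).2.contMDiffWithinAt,
    hC⟩
  · rintro _ ⟨b, hb, s, hs, rfl⟩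
    exact ⟨ψ b, (hψ b hb).1, s, hT b hb s hs, (hfs b hb s hs).symm⟩
  · rintro _ ⟨b, hb, s, hs, rfl⟩
    exact ⟨ψ' b, (hψ' b hb).1, s, hT' b hb s hs, (hgs b hb s hs).symm⟩
  · rintro _ ⟨b, hb, s, hs, rfl⟩
    rw [hfs b hb s hs, hgs _ (hψ b hb).1 s (hT b hb s hs), hl b hb]
  · rintro _ ⟨b, hb, s, hs, rfl⟩
    rw [hgs b hb s hs, hfs _ (hψ' b hb).1 s (hT' b hb s hs), hr b hb]

end Conjugation

/-! ### Conservation of energy and comparison of Hamiltonians over the boundary -/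

section

variable {n : ℕ} [NeZero n] {M M' : Type*}
  [TopologicalSpace M] [ChartedSpace (EuclideanHalfSpace n) M] [IsManifold (𝓡∂ n) ∞ M]
  [TopologicalSpace M'] [ChartedSpace (EuclideanHalfSpace n) M'] [IsManifold (𝓡∂ n) ∞ M']
  {F : TanB n M → ℝ}

/-- The Hamiltonian is constant along its orbits. -/
theorem hamiltonian_conserved {G : CotB n M → ℝ} {c : ℝ → CotB n M} {T : ℝ}
    (hc : IsMIntegralCurveOn c (hamField G) (Icc 0 T))
    (hG : ∀ t ∈ Icc 0 T, MDifferentiableAt (cotModel n) 𝓘(ℝ, ℝ) G (c t)) {t : ℝ}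
    (ht : t ∈ Icc 0 T) : G (c t) = G (c 0) := by
  have hd : ∀ t ∈ Icc 0 T, HasDerivWithinAt (fun s => G (c s)) 0 (Icc 0 T) t := by
    intro t ht
    have h1 : HasMFDerivAt (cotModel n) 𝓘(ℝ, ℝ) G (c t) (cotDeriv G (c t)) :=
      ⟨(hG t ht).continuousAt, hasFDerivWithinAt_cotDeriv (hG t ht)⟩
    have h2 := HasMFDerivAt.comp_hasMFDerivWithinAt t h1 (hc t ht)
    have h3 : HasDerivWithinAt (fun s => G (c s)) (cotDeriv G (c t) (hamField G (c t)))
        (Icc 0 T) t := by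
      have h4 : HasFDerivWithinAt (fun s => G (c s)) ((cotDeriv G (c t)).comp
          (ContinuousLinearMap.smulRight (1 : ℝ →L[ℝ] ℝ) (sharp n (cotDeriv G (c t)))))
          (Icc 0 T) t := hasMFDerivWithinAt_iff_hasFDerivWithinAt.1 h2
      refine h4.hasDerivWithinAt.congr_deriv ?_
      show cotDeriv G (c t) ((1 : ℝ) • sharp n (cotDeriv G (c t))) = _
      rw [one_smul]
      rfl
    have h5 : cotDeriv G (c t) (hamField G (c t)) = 0 := by
      have h6 := sympForm_sharp (sharp n (cotDeriv G (c t))) (cotDeriv G (c t))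
      have h7 := sympForm_antisymm (sharp n (cotDeriv G (c t))) (sharp n (cotDeriv G (c t)))
      show cotDeriv G (c t) (sharp n (cotDeriv G (c t))) = 0
      linarith
    rwa [h5] at h3
  rcases ht.1.eq_or_lt with rfl | h0
  · rfl
  have hT : 0 < T := h0.trans_le ht.2
  exact constant_of_derivWithin_zero (fun t ht => (hd t ht).differentiableWithinAt)
    (fun t ht => (hd t (Ico_subset_Icc_self ht)).derivWithin
      (uniqueDiffOn_Icc hT t (Ico_subset_Icc_self ht))) t ht

theorem IsFinsler.mdifferentiableAt_hamiltonian (hF : IsFinsler F) {q : CotB n M}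
    (hq : q ∈ coslit n M) : MDifferentiableAt (cotModel n) 𝓘(ℝ, ℝ) (hamiltonian F) q :=
  (hF.contMDiffAt_hamiltonian hq).mdifferentiableAt (by simp)

/-- Geodesics have constant speed. -/
theorem IsFirstHitGeodesic.speed_eq (hF : IsFinsler F) {c : ℝ → TanB n M} {T : ℝ}
    (hc : IsFirstHitGeodesic F (slit n M) c T) {t : ℝ} (ht : t ∈ Icc 0 T) : F (c t) = F (c 0) := by
  have h1 := hamiltonian_conserved (hc.isMIntegralCurveOn hF)
    (fun t ht => hF.mdifferentiableAt_hamiltonian (hF.legendre_mem_coslit (hc.mem t ht))) ht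
  have h0 := hc.mem 0 (left_mem_Icc.2 hc.pos.le)
  rw [hF.hamiltonian_legendre (hc.mem t ht), hF.hamiltonian_legendre h0] at h1
  have h2 := hF.isFinslerOn.pos _ (hc.mem t ht)
  have h3 := hF.isFinslerOn.pos _ h0
  have h4 : F (c t) ^ 2 / 2 = F (c 0) ^ 2 / 2 := h1
  exact (pow_left_inj₀ h2.le h3.le two_ne_zero).1 (by linarith)

theorem IsFirstHitGeodesic.eqOn [T2Space M] (hF : IsFinsler F) {c₁ c₂ : ℝ → TanB n M} {T₁ T₂ : ℝ}
    (h₁ : IsFirstHitGeodesic F (slit n M) c₁ T₁) (h₂ : IsFirstHitGeodesic F (slit n M) c₂ T₂)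
    (h0 : c₁ 0 = c₂ 0) : T₁ = T₂ ∧ EqOn c₁ c₂ (Icc 0 T₁) := by
  have hE : EqOn c₁ c₂ (Icc 0 (min T₁ T₂)) := by
    have hs₁ : Icc 0 (min T₁ T₂) ⊆ Icc 0 T₁ := Icc_subset_Icc_right (min_le_left _ _)
    have hs₂ : Icc 0 (min T₁ T₂) ⊆ Icc 0 T₂ := Icc_subset_Icc_right (min_le_right _ _)
    have h1 := isMIntegralCurveOn_eqOn bdf_inward range_cotModel_eq
      (left_mem_Icc.2 (le_min h₁.pos.le h₂.pos.le)) ((h₁.isMIntegralCurveOn hF).mono hs₁)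
      ((h₂.isMIntegralCurveOn hF).mono hs₂) (fun s hs => (symplecticFieldAt_hamField
        (hF.contMDiffAt_hamiltonian_legendre (h₁.mem s (hs₁ hs)))).1) (by rw [h0])
    exact fun t ht => hF.legendre_injOn (h₁.mem t (hs₁ ht)) (h₂.mem t (hs₂ ht)) (h1 ht)
  have hT := h₁.time_eq h₂ hE
  refine ⟨hT, ?_⟩
  rwa [← hT, min_self] at hE

/-! ### The identification over the boundary and the Legendre transform -/

variable {F' : TanB n M' → ℝ} {Ψ : OpenPartialHomeomorph M M'}
  (hΨ : IsBoundaryIdentification (n := n) Ψ)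

include hΨ

/-- The Legendre transform involves fibre derivatives only, so equality of the metrics over the
boundary suffices. In each fibre it is the chain rule for a linear isomorphism. -/
theorem legendre_tanId (hF' : IsFinsler F')
    (hFF' : ∀ p : TanB n M, p.proj ∈ (𝓡∂ n).boundary M → F' (tanId Ψ p) = F p)
    {p : TanB n M} (hp : p ∈ slit n M) (hb : p.proj ∈ (𝓡∂ n).boundary M) :
    legendre F' (tanId Ψ p) = cotId Ψ (legendre F p) := by
  have hx := hΨ.subset_source hb
  set A : Vec n →L[ℝ] Vec n := mfderiv (𝓡∂ n) (𝓡∂ n) Ψ p.proj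
  set B : Vec n →L[ℝ] Vec n := mfderiv (𝓡∂ n) (𝓡∂ n) Ψ.symm (Ψ p.proj)
  have hAB : ∀ w, A (B w) = w := fun w => hΨ.mfderiv_mfderiv_symm hx w
  have h1 : halfSq F p.proj = fun w => halfSq F' (Ψ p.proj) (A w) := by
    funext w
    show F (tvec p.proj w) ^ 2 / 2 = F' (tanId Ψ (tvec p.proj w)) ^ 2 / 2
    rw [hFF' (tvec p.proj w) hb]
  have h2 : DifferentiableAt ℝ (halfSq F' (Ψ p.proj)) (A (TanB.vec p)) :=
    differentiableAt_halfSq (p := tanId Ψ p)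
      (hF'.isFinslerOn.contMDiffAt (hΨ.tanId_mem_slit hx hp))
  have h3 : fderiv ℝ (halfSq F p.proj) (TanB.vec p) =
      (fderiv ℝ (halfSq F' (Ψ p.proj)) (A (TanB.vec p))).comp A := by
    rw [h1]
    exact (h2.hasFDerivAt.comp (TanB.vec p) A.hasFDerivAt).fderiv
  show cvec (Ψ p.proj) (fderiv ℝ (halfSq F' (Ψ p.proj)) (A (TanB.vec p))) =
    cvec (Ψ p.proj) ((fderiv ℝ (halfSq F p.proj) (TanB.vec p)).comp B)
  rw [h3]
  refine congrArg _ ?_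
  ext1 w
  exact congrArg _ (hAB w).symm

theorem hamiltonian_cotId (hF : IsFinsler F) (hF' : IsFinsler F')
    (hFF' : ∀ p : TanB n M, p.proj ∈ (𝓡∂ n).boundary M → F' (tanId Ψ p) = F p)
    {q : CotB n M} (hq : q ∈ coslit n M) (hb : q.proj ∈ (𝓡∂ n).boundary M) :
    hamiltonian F' (cotId Ψ q) = hamiltonian F q := by
  obtain ⟨p, hp, hproj, rfl⟩ := hF.exists_legendre_eq hq
  have hb' : p.proj ∈ (𝓡∂ n).boundary M := hb
  rw [← legendre_tanId hΨ hF' hFF' hp hb', hF.hamiltonian_legendre hp,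
    hF'.hamiltonian_legendre (hΨ.tanId_mem_slit (hΨ.subset_source hb') hp), energy, energy,
    hFF' p hb']

end

/-- Functions on a half-space that agree on the boundary hyperplane have the same tangential
derivatives there; restrict both to a line in the hyperplane. The normal derivatives may differ. -/
theorem apply_eq_of_eqOn_hyperplane {V : Type*} [NormedAddCommGroup V] [NormedSpace ℝ V]
    {f g : V → ℝ} {l l' ℓ : V →L[ℝ] ℝ} {R : Set V} (hR : R = {z | 0 ≤ ℓ z}) {z u : V}
    (hf : HasFDerivWithinAt f l R z) (hg : HasFDerivWithinAt g l' R z) (hz : ℓ z = 0)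
    (hu : ℓ u = 0) (h : ∀ᶠ w in 𝓝[R] z, ℓ w = 0 → f w = g w) : l u = l' u := by
  have hline : HasDerivAt (fun t : ℝ => z + t • u) u 0 := by
    simpa using ((hasDerivAt_id (0 : ℝ)).smul_const u).const_add z
  have hℓ : ∀ t : ℝ, ℓ (z + t • u) = 0 := fun t => by simp [hz, hu]
  have hmem : ∀ t : ℝ, z + t • u ∈ R := fun t => by rw [hR]; exact (hℓ t).ge
  have key : ∀ {f : V → ℝ} {l : V →L[ℝ] ℝ}, HasFDerivWithinAt f l R z →
      HasDerivAt (fun t : ℝ => f (z + t • u)) (l u) 0 := by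
    intro f l hf
    have h1 : HasDerivWithinAt (fun t : ℝ => f (z + t • u)) (l u) univ 0 := by
      refine HasFDerivWithinAt.comp_hasDerivWithinAt (t := R) (l := f) 0 ?_ hline.hasDerivWithinAt
        fun t _ => hmem t
      rwa [zero_smul, add_zero]
    exact h1.hasDerivAt univ_mem
  have h2 : Tendsto (fun t : ℝ => z + t • u) (𝓝 0) (𝓝[R] z) := by
    refine tendsto_nhdsWithin_iff.2 ⟨?_, Eventually.of_forall hmem⟩
    have := hline.continuousAt.tendsto
    simpa using this
  refine ((key hf).congr_of_eventuallyEq (f := fun t : ℝ => f (z + t • u)) ?_).unique (key hg)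
  filter_upwards [h2.eventually h] with t ht
  exact (ht (hℓ t)).symm

/-! ### The conic family of Hamiltonian orbits over a set of unit vectors -/

section

variable {n : ℕ} [NeZero n] {M : Type*}
  [TopologicalSpace M] [ChartedSpace (EuclideanHalfSpace n) M] [IsManifold (𝓡∂ n) ∞ M]
  {F : TanB n M → ℝ} {𝒰 : Set (TanB n M)} {T : TanB n M → ℝ} {γ : TanB n M → ℝ → TanB n M}

/-! ### The conic family of orbits defined by a set of unit vectors -/

/-- The unit vector in the direction of a covector. -/
def unitVec (F : TanB n M → ℝ) (b : CotB n M) : TanB n M :=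
  tdil (dualNorm F b)⁻¹ (velocity (hamiltonian F) b)

/-- The cone of covectors over a set of unit vectors. -/
def covecCone (F : TanB n M → ℝ) (𝒰 : Set (TanB n M)) : Set (CotB n M) :=
  {b | ∃ u ∈ 𝒰, ∃ r : ℝ, 0 < r ∧ b = cdil r (legendre F u)}

/-- The homogeneous extension of a function of unit vectors. -/
def coneTime (F : TanB n M → ℝ) (T : TanB n M → ℝ) (b : CotB n M) : ℝ :=
  T (unitVec F b) / dualNorm F b

/-- The homogeneous extension of a family of geodesics with unit initial vectors. -/
def coneOrbit (F : TanB n M → ℝ) (γ : TanB n M → ℝ → TanB n M) (b : CotB n M) (s : ℝ) : CotB n M :=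
  cdil (dualNorm F b) (legendre F (γ (unitVec F b) (dualNorm F b * s)))

variable (F 𝒰 T γ) in
/-- A choice of geodesics with initial vectors in `𝒰`, which meet the boundary transversally. -/
structure IsGeodesicFamily : Prop where
  inward : 𝒰 ⊆ inwardUnit F
  geodesic : ∀ u ∈ 𝒰, IsFirstHitGeodesic F (slit n M) (γ u) (T u)
  zero : ∀ u ∈ 𝒰, γ u 0 = u
  transversal : ∀ u ∈ 𝒰, TanB.vec (γ u (T u)) 0 ≠ 0

theorem unitVec_cdil_legendre (hF : IsFinsler F) {u : TanB n M} (hu : u ∈ slit n M) (h1 : F u = 1)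
    {r : ℝ} (hr : 0 < r) : dualNorm F (cdil r (legendre F u)) = r ∧
      unitVec F (cdil r (legendre F u)) = u := by
  have hru := hF.isFinslerOn.conic u hu r hr
  have h2 : dualNorm F (cdil r (legendre F u)) = r := by
    rw [← hF.legendre_tdil hu hr, hF.dualNorm_legendre hru, hF.isFinslerOn.homogeneous u hu r hr, h1,
      mul_one]
  refine ⟨h2, ?_⟩
  rw [unitVec, h2, ← hF.legendre_tdil hu hr, hF.velocity_legendre hru, tdil_tdil,
    inv_mul_cancel₀ hr.ne', tdil_one]

theorem cdil_legendre_unitVec (hF : IsFinsler F) {b : CotB n M} (hb : b ∈ coslit n M) :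
    0 < dualNorm F b ∧ F (unitVec F b) = 1 ∧ b = cdil (dualNorm F b) (legendre F (unitVec F b)) := by
  obtain ⟨p, hp, -, rfl⟩ := hF.exists_legendre_eq hb
  have hpos := hF.isFinslerOn.pos p hp
  have hinv := inv_pos.2 hpos
  rw [unitVec, hF.dualNorm_legendre hp, hF.velocity_legendre hp,
    hF.isFinslerOn.homogeneous p hp _ hinv, hF.legendre_tdil hp hinv, cdil_cdil,
    mul_inv_cancel₀ hpos.ne', cdil_one, inv_mul_cancel₀ hpos.ne']
  exact ⟨hpos, rfl, rfl⟩

theorem continuousAt_unitVec (hF : IsFinsler F) {b : CotB n M} (hb : b ∈ coslit n M) :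
    ContinuousAt (unitVec F) b := by
  have h1 : ContinuousAt (dualNorm F) b := by
    have h2 : ContinuousAt (fun b => Real.sqrt (2 * hamiltonian F b)) b :=
      (continuousAt_const.mul (hF.contMDiffAt_hamiltonian hb).continuousAt).sqrt
    refine h2.congr ?_
    filter_upwards [isOpen_coslit.mem_nhds hb] with b' hb'
    rw [hamiltonian, mul_div_cancel₀ _ two_ne_zero,
      Real.sqrt_sq (cdil_legendre_unitVec hF hb').1.le]
  exact continuousAt_tdil (h1.inv₀ (cdil_legendre_unitVec hF hb).1.ne')
    (continuousAt_velocity (hF.eventually_contMDiffAt_hamiltonian hb))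

/-- The unit vector of a covector depends continuously on it. Belonging to the open set `O` and
pointing inwards are open conditions over the boundary, so relative openness of `𝒰` passes to the
cone. -/
theorem eventually_mem_covecCone (hF : IsFinsler F)
    (h𝒰 : ∃ O : Set (TanB n M), IsOpen O ∧ 𝒰 = O ∩ inwardUnit F) {b : CotB n M}
    (hb : b ∈ covecCone F 𝒰) :
    ∀ᶠ b' in 𝓝 b, b'.proj ∈ (𝓡∂ n).boundary M → b' ∈ covecCone F 𝒰 := by
  obtain ⟨O, hO, h𝒰⟩ := h𝒰
  obtain ⟨u, hu, r, hr, rfl⟩ := hb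
  have hu' := hu
  rw [h𝒰] at hu'
  have hus : u ∈ slit n M := fun h0 => by
    have h1 := hu'.2.2.2
    rw [h0] at h1
    exact lt_irrefl _ h1
  have hb : cdil r (legendre F u) ∈ coslit n M := by
    rw [← hF.legendre_tdil hus hr]
    exact hF.legendre_mem_coslit (hF.isFinslerOn.conic u hus r hr)
  have hc := (continuousAt_unitVec hF hb).tendsto
  rw [(unitVec_cdil_legendre hF hus hu'.2.2.1 hr).2] at hc
  filter_upwards [hc.eventually (hO.mem_nhds hu'.1), hc.eventually (eventually_normal_pos hu'.2.2.2),
    isOpen_coslit.mem_nhds hb] with b' h1 h2 h3 h4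
  obtain ⟨h5, h6, h7⟩ := cdil_legendre_unitVec hF h3
  refine ⟨unitVec F b', ?_, _, h5, h7⟩
  rw [h𝒰]
  exact ⟨h1, h4, h6, h2 h4⟩

namespace IsGeodesicFamily

variable (hF : IsFinsler F) (h : IsGeodesicFamily F 𝒰 T γ)

include hF h

theorem mem_slit {u : TanB n M} (hu : u ∈ 𝒰) {t : ℝ} (ht : t ∈ Icc 0 (T u)) : γ u t ∈ slit n M :=
  (h.geodesic u hu).mem t ht

theorem speed {u : TanB n M} (hu : u ∈ 𝒰) {t : ℝ} (ht : t ∈ Icc 0 (T u)) : F (γ u t) = 1 := by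
  rw [(h.geodesic u hu).speed_eq hF ht, h.zero u hu]
  exact (h.inward hu).2.1

theorem init_mem_slit {u : TanB n M} (hu : u ∈ 𝒰) : u ∈ slit n M := by
  have h1 := h.mem_slit hF hu (left_mem_Icc.2 (h.geodesic u hu).pos.le)
  rwa [h.zero u hu] at h1

theorem cone_apply {u : TanB n M} (hu : u ∈ 𝒰) {r : ℝ} (hr : 0 < r) :
    coneTime F T (cdil r (legendre F u)) = T u / r ∧
    ∀ s, coneOrbit F γ (cdil r (legendre F u)) s = cdil r (legendre F (γ u (r * s))) := by
  obtain ⟨h1, h2⟩ := unitVec_cdil_legendre hF (h.init_mem_slit hF hu) (h.inward hu).2.1 hr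
  refine ⟨?_, fun s => ?_⟩
  · rw [coneTime, h1, h2]
  · rw [coneOrbit, h1, h2]

theorem mem_Icc_cone {u : TanB n M} {r : ℝ} (hr : 0 < r) {s : ℝ}
    (hs : s ∈ Icc 0 (T u / r)) : r * s ∈ Icc 0 (T u) :=
  ⟨mul_nonneg hr.le hs.1, by rw [mul_comm]; exact (le_div_iff₀ hr).1 hs.2⟩

theorem cdil_eq {u : TanB n M} (hu : u ∈ 𝒰) {t : ℝ} (ht : t ∈ Icc 0 (T u)) {r : ℝ} (hr : 0 < r) :
    cdil r (legendre F (γ u t)) = legendre F (tdil r (γ u t)) ∧ tdil r (γ u t) ∈ slit n M :=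
  ⟨(hF.legendre_tdil (h.mem_slit hF hu ht) hr).symm,
    hF.isFinslerOn.conic _ (h.mem_slit hF hu ht) r hr⟩

theorem bdf_hamField {u : TanB n M} (hu : u ∈ 𝒰) {t : ℝ} (ht : t ∈ Icc 0 (T u)) {r : ℝ}
    (hr : 0 < r) : bdf n (hamField (hamiltonian F) (cdil r (legendre F (γ u t)))) =
      r * TanB.vec (γ u t) 0 := by
  obtain ⟨h1, h2⟩ := h.cdil_eq hF hu ht hr
  rw [h1, (hF.isDualAt h2).hamField_eq]
  rfl

/-- All positive multiples of the unit vectors are included because the orbits must sweep out an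
open, conic set. The orbit from the covector dilated by `r` is the dilated one run `r` times as
fast, so its travel time is divided by `r`. Its normal velocity at either end is `r` times that of
the geodesic, which gives transversality. -/
theorem orbitFamily : OrbitFamily (I := cotModel n) (bdf n) (hamField (hamiltonian F))
    (covecCone F 𝒰) (coneTime F T) (coneOrbit F γ) where
  boundary := by
    rintro _ ⟨u, hu, r, hr, rfl⟩
    rw [cot_mem_boundary_iff]
    exact (h.inward hu).1
  inward := by
    rintro _ ⟨u, hu, r, hr, rfl⟩
    have h1 := h.bdf_hamField hF hu (left_mem_Icc.2 (h.geodesic u hu).pos.le) hr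
    rw [h.zero u hu] at h1
    rw [h1]
    exact mul_pos hr (h.inward hu).2.2
  pos := by
    rintro _ ⟨u, hu, r, hr, rfl⟩
    rw [(h.cone_apply hF hu hr).1]
    exact div_pos (h.geodesic u hu).pos hr
  zero := by
    rintro _ ⟨u, hu, r, hr, rfl⟩
    rw [(h.cone_apply hF hu hr).2, mul_zero, h.zero u hu]
  integral := by
    rintro _ ⟨u, hu, r, hr, rfl⟩
    obtain ⟨h1, h2⟩ := h.cone_apply hF hu hr
    rw [h1, show coneOrbit F γ (cdil r (legendre F u)) =
      fun s => cdil r (legendre F (γ u (r * s))) from funext h2]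
    refine isMIntegralCurveOn_cdil (c := fun t => legendre F (γ u t)) hr
      ((h.geodesic u hu).isMIntegralCurveOn hF) fun t ht => ?_
    have h3 := hF.legendre_mem_coslit (h.mem_slit hF hu ht)
    refine ⟨hF.mdifferentiableAt_hamiltonian h3, ?_, ?_⟩
    · obtain ⟨h4, h5⟩ := h.cdil_eq hF hu ht hr
      show MDifferentiableAt _ _ _ (cdil r (legendre F (γ u t)))
      rw [h4]
      exact hF.mdifferentiableAt_hamiltonian (hF.legendre_mem_coslit h5)
    · filter_upwards [isOpen_coslit.mem_nhds h3] with q hq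
      exact hF.hamiltonian_cdil hq hr
  smooth := by
    rintro _ ⟨u, hu, r, hr, rfl⟩ s hs
    rw [(h.cone_apply hF hu hr).1] at hs
    obtain ⟨h4, h5⟩ := h.cdil_eq hF hu (h.mem_Icc_cone hF hr hs) hr
    rw [(h.cone_apply hF hu hr).2, h4]
    exact (symplecticFieldAt_hamField (hF.contMDiffAt_hamiltonian_legendre h5)).1
  interior := by
    rintro _ ⟨u, hu, r, hr, rfl⟩ s hs
    rw [(h.cone_apply hF hu hr).1] at hs
    rw [(h.cone_apply hF hu hr).2, cot_mem_interior_iff]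
    refine (h.geodesic u hu).interior (r * s) ⟨mul_pos hr hs.1, ?_⟩
    rw [mul_comm]
    exact (lt_div_iff₀ hr).1 hs.2
  exit := by
    rintro _ ⟨u, hu, r, hr, rfl⟩
    rw [(h.cone_apply hF hu hr).1, (h.cone_apply hF hu hr).2, cot_mem_boundary_iff,
      mul_div_cancel₀ _ hr.ne']
    exact (h.geodesic u hu).boundary
  transversal := by
    rintro _ ⟨u, hu, r, hr, rfl⟩
    rw [(h.cone_apply hF hu hr).1, (h.cone_apply hF hu hr).2, mul_div_cancel₀ _ hr.ne',
      h.bdf_hamField hF hu (right_mem_Icc.2 (h.geodesic u hu).pos.le) hr]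
    exact mul_ne_zero hr.ne' (h.transversal u hu)

theorem mem_sweep_iff {q : CotB n M} : q ∈ sweep (covecCone F 𝒰) (coneTime F T) (coneOrbit F γ) ↔
    ∃ u ∈ 𝒰, ∃ t ∈ Icc 0 (T u), ∃ r : ℝ, 0 < r ∧ q = cdil r (legendre F (γ u t)) := by
  constructor
  · rintro ⟨_, ⟨u, hu, r, hr, rfl⟩, s, hs, rfl⟩
    rw [(h.cone_apply hF hu hr).1] at hs
    exact ⟨u, hu, r * s, h.mem_Icc_cone hF hr hs, r, hr, (h.cone_apply hF hu hr).2 s⟩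
  · rintro ⟨u, hu, t, ht, r, hr, rfl⟩
    refine ⟨_, ⟨u, hu, r, hr, rfl⟩, t / r, ?_, ?_⟩
    · rw [(h.cone_apply hF hu hr).1]
      exact ⟨div_nonneg ht.1 hr.le, div_le_div_of_nonneg_right ht.2 hr.le⟩
    · rw [(h.cone_apply hF hu hr).2, mul_div_cancel₀ _ hr.ne']

theorem mem_geodesicCone_iff [T2Space M] {p : TanB n M} : p ∈ geodesicCone F 𝒰 ↔
    ∃ u ∈ 𝒰, ∃ t ∈ Icc 0 (T u), ∃ r : ℝ, 0 < r ∧ p = tdil r (γ u t) := by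
  constructor
  · rintro ⟨c, T₁, hc, h0, t, ht, r, hr, rfl⟩
    obtain ⟨rfl, hE⟩ := hc.eqOn hF (h.geodesic _ h0) (h.zero _ h0).symm
    exact ⟨c 0, h0, t, ht, r, hr, by rw [hE ht]⟩
  · rintro ⟨u, hu, t, ht, r, hr, rfl⟩
    exact ⟨γ u, T u, h.geodesic u hu, by rwa [h.zero u hu], t, ht, r, hr, rfl⟩

theorem sweep_eq [T2Space M] : sweep (covecCone F 𝒰) (coneTime F T) (coneOrbit F γ) =
    legendre F '' geodesicCone F 𝒰 := by
  ext q
  rw [h.mem_sweep_iff hF]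
  constructor
  · rintro ⟨u, hu, t, ht, r, hr, rfl⟩
    exact ⟨tdil r (γ u t), (h.mem_geodesicCone_iff hF).2 ⟨u, hu, t, ht, r, hr, rfl⟩,
      (h.cdil_eq hF hu ht hr).1.symm⟩
  · rintro ⟨p, hp, rfl⟩
    obtain ⟨u, hu, t, ht, r, hr, rfl⟩ := (h.mem_geodesicCone_iff hF).1 hp
    exact ⟨u, hu, t, ht, r, hr, (h.cdil_eq hF hu ht hr).1.symm⟩

end IsGeodesicFamily

end

/-! ### Construction of the canonical transformation from equal lens data -/

section

variable {n : ℕ} [NeZero n] {M M' : Type*}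
  [TopologicalSpace M] [ChartedSpace (EuclideanHalfSpace n) M] [IsManifold (𝓡∂ n) ∞ M]
  [TopologicalSpace M'] [ChartedSpace (EuclideanHalfSpace n) M'] [IsManifold (𝓡∂ n) ∞ M']
  {F : TanB n M → ℝ} {F' : TanB n M' → ℝ} {Ψ : OpenPartialHomeomorph M M'}
  {𝒰 : Set (TanB n M)} {T : TanB n M → ℝ} {γ : TanB n M → ℝ → TanB n M}
  {T' : TanB n M' → ℝ} {γ' : TanB n M' → ℝ → TanB n M'}

/-- The identification over the boundary respects the Hamiltonian fields, up to the normal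
direction. -/
theorem cotId_infinitesimal (hΨ : IsBoundaryIdentification (n := n) Ψ) (hF : IsFinsler F)
    (hF' : IsFinsler F')
    (hFF' : ∀ p : TanB n M, p.proj ∈ (𝓡∂ n).boundary M → F' (tanId Ψ p) = F p)
    {q : CotB n M} (hq : q ∈ coslit n M) (hb : q.proj ∈ (𝓡∂ n).boundary M)
    (hq' : cotId Ψ q ∈ coslit n M') :
    ∃ D : (Vec n × Covec n) →L[ℝ] (Vec n × Covec n),
      HasMFDerivAt (cotModel n) (cotModel n) (cotId Ψ) q D ∧
      (∀ u v, bdf n u = 0 → bdf n v = 0 → sympForm n (D u) (D v) = sympForm n u v) ∧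
      ∀ u, bdf n u = 0 → sympForm n (D u) (hamField (hamiltonian F') (cotId Ψ q)) =
        sympForm n u (hamField (hamiltonian F) q) := by
  obtain ⟨D, hD, hDs⟩ := cotId_symplectic hΨ.smooth hΨ.smooth_symm (hΨ.subset_source hb)
  refine ⟨D, hD, fun u v _ _ => hDs u v, fun u hu => ?_⟩
  have hG' := hF'.mdifferentiableAt_hamiltonian hq'
  have h1 : HasMFDerivAt (cotModel n) 𝓘(ℝ, ℝ) (hamiltonian F' ∘ cotId Ψ) q
      ((cotDeriv (hamiltonian F') (cotId Ψ q)).comp D) :=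
    HasMFDerivAt.comp q (g := hamiltonian F') (g' := cotDeriv (hamiltonian F') (cotId Ψ q))
      ⟨hG'.continuousAt, hasFDerivWithinAt_cotDeriv hG'⟩ hD
  have h2 := hasFDerivWithinAt_cotDeriv (hF.mdifferentiableAt_hamiltonian hq)
  have hz : bdf n (extChartAt (cotModel n) q q) = 0 :=
    (mem_boundary_iff_eq_zero bdf_inward range_cotModel_eq (mem_extChartAt_source q)).1
      (cot_mem_boundary_iff.2 hb)
  -- The Hamiltonians correspond only over the boundary, so only their tangential derivatives can be
  -- compared. Since pairing with the Hamiltonian field is the differential of the Hamiltonian, this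
  -- is the asserted identity for tangential `u`.
  have h3 : cotDeriv (hamiltonian F') (cotId Ψ q) (D u) = cotDeriv (hamiltonian F) q u := by
    refine apply_eq_of_eqOn_hyperplane (l := (cotDeriv (hamiltonian F') (cotId Ψ q)).comp D)
      (f := (hamiltonian F' ∘ cotId Ψ) ∘ (extChartAt (cotModel n) q).symm)
      range_cotModel_eq h1.2 h2 hz hu ?_
    filter_upwards [eventually_symm_extChartAt ((eventually_mem_set.2
      (isOpen_coslit.mem_nhds hq)).and (extChartAt_source_mem_nhds (I := cotModel n) q))
      (mem_extChartAt_source q)] with z hz hz0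
    refine hamiltonian_cotId hΨ hF hF' hFF' hz.2.1 (cot_mem_boundary_iff.1 ?_)
    rw [mem_boundary_iff_eq_zero bdf_inward range_cotModel_eq hz.2.2,
      (extChartAt (cotModel n) q).right_inv hz.1]
    exact hz0
  show sympForm n (D u) (sharp n (cotDeriv (hamiltonian F') (cotId Ψ q))) =
    sympForm n u (sharp n (cotDeriv (hamiltonian F) q))
  rw [sympForm_sharp, sympForm_sharp, h3]

theorem covecCone_subset_coslit (hF : IsFinsler F) (h𝒰 : 𝒰 ⊆ slit n M) :
    covecCone F 𝒰 ⊆ coslit n M := by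
  rintro _ ⟨u, hu, r, hr, rfl⟩
  rw [← hF.legendre_tdil (h𝒰 hu) hr]
  exact hF.legendre_mem_coslit (hF.isFinslerOn.conic u (h𝒰 hu) r hr)

theorem covecCone_tanId (hΨ : IsBoundaryIdentification (n := n) Ψ) (hF' : IsFinsler F')
    (hFF' : ∀ p : TanB n M, p.proj ∈ (𝓡∂ n).boundary M → F' (tanId Ψ p) = F p)
    (h𝒰 : 𝒰 ⊆ slit n M) (h𝒰b : ∀ u ∈ 𝒰, u.proj ∈ (𝓡∂ n).boundary M) :
    covecCone F' (tanId Ψ '' 𝒰) = cotId Ψ '' covecCone F 𝒰 := by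
  have key : ∀ u ∈ 𝒰, ∀ r : ℝ,
      cdil r (legendre F' (tanId Ψ u)) = cotId Ψ (cdil r (legendre F u)) := fun u hu r => by
    rw [legendre_tanId hΨ hF' hFF' (h𝒰 hu) (h𝒰b u hu)]
    rfl
  ext b
  constructor
  · rintro ⟨_, ⟨u, hu, rfl⟩, r, hr, rfl⟩
    exact ⟨_, ⟨u, hu, r, hr, rfl⟩, (key u hu r).symm⟩
  · rintro ⟨_, ⟨u, hu, r, hr, rfl⟩, rfl⟩
    exact ⟨_, ⟨u, hu, rfl⟩, r, hr, (key u hu r).symm⟩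

theorem cotId_cotId_symm (hΨ : IsBoundaryIdentification (n := n) Ψ) {q : CotB n M'}
    (hq : q.proj ∈ Ψ.target) : cotId Ψ (cotId Ψ.symm q) = q := by
  have h := hΨ.symm.cotId_symm_cotId (q := q) hq
  rwa [OpenPartialHomeomorph.symm_symm] at h

/-- Metrics with the same lens data are conjugate by a canonical transformation. -/
theorem exists_canonical [T2Space M] [T2Space M'] (hΨ : IsBoundaryIdentification (n := n) Ψ)
    (hF : IsFinsler F) (hF' : IsFinsler F')
    (hFF' : ∀ p : TanB n M, p.proj ∈ (𝓡∂ n).boundary M → F' (tanId Ψ p) = F p)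
    (h𝒰 : ∃ O : Set (TanB n M), IsOpen O ∧ 𝒰 = O ∩ inwardUnit F)
    (h : IsGeodesicFamily F 𝒰 T γ) (h' : IsGeodesicFamily F' (tanId Ψ '' 𝒰) T' γ')
    (hT : ∀ u ∈ 𝒰, T' (tanId Ψ u) = T u) :
    ∃ κ : OpenPartialHomeomorph (CotB n M) (CotB n M'),
      κ.source = legendre F '' geodesicCone F 𝒰 ∧
      κ.target = legendre F' '' geodesicCone F' (tanId Ψ '' 𝒰) ∧
      ContMDiffOn (cotModel n) (cotModel n) ∞ κ κ.source ∧
      ContMDiffOn (cotModel n) (cotModel n) ∞ κ.symm κ.target ∧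
      (∀ q ∈ κ.source, PreservesAt (cotModel n) (sympForm n) κ q) ∧
      ∀ u ∈ 𝒰, ∀ t ∈ Icc 0 (T u), ∀ r : ℝ, 0 < r →
        κ (cdil r (legendre F (γ u t))) = cdil r (legendre F' (γ' (tanId Ψ u) t)) := by
  have hslit : 𝒰 ⊆ slit n M := fun u hu => h.init_mem_slit hF hu
  have hbd : ∀ u ∈ 𝒰, u.proj ∈ (𝓡∂ n).boundary M := fun u hu => (h.inward hu).1
  have hcone := covecCone_tanId hΨ hF' hFF' hslit hbd
  have hfam := h.orbitFamily hF
  have hfam' := h'.orbitFamily hF'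
  have hbB : ∀ b ∈ covecCone F 𝒰, b.proj ∈ (𝓡∂ n).boundary M := fun b hb =>
    cot_mem_boundary_iff.1 (hfam.boundary b hb)
  have hbB' : ∀ b ∈ covecCone F' (tanId Ψ '' 𝒰), b.proj ∈ (𝓡∂ n).boundary M' := fun b hb =>
    cot_mem_boundary_iff.1 (hfam'.boundary b hb)
  have hψ : ∀ b ∈ covecCone F 𝒰, cotId Ψ b ∈ covecCone F' (tanId Ψ '' 𝒰) ∧
      coneTime F' T' (cotId Ψ b) = coneTime F T b := by
    rintro b hb
    refine ⟨by rw [hcone]; exact mem_image_of_mem _ hb, ?_⟩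
    obtain ⟨u, hu, r, hr, rfl⟩ := hb
    rw [hΨ.cotId_cdil, ← legendre_tanId hΨ hF' hFF' (hslit hu) (hbd u hu),
      (h.cone_apply hF hu hr).1, (h'.cone_apply hF' (mem_image_of_mem _ hu) hr).1, hT u hu]
  have hl : ∀ b ∈ covecCone F 𝒰, cotId Ψ.symm (cotId Ψ b) = b := fun b hb =>
    hΨ.cotId_symm_cotId (hΨ.subset_source (hbB b hb))
  have hr : ∀ b ∈ covecCone F' (tanId Ψ '' 𝒰), cotId Ψ (cotId Ψ.symm b) = b := fun b hb =>
    cotId_cotId_symm hΨ (hΨ.symm.subset_source (hbB' b hb))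
  have hψ' : ∀ b ∈ covecCone F' (tanId Ψ '' 𝒰), cotId Ψ.symm b ∈ covecCone F 𝒰 ∧
      coneTime F T (cotId Ψ.symm b) = coneTime F' T' b := by
    intro b hb
    rw [hcone] at hb
    obtain ⟨b, hb, rfl⟩ := hb
    rw [hl b hb]
    exact ⟨hb, (hψ b hb).2.symm⟩
  have hs : ∀ b ∈ covecCone F 𝒰, ContMDiffAt (cotModel n) (cotModel n) ∞ (cotId Ψ) b :=
    fun b hb => contMDiffAt_cotId hΨ.smooth hΨ.smooth_symm (hΨ.subset_source (hbB b hb))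
  have hs' : ∀ b ∈ covecCone F' (tanId Ψ '' 𝒰),
      ContMDiffAt (cotModel n) (cotModel n) ∞ (cotId Ψ.symm) b := fun b hb =>
    contMDiffAt_cotId hΨ.symm.smooth hΨ.symm.smooth_symm (hΨ.symm.subset_source (hbB' b hb))
  have hopen : ∀ b ∈ covecCone F 𝒰, ∀ᶠ b' in 𝓝 b,
      b' ∈ (cotModel n).boundary (CotB n M) → b' ∈ covecCone F 𝒰 := fun b hb =>
    (eventually_mem_covecCone hF h𝒰 hb).mono fun b' h1 h2 => h1 (cot_mem_boundary_iff.1 h2)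
  -- Relative openness is assumed for `𝒰` only; it is carried over to the second manifold by the
  -- continuous inverse of the boundary identification.
  have hopen' : ∀ b ∈ covecCone F' (tanId Ψ '' 𝒰), ∀ᶠ b' in 𝓝 b,
      b' ∈ (cotModel n).boundary (CotB n M') → b' ∈ covecCone F' (tanId Ψ '' 𝒰) := by
    intro b hb
    filter_upwards [(hs' b hb).continuousAt.eventually
      (eventually_mem_covecCone hF h𝒰 (hψ' b hb).1)] with b' h1 h2
    have h3 := cot_mem_boundary_iff.1 h2
    have h4 := h1 (hΨ.symm.map_boundary h3)
    rw [← cotId_cotId_symm hΨ (hΨ.symm.subset_source h3)]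
    exact (hψ _ h4).1
  obtain ⟨κ, h1, h2, h3, h4, hC⟩ := hfam.exists_conjugation bdf_inward range_cotModel_eq hfam' hopen
    hopen' hψ hs hψ' hs' hl hr
  refine ⟨κ, h1.trans (h.sweep_eq hF), h2.trans (h'.sweep_eq hF'), h3, h4, fun q hq => ?_, ?_⟩
  · rw [h1] at hq
    refine hfam.preservesAt bdf_inward range_cotModel_eq hopen hC sympForm_antisymm
      chartsPreserve_cot chartsPreserve_cot ?_ ?_ (fun b hb => ?_) hq
    · rintro _ ⟨u, hu, r, hr, rfl⟩ s hs
      rw [(h.cone_apply hF hu hr).1] at hs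
      obtain ⟨h4, h5⟩ := h.cdil_eq hF hu (h.mem_Icc_cone hF hr hs) hr
      rw [(h.cone_apply hF hu hr).2, h4]
      exact symplecticFieldAt_hamField (hF.contMDiffAt_hamiltonian_legendre h5)
    · intro b hb s hs
      rw [← (hψ b hb).2] at hs
      obtain ⟨u, hu, r, hr, hbu⟩ := (hψ b hb).1
      show SymplecticFieldAt _ _ _ (coneOrbit F' γ' (cotId Ψ b) s)
      rw [hbu] at hs ⊢
      rw [(h'.cone_apply hF' hu hr).1] at hs
      obtain ⟨h4, h5⟩ := h'.cdil_eq hF' hu (h'.mem_Icc_cone hF' hr hs) hr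
      rw [(h'.cone_apply hF' hu hr).2, h4]
      exact symplecticFieldAt_hamField (hF'.contMDiffAt_hamiltonian_legendre h5)
    · refine cotId_infinitesimal hΨ hF hF' hFF' (covecCone_subset_coslit hF hslit hb) (hbB b hb)
        (covecCone_subset_coslit hF' ?_ (hψ b hb).1)
      rintro _ ⟨u, hu, rfl⟩
      exact hΨ.tanId_mem_slit (hΨ.subset_source (hbd u hu)) (hslit hu)
  · intro u hu t ht r hr
    have h5 := hC.map (cdil r (legendre F u)) ⟨u, hu, r, hr, rfl⟩ (t / r) (by
      rw [(h.cone_apply hF hu hr).1]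
      exact ⟨div_nonneg ht.1 hr.le, div_le_div_of_nonneg_right ht.2 hr.le⟩)
    rw [(h.cone_apply hF hu hr).2, mul_div_cancel₀ _ hr.ne'] at h5
    rw [h5, hΨ.cotId_cdil, ← legendre_tanId hΨ hF' hFF' (hslit hu) (hbd u hu),
      (h'.cone_apply hF' (mem_image_of_mem _ hu) hr).2, mul_div_cancel₀ _ hr.ne']

/-- For each initial vector choose a geodesic of `F`; equality of the lens data supplies a geodesic
of `F'` with the same travel time and the identified end vectors. Transversality of the second
family is inherited through the identification and needs no separate assumption on `F'`. -/
theorem exists_geodesicFamilies (hΨ : IsBoundaryIdentification (n := n) Ψ)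
    (hFF' : ∀ p : TanB n M, p.proj ∈ (𝓡∂ n).boundary M → F' (tanId Ψ p) = F p)
    (h𝒰 : IsAdmissible F 𝒰) (hlens : SameLensData Ψ F (slit n M) F' (slit n M') 𝒰) :
    ∃ (T : TanB n M → ℝ) (γ : TanB n M → ℝ → TanB n M) (T' : TanB n M' → ℝ)
      (γ' : TanB n M' → ℝ → TanB n M'), IsGeodesicFamily F 𝒰 T γ ∧
      IsGeodesicFamily F' (tanId Ψ '' 𝒰) T' γ' ∧ (∀ u ∈ 𝒰, T' (tanId Ψ u) = T u) ∧
      ∀ u ∈ 𝒰, γ' (tanId Ψ u) (T u) = tanId Ψ (γ u (T u)) := by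
  have hinw : 𝒰 ⊆ inwardUnit F := by
    obtain ⟨O, -, rfl⟩ := h𝒰.relOpen
    exact inter_subset_right
  have key : ∀ u, ∃ (T : ℝ) (γ : ℝ → TanB n M) (γ' : ℝ → TanB n M'), u ∈ 𝒰 →
      IsFirstHitGeodesic F (slit n M) γ T ∧ γ 0 = u ∧ TanB.vec (γ T) 0 ≠ 0 ∧
      IsFirstHitGeodesic F' (slit n M') γ' T ∧ γ' 0 = tanId Ψ u ∧ γ' T = tanId Ψ (γ T) := by
    intro u
    by_cases hu : u ∈ 𝒰
    · obtain ⟨T, _, ⟨γ, hγ, h0, rfl⟩, hw⟩ := h𝒰.hits u hu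
      obtain ⟨γ', hγ', h0', h1'⟩ := (hlens u hu T _ hγ.boundary).1 ⟨γ, hγ, h0, rfl⟩
      exact ⟨T, γ, γ', fun _ => ⟨hγ, h0, hw, hγ', h0', h1'⟩⟩
    · exact ⟨0, fun _ => u, fun _ => tanId Ψ u, fun h => absurd h hu⟩
  choose T γ γ' hγ using key
  have hsymm : ∀ u ∈ 𝒰, tanId Ψ.symm (tanId Ψ u) = u := fun u hu =>
    hΨ.tanId_symm_tanId (hΨ.subset_source (hinw hu).1)
  refine ⟨T, γ, fun u => T (tanId Ψ.symm u), fun u => γ' (tanId Ψ.symm u),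
    ⟨hinw, fun u hu => (hγ u hu).1, fun u hu => (hγ u hu).2.1, fun u hu => (hγ u hu).2.2.1⟩,
    ⟨?_, ?_, ?_, ?_⟩, fun u hu => by simp only [hsymm u hu], fun u hu => ?_⟩
  · rintro _ ⟨u, hu, rfl⟩
    refine ⟨hΨ.map_boundary (hinw hu).1, ?_, hΨ.tanId_normal_pos (hinw hu).1 (hinw hu).2.2⟩
    rw [hFF' u (hinw hu).1]
    exact (hinw hu).2.1
  · rintro _ ⟨u, hu, rfl⟩
    simp only [hsymm u hu]
    exact (hγ u hu).2.2.2.1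
  · rintro _ ⟨u, hu, rfl⟩
    simp only [hsymm u hu]
    exact (hγ u hu).2.2.2.2.1
  · rintro _ ⟨u, hu, rfl⟩
    simp only [hsymm u hu]
    rw [(hγ u hu).2.2.2.2.2]
    exact hΨ.tanId_normal_ne_zero (hγ u hu).1.boundary (hγ u hu).2.2.1
  · simp only [hsymm u hu]
    exact (hγ u hu).2.2.2.2.2

end

/-! ### The inverse problem -/

section

variable {n : ℕ} [NeZero n] {M M' : Type*}
  [TopologicalSpace M] [ChartedSpace (EuclideanHalfSpace n) M] [IsManifold (𝓡∂ n) ∞ M] [T2Space M]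
  [TopologicalSpace M'] [ChartedSpace (EuclideanHalfSpace n) M'] [IsManifold (𝓡∂ n) ∞ M']
  [T2Space M']
  {F : TanB n M → ℝ} {F' : TanB n M' → ℝ} {Ψ : OpenPartialHomeomorph M M'}
  {𝒰 : Set (TanB n M)}

/-- The inverse problem: metrics with the same lens data are related by a convex canonical
transformation. -/
theorem exists_isConvexCanonical (hΨ : IsBoundaryIdentification (n := n) Ψ) (hF : IsFinsler F)
    (hF' : IsFinsler F')
    (hFF' : ∀ p : TanB n M, p.proj ∈ (𝓡∂ n).boundary M → F' (tanId Ψ p) = F p)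
    (h𝒰 : IsAdmissible F 𝒰) (hlens : SameLensData Ψ F (slit n M) F' (slit n M') 𝒰) :
    ∃ κ : OpenPartialHomeomorph (CotB n M) (CotB n M'),
      IsConvexCanonical (legendre F '' geodesicCone F 𝒰) (hamiltonian F) κ ∧
      IsBoundaryIdentity Ψ (legendre F '' geodesicCone F 𝒰) κ ∧
      ∃ φ : TanB n M → TanB n M',
        (∀ p ∈ geodesicCone F 𝒰, φ p ∈ slit n M' ∧ legendre F' (φ p) = κ (legendre F p)) ∧
        (∀ p ∈ geodesicCone F 𝒰, F' (φ p) = F p) ∧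
        ∀ p ∈ geodesicCone F 𝒰, p.proj ∈ (𝓡∂ n).boundary M → φ p = tanId Ψ p := by
  obtain ⟨T, γ, T', γ', h, h', hT, hend⟩ := exists_geodesicFamilies hΨ hFF' h𝒰 hlens
  obtain ⟨κ, hsource, htarget, hs, hs', hpres, hmap⟩ :=
    exists_canonical hΨ hF hF' hFF' h𝒰.relOpen h h' hT
  have hIcc : ∀ u ∈ 𝒰, ∀ t ∈ Icc 0 (T u), t ∈ Icc 0 (T' (tanId Ψ u)) := fun u hu t ht => by
    rwa [hT u hu]
  have hmap' : ∀ u ∈ 𝒰, ∀ t ∈ Icc 0 (T u), ∀ r : ℝ, 0 < r →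
      κ (legendre F (tdil r (γ u t))) = legendre F' (tdil r (γ' (tanId Ψ u) t)) ∧
      tdil r (γ' (tanId Ψ u) t) ∈ slit n M' ∧
      F' (tdil r (γ' (tanId Ψ u) t)) = F (tdil r (γ u t)) := by
    intro u hu t ht r hr
    have hu' := mem_image_of_mem (tanId Ψ) hu
    have ht' := hIcc u hu t ht
    rw [← (h.cdil_eq hF hu ht hr).1, ← (h'.cdil_eq hF' hu' ht' hr).1, hmap u hu t ht r hr,
      hF.isFinslerOn.homogeneous _ (h.mem_slit hF hu ht) r hr,
      hF'.isFinslerOn.homogeneous _ (h'.mem_slit hF' hu' ht') r hr, h.speed hF hu ht,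
      h'.speed hF' hu' ht']
    exact ⟨rfl, (h'.cdil_eq hF' hu' ht' hr).2, rfl⟩
  have hφ : ∀ p ∈ geodesicCone F 𝒰, ∃ p' ∈ slit n M', κ (legendre F p) = legendre F' p' ∧
      F' p' = F p := by
    intro p hp
    obtain ⟨u, hu, t, ht, r, hr, rfl⟩ := (h.mem_geodesicCone_iff hF).1 hp
    obtain ⟨h1, h2, h3⟩ := hmap' u hu t ht r hr
    exact ⟨_, h2, h1, h3⟩
  have hbdry : ∀ p ∈ geodesicCone F 𝒰, p.proj ∈ (𝓡∂ n).boundary M →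
      κ (legendre F p) = legendre F' (tanId Ψ p) := by
    intro p hp hb
    obtain ⟨u, hu, t, ht, r, hr, rfl⟩ := (h.mem_geodesicCone_iff hF).1 hp
    -- A geodesic of the family is over the boundary only at its two ends. At the start the vectors
    -- are identified by construction, at the exit by equality of the scattering relations.
    have h1 : γ' (tanId Ψ u) t = tanId Ψ (γ u t) := by
      rcases ht.1.eq_or_lt with rfl | h0
      · rw [h.zero u hu, h'.zero _ (mem_image_of_mem _ hu)]
      rcases ht.2.eq_or_lt with rfl | h1
      · exact hend u hu
      · exact absurd hb (not_mem_boundary_of_mem_interior ((h.geodesic u hu).interior t ⟨h0, h1⟩))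
    rw [(hmap' u hu t ht r hr).1, h1, hΨ.tanId_tdil]
  have hslit := geodesicCone_subset_slit (𝒰 := 𝒰) hF
  -- Corresponding geodesics both have unit speed, and `κ` commutes with dilations on them, so
  -- corresponding points have equal energy. Thus `H ∘ κ⁻¹` is the Hamiltonian of `F'` on the open
  -- set `κ.target`, and its convexity is that of a Finsler Hamiltonian.
  have hH : ∀ q ∈ κ.target, hamiltonian F (κ.symm q) = hamiltonian F' q ∧ q ∈ coslit n M' := by
    intro q hq
    have h1 := κ.map_target hq
    rw [hsource] at h1
    obtain ⟨p, hp, hpq⟩ := h1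
    obtain ⟨p', hp', h2, h3⟩ := hφ p hp
    have h4 : q = legendre F' p' := by rw [← h2, hpq, κ.right_inv hq]
    rw [← hpq, h4, hF.hamiltonian_legendre (hslit hp), hF'.hamiltonian_legendre hp', energy, energy,
      h3]
    exact ⟨rfl, hF'.legendre_mem_coslit hp'⟩
  have hvel : ∀ p ∈ geodesicCone F 𝒰, ∀ p' ∈ slit n M', κ (legendre F p) = legendre F' p' →
      velocity (hamiltonian F') (κ (legendre F p)) = p' := fun p _ p' hp' h1 => by
    rw [h1, hF'.velocity_legendre hp']
  -- The inverse of the Legendre transform of `F'` is the fibre derivative of its Hamiltonian, so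
  -- `φ` can be written down directly as a velocity.
  refine ⟨κ, ⟨hsource, ⟨hs, hs', fun q hq a b => ?_, fun q hq r hr => ?_⟩, fun q hq θ hθ => ?_⟩, ?_,
    fun p => velocity (hamiltonian F') (κ (legendre F p)), fun p hp => ?_, fun p hp => ?_,
    fun p hp hb => ?_⟩
  · obtain ⟨D, hD, hDs⟩ := hpres q hq
    have h1 : mfderiv (cotModel n) (cotModel n) κ q = D := hD.mfderiv
    rw [h1]
    exact hDs a b
  · rw [hsource] at hq ⊢
    obtain ⟨p, hp, rfl⟩ := hq
    obtain ⟨u, hu, t, ht, ρ, hρ, rfl⟩ := (h.mem_geodesicCone_iff hF).1 hp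
    have hrρ := mul_pos hr hρ
    rw [← (h.cdil_eq hF hu ht hρ).1, cdil_cdil, hmap u hu t ht _ hrρ, hmap u hu t ht _ hρ, cdil_cdil]
    refine ⟨⟨tdil (r * ρ) (γ u t), ?_, ((h.cdil_eq hF hu ht hrρ).1).symm⟩, rfl⟩
    exact (h.mem_geodesicCone_iff hF).2 ⟨u, hu, t, ht, _, hrρ, rfl⟩
  · have hev : (fun ζ => hamiltonian F (κ.symm (cvec q.proj ζ))) =ᶠ[𝓝 (CotB.covec q)]
        fun ζ => hamiltonian F' (cvec q.proj ζ) := by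
      filter_upwards [(continuousAt_cvec q).eventually (κ.open_target.mem_nhds hq)] with ζ hζ
      exact (hH _ hζ).1
    rw [hev.fderiv.fderiv_eq]
    exact hF'.strictConvexFiberOn q (hH q hq).2 θ hθ
  · rintro _ ⟨p, hp, rfl⟩ hb
    rw [hbdry p hp hb, legendre_tanId hΨ hF' hFF' (hslit hp) hb]
  · obtain ⟨p', hp', h1, -⟩ := hφ p hp
    show velocity (hamiltonian F') (κ (legendre F p)) ∈ _ ∧
      legendre F' (velocity (hamiltonian F') (κ (legendre F p))) = _
    rw [hvel p hp p' hp' h1]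
    exact ⟨hp', h1.symm⟩
  · obtain ⟨p', hp', h1, h2⟩ := hφ p hp
    show F' (velocity (hamiltonian F') (κ (legendre F p))) = _
    rw [hvel p hp p' hp' h1, h2]
  · exact hvel p hp _ (hΨ.tanId_mem_slit (hΨ.subset_source hb) (hslit hp)) (hbdry p hp hb)

end

end FinslerRigidity

end

theorem theorem5p3 {n : ℕ} [NeZero n] (hn : 2 ≤ n)
    {M M' : Type*}
    [TopologicalSpace M] [T2Space M] [SecondCountableTopology M]
    [ChartedSpace (EuclideanHalfSpace n) M] [IsManifold (𝓡∂ n) ∞ M]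
    [TopologicalSpace M'] [T2Space M'] [SecondCountableTopology M']
    [ChartedSpace (EuclideanHalfSpace n) M'] [IsManifold (𝓡∂ n) ∞ M']
    (Ψ : OpenPartialHomeomorph M M')
    (hΨ : FinslerRigidity.IsBoundaryIdentification (n := n) Ψ)
    (F : FinslerRigidity.TanB n M → ℝ) (hF : FinslerRigidity.IsFinsler F)
    (𝒰 : Set (FinslerRigidity.TanB n M)) (h𝒰 : FinslerRigidity.IsAdmissible F 𝒰)
    (𝒢 : Set (FinslerRigidity.TanB n M)) (h𝒢 : 𝒢 = FinslerRigidity.geodesicCone F 𝒰)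
    (Γ : Set (FinslerRigidity.CotB n M)) (hΓ : Γ = FinslerRigidity.legendre F '' 𝒢)
    (H : FinslerRigidity.CotB n M → ℝ) (hH : H = FinslerRigidity.hamiltonian F) :
    -- the direct problem
    (∀ κ : OpenPartialHomeomorph (FinslerRigidity.CotB n M) (FinslerRigidity.CotB n M'),
      FinslerRigidity.IsConvexCanonical Γ H κ →
      FinslerRigidity.IsBoundaryIdentity Ψ Γ κ →
      -- for a Finsler metric on all of `M'` with `H ∘ κ⁻¹ = ½(F'*)²` on `κ(Γ)`
      (∀ F' : FinslerRigidity.TanB n M' → ℝ, FinslerRigidity.IsFinsler F' →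
        (∀ q ∈ κ.target, H (κ.symm q) = FinslerRigidity.hamiltonian F' q) →
        FinslerRigidity.SameLensData Ψ F (FinslerRigidity.slit n M)
          F' (FinslerRigidity.slit n M') 𝒰) ∧
      -- for a Finsler metric that is only defined on an open cone `D'` and is dual to `H ∘ κ⁻¹`
      (∀ (F' : FinslerRigidity.TanB n M' → ℝ) (D' : Set (FinslerRigidity.TanB n M')),
        FinslerRigidity.IsFinslerOn F' D' →
        FinslerRigidity.IsLegendreDualOn F' D' (fun q => H (κ.symm q)) κ.target →
        FinslerRigidity.SameLensData Ψ F (FinslerRigidity.slit n M) F' D' 𝒰)) ∧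
    -- the inverse problem
    (∀ F' : FinslerRigidity.TanB n M' → ℝ, FinslerRigidity.IsFinsler F' →
      (∀ p : FinslerRigidity.TanB n M, p.proj ∈ (𝓡∂ n).boundary M →
        F' (FinslerRigidity.tanId Ψ p) = F p) →
      FinslerRigidity.SameLensData Ψ F (FinslerRigidity.slit n M)
        F' (FinslerRigidity.slit n M') 𝒰 →
      ∃ κ : OpenPartialHomeomorph (FinslerRigidity.CotB n M) (FinslerRigidity.CotB n M'),
        FinslerRigidity.IsConvexCanonical Γ H κ ∧
        FinslerRigidity.IsBoundaryIdentity Ψ Γ κ ∧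
        ∃ φ : FinslerRigidity.TanB n M → FinslerRigidity.TanB n M',
          -- `φ = 𝓛_{F'}⁻¹ ∘ κ ∘ 𝓛_F` on `𝒢`
          (∀ p ∈ 𝒢, φ p ∈ FinslerRigidity.slit n M' ∧
            FinslerRigidity.legendre F' (φ p) = κ (FinslerRigidity.legendre F p)) ∧
          (∀ p ∈ 𝒢, F' (φ p) = F p) ∧
          (∀ p ∈ 𝒢, p.proj ∈ (𝓡∂ n).boundary M → φ p = FinslerRigidity.tanId Ψ p)) := by
  subst h𝒢 hΓ hH
  refine ⟨fun κ hκ hid => ?_, fun F' hF' hFF' hlens =>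
    FinslerRigidity.exists_isConvexCanonical hΨ hF hF' hFF' h𝒰 hlens⟩
  have hdual : ∀ (F' : FinslerRigidity.TanB n M' → ℝ) (D' : Set (FinslerRigidity.TanB n M')),
      FinslerRigidity.IsFinslerOn F' D' →
      FinslerRigidity.IsLegendreDualOn F' D'
        (fun q => FinslerRigidity.hamiltonian F (κ.symm q)) κ.target →
      FinslerRigidity.SameLensData Ψ F (FinslerRigidity.slit n M) F' D' 𝒰 := fun F' D' hF' h =>
    FinslerRigidity.sameLensData_of_isLegendreDualOn hΨ hF h𝒰 hκ hid hF' h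
  refine ⟨fun F' hF' h => hdual F' _ hF'.isFinslerOn
    (hF'.isLegendreDualOn κ.open_target (fun q hq => ?_) h), hdual⟩
  -- Points of `Γ` are non-zero covectors, so the transported Hamiltonian is positive; this places
  -- `κ(Γ)` off the zero section, where `F'` has a Legendre inverse.
  refine hF.hamiltonian_pos (FinslerRigidity.legendre_geodesicCone_subset_coslit (𝒰 := 𝒰) hF ?_)
  rw [← hκ.source_eq]
  exact κ.map_target hq
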